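/- Let $k$ be a field of characteristic $p>2$, let $\mathfrak g$ be a restricted Lie superalgebra over $k$ (for $p=3$ the axiom $[x,[x,x]]=0$ for odd $x$ belongs to the definition of a Lie superalgebra), $\mathfrak h\subset\mathfrak g$ a restricted subsuperalgebra, and $(e_1,\dots,e_n,\epsilon_1,\dots,\epsilon_m)$ a homogeneous basis ($e_i$ even, $\epsilon_s$ odd) of a graded supplement of $\mathfrak h$ in $\mathfrak g$. Let $(\pi,V)$ be a restricted representation of $\mathfrak h$ (of any dimension). Let $\mathrm{strad}=\mathrm{str}\circ \mathrm{ad}_{\mathfrak g/\mathfrak h}$ be the supertrace character of $\mathfrak h$, and let $U'$ denote restricted enveloping superalgebras, with coproduct $\Delta(u)=\sum u_{(1)}\otimes u_{(2)}$ and antipode $u\mapsto\check u$ (in the super sense). *Conventions.* For a map $f$ and a vector $v$, homogeneous, put $\langle v,f\rangle=(-1)^{|v||f|}f(v)$. For a restricted representation $(\rho,W)$ of $\mathfrak h$ put $\mathrm{Ind}(\rho)=U'(\mathfrak g)\otimes_{U'(\mathfrak h)}W$ and $\mathrm{Coind}(\rho)=\mathrm{Hom}_{U'(\mathfrak h)}(U'(\mathfrak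 g),W)$, that is, the maps $\mu$ with $\langle Hu,\mu\rangle=\rho(H)\langle u,\mu\rangle$ for $H\in\mathfrak h$, with the action $\langle w,\delta_u\mu\rangle=\langle wu,\mu\rangle$ of $u\in U'(\mathfrak g)$. For $\lambda\in\mathrm{Coind}(\rho)$, $\mu\in\mathrm{Coind}(\rho')$ let $\lambda\mu\in\mathrm{Coind}(\rho\otimes\rho')$ be given by $\langle u,\lambda\mu\rangle=\sum(-1)^{|\lambda||u_{(2)}|}\langle u_{(1)},\lambda\rangle\otimes\langle u_{(2)},\mu\rangle$. So $\mathcal A=\mathrm{Coind}(k)$ is a superalgebra and $\mathrm{Coind}(\rho)$ an $\mathcal A$-module. Duals of representations are contragredient. The space $\Pi^mk$ is one-dimensional of degree $m$; the basis of $\Pi^mk_{\mathrm{strad}}$ is denoted $\Lambda$, and that of $\Pi^mk_{-\mathrm{strad}}$ is the dual basis $\bar\omega$, with $\langle\Lambda,\bar\omega\rangle=1$. Thereby $\pi^*\otimes\Pi^mk_{-\mathrm{strad}}$ is identified with $(\Pi^mk_{\mathrm{strad}}\otimes\pi)^*$ via $(v^*\otimes\bar\omega)(\Lambda\otimes v)=v^*(v)\,\bar\omega(\Lambda)$.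 *Coordinates.* Evaluation on the monomials $e^{\underline a}\epsilon^{\underline\alpha}$, $(\underline a,\underline\alpha)\in[0,p-1]^n\times\{0,1\}^m$, is a bijection from $\mathrm{Coind}(\rho)$ to the families in $W$, for $\rho=k,\pi,\pi^*$. Let $\eta_i$, $\zeta_s\in\mathcal A$ be the elements with value $1$ on $e_i$, respectively $\epsilon_s$, and $0$ on the other monomials, and $\hat w\in\mathrm{Coind}(\rho)$ the element with value $w$ on $1$ and $0$ on the other monomials. Put $\Lambda=\eta_1^{p-1}\cdots\eta_n^{p-1}\zeta_1\cdots\zeta_m\in\mathcal A$ as well. Let $\partial_i,\bar\partial_s$ be the superderivations $\partial/\partial\eta_i$, $\partial/\partial\zeta_s$ of $\mathcal A$, and let $\Omega=\mathcal A\,\omega$ be the Berezinian module of $\mathrm{Der}(\mathcal A)^*$ in these coordinates, on which $X\in\mathfrak g$ acts by the Lie derivative $L_X(f\omega)=\delta_X(f)\omega+(-1)^{|X||f|}f\,\mathrm{div}(\delta_X)\,\omega$, $\mathrm{div}(\delta_X)=\sum_i\partial_i(\delta_X\eta_i)-(-1)^{|X|}\sum_s\bar\partial_s(\delta_X\zeta_s)$.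 There is an isomorphism $\chi:\Omega\to\mathrm{Coind}(\Pi^mk_{-\mathrm{strad}})$ of $\mathcal A$-modules and of representations of $\mathfrak g$ with $\langle 1,\chi(\omega)\rangle=\bar\omega$. *The maps.* There are - an isomorphism of $U'(\mathfrak g)$-modules $\Phi:\mathrm{Ind}(\Pi^mk_{\mathrm{strad}}\otimes\pi)\to\mathrm{Coind}(\pi)$ with $\Phi(u\otimes(\Lambda\otimes v))=\delta_u(\Lambda\hat v)$; - a bilinear form $\Psi$ on $\mathrm{Coind}(\pi)\times\mathrm{Coind}(\pi^*\otimes\Pi^mk_{-\mathrm{strad}})$ such that $$\Psi\big(\eta^{\underline a}\zeta^{\underline\alpha}\hat v,\ \eta^{\underline b}\zeta^{\underline\beta}\widehat{v^*}\,\chi(\omega)\big)=(-1)^{\mathrm{Inv}(\underline\alpha,\underline\beta)}(-1)^{|v||\underline\beta|}\langle v,v^*\rangle$$ if $a_i+b_i=p-1$ and $\alpha_s+\beta_s=1$ for all $i,s$, and $0$ otherwise, where $|\underline\beta|=\sum_s\beta_s$ and $\zeta^{\underline\alpha}\zeta^{\underline\beta}=(-1)^{\mathrm{Inv}(\underline\alpha,\underline\beta)}\zeta_1\cdots\zeta_m$;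 and the injective $\mathfrak g$-morphism $\Psi^\natural:\mathrm{Coind}(\pi^*\otimes\Pi^mk_{-\mathrm{strad}})\to\mathrm{Coind}(\pi)^*$ with $\langle\lambda,\Psi^\natural(\mu)\rangle=\Psi(\lambda,\mu)$; - an isomorphism of representations $\Theta:\mathrm{Coind}(\pi^*\otimes\Pi^mk_{-\mathrm{strad}})\to\mathrm{Ind}(\Pi^mk_{\mathrm{strad}}\otimes\pi)^*$, $\mu\mapsto[u\otimes w\mapsto\langle\mu(\check u),w\rangle]$, where $\langle\mu(\check u),w\rangle$ is the value at $w$ of $\mu(\check u)\in(\Pi^mk_{\mathrm{strad}}\otimes\pi)^*$; and for the transpose ${}^t\Phi:\mathrm{Coind}(\pi)^*\to\mathrm{Ind}(\Pi^mk_{\mathrm{strad}}\otimes\pi)^*$ one has $${}^t\Phi\circ\Psi^\natural=\Theta .$$ -/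

import Mathlib

open scoped TensorProduct

noncomputable section

namespace RestrictedSuper

/-! ### Superspaces -/

/-- A superspace over a field of characteristic different from `2`: the `ℤ/2`-grading is recorded by
its parity involution `v ↦ (-1)^{|v|} v` (see `homog` and `isCompl_homog`). -/
class Superspace (k V : Type*) [Field k] [AddCommGroup V] [Module k V] where
  parity : V →ₗ[k] V
  parity_parity : ∀ v, parity (parity v) = v

/-- The sign `(-1)^i`. -/
def sgn (k : Type*) [Field k] (i : ZMod 2) : k := if i = 0 then 1 else -1

section Superspace

variable {k V W : Type*} [Field k] [AddCommGroup V] [Module k V] [AddCommGroup W] [Module k W]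

/-- The parity involution `v ↦ (-1)^{|v|} v`. -/
def parity [Superspace k V] : V →ₗ[k] V := Superspace.parity

@[simp] theorem parity_parity [Superspace k V] (v : V) :
    parity (k := k) (parity (k := k) v) = v := Superspace.parity_parity v

variable (k V) in
/-- The homogeneous elements of degree `i`. -/
def homog [Superspace k V] (i : ZMod 2) : Submodule k V :=
  LinearMap.ker (parity (k := k) (V := V) - sgn k i • LinearMap.id)

theorem mem_homog [Superspace k V] {i : ZMod 2} {v : V} :
    v ∈ homog k V i ↔ parity (k := k) v = sgn k i • v := by
  simp [homog, sub_eq_zero]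

/-- The projection of a superspace onto its component of degree `i`. -/
def proj [Superspace k V] (i : ZMod 2) : V →ₗ[k] V :=
  (2 : k)⁻¹ • (LinearMap.id + sgn k i • parity (k := k))

@[simp] theorem sgn_zero : sgn k 0 = 1 := by simp [sgn]

@[simp] theorem sgn_one : sgn k 1 = -1 := by simp [sgn]

theorem zmod_two_cases (i : ZMod 2) : i = 0 ∨ i = 1 := by
  revert i; decide

theorem proj_mem [Superspace k V] (i : ZMod 2) (v : V) : proj (k := k) i v ∈ homog k V i := by
  rw [mem_homog]
  rcases zmod_two_cases i with rfl | rfl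
  · simp [proj, add_comm]
  · simp [proj, add_comm]

theorem proj_add_proj [Superspace k V] (h2 : (2 : k) ≠ 0) (v : V) :
    proj (k := k) 0 v + proj (k := k) 1 v = v := by
  have : (2 : k)⁻¹ • ((2 : k) • v) = v := by rw [smul_smul, inv_mul_cancel₀ h2, one_smul]
  simp only [proj, sgn_zero, sgn_one, LinearMap.smul_apply, LinearMap.add_apply, LinearMap.id_apply]
  rw [← smul_add]
  conv_rhs => rw [← this, two_smul]
  congr 1
  module

/-- In characteristic different from `2` a superspace is the direct sum of its even and its odd
part. -/
theorem isCompl_homog [Superspace k V] (h2 : (2 : k) ≠ 0) :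
    IsCompl (homog k V 0) (homog k V 1) := by
  constructor
  · rw [Submodule.disjoint_def]
    intro v h0 h1
    rw [mem_homog] at h0 h1
    rw [h0] at h1
    simp only [sgn_zero, sgn_one, one_smul, neg_smul] at h1
    have : (2 : k) • v = 0 := by rw [two_smul]; nth_rewrite 1 [h1]; simp
    exact (smul_eq_zero.mp this).resolve_left h2
  · rw [codisjoint_iff, eq_top_iff]
    intro v _
    rw [← proj_add_proj h2 v]
    exact Submodule.add_mem_sup (proj_mem 0 v) (proj_mem 1 v)

theorem proj_of_mem [Superspace k V] (h2 : (2 : k) ≠ 0) {i : ZMod 2} {v : V}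
    (h : v ∈ homog k V i) (j : ZMod 2) : proj (k := k) j v = if i = j then v else 0 := by
  have : (2 : k)⁻¹ • (v + v) = v := by rw [← two_smul k, smul_smul, inv_mul_cancel₀ h2, one_smul]
  rw [mem_homog] at h
  rcases zmod_two_cases i with rfl | rfl <;> rcases zmod_two_cases j with rfl | rfl
  · simpa [proj, h] using this
  · simp [proj, h]
  · simp [proj, h]
  · simpa [proj, h] using this

/-- The ground field is even. -/
instance : Superspace k k where
  parity := LinearMap.id
  parity_parity _ := rfl

/-- The grading of `Hom_k(V, W)`; it contains the grading of the dual `V*`. -/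
instance [Superspace k V] [Superspace k W] : Superspace k (V →ₗ[k] W) where
  parity :=
    { toFun := fun f => parity (k := k) ∘ₗ f ∘ₗ parity (k := k)
      map_add' := fun f g => by ext; simp
      map_smul' := fun c f => by ext; simp }
  parity_parity f := by ext; simp

/-- The grading of the tensor product. -/
instance [Superspace k V] [Superspace k W] : Superspace k (V ⊗[k] W) where
  parity := TensorProduct.map (parity (k := k)) (parity (k := k))
  parity_parity t := by
    induction t with
    | zero => simp
    | tmul v w => simp
    | add a b ha hb => simp only [map_add, ha, hb]

@[simp] theorem parity_field (c : k) : parity (k := k) c = c := rfl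

@[simp] theorem parity_hom [Superspace k V] [Superspace k W] (f : V →ₗ[k] W) (v : V) :
    parity (k := k) f v = parity (k := k) (f (parity (k := k) v)) := rfl

@[simp] theorem parity_tmul [Superspace k V] [Superspace k W] (v : V) (w : W) :
    parity (k := k) (v ⊗ₜ[k] w) = parity (k := k) v ⊗ₜ[k] parity (k := k) w := rfl

end Superspace

/-- The one-dimensional superspace `Π^m k`, with basis `1` of degree `m`. -/
def Line (k : Type*) [Field k] (_m : ℕ) : Type _ := k

section Line

variable (k : Type*) [Field k] (m : ℕ)

instance : AddCommGroup (Line k m) := inferInstanceAs (AddCommGroup k)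

instance : Module k (Line k m) := inferInstanceAs (Module k k)

instance : Superspace k (Line k m) where
  parity := (-1 : k) ^ m • LinearMap.id
  parity_parity v := by simp [smul_smul, ← mul_pow]

/-- The basis vector of `Π^m k`. -/
def lineGen : Line k m := (1 : k)

/-- The coordinate on `Π^m k`. -/
def lineCoord : Line k m →ₗ[k] k := LinearMap.id (R := k) (M := k)

end Line

/-! ### Restricted Lie superalgebras -/

/-- Lie superalgebras (in characteristic different from `2`). The last axiom follows from the others
unless the characteristic is `3`, where it belongs to the definition. -/
class LieSuperalgebra (k g : Type*) [Field k] [AddCommGroup g] [Module k g] extends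
    Superspace k g where
  br : g →ₗ[k] g →ₗ[k] g
  parity_br : ∀ x y, parity (br x y) = br (parity x) (parity y)
  br_skew : ∀ (i j : ZMod 2), ∀ x ∈ homog k g i, ∀ y ∈ homog k g j,
    br x y = -(sgn k (i * j) • br y x)
  br_jacobi : ∀ (i j : ZMod 2), ∀ x ∈ homog k g i, ∀ y ∈ homog k g j, ∀ z,
    br x (br y z) = br (br x y) z + sgn k (i * j) • br y (br x z)
  br_cube : ∀ x ∈ homog k g 1, br x (br x x) = 0

section Lie

variable {k g : Type*} [Field k] [AddCommGroup g] [Module k g] [LieSuperalgebra k g]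

/-- The Lie superbracket. -/
def br : g →ₗ[k] g →ₗ[k] g := LieSuperalgebra.br

theorem parity_br (x y : g) : parity (k := k) (br (k := k) x y) =
    br (k := k) (parity (k := k) x) (parity (k := k) y) := LieSuperalgebra.parity_br x y

variable (k) in
/-- The sum `∑_{i=1}^{p-1} s_i(x, y)` of Jacobson's formula, where `i s_i(x, y)` is the coefficient of
`t^{i-1}` in `ad(t x + y)^{p-1}(x)`: the sum over all words `w` of length `p - 1` in `x` and `y` of
`1/i` times the iterated bracket of the word with `x`, where `x` occurs `i - 1` times in `w`.
(The word with `i = p` contributes zero.) -/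
def jacobsonSum (p : ℕ) (x y : g) : g :=
  ∑ w : Fin (p - 1) → Bool,
    ((((List.ofFn w).count true + 1 : ℕ) : k))⁻¹ •
      (List.ofFn w).foldr (fun b z => br (k := k) (if b then x else y) z) x

end Lie

/-- A `p`-operation on the even part, turning the even part into a restricted Lie algebra
(`pMap_smul`, `pMap_add`, and `ad_pMap` on the even part) such that the action on the odd part is
restricted (`ad_pMap` on the odd part). -/
class RestrictedLieSuperalgebra (k : Type*) (p : ℕ) (g : Type*) [Field k] [AddCommGroup g]
    [Module k g] [LieSuperalgebra k g] where
  pMap : homog k g 0 → homog k g 0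
  pMap_smul : ∀ (c : k) (x : homog k g 0), pMap (c • x) = c ^ p • pMap x
  pMap_add : ∀ x y : homog k g 0,
    (pMap (x + y) : g) = pMap x + pMap y + jacobsonSum k p (x : g) (y : g)
  ad_pMap : ∀ (x : homog k g 0) (y : g), br (k := k) (pMap x : g) y = (br (k := k) (x : g))^[p] y

section Restricted

variable {k g : Type*} [Field k] [AddCommGroup g] [Module k g] [LieSuperalgebra k g]

/-- The `p`-operation `x ↦ x^[p]` on the even part. -/
def pMap (p : ℕ) [RestrictedLieSuperalgebra k p g] (x : homog k g 0) : homog k g 0 :=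
  RestrictedLieSuperalgebra.pMap (p := p) x

end Restricted

/-- Restricted subsuperalgebras. -/
structure RestrictedSubalgebra (k : Type*) (p : ℕ) (g : Type*) [Field k] [AddCommGroup g]
    [Module k g] [LieSuperalgebra k g] [RestrictedLieSuperalgebra k p g] where
  carrier : Submodule k g
  parity_mem : ∀ x ∈ carrier, parity (k := k) x ∈ carrier
  br_mem : ∀ x ∈ carrier, ∀ y ∈ carrier, br (k := k) x y ∈ carrier
  pMap_mem : ∀ x : homog k g 0, (x : g) ∈ carrier → (pMap p x : g) ∈ carrier

section Sub

variable {k g : Type*} {p : ℕ} [Field k] [AddCommGroup g] [Module k g] [LieSuperalgebra k g]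
  [RestrictedLieSuperalgebra k p g] (H : RestrictedSubalgebra k p g)

instance : Superspace k H.carrier where
  parity := (parity (k := k)).restrict H.parity_mem
  parity_parity x := by ext; simp

@[simp] theorem coe_parity (x : H.carrier) :
    ((parity (k := k) x : H.carrier) : g) = parity (k := k) (x : g) := rfl

theorem coe_mem_homog {i : ZMod 2} {x : H.carrier} :
    (x : g) ∈ homog k g i ↔ x ∈ homog k H.carrier i := by
  rw [mem_homog, mem_homog, Subtype.ext_iff]
  rfl

instance : LieSuperalgebra k H.carrier where
  br := LinearMap.mk₂ k (fun x y => ⟨br (k := k) (x : g) (y : g), H.br_mem x x.2 y y.2⟩)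
    (fun x y z => by ext; simp) (fun c x y => by ext; simp)
    (fun x y z => by ext; simp) (fun c x y => by ext; simp)
  parity_br x y := Subtype.ext (parity_br (k := k) (x : g) (y : g))
  br_skew i j x hx y hy := Subtype.ext (LieSuperalgebra.br_skew i j (x : g)
    ((coe_mem_homog H).mpr hx) (y : g) ((coe_mem_homog H).mpr hy))
  br_jacobi i j x hx y hy z := Subtype.ext (LieSuperalgebra.br_jacobi i j (x : g)
    ((coe_mem_homog H).mpr hx) (y : g) ((coe_mem_homog H).mpr hy) (z : g))
  br_cube x hx := Subtype.ext (LieSuperalgebra.br_cube (x : g) ((coe_mem_homog H).mpr hx))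

theorem coe_br (x y : H.carrier) :
    ((br (k := k) x y : H.carrier) : g) = br (k := k) (x : g) (y : g) := rfl

theorem coe_jacobsonSum (q : ℕ) (x y : H.carrier) :
    ((jacobsonSum k q x y : H.carrier) : g) = jacobsonSum k q (x : g) (y : g) := by
  have h : ∀ l : List Bool,
      ((l.foldr (fun b z => br (k := k) (if b then x else y) z) x : H.carrier) : g) =
        l.foldr (fun b z => br (k := k) (if b then (x : g) else y) z) (x : g) := by
    intro l
    induction l with
    | nil => rfl
    | cons b l ih =>
      rw [List.foldr_cons, List.foldr_cons, coe_br, ih]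
      cases b <;> rfl
  simp only [jacobsonSum, Submodule.coe_sum, Submodule.coe_smul, h]

/-- The even part of `h` inside the even part of `g`. -/
def evenIncl (x : homog k H.carrier 0) : homog k g 0 := ⟨x, (coe_mem_homog H).mpr x.2⟩

/-- The `p`-operation of `h` is the restriction of the `p`-operation of `g`. -/
instance : RestrictedLieSuperalgebra k p H.carrier where
  pMap x := ⟨⟨pMap p (evenIncl H x), H.pMap_mem _ (x : H.carrier).2⟩,
    (coe_mem_homog H).mp (pMap p (evenIncl H x)).2⟩
  pMap_smul c x := Subtype.ext (Subtype.ext (by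
    have h := congrArg (fun y : homog k g 0 => (y : g))
      (RestrictedLieSuperalgebra.pMap_smul (p := p) c (evenIncl H x))
    exact h))
  pMap_add x y := Subtype.ext (by
    simp only [Submodule.coe_add, coe_jacobsonSum]
    exact RestrictedLieSuperalgebra.pMap_add (p := p) (evenIncl H x) (evenIncl H y))
  ad_pMap x y := Subtype.ext (by
    have h : ∀ q : ℕ, (((br (k := k) (x : H.carrier))^[q] y : H.carrier) : g) =
        (br (k := k) ((x : H.carrier) : g))^[q] (y : g) := by
      intro q
      induction q with
      | zero => rfl
      | succ q ih => rw [Function.iterate_succ_apply', Function.iterate_succ_apply', coe_br, ih]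
    rw [h]
    exact RestrictedLieSuperalgebra.ad_pMap (p := p) (evenIncl H x) (y : g))

/-- The parity involution of `g/h`. -/
def parityQuot : Module.End k (g ⧸ H.carrier) :=
  H.carrier.mapQ H.carrier (parity (k := k)) H.parity_mem

/-- The action `ad_{g/h}` of `h` on `g/h`. -/
def adQuot : H.carrier →ₗ[k] Module.End k (g ⧸ H.carrier) where
  toFun x := H.carrier.mapQ H.carrier (br (k := k) (x : g)) (fun y hy => H.br_mem x x.2 y hy)
  map_add' x y := by
    ext z
    simp
  map_smul' c x := by
    ext z
    simp

/-- The supertrace character `strad_{g/h}` of `h`, for `g/h` of finite dimension: the supertrace of an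
endomorphism is the trace of its composition with the parity involution, that is, the difference
of the traces of its even-even and its odd-odd blocks. -/
def strad : H.carrier →ₗ[k] k :=
  LinearMap.trace k (g ⧸ H.carrier) ∘ₗ LinearMap.mulLeft k (parityQuot H) ∘ₗ adQuot H

theorem strad_parity (x : H.carrier) : strad H (parity (k := k) x) = strad H x := by
  have h1 : parityQuot H * parityQuot H = 1 := by
    ext z
    simp [parityQuot]
  have h2 : adQuot H (parity (k := k) x) = parityQuot H * adQuot H x * parityQuot H := by
    ext z
    simp [parityQuot, adQuot, parity_br]
  simp only [strad, LinearMap.comp_apply, LinearMap.mulLeft_apply]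
  rw [h2, ← mul_assoc, ← mul_assoc, h1, one_mul, LinearMap.trace_mul_comm]

end Sub

/-! ### Actions and representations -/

/-- An even linear map from the superspace `L` to the endomorphisms of the superspace `V`. -/
structure SuperAction (k L V : Type*) [Field k] [AddCommGroup L] [Module k L] [Superspace k L]
    [AddCommGroup V] [Module k V] [Superspace k V] where
  act : L →ₗ[k] Module.End k V
  parity_act : ∀ x v, parity (k := k) (act x v) = act (parity (k := k) x) (parity (k := k) v)

section Actions

variable {k L V W : Type*} [Field k] [AddCommGroup L] [Module k L]
  [AddCommGroup V] [Module k V] [Superspace k V] [AddCommGroup W] [Module k W] [Superspace k W]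

variable (k L) in
/-- The trivial action on the ground field. -/
def trivAct [Superspace k L] : SuperAction k L k where
  act := 0
  parity_act _ _ := by simp

/-- The action `Π^m k_χ` on `Π^m k` given by an even linear form `χ`. -/
def lineAct [Superspace k L] (m : ℕ) (χ : L →ₗ[k] k) (hχ : ∀ x, χ (parity (k := k) x) = χ x) :
    SuperAction k L (Line k m) where
  act := χ.smulRight LinearMap.id
  parity_act x v := by simp [hχ]

/-- The contragredient action `(x f)(v) = -(-1)^{|x||f|} f(x v)` on `V*`. -/
def dualAct [Superspace k L] (π : SuperAction k L V) : SuperAction k L (Module.Dual k V) where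
  act :=
    { toFun := fun x => -(LinearMap.lcomp k k (π.act (proj (k := k) 0 x)) +
        LinearMap.lcomp k k (π.act (proj (k := k) 1 x)) ∘ₗ parity (k := k))
      map_add' := fun x y => by
        ext f v
        simp only [map_add, LinearMap.neg_apply, LinearMap.add_apply, LinearMap.comp_apply,
          LinearMap.lcomp_apply]
        ring
      map_smul' := fun c x => by
        ext f v
        simp only [map_smul, LinearMap.neg_apply, LinearMap.add_apply, LinearMap.comp_apply,
          LinearMap.lcomp_apply, LinearMap.smul_apply, smul_eq_mul, RingHom.id_apply]
        ring }
  parity_act x f := by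
    have h : ∀ i : ZMod 2, proj (k := k) i (parity (k := k) x) = parity (k := k) (proj (k := k) i x) := by
      intro i; simp [proj]
    ext v
    simp [π.parity_act, h]

/-- The action `x (v ⊗ w) = x v ⊗ w + (-1)^{|x||v|} v ⊗ x w` on `V ⊗ W`. -/
def tensorAct [Superspace k L] (π : SuperAction k L V) (ρ : SuperAction k L W) :
    SuperAction k L (V ⊗[k] W) where
  act :=
    { toFun := fun x => TensorProduct.map (π.act x) LinearMap.id +
        TensorProduct.map LinearMap.id (ρ.act (proj (k := k) 0 x)) +
        TensorProduct.map (parity (k := k)) (ρ.act (proj (k := k) 1 x))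
      map_add' := fun x y => by
        ext v w
        simp [TensorProduct.add_tmul, TensorProduct.tmul_add]
        abel
      map_smul' := fun c x => by
        ext v w
        simp [TensorProduct.smul_tmul'] }
  parity_act x t := by
    have h : ∀ i : ZMod 2, proj (k := k) i (parity (k := k) x) = parity (k := k) (proj (k := k) i x) := by
      intro i; simp [proj]
    induction t with
    | zero => simp
    | tmul v w => simp [π.parity_act, ρ.parity_act, h]
    | add a b ha hb => simp only [map_add, ha, hb]

variable (p : ℕ)

/-- The action is a restricted representation of the restricted Lie superalgebra `L`. -/
structure SuperAction.IsRestricted [LieSuperalgebra k L] [RestrictedLieSuperalgebra k p L]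
    (π : SuperAction k L V) : Prop where
  act_br : ∀ (i j : ZMod 2), ∀ x ∈ homog k L i, ∀ y ∈ homog k L j,
    π.act (br (k := k) x y) = π.act x * π.act y - sgn k (i * j) • (π.act y * π.act x)
  act_pMap : ∀ x : homog k L 0, π.act (pMap p x : L) = π.act (x : L) ^ p

end Actions

/-! ### The restricted enveloping superalgebra -/

/-- The defining relations of the restricted enveloping superalgebra. -/
inductive EnvRel (k : Type*) (p : ℕ) (g : Type*) [Field k] [AddCommGroup g] [Module k g]
    [LieSuperalgebra k g] [RestrictedLieSuperalgebra k p g] :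
    TensorAlgebra k g → TensorAlgebra k g → Prop
  | br (i j : ZMod 2) (x y : g) (hx : x ∈ homog k g i) (hy : y ∈ homog k g j) :
      EnvRel k p g (TensorAlgebra.ι k (br (k := k) x y))
        (TensorAlgebra.ι k x * TensorAlgebra.ι k y -
          sgn k (i * j) • (TensorAlgebra.ι k y * TensorAlgebra.ι k x))
  | pMap (x : homog k g 0) :
      EnvRel k p g (TensorAlgebra.ι k (pMap p x : g)) (TensorAlgebra.ι k (x : g) ^ p)

/-- The restricted enveloping superalgebra `U'(g)`. -/
def Env (k : Type*) (p : ℕ) (g : Type*) [Field k] [AddCommGroup g] [Module k g]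
    [LieSuperalgebra k g] [RestrictedLieSuperalgebra k p g] : Type _ := RingQuot (EnvRel k p g)

section Env

variable {k : Type*} {p : ℕ} {g : Type*} [Field k] [AddCommGroup g] [Module k g]
  [LieSuperalgebra k g] [RestrictedLieSuperalgebra k p g]

instance : Ring (Env k p g) := inferInstanceAs (Ring (RingQuot (EnvRel k p g)))

instance : Algebra k (Env k p g) := inferInstanceAs (Algebra k (RingQuot (EnvRel k p g)))

variable (k p g) in
/-- The quotient map from the tensor algebra. -/
def envMk : TensorAlgebra k g →ₐ[k] Env k p g := RingQuot.mkAlgHom k (EnvRel k p g)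

variable (k p) in
/-- The canonical map `g → U'(g)`. -/
def envι : g →ₗ[k] Env k p g := (envMk k p g).toLinearMap ∘ₗ TensorAlgebra.ι k

theorem envι_apply (x : g) : envι k p x = envMk k p g (TensorAlgebra.ι k x) := rfl

theorem envι_br (i j : ZMod 2) (x y : g) (hx : x ∈ homog k g i) (hy : y ∈ homog k g j) :
    envι k p (br (k := k) x y) =
      envι k p x * envι k p y - sgn k (i * j) • (envι k p y * envι k p x) := by
  have : envMk k p g _ = envMk k p g _ :=
    RingQuot.mkAlgHom_rel k (EnvRel.br (p := p) i j x y hx hy)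
  simpa only [envι_apply, map_sub, map_mul, map_smul] using this

theorem envι_pMap (x : homog k g 0) : envι k p (pMap p x : g) = envι k p (x : g) ^ p := by
  have : envMk k p g _ = envMk k p g _ := RingQuot.mkAlgHom_rel k (EnvRel.pMap (p := p) x)
  simpa only [envι_apply, map_pow] using this

/-- The universal property of `U'(g)`. -/
def envLift {A : Type*} [Ring A] [Algebra k A] (f : g →ₗ[k] A)
    (hbr : ∀ (i j : ZMod 2), ∀ x ∈ homog k g i, ∀ y ∈ homog k g j,
      f (br (k := k) x y) = f x * f y - sgn k (i * j) • (f y * f x))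
    (hp : ∀ x : homog k g 0, f (pMap p x : g) = f (x : g) ^ p) : Env k p g →ₐ[k] A :=
  RingQuot.liftAlgHom k ⟨TensorAlgebra.lift k f, by
    intro a b h
    cases h with
    | br i j x y hx hy => simpa using hbr i j x hx y hy
    | pMap x => simpa using hp x⟩

@[simp] theorem envLift_ι {A : Type*} [Ring A] [Algebra k A] (f : g →ₗ[k] A) (hbr) (hp) (x : g) :
    envLift (p := p) f hbr hp (envι k p x) = f x := by
  have : envLift (p := p) f hbr hp (envMk k p g (TensorAlgebra.ι k x)) =
      TensorAlgebra.lift k f (TensorAlgebra.ι k x) := RingQuot.liftAlgHom_mkAlgHom_apply k _ _ _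
  rw [envι_apply, this, TensorAlgebra.lift_ι_apply]

theorem env_hom_ext {A : Type*} [Ring A] [Algebra k A] {φ ψ : Env k p g →ₐ[k] A}
    (h : ∀ x, φ (envι k p x) = ψ (envι k p x)) : φ = ψ := by
  have : φ.comp (envMk k p g) = ψ.comp (envMk k p g) := by
    ext x
    exact h x
  exact RingQuot.ringQuot_ext' k φ ψ this

theorem parity_mem_homog {i : ZMod 2} {x : g} (hx : x ∈ homog k g i) :
    parity (k := k) x ∈ homog k g i := by
  rw [mem_homog] at hx ⊢
  rw [hx, map_smul, hx]

/-- The parity automorphism of `U'(g)`. -/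
def envParity : Env k p g →ₐ[k] Env k p g :=
  envLift (envι k p ∘ₗ parity (k := k))
    (fun i j x hx y hy => by
      simp only [LinearMap.comp_apply]
      rw [parity_br, envι_br i j _ _ (parity_mem_homog hx) (parity_mem_homog hy)])
    (fun x => by
      have h1 : ∀ y : homog k g 0, parity (k := k) (y : g) = y := fun y => by
        have := mem_homog.mp y.2
        simpa using this
      simp only [LinearMap.comp_apply, h1]
      exact envι_pMap x)

instance : Superspace k (Env k p g) where
  parity := envParity.toLinearMap
  parity_parity u := by
    have : (envParity (k := k) (p := p) (g := g)).comp envParity = AlgHom.id k _ := by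
      apply env_hom_ext
      intro x
      simp [envParity]
    exact congrArg (fun φ : Env k p g →ₐ[k] Env k p g => φ u) this

theorem parity_env_ι (x : g) : parity (k := k) (envι k p x) = envι k p (parity (k := k) x) := by
  change envParity (envι k p x) = _
  simp [envParity]

theorem parity_env_mul (u v : Env k p g) :
    parity (k := k) (u * v) = parity (k := k) u * parity (k := k) v :=
  map_mul envParity u v

theorem parity_env_one : parity (k := k) (1 : Env k p g) = 1 := map_one envParity

/-- The left regular action of `g` on `U'(g)`. -/
def regAct : SuperAction k g (Env k p g) where
  act := LinearMap.mul k (Env k p g) ∘ₗ envι k p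
  parity_act x u := by simp [parity_env_mul, parity_env_ι]

theorem regAct_isRestricted : (regAct (k := k) (p := p) (g := g)).IsRestricted p where
  act_br i j x hx y hy := by
    ext u
    simp [regAct, envι_br i j x y hx hy, mul_assoc]
  act_pMap x := by
    change LinearMap.mulLeft k _ = LinearMap.mulLeft k _ ^ p
    rw [LinearMap.pow_mulLeft, envι_pMap]

/-- The representation of `U'(g)` given by a restricted representation of `g`. -/
def SuperAction.toEnv {V : Type*} [AddCommGroup V] [Module k V] [Superspace k V]
    (π : SuperAction k g V) (hπ : π.IsRestricted p) : Env k p g →ₐ[k] Module.End k V :=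
  envLift π.act hπ.act_br hπ.act_pMap

section Tensor

variable {V W : Type*} [AddCommGroup V] [Module k V] [Superspace k V]
  [AddCommGroup W] [Module k W] [Superspace k W]

theorem br_mem_homog {i j : ZMod 2} {x y : g} (hx : x ∈ homog k g i) (hy : y ∈ homog k g j) :
    br (k := k) x y ∈ homog k g (i + j) := by
  rw [mem_homog] at *
  rw [parity_br, hx, hy]
  have : (1 + 1 : ZMod 2) = 0 := by decide
  rcases zmod_two_cases i with rfl | rfl <;> rcases zmod_two_cases j with rfl | rfl <;> simp [this]

theorem tensorAct_isRestricted [Fact p.Prime] [CharP k p] (h2 : (2 : k) ≠ 0)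
    (π : SuperAction k g V) (ρ : SuperAction k g W)
    (hπ : π.IsRestricted p) (hρ : ρ.IsRestricted p) : (tensorAct π ρ).IsRestricted p where
  act_br i j x hx y hy := by
    have hxy := br_mem_homog hx hy
    have e1 := hπ.act_br i j x hx y hy
    have e2 := hρ.act_br i j x hx y hy
    have px := mem_homog.mp hx
    have py := mem_homog.mp hy
    have two : (1 + 1 : ZMod 2) = 0 := by decide
    ext v w
    rcases zmod_two_cases i with rfl | rfl <;> rcases zmod_two_cases j with rfl | rfl <;>
    · simp only [two, add_zero, zero_add] at hxy
      simp [tensorAct, proj_of_mem h2 hx, proj_of_mem h2 hy, proj_of_mem h2 hxy, e1, e2,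
        TensorProduct.add_tmul, TensorProduct.tmul_add, TensorProduct.sub_tmul,
        TensorProduct.tmul_sub, π.parity_act, px, py, TensorProduct.neg_tmul]
      try abel
  act_pMap x := by
    have hx := x.2
    have hx' := (pMap p x).2
    have key : ∀ y : homog k g 0, (tensorAct π ρ).act (y : g) =
        TensorProduct.map (π.act (y : g)) LinearMap.id +
          TensorProduct.map LinearMap.id (ρ.act (y : g)) := by
      intro y
      ext v w
      simp [tensorAct, proj_of_mem h2 y.2]
    have hc : Commute (TensorProduct.map (π.act (x : g)) LinearMap.id : Module.End k (V ⊗[k] W))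
        (TensorProduct.map LinearMap.id (ρ.act (x : g))) := by
      ext v w
      simp
    have hp0 : ((p : ℕ) : Module.End k (V ⊗[k] W)) = 0 := by
      rw [← map_natCast (algebraMap k (Module.End k (V ⊗[k] W))) p, CharP.cast_eq_zero, map_zero]
    rw [key, key, hc.add_pow_prime_eq (Fact.out : p.Prime), hp0, zero_mul, zero_mul, zero_mul,
      add_zero,
      TensorProduct.map_pow, TensorProduct.map_pow, hπ.act_pMap, hρ.act_pMap]
    simp only [← Module.End.one_eq_id, one_pow]

end Tensor

theorem two_ne_zero_of_char (k : Type*) [Field k] (p : ℕ) [CharP k p] [Fact (2 < p)] :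
    (2 : k) ≠ 0 := by
  intro h
  have h' : ((2 : ℕ) : k) = 0 := by exact_mod_cast h
  rw [CharP.cast_eq_zero_iff k p] at h'
  exact absurd (Nat.le_of_dvd (by norm_num) h') (not_le.mpr (Fact.out : 2 < p))

/-- The counit of `U'(g)`. -/
def envCounit [Fact p.Prime] : Env k p g →ₐ[k] k :=
  envLift 0 (fun _ _ _ _ _ _ => by simp) (fun _ => by simp [(Fact.out : p.Prime).ne_zero])

variable (k p g) in
/-- The coproduct of the Hopf superalgebra `U'(g)`: the image of `1 ⊗ 1` under the action of `u` on
`U'(g) ⊗ U'(g)` for which `x ∈ g` acts as `x ⊗ 1 + 1 ⊗ x` (with the sign rule). -/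
def envComul [Fact p.Prime] [CharP k p] [Fact (2 < p)] :
    Env k p g →ₗ[k] Env k p g ⊗[k] Env k p g :=
  LinearMap.applyₗ (1 ⊗ₜ[k] 1) ∘ₗ ((tensorAct regAct regAct).toEnv (p := p)
    (tensorAct_isRestricted (two_ne_zero_of_char k p) _ _ regAct_isRestricted
      regAct_isRestricted)).toLinearMap

/-- The action `w ↦ -(-1)^{|x||w|} w x` of `g` on `U'(g)`. -/
def rightAct : SuperAction k g (Env k p g) where
  act := -((LinearMap.mul k (Env k p g)).flip ∘ₗ envι k p ∘ₗ proj (k := k) 0 +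
    LinearMap.lcomp k _ (parity (k := k)) ∘ₗ
      (LinearMap.mul k (Env k p g)).flip ∘ₗ envι k p ∘ₗ proj (k := k) 1)
  parity_act x u := by
    have h : ∀ i : ZMod 2, proj (k := k) i (parity (k := k) x) = parity (k := k) (proj (k := k) i x) := by
      intro i; simp [proj]
    simp [parity_env_mul, parity_env_ι, h]

theorem neg_end_pow {V : Type*} [AddCommGroup V] [Module k V] {q : ℕ} (hq : Odd q)
    (f : Module.End k V) : (-f) ^ q = -f ^ q := hq.neg_pow f

theorem rightAct_isRestricted [Fact p.Prime] [CharP k p] [Fact (2 < p)] :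
    (rightAct (k := k) (p := p) (g := g)).IsRestricted p where
  act_br i j x hx y hy := by
    have h2 := two_ne_zero_of_char k p
    have hxy := br_mem_homog hx hy
    have e := envι_br (p := p) i j x y hx hy
    have px := mem_homog.mp hx
    have py := mem_homog.mp hy
    have two : (1 + 1 : ZMod 2) = 0 := by decide
    ext u
    rcases zmod_two_cases i with rfl | rfl <;> rcases zmod_two_cases j with rfl | rfl <;>
    · simp only [two, add_zero, zero_add] at hxy
      simp [rightAct, proj_of_mem h2 hx, proj_of_mem h2 hy, proj_of_mem h2 hxy, e,
        parity_env_mul, parity_env_ι, px, py, mul_assoc]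
      try abel
  act_pMap x := by
    have h2 := two_ne_zero_of_char k p
    have key : ∀ y : homog k g 0, (rightAct (k := k) (p := p) (g := g)).act (y : g) =
        -LinearMap.mulRight k (envι k p (y : g)) := by
      intro y
      ext u
      simp [rightAct, proj_of_mem h2 y.2]
    have hodd : Odd p := (Fact.out : p.Prime).odd_of_ne_two (Fact.out : 2 < p).ne'
    have h3 := neg_end_pow hodd (LinearMap.mulRight k (envι k p (x : g)))
    rw [key, key, envι_pMap]
    refine Eq.trans ?_ h3.symm
    rw [LinearMap.pow_mulRight]

variable (k p g) in
/-- The antipode `u ↦ ǔ` of the Hopf superalgebra `U'(g)`: `(x u)ˇ = -(-1)^{|x||u|} ǔ x` for `x ∈ g`,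
and `(u v)ˇ = (-1)^{|u||v|} v̌ ǔ`. -/
def antipode [Fact p.Prime] [CharP k p] [Fact (2 < p)] : Env k p g →ₗ[k] Env k p g :=
  LinearMap.applyₗ 1 ∘ₗ ((rightAct (k := k) (p := p) (g := g)).toEnv
    rightAct_isRestricted).toLinearMap

end Env

/-! ### Coinduced and induced representations -/

section Coind

variable {k : Type*} {p : ℕ} {g : Type*} [Field k] [AddCommGroup g] [Module k g]
  [LieSuperalgebra k g] [RestrictedLieSuperalgebra k p g] {H : RestrictedSubalgebra k p g}
  {V W : Type*} [AddCommGroup V] [Module k V] [Superspace k V]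
  [AddCommGroup W] [Module k W] [Superspace k W]

/-- The restricted coinduced representation `Hom_{U'(h)}(U'(g), V)`. An element `μ` is recorded by
the linear map `u ↦ <u, μ> = (-1)^{|u||μ|} μ(u)`, for which `U'(h)`-linearity carries no sign:
`<x u, μ> = π(x) <u, μ>` for `x` in `h` (and hence in `U'(h)`). -/
def Coind (π : SuperAction k H.carrier V) : Submodule k (Env k p g →ₗ[k] V) where
  carrier := {f | ∀ (x : H.carrier) (u : Env k p g), f (envι k p (x : g) * u) = π.act x (f u)}
  add_mem' hf hg x u := by simp [hf x u, hg x u]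
  zero_mem' x u := by simp
  smul_mem' c f hf x u := by simp [hf x u]

/-- The action `<w, u μ> = <w u, μ>` of `U'(g)` on the coinduced representation. -/
instance (π : SuperAction k H.carrier V) : Module (Env k p g) (Coind π) where
  smul u f := ⟨f.1 ∘ₗ LinearMap.mulRight k u, fun x w => by
    simpa [mul_assoc] using f.2 x (w * u)⟩
  one_smul f := Subtype.ext (LinearMap.ext fun w => congrArg f.1 (mul_one w))
  mul_smul u v f := Subtype.ext (LinearMap.ext fun w => congrArg f.1 (mul_assoc w u v).symm)
  smul_zero u := Subtype.ext (LinearMap.ext fun w => rfl)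
  smul_add u f f' := Subtype.ext (LinearMap.ext fun w => rfl)
  add_smul u v f := Subtype.ext (LinearMap.ext fun w =>
    (congrArg f.1 (mul_add w u v)).trans (map_add f.1 _ _))
  zero_smul f := Subtype.ext (LinearMap.ext fun w =>
    (congrArg f.1 (mul_zero w)).trans (map_zero f.1))

theorem coind_smul_apply (π : SuperAction k H.carrier V) (u w : Env k p g) (f : Coind π) :
    (u • f).1 w = f.1 (w * u) := rfl

instance (π : SuperAction k H.carrier V) : IsScalarTower k (Env k p g) (Coind π) where
  smul_assoc c u f := Subtype.ext (LinearMap.ext fun w => by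
    rw [coind_smul_apply, mul_smul_comm, map_smul]
    rfl)

/-- The element `f` of the coinduced representation is homogeneous of degree `i`. -/
def IsHomog {π : SuperAction k H.carrier V} (f : Coind π) (i : ZMod 2) : Prop :=
  f.1 ∈ homog k (Env k p g →ₗ[k] V) i

theorem parity_mem_coind {π : SuperAction k H.carrier V} {f : Env k p g →ₗ[k] V}
    (hf : f ∈ Coind π) : parity (k := k) f ∈ Coind π := by
  intro x u
  have := hf (parity (k := k) x) (parity (k := k) u)
  simp only [parity_hom, parity_env_mul, parity_env_ι]
  rw [coe_parity] at this
  rw [this, π.parity_act, parity_parity]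

theorem proj_mem_coind {π : SuperAction k H.carrier V} {f : Env k p g →ₗ[k] V}
    (hf : f ∈ Coind π) (i : ZMod 2) : proj (k := k) i f ∈ Coind π :=
  (Coind π).smul_mem _ ((Coind π).add_mem hf ((Coind π).smul_mem _ (parity_mem_coind hf)))

/-- The functoriality of coinduction. -/
def coindMap {π : SuperAction k H.carrier V} {ρ : SuperAction k H.carrier W} (T : V →ₗ[k] W)
    (hT : ∀ x v, T (π.act x v) = ρ.act x (T v)) : Coind π →ₗ[k] Coind ρ :=
  (LinearMap.compRight k T).restrict (fun f hf x u => by simp [hf x u, hT])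

section Cup

variable [Fact p.Prime] [CharP k p] [Fact (2 < p)]

theorem envComul_ι_mul (x : g) (u : Env k p g) : envComul k p g (envι k p x * u) =
    (tensorAct regAct regAct).act x (envComul k p g u) := by
  simp [envComul, SuperAction.toEnv]

/-- The map `u₁ ⊗ u₂ ↦ (-1)^{|λ||u₂|} <u₁, λ> ⊗ <u₂, μ>`. -/
def cupAux (f : Env k p g →ₗ[k] V) (f' : Env k p g →ₗ[k] W) :
    Env k p g ⊗[k] Env k p g →ₗ[k] V ⊗[k] W :=
  TensorProduct.map (proj (k := k) 0 f) f' +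
    TensorProduct.map (proj (k := k) 1 f) (f' ∘ₗ parity (k := k))

/-- The product `Coind(π) × Coind(ρ) → Coind(π ⊗ ρ)` given by the coproduct:
`<u, λ μ> = ∑ (-1)^{|λ||u₂|} <u₁, λ> ⊗ <u₂, μ>` for `Δ(u) = ∑ u₁ ⊗ u₂`. -/
def cup {π : SuperAction k H.carrier V} {ρ : SuperAction k H.carrier W} (f : Coind π)
    (f' : Coind ρ) : Coind (tensorAct π ρ) :=
  ⟨cupAux f.1 f'.1 ∘ₗ envComul k p g, by
    intro x u
    rw [LinearMap.comp_apply, LinearMap.comp_apply, envComul_ι_mul]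
    have h0 := proj_mem_coind f.2 0
    have h1 := proj_mem_coind f.2 1
    have m0 := mem_homog.mp (proj_mem (k := k) 0 f.1)
    have m1 := mem_homog.mp (proj_mem (k := k) 1 f.1)
    have hp : ∀ i : ZMod 2, proj (k := k) i (x : g) = ((proj (k := k) i x : H.carrier) : g) := by
      intro i
      simp [proj]
    have hpar : parity (k := k) (proj (k := k) 1 x) = -proj (k := k) 1 x := by
      have := mem_homog.mp (proj_mem (k := k) 1 x)
      simpa using this
    have hpar' : parity (k := k) ((proj (k := k) 1 x : H.carrier) : g) =
        -((proj (k := k) 1 x : H.carrier) : g) := by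
      rw [← coe_parity, hpar]
      rfl
    have hpar0 : parity (k := k) ((proj (k := k) 0 x : H.carrier) : g) =
        ((proj (k := k) 0 x : H.carrier) : g) := by
      rw [← coe_parity, mem_homog.mp (proj_mem (k := k) 0 x), sgn_zero, one_smul]
    have s0 : ∀ w, parity (k := k) (proj (k := k) 0 f.1 w) =
        proj (k := k) 0 f.1 (parity (k := k) w) := by
      intro w
      have := LinearMap.congr_fun m0 (parity (k := k) w)
      simpa using this
    have s1 : ∀ w, parity (k := k) (proj (k := k) 1 f.1 w) =
        -proj (k := k) 1 f.1 (parity (k := k) w) := by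
      intro w
      have := LinearMap.congr_fun m1 (parity (k := k) w)
      simpa using this
    induction envComul k p g u with
    | zero => simp
    | add a b ha hb => simp only [map_add, ha, hb]
    | tmul a b =>
      simp only [tensorAct, regAct, cupAux, hp, LinearMap.coe_mk, AddHom.coe_mk,
        LinearMap.add_apply, TensorProduct.map_tmul, LinearMap.comp_apply, LinearMap.id_apply,
        map_add, LinearMap.mul_apply', parity_env_mul, parity_env_ι, hpar0, hpar', map_neg, neg_mul,
        h0 _ _, h1 _ _, f'.2 _ _, s0, s1, TensorProduct.tmul_neg, TensorProduct.neg_tmul]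
      abel⟩

/-- The action of the superalgebra `A = Coind(k)` on `Coind(ρ)`; for trivial `ρ` this is the
multiplication of `A`. -/
def smulA {ρ : SuperAction k H.carrier W} (a : Coind (trivAct k H.carrier)) (f : Coind ρ) :
    Coind ρ :=
  coindMap (TensorProduct.lid k W).toLinearMap (fun x t => by
    have h2 := two_ne_zero_of_char k p
    induction t with
    | zero => simp
    | add a b ha hb => simp only [map_add, ha, hb]
    | tmul c w =>
      conv_rhs => rw [← proj_add_proj h2 x]
      simp [tensorAct, trivAct]) (cup a f)

variable (H) in
/-- The unit of the superalgebra `A`. -/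
def oneA : Coind (trivAct k H.carrier) :=
  ⟨(envCounit (k := k) (p := p) (g := g)).toLinearMap, fun x u => by
    simp [trivAct, envCounit]⟩

end Cup

end Coind

section Ind

variable {k : Type*} {p : ℕ} {g : Type*} [Field k] [AddCommGroup g] [Module k g]
  [LieSuperalgebra k g] [RestrictedLieSuperalgebra k p g] {H : RestrictedSubalgebra k p g}
  {W : Type*} [AddCommGroup W] [Module k W] [Superspace k W]

/-- The relations `u x ⊗ w = u ⊗ ρ(x) w` for `x` in `h`, which define the tensor product over
`U'(h)`. -/
def indRel (ρ : SuperAction k H.carrier W) : Submodule (Env k p g) (Env k p g ⊗[k] W) :=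
  Submodule.span (Env k p g)
    {t | ∃ (u : Env k p g) (x : H.carrier) (w : W),
      t = (u * envι k p (x : g)) ⊗ₜ[k] w - u ⊗ₜ[k] ρ.act x w}

/-- The restricted induced representation `U'(g) ⊗_{U'(h)} W`. -/
def Ind (ρ : SuperAction k H.carrier W) : Type _ := (Env k p g ⊗[k] W) ⧸ indRel ρ

instance (ρ : SuperAction k H.carrier W) : AddCommGroup (Ind ρ) :=
  inferInstanceAs (AddCommGroup ((Env k p g ⊗[k] W) ⧸ indRel ρ))

instance (ρ : SuperAction k H.carrier W) : Module (Env k p g) (Ind ρ) :=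
  inferInstanceAs (Module (Env k p g) ((Env k p g ⊗[k] W) ⧸ indRel ρ))

instance (ρ : SuperAction k H.carrier W) : Module k (Ind ρ) :=
  inferInstanceAs (Module k ((Env k p g ⊗[k] W) ⧸ indRel ρ))

instance (ρ : SuperAction k H.carrier W) : IsScalarTower k (Env k p g) (Ind ρ) :=
  inferInstanceAs (IsScalarTower k (Env k p g) ((Env k p g ⊗[k] W) ⧸ indRel ρ))

/-- The element `u ⊗ w` of the induced representation. -/
def indMk (ρ : SuperAction k H.carrier W) (u : Env k p g) (w : W) : Ind ρ :=
  (indRel ρ).mkQ (u ⊗ₜ[k] w)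

end Ind

/-! ### Coordinates -/

section Coordinates

variable {k : Type*} {p : ℕ} {g : Type*} [Field k] [AddCommGroup g] [Module k g]
  [LieSuperalgebra k g] [RestrictedLieSuperalgebra k p g] {H : RestrictedSubalgebra k p g}
  {V W : Type*} [AddCommGroup V] [Module k V] [Superspace k V]
  [AddCommGroup W] [Module k W] [Superspace k W]

/-- A homogeneous basis `(e_1, …, e_n, ε_1, …, ε_m)` of a supplement of `h` in `g`: homogeneous
elements whose classes form a basis of `g/h`. -/
structure Frame (H : RestrictedSubalgebra k p g) (n m : ℕ) where
  e : Fin n → g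
  ε : Fin m → g
  e_mem : ∀ i, e i ∈ homog k g 0
  ε_mem : ∀ s, ε s ∈ homog k g 1
  linearIndependent : LinearIndependent k (fun i => H.carrier.mkQ (Sum.elim e ε i))
  span_eq_top : Submodule.span k (Set.range (fun i => H.carrier.mkQ (Sum.elim e ε i))) = ⊤

/-- The list `x_1, …, x_1, x_2, …, x_n, y_1, …, y_m` with multiplicities `a` and `α`. -/
def orderedList {n m : ℕ} {X : Type*} (x : Fin n → X) (y : Fin m → X) (a : Fin n → ℕ)
    (α : Fin m → ℕ) : List X :=
  (List.finRange n).flatMap (fun i => List.replicate (a i) (x i)) ++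
    (List.finRange m).flatMap (fun s => List.replicate (α s) (y s))

variable {n m : ℕ}

/-- The monomial `e^a ε^α = e_1^{a_1} ⋯ e_n^{a_n} ε_1^{α_1} ⋯ ε_m^{α_m}` of `U'(g)`. -/
def pbwMonomial (F : Frame H n m) (a : Fin n → ℕ) (α : Fin m → ℕ) : Env k p g :=
  ((orderedList F.e F.ε a α).map (envι k p)).prod

/-- The exponents `(a, α) ∈ [0, p-1]^n × {0, 1}^m`. -/
abbrev Expo (p n m : ℕ) : Type := (Fin n → Fin p) × (Fin m → Fin 2)

/-- The values of an element of the coinduced representation on the monomials `e^a ε^α`. -/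
def evalPBW (F : Frame H n m) (ρ : SuperAction k H.carrier W) :
    Coind ρ →ₗ[k] (Expo p n m → W) where
  toFun f b := f.1 (pbwMonomial F (fun i => (b.1 i : ℕ)) (fun s => (b.2 s : ℕ)))
  map_add' _ _ := rfl
  map_smul' _ _ := rfl

/-- The element of the coinduced representation with the given values on the monomials `e^a ε^α`
(`evalPBW` is bijective by the theorem of Poincaré, Birkhoff and Witt). -/
def ofPBW (F : Frame H n m) (ρ : SuperAction k H.carrier W) (c : Expo p n m → W) : Coind ρ :=
  Function.invFun (evalPBW F ρ) c

variable [Fact p.Prime]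

/-- The element `v̂`: `<1, v̂> = v`, and `v̂` vanishes on the other monomials. -/
def hat (F : Frame H n m) (ρ : SuperAction k H.carrier W) (w : W) : Coind ρ :=
  ofPBW F ρ (Pi.single 0 w)

/-- The even coordinate `η_i`: `<e_i, η_i> = 1`, and `η_i` vanishes on the other monomials. -/
def eta (F : Frame H n m) (i : Fin n) : Coind (trivAct k H.carrier) :=
  ofPBW F _ (Pi.single (Pi.single i 1, 0) 1)

/-- The odd coordinate `ζ_s`: `<ε_s, ζ_s> = 1`, and `ζ_s` vanishes on the other monomials. -/
def zeta (F : Frame H n m) (s : Fin m) : Coind (trivAct k H.carrier) :=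
  ofPBW F _ (Pi.single (0, Pi.single s 1) 1)

variable [CharP k p] [Fact (2 < p)]

/-- The monomial `η^a ζ^α = η_1^{a_1} ⋯ η_n^{a_n} ζ_1^{α_1} ⋯ ζ_m^{α_m}` of `A`. -/
def coordMonomial (F : Frame H n m) (a : Fin n → ℕ) (α : Fin m → ℕ) :
    Coind (trivAct k H.carrier) :=
  (orderedList (eta F) (zeta F) a α).foldr smulA (oneA H)

/-- The top monomial `Λ = η_1^{p-1} ⋯ η_n^{p-1} ζ_1 ⋯ ζ_m`. -/
def topMonomial (F : Frame H n m) : Coind (trivAct k H.carrier) :=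
  coordMonomial F (fun _ => p - 1) (fun _ => 1)

/-- Superderivations of `A` of degree `j`. -/
structure IsSuperDerivation (j : ZMod 2)
    (D : Coind (trivAct k H.carrier) →ₗ[k] Coind (trivAct k H.carrier)) : Prop where
  degree : ∀ (i : ZMod 2) (f : Coind (trivAct k H.carrier)),
    IsHomog f i → IsHomog (D f) (j + i)
  leibniz : ∀ (i : ZMod 2) (f f' : Coind (trivAct k H.carrier)),
    IsHomog f i → D (smulA f f') = smulA (D f) f' + sgn k (j * i) • smulA f (D f')

/-- `∂ i` and `∂' s` are the superderivations `∂/∂η_i` (even) and `∂/∂ζ_s` (odd) of `A`. -/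
structure IsPartials (F : Frame H n m)
    (d : Fin n → Coind (trivAct k H.carrier) →ₗ[k] Coind (trivAct k H.carrier))
    (d' : Fin m → Coind (trivAct k H.carrier) →ₗ[k] Coind (trivAct k H.carrier)) : Prop where
  even : ∀ i, IsSuperDerivation 0 (d i)
  odd : ∀ s, IsSuperDerivation 1 (d' s)
  even_eta : ∀ i j, d i (eta F j) = if i = j then oneA H else 0
  even_zeta : ∀ i t, d i (zeta F t) = 0
  odd_eta : ∀ s j, d' s (eta F j) = 0
  odd_zeta : ∀ s t, d' s (zeta F t) = if s = t then oneA H else 0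

/-- The divergence `∑_i ∂_i(f_i) - (-1)^{|x|} ∑_s ∂'_s(g_s)` of the derivation
`δ_x = ∑_i f_i ∂_i + ∑_s g_s ∂'_s` of `A`, where `f_i = δ_x(η_i)` and `g_s = δ_x(ζ_s)`. -/
def divergence (F : Frame H n m)
    (d : Fin n → Coind (trivAct k H.carrier) →ₗ[k] Coind (trivAct k H.carrier))
    (d' : Fin m → Coind (trivAct k H.carrier) →ₗ[k] Coind (trivAct k H.carrier)) (x : g) :
    Coind (trivAct k H.carrier) :=
  ∑ i, d i (envι k p x • eta F i) - ∑ s, d' s (envι k p (parity (k := k) x) • zeta F s)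

/-- The Lie derivative `L_x(f ω) = δ_x(f) ω + (-1)^{|x||f|} f div(δ_x) ω` on the Berezinian module
`Ω = A ω` of the module of differentials of `A`, where `ω` is the basis defined by the coordinates
and `f ω` is recorded as `f`; for `x` of degree `i` and `f` of degree `j`. -/
def lieDerivative (F : Frame H n m)
    (d : Fin n → Coind (trivAct k H.carrier) →ₗ[k] Coind (trivAct k H.carrier))
    (d' : Fin m → Coind (trivAct k H.carrier) →ₗ[k] Coind (trivAct k H.carrier))
    (i j : ZMod 2) (x : g) (f : Coind (trivAct k H.carrier)) : Coind (trivAct k H.carrier) :=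
  envι k p x • f + sgn k (i * j) • smulA f (divergence F d d' x)

variable (H) in
/-- The representation `Π^m k_{strad}` of `h`, with basis `Λ`. -/
def stradAct (m : ℕ) : SuperAction k H.carrier (Line k m) :=
  lineAct m (strad H) (strad_parity H)

variable (H) in
/-- The representation `Π^m k_{-strad}` of `h`. -/
def negStradAct (m : ℕ) : SuperAction k H.carrier (Line k m) :=
  lineAct m (-strad H) (fun x => by simp [strad_parity])

variable (m) in
/-- The representation `Π^m k_{strad} ⊗ π`. -/
abbrev twist (π : SuperAction k H.carrier V) : SuperAction k H.carrier (Line k m ⊗[k] V) :=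
  tensorAct (stradAct H m) π

variable (m) in
/-- The representation `π* ⊗ Π^m k_{-strad}`. -/
abbrev dualTwist (π : SuperAction k H.carrier V) :
    SuperAction k H.carrier (Module.Dual k V ⊗[k] Line k m) :=
  tensorAct (dualAct π) (negStradAct H m)

/-- `χ : Ω → Coind(Π^m k_{-strad})` is the isomorphism of `A`-modules and of representations of `g`
(for the Lie derivative on `Ω`) with `<1, χ(ω)> = 1`. -/
structure IsBerezinianIso (F : Frame H n m)
    (d : Fin n → Coind (trivAct k H.carrier) →ₗ[k] Coind (trivAct k H.carrier))
    (d' : Fin m → Coind (trivAct k H.carrier) →ₗ[k] Coind (trivAct k H.carrier))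
    (χ : Coind (trivAct k H.carrier) ≃ₗ[k] Coind (negStradAct H m)) : Prop where
  map_smulA : ∀ a f, χ (smulA a f) = smulA a (χ f)
  map_lieDerivative : ∀ (i j : ZMod 2), ∀ x ∈ homog k g i, ∀ f : Coind (trivAct k H.carrier),
    IsHomog f j → χ (lieDerivative F d d' i j x f) = envι k p x • χ f
  one_apply_one : (χ (oneA H)).1 1 = lineGen k m

/-- The number of inversions: `ζ^α ζ^β = (-1)^{inversions α β} ζ_1 ⋯ ζ_m` if `α + β = (1, …, 1)`. -/
def inversions (α β : Fin m → Fin 2) : ℕ :=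
  (Finset.univ.filter (fun st : Fin m × Fin m => st.2 < st.1 ∧ α st.1 = 1 ∧ β st.2 = 1)).card

/-- `Ψ` is the pairing of `Coind(π)` and `Coind(π* ⊗ Π^m k_{-strad}) ≃ Coind(π*) ⊗_A Ω` with
`Ψ(η^a ζ^α v̂, η^b ζ^β v̂* ⊗ ω) = (-1)^{inversions α β} (-1)^{|v||β|} <v, v*>` if `a_i + b_i = p - 1` and
`α_s + β_s = 1` for all `i` and `s`, and `0` otherwise. Here `<v, v*> = (-1)^{|v||v*|} v*(v)`, and
`λ ⊗ ω` corresponds to the product of `λ` and `χ(ω)`. -/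
def IsPsi (F : Frame H n m) (π : SuperAction k H.carrier V)
    (χ : Coind (trivAct k H.carrier) ≃ₗ[k] Coind (negStradAct H m))
    (Ψ : Coind π →ₗ[k] Coind (dualTwist m π) →ₗ[k] k) : Prop :=
  ∀ (a b : Fin n → Fin p) (α β : Fin m → Fin 2) (i j : ZMod 2), ∀ v ∈ homog k V i,
    ∀ v' ∈ homog k (Module.Dual k V) j,
      Ψ (smulA (coordMonomial F (fun r => (a r : ℕ)) (fun s => (α s : ℕ))) (hat F π v))
        (cup (smulA (coordMonomial F (fun r => (b r : ℕ)) (fun s => (β s : ℕ)))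
          (hat F (dualAct π) v')) (χ (oneA H))) =
      if (∀ r, (a r : ℕ) + (b r : ℕ) = p - 1) ∧ (∀ s, (α s : ℕ) + (β s : ℕ) = 1) then
        (-1 : k) ^ inversions α β * sgn k (i * ∑ s, ((β s : ℕ) : ZMod 2)) * (sgn k (i * j) * v' v)
      else 0

/-- `Ψ'` is the map `Coind(π* ⊗ Π^m k_{-strad}) → Coind(π)*` with `<f, Ψ'(μ)> = Ψ(f, μ)`, that is,
`Ψ'(μ)(f) = (-1)^{|f||μ|} Ψ(f, μ)`. -/
def IsInducedBy (π : SuperAction k H.carrier V)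
    (Ψ : Coind π →ₗ[k] Coind (dualTwist m π) →ₗ[k] k)
    (Ψ' : Coind (dualTwist m π) →ₗ[k] Module.Dual k (Coind π)) : Prop :=
  ∀ (i j : ZMod 2) (f : Coind π) (μ : Coind (dualTwist m π)),
    IsHomog f i → IsHomog μ j → Ψ' μ f = sgn k (i * j) * Ψ f μ

/-- The identification of `V* ⊗ Π^m k` with the dual of `Π^m k ⊗ V`:
`(f ⊗ c)(c' ⊗ v) = f(v) c(c')`, where `Π^m k` is identified with its own dual by the dual basis in the
sense `<1, 1> = 1`, that is, `c(c') = (-1)^m c c'`. -/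
def dualTwistPairing : Module.Dual k V ⊗[k] Line k m →ₗ[k] Module.Dual k (Line k m ⊗[k] V) :=
  TensorProduct.dualDistrib k (Line k m) V ∘ₗ
    (TensorProduct.comm k (Module.Dual k V) (Module.Dual k (Line k m))).toLinearMap ∘ₗ
      TensorProduct.map LinearMap.id
        ((-1 : k) ^ m • LinearMap.toSpanSingleton k _ (lineCoord k m) ∘ₗ lineCoord k m)

/-- `Θ` is the map `μ ↦ [u ⊗ w ↦ <μ(ǔ), w>]` from `Coind(π* ⊗ Π^m k_{-strad})` to the dual of
`Ind(Π^m k_{strad} ⊗ π)`, where `μ(ǔ) = (-1)^{|u||μ|} <ǔ, μ>`. -/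
def IsTheta (π : SuperAction k H.carrier V)
    (Θ : Coind (dualTwist m π) →ₗ[k] Module.Dual k (Ind (twist m π))) : Prop :=
  ∀ (i j : ZMod 2), ∀ u ∈ homog k (Env k p g) i, ∀ μ : Coind (dualTwist m π),
    IsHomog μ j → ∀ w : Line k m ⊗[k] V, Θ μ (indMk (twist m π) u w) =
        sgn k (i * j) * dualTwistPairing (μ.1 (antipode k p g u)) w

/-- `T : Coind(ρ) → M*` is a morphism of representations of `g`, for the contragredient action
`(x ξ)(t) = -(-1)^{|x||ξ|} ξ(x t)` on `M*`. -/
def IsEquivariantToDual {ρ : SuperAction k H.carrier W} {M : Type*} [AddCommGroup M] [Module k M]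
    [Module (Env k p g) M] (T : Coind ρ →ₗ[k] Module.Dual k M) : Prop :=
  ∀ (i j : ZMod 2), ∀ x ∈ homog k g i, ∀ μ : Coind ρ,
    IsHomog μ j → ∀ t : M,
      T (envι k p x • μ) t = -(sgn k (i * j) * T μ (envι k p x • t))

end Coordinates

end RestrictedSuper

end

open RestrictedSuper

/-! The theorem rests on the theorem of Poincaré, Birkhoff and Witt for `U'(g)` and on integration
over the truncated superalgebra `A = Coind(k)`, the integral being the coefficient of the top
monomial `Λ`.

PBW. A linear map on the tensor algebra that respects the defining relations up to degree `n` is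
extended to degree `n + 1` by straightening words at a chosen descent or at a chosen full power
(`x^p` for even `x`, `x^2` for odd `x`). That the choice does not matter is a diamond lemma
(`straighten_swap`, `straighten_pow`): overlapping descents are resolved by the Jacobi identity; a
letter meeting a power block by `ad(x^[p]) = ad(x)^p`, respectively by the Jacobi identity for
`[x,x]/2`; a block meeting its own letter by `[x,x] = 0`, respectively `[x,[x,x]] = 0`. Jacobson's
formula (`add_pow_eq_jacobson`) carries the `p`-power relations from a basis to all even elements.
In a basis adapted to `h`, the standard words factor as words in `h` times monomials `e^a ε^α`, so
an `h`-linear map is the same as its family of values on these monomials.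

Algebra. Elements of `g` are primitive, so they act on products by the Leibniz rule (`rmul_conv`). A
product is determined by its value at `1` and this rule; associativity and supercommutativity follow
by induction on right multiplication. Up to nonzero scalars the products of coordinates are dual to
the monomials (`exists_smulA_mon_apply`).

Integration. The matrix of the derivations `δ_{e_i}`, `δ_{ε_s}` on the coordinates is the identity
at `1`, hence invertible, and its inverse yields the partial derivatives. Integrals of partial
derivatives vanish, so `∫ (δ_x f + div(δ_x) f) = 0`. For `x` in `h` the divergence takes the value
`-strad(x)` at `1`, and therefore `x Λ = strad(x) Λ` (`smul_topMonomial_of_mem`). This makes `c ⊗ v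
↦ c Λ v̂` an `h`-morphism and gives `Φ` by Frobenius reciprocity; it also makes `u ↦ ∫ (ǔ Λ) f`, up
to sign, an element of `Coind(Π^m k_{-strad})`, which is `χ(f ω)`. The form is `Ψ(f, μ χ(ω)) = ∫ ⟨f,
μ⟩`, and its invariance is again the vanishing of integrals of Lie derivatives.

Conclusion. `ᵗΦ ∘ Ψ'` and `Θ` are both equivariant, so they need to be compared only at `1 ⊗ (Λ ⊗
v)`, where `Λ` reduces the integral to values at `1` (`psiDual_phi`). `Ψ'` is bijective because
monomials with complementary exponents are dual under the integral, and `Θ` is bijective because the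
antipode is an involution. Hence `ᵗΦ` is bijective, and so is `Φ` (`phi_bijective`). Since there are
finitely many monomials, `V` may have any dimension. -/

noncomputable section

set_option linter.unusedSectionVars false

namespace RestrictedSuper

/-! ### Words and degrees in the tensor algebra -/

section Words

variable {k g : Type*} [Field k] [AddCommGroup g] [Module k g] {B : Type*}

/-- The word `b_{l_1} ⋯ b_{l_r}` in the tensor algebra. -/
def word (b : Module.Basis B k g) (l : List B) : TensorAlgebra k g :=
  (l.map (fun x => TensorAlgebra.ι k (b x))).prod

variable (k g) in
/-- The tensors of degree `n`. -/
def tensorDeg (n : ℕ) : Submodule k (TensorAlgebra k g) :=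
  LinearMap.range (TensorAlgebra.ι k : g →ₗ[k] TensorAlgebra k g) ^ n

variable (b : Module.Basis B k g)

@[simp] theorem word_nil : word b [] = 1 := rfl

@[simp] theorem word_cons (x : B) (l : List B) :
    word b (x :: l) = TensorAlgebra.ι k (b x) * word b l := by simp [word]

@[simp] theorem word_append (l l' : List B) : word b (l ++ l') = word b l * word b l' := by
  simp [word]

@[simp] theorem word_replicate (r : ℕ) (x : B) :
    word b (List.replicate r x) = TensorAlgebra.ι k (b x) ^ r := by
  simp [word]

theorem tensorAlgebra_basis_apply (l : FreeMonoid B) :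
    b.tensorAlgebra l = word b l.toList := by
  have : b.tensorAlgebra l = (TensorAlgebra.equivFreeAlgebra b).symm
      (FreeAlgebra.basisFreeMonoid k B l) := rfl
  rw [this]
  clear this
  have h : FreeAlgebra.basisFreeMonoid k B l = (l.toList.map (FreeAlgebra.ι k)).prod := by
    induction l using FreeMonoid.inductionOn' with
    | one => simp [FreeAlgebra.basisFreeMonoid, MonoidAlgebra.one_def]
    | of_mul x xs ih =>
      rw [FreeMonoid.toList_mul, List.map_append, List.prod_append, ← ih]
      simp [FreeAlgebra.basisFreeMonoid, FreeAlgebra.equivMonoidAlgebraFreeMonoid]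
  rw [h, map_list_prod, word, List.map_map]
  congr 2
  ext x
  simp

/-- A linear map on the tensor algebra is given by its values on the words in a basis. -/
theorem exists_linear_word {Q : Type*} [AddCommGroup Q] [Module k Q] (f : List B → Q) :
    ∃ L : TensorAlgebra k g →ₗ[k] Q, ∀ l, L (word b l) = f l := by
  refine ⟨b.tensorAlgebra.constr k (fun l => f l.toList), fun l => ?_⟩
  have := b.tensorAlgebra.constr_basis k (fun l => f l.toList) (FreeMonoid.ofList l)
  rwa [tensorAlgebra_basis_apply] at this

theorem linear_word_ext {Q : Type*} [AddCommGroup Q] [Module k Q]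
    {L L' : TensorAlgebra k g →ₗ[k] Q} (h : ∀ l, L (word b l) = L' (word b l)) : L = L' :=
  b.tensorAlgebra.ext fun l => by rw [tensorAlgebra_basis_apply]; exact h _

theorem ι_mem_tensorDeg (x : g) : TensorAlgebra.ι k x ∈ tensorDeg k g 1 := by
  rw [tensorDeg, pow_one]; exact ⟨x, rfl⟩

theorem one_mem_tensorDeg : (1 : TensorAlgebra k g) ∈ tensorDeg k g 0 := by
  rw [tensorDeg, pow_zero]; exact Submodule.one_le.mp (le_refl (1 : Submodule k (TensorAlgebra k g)))

theorem mul_mem_tensorDeg {i j : ℕ} {a c : TensorAlgebra k g} (ha : a ∈ tensorDeg k g i)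
    (hc : c ∈ tensorDeg k g j) : a * c ∈ tensorDeg k g (i + j) := by
  rw [tensorDeg, pow_add]; exact Submodule.mul_mem_mul ha hc

theorem mul_ι_mem_tensorDeg {i : ℕ} {a : TensorAlgebra k g} (ha : a ∈ tensorDeg k g i) (x : g) :
    a * TensorAlgebra.ι k x ∈ tensorDeg k g (i + 1) :=
  mul_mem_tensorDeg ha (ι_mem_tensorDeg x)

theorem ι_mul_mem_tensorDeg {i : ℕ} {a : TensorAlgebra k g} (ha : a ∈ tensorDeg k g i) (x : g) :
    TensorAlgebra.ι k x * a ∈ tensorDeg k g (i + 1) := by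
  rw [add_comm]; exact mul_mem_tensorDeg (ι_mem_tensorDeg x) ha

theorem ι_pow_mem_tensorDeg (x : g) (r : ℕ) : TensorAlgebra.ι k x ^ r ∈ tensorDeg k g r := by
  induction r with
  | zero => rw [pow_zero]; exact one_mem_tensorDeg (k := k) (g := g)
  | succ r ih => rw [pow_succ]; exact mul_ι_mem_tensorDeg ih x

theorem word_mem_tensorDeg (l : List B) : word b l ∈ tensorDeg k g l.length := by
  induction l with
  | nil => exact one_mem_tensorDeg (k := k) (g := g)
  | cons x l ih => rw [word_cons]; exact ι_mul_mem_tensorDeg ih _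

theorem tensorDeg_le_span (n : ℕ) :
    tensorDeg k g n ≤ Submodule.span k {t | ∃ l : List B, l.length = n ∧ t = word b l} := by
  induction n with
  | zero =>
    rw [tensorDeg, pow_zero, Submodule.one_eq_span]
    exact Submodule.span_mono (by rintro _ rfl; exact ⟨[], rfl, rfl⟩)
  | succ n ih =>
    rw [tensorDeg, pow_succ']
    refine Submodule.mul_le.mpr ?_
    rintro _ ⟨x, rfl⟩ t ht
    replace ht := ih ht
    induction ht using Submodule.span_induction with
    | zero => simp
    | add a c _ _ h1 h2 => rw [mul_add]; exact add_mem h1 h2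
    | smul r a _ h => rw [mul_smul_comm]; exact Submodule.smul_mem _ _ h
    | mem t ht =>
      obtain ⟨l, rfl, rfl⟩ := ht
      have hx : x ∈ Submodule.span k (Set.range b) := by rw [b.span_eq]; trivial
      induction hx using Submodule.span_induction with
      | zero => simp
      | add a c _ _ h1 h2 => rw [map_add, add_mul]; exact add_mem h1 h2
      | smul r a _ h => rw [map_smul, smul_mul_assoc]; exact Submodule.smul_mem _ _ h
      | mem x hx =>
        obtain ⟨x, rfl⟩ := hx
        exact Submodule.subset_span ⟨x :: l, rfl, by simp⟩

end Words

/-! ### Inversions of words -/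

section Inversions

variable {B : Type*} [LinearOrder B]

/-- The number of inversions of a word. -/
def invCount : List B → ℕ
  | [] => 0
  | x :: l => l.countP (· < x) + invCount l

/-- The letters before the pair see the same multiset behind them, so exactly the inversion of the
pair itself disappears. This is the termination measure of straightening. -/
theorem invCount_swap_lt (a c : List B) {x y : B} (h : y < x) :
    invCount (a ++ y :: x :: c) < invCount (a ++ x :: y :: c) := by
  induction a with
  | nil =>
    simp [invCount, h, h.le]
    omega
  | cons z a ih =>
    simp only [List.cons_append, invCount]
    have : (a ++ y :: x :: c).countP (· < z) = (a ++ x :: y :: c).countP (· < z) :=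
      ((List.Perm.swap x y c).append_left a).countP_eq _
    omega

end Inversions

/-! ### Homogeneous bases and the defining relations in bounded degree -/

section Relations

variable {k : Type*} {p : ℕ} {g : Type*} [Field k] [AddCommGroup g] [Module k g]
  [LieSuperalgebra k g] [RestrictedLieSuperalgebra k p g]

/-- A homogeneous basis. -/
structure HomogBasis (k g B : Type*) [Field k] [AddCommGroup g] [Module k g] [Superspace k g] where
  basis : Module.Basis B k g
  deg : B → ZMod 2
  mem : ∀ x, basis x ∈ homog k g (deg x)

variable {B : Type*} (b : HomogBasis k g B)

variable (p) in
/-- The power of a basis element that is rewritten. -/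
def HomogBasis.expo (x : B) : ℕ := if b.deg x = 0 then p else 2

variable (p) in
/-- The element of `g` that replaces the power `x ^ expo x`. -/
def HomogBasis.root (x : B) : g :=
  if h : b.deg x = 0 then (pMap p ⟨b.basis x, h ▸ b.mem x⟩ : homog k g 0)
  else (2 : k)⁻¹ • br (k := k) (b.basis x) (b.basis x)

local notation "ι" => TensorAlgebra.ι k

/-- The map kills the consequences of degree at most `n` of the defining relations. -/
structure Rel (p : ℕ) [RestrictedLieSuperalgebra k p g] (b : HomogBasis k g B) {Q : Type*}
    [AddCommGroup Q] [Module k Q] (n : ℕ) (L : TensorAlgebra k g →ₗ[k] Q) : Prop where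
  comm : ∀ i j, i + j + 2 ≤ n → ∀ a ∈ tensorDeg k g i, ∀ c ∈ tensorDeg k g j,
    ∀ (d e : ZMod 2), ∀ x ∈ homog k g d, ∀ y ∈ homog k g e,
    L (a * (TensorAlgebra.ι k x * TensorAlgebra.ι k y) * c) =
      sgn k (d * e) • L (a * (TensorAlgebra.ι k y * TensorAlgebra.ι k x) * c) +
      L (a * TensorAlgebra.ι k (br (k := k) x y) * c)
  -- Only for basis elements: the `p`-operation is not additive. Jacobson's formula will supply the
  -- relation for the other even elements.
  pow : ∀ i j x, i + j + b.expo p x ≤ n → ∀ a ∈ tensorDeg k g i, ∀ c ∈ tensorDeg k g j,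
    L (a * TensorAlgebra.ι k (b.basis x) ^ b.expo p x * c) =
      L (a * TensorAlgebra.ι k (b.root p x) * c)

end Relations

theorem sgn_add (k : Type*) [Field k] (i j : ZMod 2) : sgn k (i + j) = sgn k i * sgn k j := by
  have two : (1 + 1 : ZMod 2) = 0 := by decide
  rcases zmod_two_cases i with rfl | rfl <;> rcases zmod_two_cases j with rfl | rfl <;> simp [two]

theorem sgn_mul_self (k : Type*) [Field k] (i : ZMod 2) : sgn k i * sgn k i = 1 := by
  rcases zmod_two_cases i with rfl | rfl <;> simp

/-! ### Straightening, and its independence of the chosen descent -/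

section Straighten

variable {k : Type*} {p : ℕ} {g : Type*} [Field k] [AddCommGroup g] [Module k g]
  [LieSuperalgebra k g] [RestrictedLieSuperalgebra k p g] {B : Type*} [LinearOrder B]
  (b : HomogBasis k g B) {Q : Type*} [AddCommGroup Q] [Module k Q]

open Classical in
variable (p) in
/-- The values on words of a map that satisfies the defining relations in one more degree than `L`. -/
def straighten (L : TensorAlgebra k g →ₗ[k] Q) (l : List B) : Q :=
  -- The descent, and below the power block, is an arbitrary choice. The bracket and root terms are
  -- shorter than the word, so `L` itself evaluates them; only the swapped word needs recursion.
  if h : ∃ d : List B × B × B × List B,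
      l = d.1 ++ d.2.1 :: d.2.2.1 :: d.2.2.2 ∧ d.2.2.1 < d.2.1 then
    sgn k (b.deg h.choose.2.1 * b.deg h.choose.2.2.1) •
      straighten L (h.choose.1 ++ h.choose.2.2.1 :: h.choose.2.1 :: h.choose.2.2.2) +
    L (word b.basis h.choose.1 *
      TensorAlgebra.ι k (br (k := k) (b.basis h.choose.2.1) (b.basis h.choose.2.2.1)) *
      word b.basis h.choose.2.2.2)
  else if h : ∃ d : List B × B × List B,
      l = d.1 ++ (List.replicate (b.expo p d.2.1) d.2.1 ++ d.2.2) then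
    L (word b.basis h.choose.1 * TensorAlgebra.ι k (b.root p h.choose.2.1) *
      word b.basis h.choose.2.2)
  else L (word b.basis l)
termination_by invCount l
decreasing_by
  have h' := h.choose_spec
  conv_rhs => rw [h'.1]
  exact invCount_swap_lt _ _ h'.2

variable {b} {L : TensorAlgebra k g →ₗ[k] Q} {n : ℕ}

/-- Diamond lemma, by induction on the number of inversions. Two descents of a word coincide, share
a letter, or are disjoint. A shared letter gives a decreasing triple, resolved by the Jacobi
identity; disjoint descents commute because `L` respects the commutation relations in lower degree.
-/
theorem straighten_swap (hL : Rel p b n L) (N : ℕ) : ∀ (a c : List B) (x y : B),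
    invCount (a ++ x :: y :: c) ≤ N → a.length + c.length + 2 ≤ n + 1 → y < x →
    straighten p b L (a ++ x :: y :: c) =
      sgn k (b.deg x * b.deg y) • straighten p b L (a ++ y :: x :: c) +
      L (word b.basis a * TensorAlgebra.ι k (br (k := k) (b.basis x) (b.basis y)) *
        word b.basis c) := by
  induction N with
  | zero =>
    intro a c x y h _ hxy
    exact absurd (invCount_swap_lt a c hxy) (by omega)
  | succ N ih =>
    -- Rewriting at the descent `x y` agrees with rewriting at a descent `u v` that starts no
    -- further left. The chosen descent may lie on either side of the given one, so `key` is used in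
    -- both directions.
    have key : ∀ (a c d c' : List B) (x y u v : B), invCount (a ++ x :: y :: c) ≤ N + 1 →
        a.length + c.length + 2 ≤ n + 1 → y < x → v < u → x :: y :: c = d ++ u :: v :: c' →
        sgn k (b.deg x * b.deg y) • straighten p b L (a ++ y :: x :: c) +
          L (word b.basis a * TensorAlgebra.ι k (br (k := k) (b.basis x) (b.basis y)) *
            word b.basis c) =
        sgn k (b.deg u * b.deg v) • straighten p b L ((a ++ d) ++ v :: u :: c') +
          L (word b.basis (a ++ d) * TensorAlgebra.ι k (br (k := k) (b.basis u) (b.basis v)) *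
            word b.basis c') := by
      intro a c d c' x y u v hN hn hxy huv he
      rcases d with _ | ⟨x₁, _ | ⟨y₁, d⟩⟩
      · simp only [List.nil_append, List.cons.injEq] at he
        obtain ⟨rfl, rfl, rfl⟩ := he
        simp
      · simp only [List.cons_append, List.nil_append, List.cons.injEq] at he
        obtain ⟨rfl, rfl, rfl⟩ := he
        -- The triple `x > y > v` is sorted in both orders. Both ways end with the word `v y x`, and
        -- the difference of the bracket terms is the Jacobi identity `f4`.
        have i1 := invCount_swap_lt a (v :: c') hxy
        have i2 := invCount_swap_lt (a ++ [y]) c' (huv.trans hxy)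
        have i3 := invCount_swap_lt (a ++ [x]) c' huv
        have i4 := invCount_swap_lt a (y :: c') (huv.trans hxy)
        simp only [List.append_assoc, List.cons_append, List.nil_append, List.length_cons]
          at i1 i2 i3 i4 hn
        have e1 := ih (a ++ [y]) c' x v (by simp; omega) (by simp; omega) (huv.trans hxy)
        have e2 := ih a (x :: c') y v (by omega) (by simp; omega) huv
        have e3 := ih a (y :: c') x v (by omega) (by simp; omega) (huv.trans hxy)
        have e4 := ih (a ++ [v]) c' x y (by simp; omega) (by simp; omega) hxy
        simp only [List.append_assoc, List.cons_append, List.nil_append, word_append, word_cons,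
          word_nil, mul_one] at e1 e2 e3 e4 ⊢
        have ha := word_mem_tensorDeg b.basis a
        have hc := word_mem_tensorDeg b.basis c'
        have f1 := hL.comm _ _ (by omega) _ ha _ hc _ _ _ (b.mem x) _
          (br_mem_homog (b.mem y) (b.mem v))
        have f2 := hL.comm _ _ (by omega) _ ha _ hc _ _ _ (b.mem y) _
          (br_mem_homog (b.mem x) (b.mem v))
        have f3 := hL.comm _ _ (by omega) _ ha _ hc _ _ _
          (br_mem_homog (b.mem x) (b.mem y)) _ (b.mem v)
        have f4 := LieSuperalgebra.br_jacobi _ _ _ (b.mem x) _ (b.mem y) (b.basis v)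
        change br (k := k) _ (br (k := k) _ _) = br (k := k) (br (k := k) _ _) _ +
          _ • br (k := k) _ (br (k := k) _ _) at f4
        rw [f4] at f1
        rw [e1, e2, e3, e4]
        simp only [mul_assoc, map_add, map_smul, mul_add, add_mul, mul_smul_comm,
          smul_mul_assoc, sgn_add] at f1 f2 f3 ⊢
        rw [f1, f2, f3]
        generalize b.deg x = dx
        generalize b.deg y = dy
        generalize b.deg v = dv
        rcases zmod_two_cases dx with rfl | rfl <;> rcases zmod_two_cases dy with rfl | rfl <;>
          rcases zmod_two_cases dv with rfl | rfl <;> simp <;> abel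
      · simp only [List.cons_append, List.cons.injEq] at he
        obtain ⟨rfl, rfl, rfl⟩ := he
        have i1 := invCount_swap_lt a (d ++ u :: v :: c') hxy
        have i2 := invCount_swap_lt (a ++ x :: y :: d) c' huv
        simp only [List.append_assoc, List.cons_append, List.length_append, List.length_cons]
          at i1 i2 hn
        have e1 := ih (a ++ y :: x :: d) c' u v (by simp; omega) (by simp; omega) huv
        have e2 := ih a (d ++ v :: u :: c') x y (by omega) (by simp; omega) hxy
        have ha := word_mem_tensorDeg b.basis a
        have hd := word_mem_tensorDeg b.basis d
        have hc := word_mem_tensorDeg b.basis c'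
        have f1 := hL.comm _ _ (by omega) _ ha _ (mul_mem_tensorDeg
          (mul_ι_mem_tensorDeg hd (br (k := k) (b.basis u) (b.basis v))) hc) _ _ _ (b.mem x) _
          (b.mem y)
        have f2 := hL.comm _ _ (by omega) _ (mul_mem_tensorDeg
          (mul_ι_mem_tensorDeg ha (br (k := k) (b.basis x) (b.basis y))) hd) _ hc _ _ _ (b.mem u) _
          (b.mem v)
        simp only [List.append_assoc, List.cons_append, word_append, word_cons] at e1 e2 ⊢
        rw [e1, e2]
        simp only [mul_assoc] at f1 f2 ⊢
        rw [f1, f2]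
        simp only [smul_add, smul_smul]
        rw [mul_comm (sgn k (b.deg u * b.deg v))]
        abel
    intro a c x y hN hn hxy
    have h : ∃ d : List B × B × B × List B,
        a ++ x :: y :: c = d.1 ++ d.2.1 :: d.2.2.1 :: d.2.2.2 ∧ d.2.2.1 < d.2.1 :=
      ⟨(a, x, y, c), rfl, hxy⟩
    rw [straighten, dif_pos h]
    obtain ⟨h1, h2⟩ := h.choose_spec
    generalize h.choose = d at h1 h2
    obtain ⟨a', u, v, c'⟩ := d
    simp only at h1 h2 ⊢
    rcases List.append_eq_append_iff.mp h1 with ⟨d, rfl, hd⟩ | ⟨d, rfl, hd⟩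
    · exact (key a c d c' x y u v hN hn hxy h2 hd).symm
    · refine key a' c' d c u v x y (by rw [← h1]; exact hN) ?_ h2 hxy hd
      have := congrArg List.length h1
      simp only [List.length_append, List.length_cons] at this hn ⊢
      omega

end Straighten

/-! ### The elements that replace full powers -/

section Roots

variable {k : Type*} {p : ℕ} {g : Type*} [Field k] [AddCommGroup g] [Module k g]
  [LieSuperalgebra k g] [RestrictedLieSuperalgebra k p g] {B : Type*}
  (b : HomogBasis k g B)

theorem br_skew {i j : ZMod 2} {x y : g} (hx : x ∈ homog k g i) (hy : y ∈ homog k g j) :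
    br (k := k) x y = -(sgn k (i * j) • br (k := k) y x) :=
  LieSuperalgebra.br_skew i j x hx y hy

theorem br_jacobi {i j : ZMod 2} {x y : g} (hx : x ∈ homog k g i) (hy : y ∈ homog k g j) (z : g) :
    br (k := k) x (br (k := k) y z) = br (k := k) (br (k := k) x y) z +
      sgn k (i * j) • br (k := k) y (br (k := k) x z) :=
  LieSuperalgebra.br_jacobi i j x hx y hy z

theorem br_self_even (h2 : (2 : k) ≠ 0) {x : g} (hx : x ∈ homog k g 0) : br (k := k) x x = 0 := by
  have h := br_skew hx hx
  simp only [mul_zero, sgn_zero, one_smul] at h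
  have : (2 : k) • br (k := k) x x = 0 := by rw [two_smul]; nth_rewrite 1 [h]; simp
  exact (smul_eq_zero.mp this).resolve_left h2

theorem br_pMap (x : homog k g 0) (y : g) :
    br (k := k) (pMap p x : g) y = (br (k := k) (x : g))^[p] y :=
  RestrictedLieSuperalgebra.ad_pMap (p := p) x y

theorem HomogBasis.root_mem (x : B) : b.root p x ∈ homog k g 0 := by
  unfold HomogBasis.root
  split_ifs with h
  · exact (pMap p _).2
  · have h1 : b.deg x = 1 := (zmod_two_cases _).resolve_left h
    have hx := b.mem x
    rw [h1] at hx
    have := br_mem_homog hx hx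
    exact Submodule.smul_mem _ _ (by simpa [show (1 + 1 : ZMod 2) = 0 by decide] using this)

theorem HomogBasis.expo_even {x : B} (h : b.deg x = 0) : b.expo p x = p := if_pos h

theorem HomogBasis.expo_odd {x : B} (h : b.deg x = 1) : b.expo p x = 2 := by
  simp [HomogBasis.expo, h]

theorem HomogBasis.root_even {x : B} (h : b.deg x = 0) :
    b.root p x = (pMap p ⟨b.basis x, h ▸ b.mem x⟩ : homog k g 0) := dif_pos h

theorem HomogBasis.root_odd {x : B} (h : b.deg x = 1) :
    b.root p x = (2 : k)⁻¹ • br (k := k) (b.basis x) (b.basis x) :=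
  dif_neg (by simp [h])

variable [Fact p.Prime] [CharP k p] [Fact (2 < p)]

theorem HomogBasis.two_le_expo (x : B) : 2 ≤ b.expo p x := by
  rcases zmod_two_cases (b.deg x) with h | h
  · rw [b.expo_even h]; exact (Fact.out : p.Prime).two_le
  · rw [b.expo_odd h]

/-- A letter passes a full power block without a sign, because the root is even. -/
theorem HomogBasis.sgn_pow_expo (x y : B) : sgn k (b.deg y * b.deg x) ^ b.expo p x = 1 := by
  rcases zmod_two_cases (b.deg x) with h | h
  · simp [h]
  · rw [b.expo_odd h, pow_two, sgn_mul_self]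

/-- For even `x` this is `ad(x)^p(x) = 0`, from `[x,x] = 0`. For odd `x` it is the axiom `[x,[x,x]]
= 0`, which is independent of the other axioms in characteristic 3. -/
theorem HomogBasis.br_root_self (x : B) : br (k := k) (b.basis x) (b.root p x) = 0 := by
  have h2 := two_ne_zero_of_char k p
  rcases zmod_two_cases (b.deg x) with h | h
  · have hx := b.mem x
    rw [h] at hx
    rw [br_skew hx (b.root_mem x), b.root_even h, br_pMap]
    obtain ⟨r, hr⟩ := Nat.exists_eq_succ_of_ne_zero (Fact.out : p.Prime).ne_zero
    rw [hr, Function.iterate_succ_apply, br_self_even h2 hx]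
    have : (br (k := k) (b.basis x))^[r] 0 = 0 := Function.iterate_fixed (by simp) r
    simp [this]
  · have hx := b.mem x
    rw [h] at hx
    rw [b.root_odd h, map_smul]
    have := LieSuperalgebra.br_cube (k := k) _ hx
    change br (k := k) _ (br (k := k) _ _) = 0 at this
    rw [this, smul_zero]

/-- The hockey-stick identity. For `r = p` and `t + 1 < p` the right side is divisible by `p`. -/
theorem sum_range_choose_eq (t r : ℕ) : ∑ i ∈ Finset.range r, i.choose t = r.choose (t + 1) := by
  induction r with
  | zero => simp
  | succ r ih => rw [Finset.sum_range_succ, ih, Nat.choose_succ_succ', add_comm]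

end Roots

/-! ### Commuting a letter through a power -/

section Powers

variable {k : Type*} {p : ℕ} {g : Type*} [Field k] [AddCommGroup g] [Module k g]
  [LieSuperalgebra k g] [RestrictedLieSuperalgebra k p g] {B : Type*}
  {b : HomogBasis k g B} {Q : Type*} [AddCommGroup Q] [Module k Q]
  {L : TensorAlgebra k g →ₗ[k] Q} {n : ℕ}

/-- Left multiplication by `x` is `ad(x)` plus right multiplication, and these commute; this is the
binomial formula for its powers, in the degrees where `L` respects the relations. -/
theorem Rel.pow_mul (hL : Rel p b n L) {i : ℕ} {a : TensorAlgebra k g} (ha : a ∈ tensorDeg k g i)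
    {x : g} (hx : x ∈ homog k g 0) {e : ZMod 2} (r : ℕ) :
    ∀ (j : ℕ), ∀ c ∈ tensorDeg k g j, ∀ z ∈ homog k g e, i + r + 1 + j ≤ n →
    L (a * (TensorAlgebra.ι k x ^ r * TensorAlgebra.ι k z) * c) =
      ∑ t ∈ Finset.range (r + 1), r.choose t •
        L (a * (TensorAlgebra.ι k ((br (k := k) x)^[t] z) * TensorAlgebra.ι k x ^ (r - t)) * c) := by
  induction r with
  | zero => intro j c hc z hz hn; simp
  | succ r ih =>
    intro j c hc z hz hn
    rw [Finset.sum_choose_succ_nsmul (fun t s => L (a * (TensorAlgebra.ι k ((br (k := k) x)^[t] z) *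
      TensorAlgebra.ι k x ^ s) * c))]
    have h1 := ih _ _ (ι_mul_mem_tensorDeg hc x) z hz (by omega)
    have h2 := ih _ _ hc _ (by simpa using br_mem_homog hx hz) (by omega)
    have h3 := hL.comm _ _ (by omega) _ (mul_mem_tensorDeg ha (ι_pow_mem_tensorDeg x r)) _ hc
      _ _ _ hx _ hz
    have e1 : L (a * (TensorAlgebra.ι k x ^ (r + 1) * TensorAlgebra.ι k z) * c) =
        L (a * TensorAlgebra.ι k x ^ r * (TensorAlgebra.ι k x * TensorAlgebra.ι k z) * c) := by
      simp only [pow_succ, mul_assoc]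
    rw [e1, h3]
    simp only [zero_mul, sgn_zero, one_smul, mul_assoc] at h1 h2 ⊢
    rw [h1, h2]
    congr 1
    refine Finset.sum_congr rfl fun t ht => ?_
    rw [show r + 1 - t = r - t + 1 by have := Finset.mem_range.mp ht; omega, pow_succ]
    simp only [mul_assoc]

variable [Fact p.Prime] [CharP k p] [Fact (2 < p)]

/-- After expanding by `Rel.pow_mul`, the term with `ad(x)^t` has coefficient `∑_r C(r,t) =
C(p,t+1)`, which vanishes modulo `p` unless `t = p - 1`. -/
theorem Rel.sum_pow_even (hL : Rel p b n L) {i j : ℕ} {a c : TensorAlgebra k g}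
    (ha : a ∈ tensorDeg k g i) (hc : c ∈ tensorDeg k g j)
    {x z : g} (hx : x ∈ homog k g 0) {e : ZMod 2} (hz : z ∈ homog k g e) (hn : i + j + p ≤ n) :
    ∑ r ∈ Finset.range p, L (a * (TensorAlgebra.ι k x ^ r * TensorAlgebra.ι k z) *
        (TensorAlgebra.ι k x ^ (p - 1 - r) * c)) =
      L (a * TensorAlgebra.ι k ((br (k := k) x)^[p - 1] z) * c) := by
  have hp := (Fact.out : p.Prime)
  have hp1 := hp.one_le
  have step : ∀ r ∈ Finset.range p, L (a * (TensorAlgebra.ι k x ^ r * TensorAlgebra.ι k z) *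
        (TensorAlgebra.ι k x ^ (p - 1 - r) * c)) =
      ∑ t ∈ Finset.range p, r.choose t •
        L (a * TensorAlgebra.ι k ((br (k := k) x)^[t] z) * TensorAlgebra.ι k x ^ (p - 1 - t) * c) := by
    intro r hr
    have hr' := Finset.mem_range.mp hr
    rw [hL.pow_mul ha hx r _ _ (mul_mem_tensorDeg (ι_pow_mem_tensorDeg x (p - 1 - r)) hc) z hz
      (by omega)]
    rw [← Finset.sum_subset (Finset.range_mono (show r + 1 ≤ p by omega))]
    · refine Finset.sum_congr rfl fun t ht => ?_
      have ht' := Finset.mem_range.mp ht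
      rw [show p - 1 - t = (r - t) + (p - 1 - r) by omega, pow_add]
      simp only [mul_assoc]
    · intro t _ ht
      rw [Nat.choose_eq_zero_of_lt (by simpa using ht), zero_smul]
  rw [Finset.sum_congr rfl step, Finset.sum_comm]
  simp only [← Finset.sum_smul, sum_range_choose_eq]
  rw [Finset.sum_eq_single (p - 1)]
  · rw [Nat.sub_add_cancel hp1]; simp
  · intro t ht htp
    have ht' := Finset.mem_range.mp ht
    obtain ⟨d, hd⟩ := hp.dvd_choose_self (k := t + 1) (by omega) (by omega)
    rw [hd, ← Nat.cast_smul_eq_nsmul k]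
    simp
  · intro h
    exact absurd (Finset.mem_range.mpr (by omega)) h

/-- The derivation `[y,·]` takes the same value on the power of `x` as on its root, which makes the
power relation compatible with commutation. The reason is `ad(x^[p]) = ad(x)^p` for even `x` and the
Jacobi identity for odd `x`. -/
theorem Rel.sum_pow (hL : Rel p b n L) {i j : ℕ} {a c : TensorAlgebra k g}
    (ha : a ∈ tensorDeg k g i) (hc : c ∈ tensorDeg k g j) (x y : B) (hn : i + j + b.expo p x ≤ n) :
    ∑ r ∈ Finset.range (b.expo p x), sgn k (b.deg y * b.deg x) ^ r •
      L (a * (TensorAlgebra.ι k (b.basis x) ^ r *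
        TensorAlgebra.ι k (br (k := k) (b.basis y) (b.basis x))) *
        (TensorAlgebra.ι k (b.basis x) ^ (b.expo p x - 1 - r) * c)) =
      L (a * TensorAlgebra.ι k (br (k := k) (b.basis y) (b.root p x)) * c) := by
  have h2 := two_ne_zero_of_char k p
  have hx := b.mem x
  have hy := b.mem y
  rcases zmod_two_cases (b.deg x) with h | h
  · rw [b.expo_even h] at hn ⊢
    rw [h] at hx
    simp only [h, mul_zero, sgn_zero, one_pow, one_smul]
    rw [hL.sum_pow_even ha hc hx (br_mem_homog hy hx) hn, br_skew hy hx,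
      br_skew hy (b.root_mem x), b.root_even h, br_pMap]
    simp only [mul_zero, sgn_zero, one_smul]
    obtain ⟨r, hr⟩ := Nat.exists_eq_succ_of_ne_zero (Fact.out : p.Prime).ne_zero
    rw [hr, Nat.succ_sub_one, Function.iterate_succ_apply]
    have hneg : (br (k := k) (b.basis x))^[r] (-br (k := k) (b.basis x) (b.basis y)) =
        -(br (k := k) (b.basis x))^[r] (br (k := k) (b.basis x) (b.basis y)) := by
      simp only [← Module.End.pow_apply, map_neg]
    rw [hneg]
  · rw [b.expo_odd h] at hn ⊢
    rw [h] at hx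
    have f1 := hL.comm _ _ (by omega) _ ha _ hc _ _ _ (br_mem_homog hy hx) _ hx
    have f2 := br_jacobi hy hx (b.basis x)
    rw [br_skew hx (br_mem_homog hy hx)] at f2
    have f3 : br (k := k) (b.basis y) (b.root p x) =
        br (k := k) (br (k := k) (b.basis y) (b.basis x)) (b.basis x) := by
      rw [b.root_odd h, map_smul, f2, inv_smul_eq_iff₀ h2, two_smul, mul_one, smul_neg, smul_smul]
      congr 1
      rcases zmod_two_cases (b.deg y) with hd | hd <;> simp [hd, show (1 + 1 : ZMod 2) = 0 by decide]
    rw [f3, Finset.sum_range_succ, Finset.sum_range_one]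
    simp only [h, mul_one, pow_zero, pow_one, one_mul, one_smul, Nat.sub_zero, Nat.sub_self,
      Nat.add_one_sub_one, mul_assoc, sgn_add] at f1 ⊢
    rw [f1]
    rcases zmod_two_cases (b.deg y) with hd | hd <;> simp [hd]

end Powers

/-! ### Compatibility of straightening with the power relations -/

section Step

variable {k : Type*} {p : ℕ} {g : Type*} [Field k] [AddCommGroup g] [Module k g]
  [LieSuperalgebra k g] [RestrictedLieSuperalgebra k p g] {B : Type*} [LinearOrder B]
  {b : HomogBasis k g B} {Q : Type*} [AddCommGroup Q] [Module k Q]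
  {L : TensorAlgebra k g →ₗ[k] Q} {n : ℕ}

theorem straighten_swap_ne (hL : Rel p b n L) (a c : List B) {x y : B}
    (hn : a.length + c.length + 2 ≤ n + 1) (hxy : x ≠ y) :
    straighten p b L (a ++ x :: y :: c) =
      sgn k (b.deg x * b.deg y) • straighten p b L (a ++ y :: x :: c) +
      L (word b.basis a * TensorAlgebra.ι k (br (k := k) (b.basis x) (b.basis y)) *
        word b.basis c) := by
  rcases lt_or_gt_of_ne hxy with h | h
  · have h1 := straighten_swap hL _ a c y x le_rfl hn h
    rw [h1, br_skew (b.mem x) (b.mem y), mul_comm (b.deg y), smul_add, smul_smul, sgn_mul_self]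
    simp
  · exact straighten_swap hL _ a c x y le_rfl hn h

/-- The letter `y` passes the copies of `x` one at a time; each passage leaves one bracket term,
evaluated by `L`. -/
theorem straighten_move (hL : Rel p b n L) {x y : B} (hxy : y ≠ x) (c : List B) (r : ℕ) :
    ∀ a : List B, a.length + c.length + r + 1 ≤ n + 1 →
    straighten p b L (a ++ y :: (List.replicate r x ++ c)) =
      sgn k (b.deg y * b.deg x) ^ r • straighten p b L (a ++ (List.replicate r x ++ y :: c)) +
      ∑ t ∈ Finset.range r, sgn k (b.deg y * b.deg x) ^ t •
        L (word b.basis a * (TensorAlgebra.ι k (b.basis x) ^ t *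
          TensorAlgebra.ι k (br (k := k) (b.basis y) (b.basis x))) *
          (TensorAlgebra.ι k (b.basis x) ^ (r - 1 - t) * word b.basis c)) := by
  induction r with
  | zero => intro a _; simp
  | succ r ih =>
    intro a hn
    have h1 := straighten_swap_ne hL a (List.replicate r x ++ c) (by simp; omega) hxy
    have h2 := ih (a ++ [x]) (by simp; omega)
    simp only [List.append_assoc, List.cons_append, List.nil_append] at h2
    rw [List.replicate_succ, List.cons_append, h1, h2, Finset.sum_range_succ', smul_add, smul_smul,
      ← pow_succ', Finset.smul_sum, add_assoc, List.cons_append]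
    congr 2
    · refine Finset.sum_congr rfl fun t ht => ?_
      rw [smul_smul, ← pow_succ']
      simp only [word_append, word_cons, word_nil, mul_one, pow_succ', mul_assoc]
      rw [show r + 1 - 1 - (t + 1) = r - 1 - t by omega]
    · simp [mul_assoc]

variable [Fact p.Prime] [CharP k p] [Fact (2 < p)]

theorem rel_root_pow_comm (hL : Rel p b n L) {i : ℕ} {a : TensorAlgebra k g}
    (ha : a ∈ tensorDeg k g i) (x : B) (r : ℕ) : ∀ (j : ℕ), ∀ c ∈ tensorDeg k g j,
    i + j + r + 1 ≤ n →
    L (a * (TensorAlgebra.ι k (b.basis x) ^ r * TensorAlgebra.ι k (b.root p x)) * c) =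
      L (a * (TensorAlgebra.ι k (b.root p x) * TensorAlgebra.ι k (b.basis x) ^ r) * c) := by
  induction r with
  | zero => intro j c hc hn; simp
  | succ r ih =>
    intro j c hc hn
    have h1 := hL.comm _ _ (by omega) _ (mul_mem_tensorDeg ha (ι_pow_mem_tensorDeg (b.basis x) r))
      _ hc _ _ _ (b.mem x) _ (b.root_mem (p := p) x)
    have h2 := ih _ _ (ι_mul_mem_tensorDeg hc (b.basis x)) (by omega)
    rw [b.br_root_self] at h1
    simp only [mul_zero, sgn_zero, one_smul, map_zero, zero_mul, add_zero, mul_assoc,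
      pow_succ] at h1 h2 ⊢
    rw [h1, h2]

/-- Two blocks in one word give the same value of `L`. If they are disjoint, the power relation in
lower degree rewrites the other block on both sides. If they overlap they consist of the same
letter, and the root commutes with that letter. -/
theorem rel_block_agree (hL : Rel p b n L) {a c d c' : List B} {x x' : B}
    (hn : a.length + c.length + b.expo p x ≤ n + 1)
    (h : List.replicate (b.expo p x) x ++ c = d ++ (List.replicate (b.expo p x') x' ++ c')) :
    L (word b.basis a * TensorAlgebra.ι k (b.root p x) * word b.basis c) =
      L (word b.basis (a ++ d) * TensorAlgebra.ι k (b.root p x') * word b.basis c') := by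
  have q2 := b.two_le_expo (p := p) x
  have q2' := b.two_le_expo (p := p) x'
  have ha := word_mem_tensorDeg b.basis a
  have hc' := word_mem_tensorDeg b.basis c'
  have hlen := congrArg List.length h
  simp only [List.length_append, List.length_replicate] at hlen
  have disjoint : ∀ e : List B, d = List.replicate (b.expo p x) x ++ e →
      c = e ++ (List.replicate (b.expo p x') x' ++ c') →
      L (word b.basis a * TensorAlgebra.ι k (b.root p x) * word b.basis c) =
      L (word b.basis (a ++ d) * TensorAlgebra.ι k (b.root p x') * word b.basis c') := by
    rintro e rfl rfl
    have he := word_mem_tensorDeg b.basis e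
    simp only [List.length_append, List.length_replicate] at hlen hn
    have h1 := hL.pow _ _ x' (by omega) _ (mul_mem_tensorDeg (mul_ι_mem_tensorDeg ha
      (b.root p x)) he) _ hc'
    have h2 := hL.pow _ _ x (by omega) _ ha _ (mul_mem_tensorDeg (mul_ι_mem_tensorDeg he
      (b.root p x')) hc')
    simp only [word_append, word_replicate, mul_assoc] at h1 h2 ⊢
    rw [h1, h2]
  rcases List.append_eq_append_iff.mp h with ⟨e, hd, hc⟩ | ⟨e, hd, hc⟩
  · exact disjoint e hd hc
  · rcases e with _ | ⟨z, e⟩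
    · exact disjoint [] (by simpa using hd.symm) (by simpa using hc.symm)
    · have hz : ∀ w ∈ d ++ z :: e, w = x := by
        rw [← hd]; intro w hw; exact List.eq_of_mem_replicate hw
      have hx' : x' = x := by
        obtain ⟨r, hr⟩ := Nat.exists_eq_add_of_le q2'
        rw [hr, add_comm, List.replicate_succ, List.cons_append, List.cons_append,
          List.cons.injEq] at hc
        rw [hc.1]
        exact hz z (by simp)
      subst hx'
      have hd' : d = List.replicate d.length x' :=
        List.eq_replicate_iff.mpr ⟨rfl, fun w hw => hz w (by simp [hw])⟩
      have hcc : c = List.replicate d.length x' ++ c' := by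
        rw [hd', ← List.append_assoc, List.replicate_append_replicate, add_comm,
          ← List.replicate_append_replicate, List.append_assoc] at h
        exact List.append_cancel_left h
      rw [hcc, hd']
      simp only [hcc, List.length_append, List.length_replicate] at hlen hn
      have := rel_root_pow_comm hL ha x' d.length _ _ hc' (by omega)
      simp only [word_append, word_replicate, List.length_replicate, mul_assoc] at this ⊢
      exact this.symm

variable (p b L) in
/-- The compatibility of `straighten` with one power relation. -/
def BlockValid (x : B) (a c : List B) : Prop :=
  straighten p b L (a ++ (List.replicate (b.expo p x) x ++ c)) =
    L (word b.basis a * TensorAlgebra.ι k (b.root p x) * word b.basis c)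

/-- Moving `y` across the block changes the straightened word by the sum in `Rel.sum_pow`, and
moving it across the root changes the right side by `[y, root]`; these corrections agree. -/
theorem blockValid_move (hL : Rel p b n L) {x y : B} {a c : List B}
    (hn : a.length + c.length + b.expo p x + 1 ≤ n + 1) :
    BlockValid p b L x (a ++ [y]) c ↔ BlockValid p b L x a (y :: c) := by
  have ha := word_mem_tensorDeg b.basis a
  have hc := word_mem_tensorDeg b.basis c
  have q2 := b.two_le_expo (p := p) x
  unfold BlockValid
  by_cases hxy : y = x
  · subst hxy
    have h1 := rel_root_pow_comm hL ha y 1 _ _ hc (by omega)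
    have h2 : (a ++ [y]) ++ (List.replicate (b.expo p y) y ++ c) =
        a ++ (List.replicate (b.expo p y) y ++ y :: c) := by
      have : List.replicate (b.expo p y) y ++ [y] = [y] ++ List.replicate (b.expo p y) y := by
        rw [← List.replicate_succ', List.replicate_succ]; rfl
      calc _ = a ++ (([y] ++ List.replicate (b.expo p y) y) ++ c) := by simp
        _ = _ := by rw [← this]; simp
    rw [h2]
    simp only [word_append, word_cons, word_nil, mul_one, pow_one, mul_assoc] at h1 ⊢
    rw [h1]
  · have h1 := straighten_move hL hxy c (b.expo p x) a (by omega)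
    have h2 := hL.sum_pow ha hc x y (by omega)
    have h3 := hL.comm _ _ (by omega) _ ha _ hc _ _ _ (b.mem y) _ (b.root_mem (p := p) x)
    rw [h2, b.sgn_pow_expo, one_smul] at h1
    simp only [List.append_assoc, List.cons_append, List.nil_append, word_append, word_cons,
      word_nil, mul_one, mul_zero, sgn_zero, one_smul, mul_assoc] at h1 h3 ⊢
    rw [h1, h3, add_left_inj]

theorem blockValid_moves (hL : Rel p b n L) {x : B} (a c : List B)
    (hn : a.length + c.length + b.expo p x ≤ n + 1) :
    BlockValid p b L x a c ↔ BlockValid p b L x [] (a ++ c) := by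
  induction a using List.reverseRecOn generalizing c with
  | nil => rfl
  | append_singleton a y ih =>
    simp only [List.length_append, List.length_singleton] at hn
    rw [blockValid_move hL (by omega), ih (y :: c) (by simp; omega)]
    simp

/-- A transposition of letters behind the block adds the same bracket term to both sides, once the
power relation of `L` has been applied to that term. -/
theorem blockValid_perm (hL : Rel p b n L) {x : B} {l l' : List B} (h : l.Perm l') :
    ∀ a : List B, a.length + l.length + b.expo p x ≤ n + 1 →
      BlockValid p b L x a l → BlockValid p b L x a l' := by
  have q2 := b.two_le_expo (p := p) x
  induction h with
  | nil => intro a _ h; exact h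
  | cons y hp ih =>
    intro a hn h
    have := hp.length_eq
    simp only [List.length_cons] at hn
    rw [← blockValid_move hL (by omega)] at h ⊢
    exact ih _ (by simp; omega) h
  | trans h1 _ ih1 ih2 =>
    intro a hn h
    exact ih2 a (by rw [← h1.length_eq]; exact hn) (ih1 a hn h)
  | swap y z c =>
    intro a hn h
    by_cases hyz : y = z
    · subst hyz; exact h
    · unfold BlockValid at h ⊢
      simp only [List.length_cons] at hn
      have ha := word_mem_tensorDeg b.basis a
      have hc := word_mem_tensorDeg b.basis c
      have h1 := straighten_swap_ne hL (a ++ List.replicate (b.expo p x) x) c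
        (by simp; omega) hyz
      have h2 := hL.comm _ _ (by omega) _ (mul_ι_mem_tensorDeg ha (b.root p x)) _ hc _ _ _
        (b.mem y) _ (b.mem z)
      have h3 := hL.pow _ _ x (by omega) _ ha _
        (ι_mul_mem_tensorDeg hc (br (k := k) (b.basis y) (b.basis z)))
      simp only [List.append_assoc, word_append, word_replicate, word_cons, mul_assoc]
        at h h1 h2 h3 ⊢
      rw [h1, h, h2, h3]

/-- A sorted word has no descent, so `straighten` rewrites a block, possibly another one than the
given; `rel_block_agree` compares the two. -/
theorem blockValid_of_sorted (hL : Rel p b n L) {x : B} {a c : List B}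
    (hn : a.length + c.length + b.expo p x ≤ n + 1)
    (hs : (a ++ (List.replicate (b.expo p x) x ++ c)).Pairwise (· ≤ ·)) :
    BlockValid p b L x a c := by
  have hno : ¬ ∃ d : List B × B × B × List B,
      a ++ (List.replicate (b.expo p x) x ++ c) = d.1 ++ d.2.1 :: d.2.2.1 :: d.2.2.2 ∧
        d.2.2.1 < d.2.1 := by
    rintro ⟨⟨a', u, v, c'⟩, h, huv⟩
    rw [h] at hs
    have := (List.pairwise_cons.mp (List.pairwise_append.mp hs).2.1).1 v (by simp)
    exact absurd huv (not_lt.mpr this)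
  have hblock : ∃ d : List B × B × List B, a ++ (List.replicate (b.expo p x) x ++ c) =
      d.1 ++ (List.replicate (b.expo p d.2.1) d.2.1 ++ d.2.2) := ⟨(a, x, c), rfl⟩
  rw [BlockValid, straighten, dif_neg hno, dif_pos hblock]
  have h := hblock.choose_spec
  generalize hblock.choose = d at h
  obtain ⟨a', x', c'⟩ := d
  simp only at h ⊢
  have hlen := congrArg List.length h
  simp only [List.length_append, List.length_replicate] at hlen
  rcases List.append_eq_append_iff.mp h with ⟨d, rfl, hd⟩ | ⟨d, rfl, hd⟩
  · exact (rel_block_agree hL hn hd).symm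
  · exact rel_block_agree hL (by omega) hd

/-- Validity is unchanged by moving letters across the block and by permuting the letters behind it.
So the whole word may be assumed sorted. -/
theorem straighten_pow (hL : Rel p b n L) (x : B) (a c : List B)
    (hn : a.length + c.length + b.expo p x ≤ n + 1) : BlockValid p b L x a c := by
  rw [blockValid_moves hL a c hn]
  set l := a ++ c with hl
  have hlen : l.length = a.length + c.length := by simp [hl]
  set s := l.mergeSort (· ≤ ·) with hsdef
  have hsl : s.Perm l := List.mergeSort_perm _ _
  have hss : s.Pairwise (· ≤ ·) := List.pairwise_mergeSort' _ _
  -- In the sorted word the block has its place after the letters smaller than `x`.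
  have hperm : (s.filter (· < x) ++ s.filter (fun y => !decide (y < x))).Perm l :=
    (List.filter_append_perm _ s).trans hsl
  refine blockValid_perm hL hperm [] (by rw [hperm.length_eq]; simp; omega) ?_
  have hl2 := hperm.length_eq
  rw [List.length_append] at hl2
  rw [← blockValid_moves hL _ _ (by omega)]
  refine blockValid_of_sorted hL (by omega) ?_
  rw [List.pairwise_append, List.pairwise_append]
  refine ⟨hss.filter _, ⟨?_, hss.filter _, ?_⟩, ?_⟩
  · exact List.pairwise_replicate.mpr (Or.inr le_rfl)
  · intro u hu v hv
    rw [List.eq_of_mem_replicate hu]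
    simpa using (List.mem_filter.mp hv).2
  · intro u hu v hv
    have hu' : u < x := by simpa using (List.mem_filter.mp hu).2
    rcases List.mem_append.mp hv with hv | hv
    · rw [List.eq_of_mem_replicate hv]; exact hu'.le
    · have : x ≤ v := by simpa using (List.mem_filter.mp hv).2
      exact hu'.le.trans this

end Step

/-! ### PBW in the tensor algebra: extension degree by degree, and uniqueness -/

section Extension

variable {k : Type*} {p : ℕ} {g : Type*} [Field k] [AddCommGroup g] [Module k g]
  [LieSuperalgebra k g] [RestrictedLieSuperalgebra k p g] {B : Type*}
  {b : HomogBasis k g B} {Q : Type*} [AddCommGroup Q] [Module k Q]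

theorem HomogBasis.homog_le_span (h2 : (2 : k) ≠ 0) (b : HomogBasis k g B) (d : ZMod 2) :
    homog k g d ≤ Submodule.span k {x | ∃ u, b.deg u = d ∧ x = b.basis u} := by
  have key : ∀ x ∈ Submodule.span k (Set.range b.basis),
      proj (k := k) d x ∈ Submodule.span k {x | ∃ u, b.deg u = d ∧ x = b.basis u} := by
    intro x hx
    induction hx using Submodule.span_induction with
    | zero => simp
    | add x y _ _ h1 h2 => rw [map_add]; exact add_mem h1 h2
    | smul c x _ h => rw [map_smul]; exact Submodule.smul_mem _ _ h
    | mem x hx =>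
      obtain ⟨u, rfl⟩ := hx
      rw [proj_of_mem h2 (b.mem u)]
      split_ifs with h
      · exact Submodule.subset_span ⟨u, h, rfl⟩
      · simp
  intro x hx
  have := key x (by rw [b.basis.span_eq]; trivial)
  rwa [proj_of_mem h2 hx, if_pos rfl] at this

/-- The relations follow from the relations between words. -/
theorem rel_of_words (h2 : (2 : k) ≠ 0) {n : ℕ} {L : TensorAlgebra k g →ₗ[k] Q}
    (hcomm : ∀ (a c : List B) (x y : B), a.length + c.length + 2 ≤ n →
      L (word b.basis (a ++ x :: y :: c)) =
        sgn k (b.deg x * b.deg y) • L (word b.basis (a ++ y :: x :: c)) +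
        L (word b.basis a * TensorAlgebra.ι k (br (k := k) (b.basis x) (b.basis y)) *
          word b.basis c))
    (hpow : ∀ (a c : List B) (x : B), a.length + c.length + b.expo p x ≤ n →
      L (word b.basis (a ++ (List.replicate (b.expo p x) x ++ c))) =
        L (word b.basis a * TensorAlgebra.ι k (b.root p x) * word b.basis c)) :
    Rel p b n L where
  comm i j hn a ha c hc d e x hx y hy := by
    replace ha := tensorDeg_le_span b.basis i ha
    replace hc := tensorDeg_le_span b.basis j hc
    replace hx := b.homog_le_span h2 d hx
    replace hy := b.homog_le_span h2 e hy
    rw [← sub_eq_zero]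
    induction ha using Submodule.span_induction with
    | zero => simp
    | add a a' _ _ h h' =>
      simp only [add_mul, map_add, smul_add] at h h' ⊢
      rw [sub_eq_zero] at h h' ⊢
      rw [h, h']
      abel
    | smul r a _ h =>
      have h' := congrArg (fun t => r • t) h
      simpa only [smul_mul_assoc, map_smul, smul_sub, smul_add, smul_zero,
        smul_comm r (sgn k (d * e))] using h'
    | mem a ha =>
    obtain ⟨a, rfl, rfl⟩ := ha
    induction hc using Submodule.span_induction with
    | zero => simp
    | add a a' _ _ h h' =>
      simp only [mul_add, map_add, smul_add] at h h' ⊢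
      rw [sub_eq_zero] at h h' ⊢
      rw [h, h']
      abel
    | smul r a _ h =>
      have h' := congrArg (fun t => r • t) h
      simpa only [mul_smul_comm, map_smul, smul_sub, smul_add, smul_zero,
        smul_comm r (sgn k (d * e))] using h'
    | mem c hc =>
    obtain ⟨c, rfl, rfl⟩ := hc
    induction hx using Submodule.span_induction with
    | zero => simp
    | add a a' _ _ h h' =>
      simp only [mul_add, add_mul, map_add, smul_add, LinearMap.add_apply] at h h' ⊢
      rw [sub_eq_zero] at h h' ⊢
      rw [h, h']
      abel
    | smul r a _ h =>
      have h' := congrArg (fun t => r • t) h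
      simpa only [mul_smul_comm, smul_mul_assoc, LinearMap.smul_apply, map_smul, smul_sub,
        smul_add, smul_zero, smul_comm r (sgn k (d * e))] using h'
    | mem x hx =>
    obtain ⟨x, rfl, rfl⟩ := hx
    induction hy using Submodule.span_induction with
    | zero => simp
    | add a a' _ _ h h' =>
      simp only [mul_add, add_mul, map_add, smul_add] at h h' ⊢
      rw [sub_eq_zero] at h h' ⊢
      rw [h, h']
      abel
    | smul r a _ h =>
      have h' := congrArg (fun t => r • t) h
      simpa only [mul_smul_comm, smul_mul_assoc, LinearMap.smul_apply, map_smul, smul_sub,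
        smul_add, smul_zero, smul_comm r (sgn k (b.deg x * e))] using h'
    | mem y hy =>
    obtain ⟨y, rfl, rfl⟩ := hy
    have := hcomm a c x y hn
    rw [sub_eq_zero]
    simpa only [word_append, word_cons, mul_assoc] using this
  pow i j x hn a ha c hc := by
    replace ha := tensorDeg_le_span b.basis i ha
    replace hc := tensorDeg_le_span b.basis j hc
    rw [← sub_eq_zero]
    induction ha using Submodule.span_induction with
    | zero => simp
    | add a a' _ _ h h' =>
      simp only [add_mul, map_add] at h h' ⊢
      rw [add_sub_add_comm, h, h', add_zero]
    | smul r a _ h =>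
      simp only [smul_mul_assoc, map_smul] at h ⊢
      rw [← smul_sub, h, smul_zero]
    | mem a ha =>
    obtain ⟨a, rfl, rfl⟩ := ha
    induction hc using Submodule.span_induction with
    | zero => simp
    | add a a' _ _ h h' =>
      simp only [mul_add, map_add] at h h' ⊢
      rw [add_sub_add_comm, h, h', add_zero]
    | smul r a _ h =>
      simp only [mul_smul_comm, map_smul] at h ⊢
      rw [← smul_sub, h, smul_zero]
    | mem c hc =>
    obtain ⟨c, rfl, rfl⟩ := hc
    have := hpow a c x hn
    rw [sub_eq_zero]
    simpa only [word_append, word_replicate, mul_assoc] using this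

variable (p b) in
/-- The standard words: nondecreasing words without the powers that are rewritten. -/
def IsStandard [LinearOrder B] (l : List B) : Prop :=
  l.Pairwise (· ≤ ·) ∧ ∀ x, l.count x < b.expo p x

theorem eq_on_tensorDeg {L L' : TensorAlgebra k g →ₗ[k] Q} {n : ℕ} (b : Module.Basis B k g)
    (h : ∀ l : List B, l.length = n → L (word b l) = L' (word b l)) {t : TensorAlgebra k g}
    (ht : t ∈ tensorDeg k g n) : L t = L' t := by
  have : Submodule.span k {t | ∃ l : List B, l.length = n ∧ t = word b l} ≤
      LinearMap.eqLocus L L' := by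
    rw [Submodule.span_le]
    rintro _ ⟨l, hl, rfl⟩
    exact h l hl
  exact this (tensorDeg_le_span b n ht)

theorem count_filter_ite [DecidableEq B] (l : List B) (P : B → Prop) [DecidablePred P] (z : B) :
    (l.filter (fun y => decide (P y))).count z = if P z then l.count z else 0 := by
  split_ifs with h
  · exact List.count_filter (by simpa using h)
  · exact List.count_eq_zero_of_not_mem (by simp [h])

variable [LinearOrder B] [Fact p.Prime] [CharP k p] [Fact (2 < p)]

theorem straighten_standard {L : TensorAlgebra k g →ₗ[k] Q} {l : List B}
    (hl : IsStandard p b l) : straighten p b L l = L (word b.basis l) := by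
  rw [straighten, dif_neg, dif_neg]
  · rintro ⟨⟨a, x, c⟩, rfl⟩
    have := hl.2 x
    simp at this
    omega
  · rintro ⟨⟨a', u, v, c'⟩, h, huv⟩
    have hs := hl.1
    rw [h] at hs
    have := (List.pairwise_cons.mp (List.pairwise_append.mp hs).2.1).1 v (by simp)
    exact absurd huv (not_lt.mpr this)

/-- The new map is `straighten` on words of length `n + 1` and `L` on all others. Standard words
keep their values, which is what fixes the values of the limit. -/
theorem exists_rel_succ {n : ℕ} {L : TensorAlgebra k g →ₗ[k] Q} (hL : Rel p b n L) :
    ∃ L' : TensorAlgebra k g →ₗ[k] Q, Rel p b (n + 1) L' ∧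
      (∀ l : List B, l.length ≤ n → L' (word b.basis l) = L (word b.basis l)) ∧
      ∀ l : List B, IsStandard p b l → L' (word b.basis l) = L (word b.basis l) := by
  have h2 := two_ne_zero_of_char k p
  obtain ⟨L', hL'⟩ := exists_linear_word b.basis
    (fun l => if l.length = n + 1 then straighten p b L l else L (word b.basis l))
  have low : ∀ l : List B, l.length ≤ n → L' (word b.basis l) = L (word b.basis l) :=
    fun l hl => by rw [hL', if_neg (by omega)]
  have top : ∀ l : List B, l.length = n + 1 → L' (word b.basis l) = straighten p b L l :=
    fun l hl => by rw [hL', if_pos hl]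
  have low' : ∀ (m : ℕ) (t : TensorAlgebra k g), t ∈ tensorDeg k g m → m ≤ n → L' t = L t :=
    fun m t ht hm => eq_on_tensorDeg b.basis (fun l hl => low l (by omega)) ht
  have brk : ∀ (a c : List B) (z : g), a.length + c.length + 1 ≤ n →
      L' (word b.basis a * TensorAlgebra.ι k z * word b.basis c) =
        L (word b.basis a * TensorAlgebra.ι k z * word b.basis c) := fun a c z h =>
    low' _ _ (mul_mem_tensorDeg (mul_ι_mem_tensorDeg (word_mem_tensorDeg b.basis a) z)
      (word_mem_tensorDeg b.basis c)) (by omega)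
  have hpow : ∀ (a c : List B) (x : B), a.length + c.length + b.expo p x ≤ n + 1 →
      L' (word b.basis (a ++ (List.replicate (b.expo p x) x ++ c))) =
        L' (word b.basis a * TensorAlgebra.ι k (b.root p x) * word b.basis c) := by
    intro a c x h
    have q2 := b.two_le_expo (p := p) x
    rw [brk _ _ _ (by omega)]
    by_cases h' : a.length + c.length + b.expo p x = n + 1
    · rw [top _ (by simp; omega)]
      exact straighten_pow hL x a c h
    · rw [low _ (by simp; omega)]
      have := hL.pow _ _ x (by omega) _ (word_mem_tensorDeg b.basis a) _
        (word_mem_tensorDeg b.basis c)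
      simpa only [word_append, word_replicate, mul_assoc] using this
  refine ⟨L', rel_of_words h2 ?_ hpow, low, fun l hl => ?_⟩
  · intro a c x y h
    rw [brk _ _ _ (by omega)]
    by_cases h' : a.length + c.length + 2 = n + 1
    · by_cases hxy : x = y
      · subst hxy
        -- Two equal letters are no descent. For even `x` the relation is `[x,x] = 0`; for odd `x`
        -- it is twice the power relation `x^2 = [x,x]/2`.
        rcases zmod_two_cases (b.deg x) with hd | hd
        · have hx := b.mem x
          rw [hd] at hx
          simp [hd, br_self_even h2 hx]
        · have hp := hpow a c x (by rw [b.expo_odd hd]; omega)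
          rw [brk _ _ _ (by omega), b.expo_odd hd, b.root_odd hd, map_smul] at hp
          simp only [mul_smul_comm, smul_mul_assoc, map_smul] at hp
          rw [eq_inv_smul_iff₀ h2, two_smul] at hp
          simp only [List.replicate, List.cons_append, List.nil_append] at hp
          rw [hd, mul_one, sgn_one, neg_one_smul, ← hp]
          abel
      · rw [top _ (by simp; omega), top _ (by simp; omega)]
        exact straighten_swap_ne hL a c h hxy
    · rw [low _ (by simp; omega), low _ (by simp; omega)]
      have := hL.comm _ _ (by omega) _ (word_mem_tensorDeg b.basis a) _
        (word_mem_tensorDeg b.basis c) _ _ _ (b.mem x) _ (b.mem y)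
      simpa only [word_append, word_cons, mul_assoc] using this
  · rw [hL']
    split_ifs with h
    · exact straighten_standard hl
    · rfl

/-- The theorem of Poincaré, Birkhoff and Witt in the tensor algebra: existence. -/
theorem exists_rel (f : List B → Q) : ∃ L : TensorAlgebra k g →ₗ[k] Q, (∀ n, Rel p b n L) ∧
    ∀ l : List B, IsStandard p b l → L (word b.basis l) = f l := by
  obtain ⟨L₀, hL₀⟩ := exists_linear_word b.basis f
  have r0 : Rel p b 0 L₀ :=
    ⟨fun i j h => by omega, fun i j x h => by have := b.two_le_expo (p := p) x; omega⟩
  choose! next hnext using fun (n : ℕ) (L : TensorAlgebra k g →ₗ[k] Q) (hL : Rel p b n L) =>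
    exists_rel_succ hL
  let S : ℕ → (TensorAlgebra k g →ₗ[k] Q) := fun n => Nat.rec L₀ (fun n L => next n L) n
  have hS : ∀ n, Rel p b n (S n) := by
    intro n
    induction n with
    | zero => exact r0
    | succ n ih => exact (hnext n (S n) ih).1
  have hS' : ∀ n m (l : List B), l.length ≤ n → n ≤ m →
      S m (word b.basis l) = S n (word b.basis l) := by
    intro n m l hl hm
    induction m, hm using Nat.le_induction with
    | base => rfl
    | succ m hm ih =>
      rw [← ih]
      exact (hnext m (S m) (hS m)).2.1 l (by omega)
  have hSs : ∀ n (l : List B), IsStandard p b l → S n (word b.basis l) = f l := by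
    intro n l hl
    induction n with
    | zero => exact hL₀ l
    | succ n ih => rw [← ih]; exact (hnext n (S n) (hS n)).2.2 l hl
  -- From stage `n` on, the values on words of length at most `n` no longer change, so a word is
  -- read off at the stage given by its length.
  obtain ⟨L, hL⟩ := exists_linear_word b.basis (fun l => S l.length (word b.basis l))
  have heq : ∀ n m (t : TensorAlgebra k g), t ∈ tensorDeg k g m → m ≤ n → L t = S n t := by
    intro n m t ht hm
    refine eq_on_tensorDeg b.basis (fun l hl => ?_) ht
    rw [hL, hS' l.length n l le_rfl (by omega)]
  refine ⟨L, fun n => ⟨?_, ?_⟩, fun l hl => by rw [hL]; exact hSs _ l hl⟩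
  · intro i j hn a ha c hc d e x hx y hy
    have mem2 : ∀ x y : g, a * (TensorAlgebra.ι k x * TensorAlgebra.ι k y) * c ∈
        tensorDeg k g (i + 2 + j) := fun x y => mul_mem_tensorDeg (mul_mem_tensorDeg ha
        (mul_ι_mem_tensorDeg (ι_mem_tensorDeg x) y)) hc
    rw [heq n _ _ (mem2 x y) (by omega), heq n _ _ (mem2 y x) (by omega),
      heq n _ _ (mul_mem_tensorDeg (mul_ι_mem_tensorDeg ha _) hc) (by omega)]
    exact (hS n).comm i j hn a ha c hc d e x hx y hy
  · intro i j x hn a ha c hc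
    have q2 := b.two_le_expo (p := p) x
    rw [heq n _ _ (mul_mem_tensorDeg (mul_mem_tensorDeg ha (ι_pow_mem_tensorDeg _ _)) hc)
        (by omega), heq n _ _ (mul_mem_tensorDeg (mul_ι_mem_tensorDeg ha _) hc) (by omega)]
    exact (hS n).pow i j x hn a ha c hc

/-- The theorem of Poincaré, Birkhoff and Witt in the tensor algebra: uniqueness. -/
theorem rel_eq_zero {L : TensorAlgebra k g →ₗ[k] Q} (hL : ∀ n, Rel p b n L)
    (h : ∀ l : List B, IsStandard p b l → L (word b.basis l) = 0) : L = 0 := by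
  -- Induction on the length and, for fixed length, on the number of inversions. A word that is not
  -- standard has a full block or a descent, and the relation replaces it by words smaller in this
  -- order.
  have key : ∀ n, ∀ l : List B, l.length = n → L (word b.basis l) = 0 := by
    intro n
    induction n using Nat.strong_induction_on with
    | _ n ih =>
    have low : ∀ m t, t ∈ tensorDeg k g m → m < n → L t = 0 := fun m t ht hm =>
      eq_on_tensorDeg (L' := 0) b.basis (fun l hl => ih m hm l hl) ht
    intro l
    induction hN : invCount l using Nat.strong_induction_on generalizing l with
    | _ N ihN =>
    intro hl
    by_cases hs : IsStandard p b l
    · exact h l hs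
    by_cases hs' : l.Pairwise (· ≤ ·)
    · simp only [IsStandard, hs', true_and, not_forall, not_lt] at hs
      obtain ⟨x, hx⟩ := hs
      have q2 := b.two_le_expo (p := p) x
      obtain ⟨a, c, rfl⟩ : ∃ a c, l = a ++ (List.replicate (b.expo p x) x ++ c) := by
        obtain ⟨r, hr⟩ := Nat.exists_eq_add_of_le hx
        have hp : (l.filter (· < x) ++ (List.replicate (l.count x) x ++
            l.filter (x < ·))).Perm l := by
          rw [List.perm_iff_count]
          intro z
          rw [List.count_append, List.count_append, count_filter_ite, count_filter_ite,
            List.count_replicate]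
          rcases lt_trichotomy z x with hz | rfl | hz
          · simp [hz, hz.ne', hz.le]
          · simp
          · simp [hz, hz.ne, hz.le]
        have := hp.eq_of_pairwise (le := (· ≤ ·)) (fun a b _ _ h1 h2 => le_antisymm h1 h2) (by
          rw [List.pairwise_append, List.pairwise_append]
          refine ⟨hs'.filter _, ⟨List.pairwise_replicate.mpr (Or.inr le_rfl),
            hs'.filter _, ?_⟩, ?_⟩
          · intro u hu v hv
            rw [List.eq_of_mem_replicate hu]
            have := (List.mem_filter.mp hv).2
            simp only [decide_eq_true_eq] at this
            exact this.le
          · intro u hu v hv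
            have hu' : u < x := by simpa using (List.mem_filter.mp hu).2
            rcases List.mem_append.mp hv with hv | hv
            · rw [List.eq_of_mem_replicate hv]; exact hu'.le
            · have : x < v := by simpa using (List.mem_filter.mp hv).2
              exact (hu'.trans this).le) hs'
        refine ⟨l.filter (· < x), List.replicate r x ++ l.filter (x < ·), ?_⟩
        rw [← List.append_assoc (List.replicate _ _), List.replicate_append_replicate, ← hr]
        exact this.symm
      have h1 := (hL _).pow _ _ x le_rfl _ (word_mem_tensorDeg b.basis a) _
        (word_mem_tensorDeg b.basis c)
      have h3 := low _ _ (mul_mem_tensorDeg (mul_ι_mem_tensorDeg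
        (word_mem_tensorDeg b.basis a) (b.root p x)) (word_mem_tensorDeg b.basis c))
        (by simp at hl; omega)
      simp only [word_append, word_replicate, mul_assoc] at h1 h3 ⊢
      rw [h1, h3]
    · rw [← List.isChain_iff_pairwise, List.isChain_iff_forall_rel_of_append_cons_cons] at hs'
      push Not at hs'
      obtain ⟨x, y, a, c, rfl, hxy⟩ := hs'
      have h1 := (hL _).comm _ _ le_rfl _ (word_mem_tensorDeg b.basis a) _
        (word_mem_tensorDeg b.basis c) _ _ _ (b.mem x) _ (b.mem y)
      have h2 := ihN _ (by rw [← hN]; exact invCount_swap_lt a c hxy) (a ++ y :: x :: c) rfl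
        (by simpa using hl)
      have h3 := low _ _ (mul_mem_tensorDeg (mul_ι_mem_tensorDeg
        (word_mem_tensorDeg b.basis a)
        (br (k := k) (b.basis x) (b.basis y))) (word_mem_tensorDeg b.basis c))
        (by simp at hl; omega)
      simp only [word_append, word_cons, mul_assoc] at h1 h2 h3 ⊢
      rw [h1, h2, h3]
      simp
  exact linear_word_ext b.basis fun l => key _ l rfl

end Extension

/-! ### Jacobson's formula -/

section Jacobson

open Polynomial in
theorem derivative_pow_eq_sum {A : Type*} [Ring A] (f : A[X]) (r : ℕ) :
    derivative (f ^ r) = ∑ i ∈ Finset.range r, f ^ i * derivative f * f ^ (r - 1 - i) := by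
  induction r with
  | zero => simp
  | succ r ih =>
    rw [pow_succ, derivative_mul, ih, Finset.sum_mul, Finset.sum_range_succ]
    congr 1
    · refine Finset.sum_congr rfl fun i hi => ?_
      have := Finset.mem_range.mp hi
      rw [show r + 1 - 1 - i = r - 1 - i + 1 by omega, pow_succ]
      simp only [mul_assoc]
    · simp

/-- Formally this is `((D+R)^p - R^p)/D` with `(D+R)^p = D^p + R^p`. Since `D` need not be
invertible, the terms are expanded and summed by the hockey-stick identity. -/
theorem sum_pow_mul_pow_of_commute {E : Type*} [Ring E] {p : ℕ} (hp : p.Prime)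
    (h0 : ((p : ℕ) : E) = 0) {D R : E} (hc : Commute D R) :
    ∑ r ∈ Finset.range p, (D + R) ^ r * R ^ (p - 1 - r) = D ^ (p - 1) := by
  have step : ∀ r ∈ Finset.range p, (D + R) ^ r * R ^ (p - 1 - r) =
      ∑ t ∈ Finset.range p, D ^ t * R ^ (p - 1 - t) * (r.choose t : E) := by
    intro r hr
    have hr' := Finset.mem_range.mp hr
    rw [hc.add_pow, Finset.sum_mul, ← Finset.sum_subset (Finset.range_mono
      (show r + 1 ≤ p by omega))]
    · refine Finset.sum_congr rfl fun t ht => ?_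
      have ht' := Finset.mem_range.mp ht
      rw [show p - 1 - t = (r - t) + (p - 1 - r) by omega, pow_add, mul_assoc, mul_assoc, mul_assoc,
        (Nat.cast_commute (r.choose t) (R ^ (p - 1 - r))).eq]
      simp only [mul_assoc]
    · intro t _ ht
      rw [Nat.choose_eq_zero_of_lt (by simpa using ht), Nat.cast_zero, mul_zero]
  rw [Finset.sum_congr rfl step, Finset.sum_comm]
  simp only [← Finset.mul_sum, ← Nat.cast_sum, sum_range_choose_eq]
  have hp1 := hp.one_le
  rw [Finset.sum_eq_single (p - 1)]
  · rw [Nat.sub_add_cancel hp1]; simp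
  · intro t ht htp
    have ht' := Finset.mem_range.mp ht
    obtain ⟨d, hd⟩ := hp.dvd_choose_self (k := t + 1) (by omega) (by omega)
    rw [hd, Nat.cast_mul, h0, zero_mul, mul_zero]
  · intro h
    exact absurd (Finset.mem_range.mpr (by omega)) h

/-- The preceding identity with `R` the right multiplication by `f` and `D` the commutator with `f`,
so that `D + R` is left multiplication. -/
theorem sum_pow_mul_mul_pow {A : Type*} [Ring A] {p : ℕ} (hp : p.Prime) (h0 : ((p : ℕ) : A) = 0)
    (f z : A) : ∑ i ∈ Finset.range p, f ^ i * z * f ^ (p - 1 - i) =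
      (fun z => f * z - z * f)^[p - 1] z := by
  have hc : Commute (LinearMap.mulLeft ℤ f - LinearMap.mulRight ℤ f) (LinearMap.mulRight ℤ f) :=
    ((LinearMap.commute_mulLeft_right f f).sub_left (Commute.refl _))
  have h0' : ((p : ℕ) : Module.End ℤ A) = 0 := by
    ext a
    change ((p : ℕ) : Module.End ℤ A) a = 0
    rw [Module.End.natCast_apply, ← Nat.cast_smul_eq_nsmul A, h0, zero_smul]
  have key := LinearMap.congr_fun (sum_pow_mul_pow_of_commute hp h0' hc) z
  rw [sub_add_cancel] at key
  have h1 : ∀ (r : ℕ) (z : A), ((LinearMap.mulLeft ℤ f - LinearMap.mulRight ℤ f) ^ r) z =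
      (fun z => f * z - z * f)^[r] z := by
    intro r
    induction r with
    | zero => intro z; rfl
    | succ r ih => intro z; rw [pow_succ, Module.End.mul_apply, ih]; rfl
  rw [h1] at key
  rw [← key, LinearMap.sum_apply]
  refine Finset.sum_congr rfl fun i _ => ?_
  rw [LinearMap.pow_mulLeft, LinearMap.pow_mulRight]
  simp [mul_assoc]

-- Expanding the iterated commutator letter by letter gives one summand for each word, and each
-- letter `x` contributes a factor `X`.
open Polynomial in
theorem iterate_commutator_eq_sum {A : Type*} [Ring A] (x y : A) (r : ℕ) :
    (fun z : A[X] => (C x * X + C y) * z - z * (C x * X + C y))^[r] (C x) =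
      ∑ w : Fin r → Bool, C ((List.ofFn w).foldr (fun b z =>
        (if b then x else y) * z - z * (if b then x else y)) x) *
          X ^ ((List.ofFn w).count true) := by
  induction r with
  | zero => simp
  | succ r ih =>
    rw [Function.iterate_succ_apply', ih, ← (Fin.consEquiv (fun _ => Bool)).sum_comp,
      Fintype.sum_prod_type, Fintype.sum_bool]
    have hcons : ∀ (c : Bool) (w : Fin r → Bool),
        List.ofFn ((Fin.consEquiv fun _ => Bool) (c, w)) = c :: List.ofFn w := fun c w => by
      rw [List.ofFn_succ]; rfl
    simp only [hcons, List.foldr_cons, List.count_cons_self,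
      if_true, Bool.false_eq_true, if_false]
    rw [Finset.mul_sum, Finset.sum_mul, ← Finset.sum_sub_distrib, ← Finset.sum_add_distrib]
    refine Finset.sum_congr rfl fun w _ => ?_
    rw [List.count_cons_of_ne (by simp)]
    generalize (List.ofFn w).foldr _ x = z
    generalize (List.ofFn w).count true = j
    have e1 : ∀ u : A, C u * X ^ j * (C x * X + C y) = C (u * x) * X ^ (j + 1) + C (u * y) * X ^ j := by
      intro u
      rw [mul_add, mul_assoc, ← mul_assoc (X ^ j), X_pow_mul_C, mul_assoc (C x), ← pow_succ,
        ← mul_assoc, ← C_mul, mul_assoc (C u), X_pow_mul_C, ← mul_assoc (C u), ← C_mul]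
    have e2 : (C x * X + C y) * (C z * X ^ j) = C (x * z) * X ^ (j + 1) + C (y * z) * X ^ j := by
      rw [add_mul, mul_assoc, ← mul_assoc X, X_mul_C, mul_assoc (C z), ← pow_succ', ← mul_assoc,
        ← C_mul, ← mul_assoc, ← C_mul]
    rw [e1, e2]
    simp only [C_sub, sub_mul]
    abel

open Polynomial in
/-- Jacobson's formula for the `p`-th power of a sum. -/
theorem add_pow_eq_jacobson {k A : Type*} [Field k] [Ring A] [Algebra k A] (p : ℕ)
    [hp : Fact p.Prime] [CharP k p] (x y : A) :
    (x + y) ^ p = x ^ p + y ^ p + ∑ w : Fin (p - 1) → Bool,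
      ((((List.ofFn w).count true + 1 : ℕ) : k))⁻¹ • (List.ofFn w).foldr
        (fun b z => (if b then x else y) * z - z * (if b then x else y)) x := by
  have h0 : ((p : ℕ) : A) = 0 := by
    rw [← map_natCast (algebraMap k A), CharP.cast_eq_zero, map_zero]
  have h0' : ((p : ℕ) : A[X]) = 0 := by rw [← C_eq_natCast, h0, C_0]
  set f : A[X] := C x * X + C y with hf
  have hdeg : f.natDegree ≤ 1 := natDegree_linear_le
  -- The derivative of `(x X + y)^p` is the iterated commutator of `x X + y` applied `p - 1` times
  -- to `x`. Comparing coefficients determines the middle coefficients of the power, and `X = 1`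
  -- then gives `(x + y)^p`.
  have hder := derivative_pow_eq_sum f p
  have hf' : derivative f = C x := by simp [hf]
  rw [hf', sum_pow_mul_mul_pow hp.out h0', hf, iterate_commutator_eq_sum, ← hf] at hder
  have hcoeff : ∀ j, j + 1 < p → (f ^ p).coeff (j + 1) = ((j + 1 : ℕ) : k)⁻¹ •
      ∑ w : Fin (p - 1) → Bool, if (List.ofFn w).count true = j then
        (List.ofFn w).foldr
        (fun b z => (if b then x else y) * z - z * (if b then x else y)) x else 0 := by
    intro j hj
    have h1 : ((j + 1 : ℕ) : k) ≠ 0 := by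
      rw [Ne, CharP.cast_eq_zero_iff k p]
      exact fun h => absurd (Nat.le_of_dvd (by omega) h) (by omega)
    rw [eq_inv_smul_iff₀ h1]
    have h2 := congrArg (fun q => q.coeff j) hder
    simp only [coeff_derivative, finsetSum_coeff, coeff_C_mul_X_pow] at h2
    rw [Nat.cast_smul_eq_nsmul, nsmul_eq_mul, (Nat.cast_commute _ _).eq]
    push_cast
    rw [h2]
    refine Finset.sum_congr rfl fun w _ => ?_
    simp only [eq_comm]
  have heval : (x + y) ^ p = ∑ j ∈ Finset.range (p + 1), (f ^ p).coeff j := by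
    have h1 : eval₂RingHom' (RingHom.id A) 1 (fun a => Commute.one_right _) (f ^ p) =
        (x + y) ^ p := by
      rw [map_pow]
      congr 1
      change eval₂ (RingHom.id A) 1 f = x + y
      simp [hf, eval₂_mul_X]
    rw [← h1]
    change eval₂ (RingHom.id A) 1 (f ^ p) = _
    rw [eval₂_eq_sum_range' (RingHom.id A) (n := p + 1)]
    · simp
    · have := natDegree_pow_le_of_le p hdeg
      omega
  have hp1 := hp.out.one_le
  obtain ⟨q, rfl⟩ := Nat.exists_eq_add_of_le' hp1
  rw [heval, Finset.sum_range_succ, Finset.sum_range_succ']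
  have c0 : (f ^ (q + 1)).coeff 0 = y ^ (q + 1) := by
    rw [← constantCoeff_apply, map_pow]
    simp [hf]
  have cp : (f ^ (q + 1)).coeff (q + 1) = x ^ (q + 1) := by
    have := coeff_pow_of_natDegree_le (m := q + 1) hdeg
    rw [mul_one] at this
    rw [this]
    simp [hf]
  rw [c0, cp, Finset.sum_congr rfl (fun j hj => hcoeff j (by
    have := Finset.mem_range.mp hj; omega))]
  simp only [Finset.smul_sum, smul_ite, smul_zero]
  rw [Finset.sum_comm]
  have hw : ∀ w : Fin q → Bool, (∑ j ∈ Finset.range q, if (List.ofFn w).count true = j then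
      ((j + 1 : ℕ) : k)⁻¹ • (List.ofFn w).foldr
        (fun b z => (if b then x else y) * z - z * (if b then x else y)) x else 0) =
      (((List.ofFn w).count true + 1 : ℕ) : k)⁻¹ • (List.ofFn w).foldr
        (fun b z => (if b then x else y) * z - z * (if b then x else y)) x := by
    intro w
    rw [Finset.sum_ite_eq]
    split_ifs with h
    · rfl
    -- The remaining word has only letters `x`; its coefficient is `p⁻¹ = 0` in `k`.
    · have h1 : (List.ofFn w).count true ≤ q := List.count_le_length.trans (by simp)
      have h2 : (List.ofFn w).count true = q := by
        have := Finset.mem_range.not.mp h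
        omega
      rw [h2, CharP.cast_eq_zero, inv_zero, zero_smul]
  change (∑ w : Fin q → Bool, _) + _ + _ = _ + _ + ∑ w : Fin q → Bool, _
  rw [Finset.sum_congr rfl fun w _ => hw w]
  abel

end Jacobson

/-! ### PBW in the restricted enveloping algebra -/

section EnvPBW

variable {k : Type*} {p : ℕ} {g : Type*} [Field k] [AddCommGroup g] [Module k g]
  [LieSuperalgebra k g] [RestrictedLieSuperalgebra k p g]

theorem envMk_surjective : Function.Surjective (envMk k p g) :=
  RingQuot.mkAlgHom_surjective k (EnvRel k p g)

theorem pMap_zero [Fact p.Prime] : (pMap p (0 : homog k g 0)) = 0 := by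
  have h := RestrictedLieSuperalgebra.pMap_smul (p := p) (0 : k) (0 : homog k g 0)
  rw [zero_smul, zero_pow (Fact.out : p.Prime).ne_zero, zero_smul] at h
  exact h

/-- An even map to an associative algebra that respects the brackets respects `p`-powers if it does
so on a basis of the even part. -/
theorem map_pMap_of_basis [Fact p.Prime] [CharP k p] [Fact (2 < p)] {A B : Type*} [Ring A]
    [Algebra k A] (b : HomogBasis k g B) (φ : g →ₗ[k] A)
    (hbr : ∀ x ∈ homog k g 0, ∀ y ∈ homog k g 0, φ (br (k := k) x y) = φ x * φ y - φ y * φ x)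
    (hb : ∀ (u : B) (hu : b.basis u ∈ homog k g 0), φ (pMap p ⟨b.basis u, hu⟩ : homog k g 0) =
      φ (b.basis u) ^ p) (x : homog k g 0) : φ (pMap p x : homog k g 0) = φ x ^ p := by
  have hle : ∀ x ∈ Submodule.span k {x | ∃ u, b.deg u = 0 ∧ x = b.basis u}, x ∈ homog k g 0 := by
    intro x hx
    refine Submodule.span_le.mpr ?_ hx
    rintro _ ⟨u, hu, rfl⟩
    exact hu ▸ b.mem u
  have key : ∀ x ∈ Submodule.span k {x | ∃ u, b.deg u = 0 ∧ x = b.basis u},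
      ∀ hx : x ∈ homog k g 0, φ (pMap p ⟨x, hx⟩ : homog k g 0) = φ x ^ p := by
    intro x hx
    induction hx using Submodule.span_induction with
    | zero =>
      intro _
      have := pMap_zero (k := k) (p := p) (g := g)
      rw [map_zero, zero_pow (Fact.out : p.Prime).ne_zero]
      change φ ((pMap p (0 : homog k g 0) : homog k g 0) : g) = 0
      rw [this]
      simp
    | mem x hx =>
      obtain ⟨u, hu, rfl⟩ := hx
      exact hb u
    | smul c x hx ih =>
      intro _
      have h := RestrictedLieSuperalgebra.pMap_smul (p := p) c (⟨x, hle x hx⟩ : homog k g 0)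
      have h' := congrArg (fun t : homog k g 0 => φ (t : g)) h
      change φ (pMap p (c • ⟨x, hle x hx⟩ : homog k g 0) : homog k g 0) =
        φ ((c ^ p • pMap p (⟨x, hle x hx⟩ : homog k g 0) : homog k g 0) : g) at h'
      rw [Submodule.coe_smul, map_smul, ih] at h'
      rw [map_smul, smul_pow]
      exact h'
    | add x y hx hy ihx ihy =>
      intro _
      have h := RestrictedLieSuperalgebra.pMap_add (p := p) (⟨x, hle x hx⟩ : homog k g 0)
        ⟨y, hle y hy⟩
      have h' := congrArg φ h
      change φ (pMap p (⟨x, hle x hx⟩ + ⟨y, hle y hy⟩ : homog k g 0) : homog k g 0) =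
        φ ((pMap p (⟨x, hle x hx⟩ : homog k g 0) : homog k g 0) +
          (pMap p (⟨y, hle y hy⟩ : homog k g 0) : homog k g 0) + jacobsonSum k p x y) at h'
      rw [map_add, map_add, ihx, ihy] at h'
      rw [map_add, add_pow_eq_jacobson (k := k) p]
      refine h'.trans ?_
      congr 1
      -- All iterated brackets stay even, so `φ` turns them into iterated commutators and the two
      -- Jacobson sums match.
      have hl : ∀ l : List Bool,
          l.foldr (fun b z => br (k := k) (if b then x else y) z) x ∈ homog k g 0 ∧
          φ (l.foldr (fun b z => br (k := k) (if b then x else y) z) x) =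
          l.foldr (fun b z => (if b then φ x else φ y) * z - z * (if b then φ x else φ y)) (φ x) := by
        intro l
        induction l with
        | nil => exact ⟨hle x hx, rfl⟩
        | cons c l ih =>
          have hc : (if c then x else y) ∈ homog k g 0 := by
            split_ifs
            · exact hle x hx
            · exact hle y hy
          rw [List.foldr_cons, List.foldr_cons, ← ih.2]
          refine ⟨by simpa using br_mem_homog hc ih.1, ?_⟩
          rw [hbr _ hc _ ih.1]
          cases c <;> simp
      rw [jacobsonSum, map_sum]
      refine Finset.sum_congr rfl fun w _ => ?_
      rw [map_smul, (hl _).2]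
  exact key x (b.homog_le_span (two_ne_zero_of_char k p) 0 x.2) x.2

variable (p) in
/-- The product of the basis elements of a word in the restricted enveloping algebra. -/
def envWord {B : Type*} (y : B → g) (l : List B) : Env k p g :=
  (l.map (fun x => envι k p (y x))).prod

@[simp] theorem envWord_nil {B : Type*} (y : B → g) : envWord (k := k) p y [] = 1 := rfl

@[simp] theorem envWord_cons {B : Type*} (y : B → g) (x : B) (l : List B) :
    envWord (k := k) p y (x :: l) = envι k p (y x) * envWord p y l := by
  simp [envWord]

@[simp] theorem envWord_append {B : Type*} (y : B → g) (l l' : List B) :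
    envWord (k := k) p y (l ++ l') = envWord p y l * envWord p y l' := by
  simp [envWord]

theorem envMk_word {B : Type*} (b : Module.Basis B k g) (l : List B) :
    envMk k p g (word b l) = envWord p b l := by
  rw [word, envWord, map_list_prod, List.map_map]
  rfl

variable [Fact p.Prime] [CharP k p] [Fact (2 < p)] {B : Type*} [LinearOrder B]
  (b : HomogBasis k g B) {Q : Type*} [AddCommGroup Q] [Module k Q]

/-- The theorem of Poincaré, Birkhoff and Witt: the standard words span. -/
theorem env_linear_ext {L L' : Env k p g →ₗ[k] Q}
    (h : ∀ l, IsStandard p b l → L (envWord p b.basis l) = L' (envWord p b.basis l)) : L = L' := by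
  have hrel : ∀ n, Rel p b n ((L - L') ∘ₗ (envMk k p g).toLinearMap) := by
    intro n
    refine rel_of_words (two_ne_zero_of_char k p) ?_ ?_
    · intro a c x y _
      simp only [LinearMap.comp_apply, AlgHom.toLinearMap_apply, map_mul, word_append, word_cons,
        ← envι_apply]
      rw [envι_br _ _ _ _ (b.mem x) (b.mem y)]
      simp only [mul_sub, sub_mul, mul_smul_comm, smul_mul_assoc, map_sub, map_smul, mul_assoc]
      abel
    · intro a c x _
      simp only [LinearMap.comp_apply, AlgHom.toLinearMap_apply, map_mul, word_append, word_replicate,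
        map_pow, ← envι_apply, mul_assoc]
      have : envι k p (b.root p x) = envι k p (b.basis x) ^ b.expo p x := by
        rcases zmod_two_cases (b.deg x) with hd | hd
        · rw [b.root_even hd, b.expo_even hd, envι_pMap]
        · have hx := b.mem x
          rw [hd] at hx
          rw [b.root_odd hd, b.expo_odd hd, map_smul, envι_br _ _ _ _ hx hx,
            inv_smul_eq_iff₀ (two_ne_zero_of_char k p), two_smul, pow_two]
          simp
      rw [this]
  have h0 := rel_eq_zero hrel (fun l hl => by
    simp only [LinearMap.comp_apply, AlgHom.toLinearMap_apply, envMk_word, LinearMap.sub_apply,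
      h l hl, sub_self])
  ext u
  obtain ⟨t, rfl⟩ := envMk_surjective u
  have := LinearMap.congr_fun h0 t
  simpa [sub_eq_zero] using this

/-- The tensors all of whose multiples are killed by a linear form. -/
def multipleKer (L : TensorAlgebra k g →ₗ[k] Q) : Ideal (TensorAlgebra k g) where
  carrier := {t | ∀ a c, L (a * t * c) = 0}
  add_mem' hs ht a c := by simp [mul_add, add_mul, hs a c, ht a c]
  zero_mem' a c := by simp
  smul_mem' r t ht a c := by simpa [mul_assoc] using ht (a * r) c

instance (L : TensorAlgebra k g →ₗ[k] Q) : (multipleKer L).IsTwoSided where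
  mul_mem_of_left r ht a c := by simpa [mul_assoc] using ht a (r * c)

theorem mem_multipleKer_of_words {L : TensorAlgebra k g →ₗ[k] Q} {t : TensorAlgebra k g}
    (h : ∀ a c : List B, L (word b.basis a * t * word b.basis c) = 0) : t ∈ multipleKer L := by
  intro a c
  have h1 : ∀ a : List B, L ∘ₗ LinearMap.mulLeft k (word b.basis a * t) = 0 := fun a =>
    linear_word_ext b.basis fun c => h a c
  have h2 : L ∘ₗ LinearMap.mulRight k (t * c) = 0 := linear_word_ext b.basis fun a => by
    have := LinearMap.congr_fun (h1 a) c
    simpa [mul_assoc] using this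
  have := LinearMap.congr_fun h2 a
  simpa [mul_assoc] using this

/-- The theorem of Poincaré, Birkhoff and Witt: the standard words are linearly independent. -/
theorem exists_env_linear (f : List B → Q) : ∃ L : Env k p g →ₗ[k] Q,
    ∀ l, IsStandard p b l → L (envWord p b.basis l) = f l := by
  obtain ⟨L, hL, hf⟩ := exists_rel (p := p) (b := b) f
  have h2 := two_ne_zero_of_char k p
  -- `multipleKer L` is the largest two-sided ideal inside the kernel of `L`. As `L` respects the
  -- relations in all degrees, they hold modulo this ideal; so `U'(g)` maps to the quotient, through
  -- which `L` factors.
  let φ : g →ₗ[k] (TensorAlgebra k g ⧸ multipleKer L) :=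
    (Ideal.Quotient.mkₐ k (multipleKer L)).toLinearMap ∘ₗ TensorAlgebra.ι k
  have hφ : ∀ x, φ x = Ideal.Quotient.mkₐ k (multipleKer L) (TensorAlgebra.ι k x) := fun x => rfl
  have hbr : ∀ (i j : ZMod 2), ∀ x ∈ homog k g i, ∀ y ∈ homog k g j,
      φ (br (k := k) x y) = φ x * φ y - sgn k (i * j) • (φ y * φ x) := by
    intro i j x hx y hy
    simp only [hφ, ← map_mul, ← map_smul, ← map_sub]
    refine (Ideal.Quotient.mk_eq_mk_iff_sub_mem _ _).mpr (mem_multipleKer_of_words b fun a c => ?_)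
    have := (hL _).comm _ _ le_rfl _ (word_mem_tensorDeg b.basis a) _
      (word_mem_tensorDeg b.basis c) _ _ x hx y hy
    simp only [mul_sub, sub_mul, map_sub, this, mul_smul_comm, smul_mul_assoc, map_smul]
    abel
  -- `Rel.pow` covers the basis elements, Jacobson's formula the rest.
  have hpm : ∀ x : homog k g 0, φ (pMap p x : homog k g 0) = φ x ^ p := by
    refine map_pMap_of_basis b φ (fun x hx y hy => by simpa using hbr 0 0 x hx y hy) ?_
    intro u hu
    simp only [hφ, ← map_pow]
    refine (Ideal.Quotient.mk_eq_mk_iff_sub_mem _ _).mpr (mem_multipleKer_of_words b fun a c => ?_)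
    have hd : b.deg u = 0 := by
      by_contra hd
      have h1 := b.mem u
      rw [(zmod_two_cases _).resolve_left hd, mem_homog] at h1
      rw [mem_homog] at hu
      rw [hu] at h1
      have : (2 : k) • b.basis u = 0 := by
        rw [two_smul]; simp only [sgn_zero, one_smul, sgn_one, neg_smul] at h1
        nth_rewrite 1 [h1]; simp
      exact b.basis.ne_zero u ((smul_eq_zero.mp this).resolve_left h2)
    have := (hL _).pow _ _ u le_rfl _ (word_mem_tensorDeg b.basis a) _
      (word_mem_tensorDeg b.basis c)
    rw [b.expo_even hd, b.root_even hd] at this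
    rw [mul_sub, sub_mul, map_sub, this, sub_self]
  let Φ := envLift (p := p) φ hbr hpm
  have hker : (multipleKer L).restrictScalars k ≤ LinearMap.ker L := fun t ht => by
    simpa using ht 1 1
  let Lq : (TensorAlgebra k g ⧸ multipleKer L) →ₗ[k] Q :=
    Submodule.liftQ _ L hker ∘ₗ (Submodule.Quotient.restrictScalarsEquiv k (multipleKer L)).symm
  refine ⟨Lq ∘ₗ Φ.toLinearMap, fun l hl => ?_⟩
  have hΦ : Φ (envWord p b.basis l) = Ideal.Quotient.mkₐ k (multipleKer L) (word b.basis l) := by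
    rw [envWord, word, map_list_prod, map_list_prod, List.map_map, List.map_map]
    congr 2
    ext x
    exact envLift_ι _ _ _ _
  rw [LinearMap.comp_apply, AlgHom.toLinearMap_apply, hΦ, ← hf l hl]
  rfl

end EnvPBW

theorem lawfulBEq_sum {X Y : Type*} [BEq X] [BEq Y] [LawfulBEq X] [LawfulBEq Y] :
    LawfulBEq (X ⊕ Y) where
  eq_of_beq {a b} h := by
    rcases a with a | a <;> rcases b with b | b
    · exact congrArg Sum.inl (eq_of_beq (show (a == b) = true from h))
    · exact absurd (show false = true from h) (by decide)
    · exact absurd (show false = true from h) (by decide)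
    · exact congrArg Sum.inr (eq_of_beq (show (a == b) = true from h))
  rfl {a} := by
    rcases a with a | a
    · exact (beq_self_eq_true a)
    · exact (beq_self_eq_true a)

attribute [local instance] lawfulBEq_sum

theorem count_map_of_inj {X Y : Type*} [BEq X] [LawfulBEq X] {dY : DecidableEq Y} (l : List X)
    {f : X → Y} (hf : Function.Injective f) (x : X) :
    @List.count Y (@instBEqOfDecidableEq Y dY) (f x) (l.map f) = l.count x :=
  List.count_map_of_injective l f hf x

theorem count_append_dec {Y : Type*} {dY : DecidableEq Y} (l l' : List Y) (y : Y) :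
    @List.count Y (@instBEqOfDecidableEq Y dY) y (l ++ l') =
      @List.count Y (@instBEqOfDecidableEq Y dY) y l +
        @List.count Y (@instBEqOfDecidableEq Y dY) y l' :=
  List.count_append

theorem count_eq_zero_of_notMem {Y : Type*} {dY : DecidableEq Y} {l : List Y} {y : Y}
    (h : y ∉ l) : @List.count Y (@instBEqOfDecidableEq Y dY) y l = 0 :=
  List.count_eq_zero_of_not_mem h

/-! ### Ordered words and their exponents -/

section OrderedList

variable {n m : ℕ} {X Y : Type*}

theorem count_orderedList [BEq X] [LawfulBEq X] [DecidableEq X] (x : Fin n → X) (y : Fin m → X) (a : Fin n → ℕ)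
    (α : Fin m → ℕ) (z : X) : (orderedList x y a α).count z =
      (∑ i, if x i = z then a i else 0) + ∑ s, if y s = z then α s else 0 := by
  rw [orderedList, List.count_append, List.count_flatMap, List.count_flatMap, Fin.sum_univ_def,
    Fin.sum_univ_def]
  simp [Function.comp_def, List.count_replicate]

theorem map_orderedList (f : X → Y) (x : Fin n → X) (y : Fin m → X) (a : Fin n → ℕ)
    (α : Fin m → ℕ) : (orderedList x y a α).map f = orderedList (f ∘ x) (f ∘ y) a α := by
  simp [orderedList, List.map_flatMap]

theorem pairwise_orderedList [LinearOrder X] {x : Fin n → X} {y : Fin m → X} (hx : StrictMono x)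
    (hy : StrictMono y) (hxy : ∀ i s, x i < y s) (a : Fin n → ℕ) (α : Fin m → ℕ) :
    (orderedList x y a α).Pairwise (· ≤ ·) := by
  have key : ∀ {r : ℕ} {w : Fin r → X} (hw : StrictMono w) (c : Fin r → ℕ),
      ((List.finRange r).flatMap (fun i => List.replicate (c i) (w i))).Pairwise (· ≤ ·) := by
    intro r w hw c
    rw [List.pairwise_flatMap]
    refine ⟨fun i _ => List.pairwise_replicate.mpr (Or.inr le_rfl), ?_⟩
    refine (List.pairwise_lt_finRange r).imp fun {i j} hij u hu v hv => ?_
    rw [List.eq_of_mem_replicate hu, List.eq_of_mem_replicate hv]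
    exact (hw hij).le
  rw [orderedList, List.pairwise_append]
  refine ⟨key hx a, key hy α, fun u hu v hv => ?_⟩
  obtain ⟨i, _, hu⟩ := List.mem_flatMap.mp hu
  obtain ⟨s, _, hv⟩ := List.mem_flatMap.mp hv
  rw [List.eq_of_mem_replicate hu, List.eq_of_mem_replicate hv]
  exact (hxy i s).le

/-- The word in the indices of a frame with the given exponents. -/
def indexWord {p : ℕ} (x : Expo p n m) : List (Fin n ⊕ Fin m) :=
  orderedList Sum.inl Sum.inr (fun i => (x.1 i : ℕ)) (fun s => (x.2 s : ℕ))

theorem count_inl_orderedList (a : Fin n → ℕ) (α : Fin m → ℕ) (i : Fin n) :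
    (orderedList (Sum.inl : _ → Fin n ⊕ Fin m) Sum.inr a α).count (Sum.inl i) = a i := by
  simp [count_orderedList]

theorem count_inr_orderedList (a : Fin n → ℕ) (α : Fin m → ℕ) (s : Fin m) :
    (orderedList (Sum.inl : _ → Fin n ⊕ Fin m) Sum.inr a α).count (Sum.inr s) = α s := by
  simp [count_orderedList]

/-- The map from the indices of a frame to an ordered sum. -/
def lexIndex {Bh : Type*} : Fin n ⊕ Fin m → Bh ⊕ₗ (Fin n ⊕ₗ Fin m) :=
  fun j => Sum.inrₗ (toLex j)

theorem lexIndex_injective {Bh : Type*} :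
    Function.Injective (lexIndex : Fin n ⊕ Fin m → Bh ⊕ₗ (Fin n ⊕ₗ Fin m)) := by
  intro i j h
  simpa [lexIndex] using h

theorem pairwise_lexIndex {Bh : Type*} [LinearOrder Bh] (a : Fin n → ℕ) (α : Fin m → ℕ) :
    ((orderedList Sum.inl Sum.inr a α).map
      (lexIndex : Fin n ⊕ Fin m → Bh ⊕ₗ (Fin n ⊕ₗ Fin m))).Pairwise (· ≤ ·) := by
  rw [map_orderedList]
  refine pairwise_orderedList ?_ ?_ ?_ _ _
  · intro i j h
    simpa [lexIndex] using h
  · intro i j h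
    simpa [lexIndex] using h
  · intro i s
    simp [lexIndex]

theorem exists_split_of_pairwise {Bh : Type*} [LinearOrder Bh] :
    ∀ l : List (Bh ⊕ₗ (Fin n ⊕ₗ Fin m)), l.Pairwise (· ≤ ·) →
    ∃ (lh : List Bh) (lf : List (Fin n ⊕ Fin m)), l = lh.map Sum.inlₗ ++ lf.map lexIndex := by
  intro l hl
  induction l with
  | nil => exact ⟨[], [], rfl⟩
  | cons z l ih =>
    obtain ⟨lh, lf, rfl⟩ := ih (List.pairwise_cons.mp hl).2
    rcases hz : ofLex z with u | j
    · refine ⟨u :: lh, lf, ?_⟩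
      have : z = Sum.inlₗ u := by rw [← toLex_ofLex z, hz]
      rw [this]
      rfl
    · have hz' : z = lexIndex (ofLex j) := by rw [← toLex_ofLex z, hz]; rfl
      rcases lh with _ | ⟨u, lh⟩
      · exact ⟨[], ofLex j :: lf, by simp [hz']⟩
      · have h1 := (List.pairwise_cons.mp hl).1 (Sum.inlₗ u) (by simp)
        rw [hz'] at h1
        simp [lexIndex] at h1

theorem eq_orderedList_of_pairwise {Bh : Type*} [LinearOrder Bh] (lf : List (Fin n ⊕ Fin m))
    (h : (lf.map (lexIndex (Bh := Bh))).Pairwise (· ≤ ·)) :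
    lf = orderedList Sum.inl Sum.inr (fun i => lf.count (Sum.inl i))
      (fun s => lf.count (Sum.inr s)) := by
  refine List.map_injective_iff.mpr (lexIndex_injective (Bh := Bh)) ?_
  refine List.Perm.eq_of_pairwise (le := (· ≤ ·)) (fun a b _ _ h1 h2 => le_antisymm h1 h2) h
    (pairwise_lexIndex _ _) (List.Perm.map _ ?_)
  rw [List.perm_iff_count]
  rintro (i | s)
  · rw [count_inl_orderedList]
  · rw [count_inr_orderedList]

end OrderedList

/-! ### Bases of `g` adapted to `h` -/

section FrameBasis

universe v

theorem exists_homogBasis {k : Type*} {V : Type v} [Field k] [AddCommGroup V] [Module k V]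
    [Superspace k V] (h2 : (2 : k) ≠ 0) : ∃ (B : Type v) (_ : LinearOrder B), Nonempty (HomogBasis k V B) := by
  classical
  let b0 := Module.Basis.ofVectorSpace k (homog k V 0)
  let b1 := Module.Basis.ofVectorSpace k (homog k V 1)
  let b := (b0.prod b1).map (Submodule.prodEquivOfIsCompl _ _ (isCompl_homog h2))
  refine ⟨_, IsWellOrder.linearOrder WellOrderingRel, ⟨⟨b, Sum.elim (fun _ => 0) (fun _ => 1), ?_⟩⟩⟩
  rintro (i | i)
  · simp [b]
  · simp [b]

variable {k : Type*} {p : ℕ} {g : Type*} [Field k] [AddCommGroup g] [Module k g]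
  [LieSuperalgebra k g] [RestrictedLieSuperalgebra k p g] {H : RestrictedSubalgebra k p g}
  {n m : ℕ} (F : Frame H n m)

/-- The elements of a frame. -/
def Frame.vec : Fin n ⊕ Fin m → g := Sum.elim F.e F.ε

variable (n m) in
/-- The degree of an element of a frame. -/
def frameDeg : Fin n ⊕ Fin m → ZMod 2 := Sum.elim (fun _ => 0) (fun _ => 1)

theorem Frame.vec_mem (j : Fin n ⊕ Fin m) : F.vec j ∈ homog k g (frameDeg n m j) := by
  rcases j with i | s
  · exact F.e_mem i
  · exact F.ε_mem s

/-- The basis of `g/h` given by a frame. -/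
def Frame.quotBasis : Module.Basis (Fin n ⊕ Fin m) k (g ⧸ H.carrier) :=
  Module.Basis.mk F.linearIndependent F.span_eq_top.ge

@[simp] theorem Frame.quotBasis_apply (j : Fin n ⊕ Fin m) :
    F.quotBasis j = H.carrier.mkQ (F.vec j) := by
  simp [Frame.quotBasis, Frame.vec]

/-- The basis of `g` given by a basis of `h` and a frame. -/
def Frame.basis {Bh : Type*} (bh : Module.Basis Bh k H.carrier) :
    Module.Basis (Bh ⊕ (Fin n ⊕ Fin m)) k g :=
  Module.Basis.mk (v := Sum.elim (fun i => (bh i : g)) F.vec)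
    (LinearIndependent.sumElim_of_quotient bh.linearIndependent _ F.linearIndependent) (by
      rw [Set.Sum.elim_range, Submodule.span_union,
        show Set.range (fun i => (bh i : g)) = H.carrier.subtype '' (Set.range bh) by
          rw [← Set.range_comp]; rfl,
        ← Submodule.map_span, bh.span_eq, Submodule.map_top, Submodule.range_subtype, top_le_iff,
        ← Submodule.map_mkQ_eq_top, Submodule.map_span, ← Set.range_comp, ← F.span_eq_top]
      rfl)

/-- The homogeneous basis of `g` given by a homogeneous basis of `h` and a frame. -/
def Frame.homogBasis {Bh : Type*} (bh : HomogBasis k H.carrier Bh) :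
    HomogBasis k g (Bh ⊕ₗ (Fin n ⊕ₗ Fin m)) where
  basis := (F.basis bh.basis).reindex ((Equiv.sumCongr (Equiv.refl _) toLex).trans toLex)
  deg z := Sum.elim bh.deg (fun j => frameDeg n m (ofLex j)) (ofLex z)
  mem z := by
    rcases hz : ofLex z with u | j
    · have : z = Sum.inlₗ u := by rw [← toLex_ofLex z, hz]
      subst this
      simpa [Frame.basis, Sum.inlₗ] using (coe_mem_homog H).mpr (bh.mem u)
    · have : z = lexIndex (ofLex j) := by rw [← toLex_ofLex z, hz]; rfl
      subst this
      simpa [Frame.basis, lexIndex, Sum.inrₗ] using F.vec_mem (ofLex j)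

@[simp] theorem Frame.homogBasis_inl {Bh : Type*} (bh : HomogBasis k H.carrier Bh) (u : Bh) :
    (F.homogBasis bh).basis (Sum.inlₗ u) = (bh.basis u : g) := by
  simp [Frame.homogBasis, Frame.basis, Sum.inlₗ]

@[simp] theorem Frame.homogBasis_lexIndex {Bh : Type*} (bh : HomogBasis k H.carrier Bh)
    (j : Fin n ⊕ Fin m) : (F.homogBasis bh).basis (lexIndex j) = F.vec j := by
  simp [Frame.homogBasis, Frame.basis, lexIndex, Sum.inrₗ]

theorem pbwMonomial_eq (F : Frame H n m) (a : Fin n → ℕ) (α : Fin m → ℕ) :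
    pbwMonomial F a α = envWord p F.vec (orderedList Sum.inl Sum.inr a α) := by
  have h : orderedList F.e F.ε a α = (orderedList Sum.inl Sum.inr a α).map F.vec := by
    rw [map_orderedList]; rfl
  rw [pbwMonomial, h, List.map_map]
  rfl

theorem evalPBW_apply {W : Type*} [AddCommGroup W] [Module k W] [Superspace k W]
    (ρ : SuperAction k H.carrier W) (f : Coind ρ) (x : Expo p n m) :
    evalPBW F ρ f x = f.1 (envWord p F.vec (indexWord x)) :=
  congrArg f.1 (pbwMonomial_eq F _ _)

variable [Fact p.Prime] {Bh : Type*} [LinearOrder Bh] (bh : HomogBasis k H.carrier Bh)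

/-- The letters of `h` precede those of the frame, so a standard word factors uniquely. This is the
freeness of `U'(g)` over `U'(h)` with the monomials `e^a ε^α` as a basis. -/
theorem isStandard_iff (l : List (Bh ⊕ₗ (Fin n ⊕ₗ Fin m))) :
    IsStandard p (F.homogBasis bh) l ↔ ∃ (lh : List Bh) (x : Expo p n m),
      IsStandard p bh lh ∧ l = lh.map Sum.inlₗ ++ (indexWord x).map lexIndex := by
  have einl : ∀ u, (F.homogBasis bh).expo p (Sum.inlₗ u) = bh.expo p u := fun u => rfl
  have einr : ∀ j, (F.homogBasis bh).expo p (lexIndex j) = if frameDeg n m j = 0 then p else 2 :=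
    fun j => rfl
  have hinl : Function.Injective (Sum.inlₗ : Bh → Bh ⊕ₗ (Fin n ⊕ₗ Fin m)) := fun u v h => by
    simpa using h
  constructor
  · rintro ⟨h1, h2⟩
    obtain ⟨lh, lf, rfl⟩ := exists_split_of_pairwise l h1
    rw [List.pairwise_append] at h1
    have c1 : ∀ u, lh.count u < bh.expo p u := fun u => by
      have := h2 (Sum.inlₗ u)
      rw [einl, count_append_dec, count_map_of_inj _ hinl] at this
      omega
    have c2 : ∀ j, lf.count j < if frameDeg n m j = 0 then p else 2 := fun j => by
      have := h2 (lexIndex j)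
      rw [einr, count_append_dec, count_map_of_inj _ lexIndex_injective] at this
      omega
    refine ⟨lh, (fun i => ⟨lf.count (Sum.inl i), by simpa [frameDeg] using c2 (Sum.inl i)⟩,
      fun s => ⟨lf.count (Sum.inr s), by simpa [frameDeg] using c2 (Sum.inr s)⟩),
      ⟨?_, c1⟩, ?_⟩
    · have := h1.1
      rw [List.pairwise_map] at this
      exact this.imp fun h => by simpa using h
    · rw [indexWord, ← eq_orderedList_of_pairwise lf h1.2.1]
  · rintro ⟨lh, x, ⟨h1, h2⟩, rfl⟩
    refine ⟨?_, fun z => ?_⟩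
    · rw [List.pairwise_append]
      refine ⟨?_, pairwise_lexIndex _ _, ?_⟩
      · rw [List.pairwise_map]
        exact h1.imp fun h => by simpa using h
      · intro u hu v hv
        obtain ⟨u, _, rfl⟩ := List.mem_map.mp hu
        obtain ⟨v, _, rfl⟩ := List.mem_map.mp hv
        simp [lexIndex]
    · rcases hz : ofLex z with u | j
      · have : z = Sum.inlₗ u := by rw [← toLex_ofLex z, hz]
        subst this
        rw [einl, count_append_dec, count_map_of_inj _ hinl,
          count_eq_zero_of_notMem (l := (indexWord x).map _), add_zero]
        · exact h2 u
        · simp [lexIndex]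
      · have : z = lexIndex (ofLex j) := by rw [← toLex_ofLex z, hz]; rfl
        subst this
        rw [einr, count_append_dec, count_map_of_inj _ lexIndex_injective,
          count_eq_zero_of_notMem (l := lh.map _), zero_add, indexWord]
        · rcases ofLex j with i | s
          · rw [count_inl_orderedList]; simp [frameDeg]
          · rw [count_inr_orderedList]; simpa [frameDeg] using (x.2 s).2
        · simp [lexIndex]

end FrameBasis

/-! ### Induction on the enveloping algebra -/

section EnvInduction

variable {k : Type*} {p : ℕ} {g : Type*} [Field k] [AddCommGroup g] [Module k g]
  [LieSuperalgebra k g] [RestrictedLieSuperalgebra k p g]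

/-- An induction principle for the restricted enveloping algebra, by left multiplication. -/
theorem env_induction {P : Env k p g → Prop} (one : P 1) (add : ∀ u v, P u → P v → P (u + v))
    (smul : ∀ (c : k) u, P u → P (c • u)) (ι_mul : ∀ x u, P u → P (envι k p x * u))
    (u : Env k p g) : P u := by
  obtain ⟨t, rfl⟩ := envMk_surjective u
  suffices h : ∀ u, P u → P (envMk k p g t * u) by simpa using h 1 one
  induction t using TensorAlgebra.induction with
  | algebraMap c =>
    intro u hu
    rw [AlgHom.commutes, ← Algebra.smul_def]
    exact smul c u hu
  | ι x => exact fun u hu => ι_mul x u hu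
  | mul a b ha hb =>
    intro u hu
    rw [map_mul, mul_assoc]
    exact ha _ (hb u hu)
  | add a b ha hb =>
    intro u hu
    rw [map_add, add_mul]
    exact add _ _ (ha u hu) (hb u hu)

/-- An induction principle for the restricted enveloping algebra, by right multiplication. -/
theorem env_induction_right {P : Env k p g → Prop} (one : P 1)
    (add : ∀ u v, P u → P v → P (u + v)) (smul : ∀ (c : k) u, P u → P (c • u))
    (mul_ι : ∀ x u, P u → P (u * envι k p x)) (u : Env k p g) : P u := by
  obtain ⟨t, rfl⟩ := envMk_surjective u
  suffices h : ∀ u, P u → P (u * envMk k p g t) by simpa using h 1 one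
  induction t using TensorAlgebra.induction with
  | algebraMap c =>
    intro u hu
    rw [AlgHom.commutes, ← Algebra.commutes, ← Algebra.smul_def]
    exact smul c u hu
  | ι x => exact fun u hu => mul_ι x u hu
  | mul a b ha hb =>
    intro u hu
    rw [map_mul, ← mul_assoc]
    exact hb _ (ha u hu)
  | add a b ha hb =>
    intro u hu
    rw [map_add, mul_add]
    exact add _ _ (ha u hu) (hb u hu)

end EnvInduction

/-! ### Trivial and contragredient representations are restricted -/

section RestrictedActions

variable {k : Type*} {p : ℕ} {g : Type*} [Field k] [AddCommGroup g] [Module k g]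
  [LieSuperalgebra k g] [RestrictedLieSuperalgebra k p g] [Fact p.Prime] [CharP k p]
  [Fact (2 < p)] {V : Type*} [AddCommGroup V] [Module k V] [Superspace k V]

theorem trivAct_isRestricted : (trivAct k g).IsRestricted p where
  act_br _ _ _ _ _ _ := by simp [trivAct]
  act_pMap _ := by simp [trivAct, (Fact.out : p.Prime).ne_zero]

theorem dualAct_isRestricted {π : SuperAction k g V} (hπ : π.IsRestricted p) :
    (dualAct π).IsRestricted p where
  act_br i j x hx y hy := by
    have h2 := two_ne_zero_of_char k p
    have hxy := br_mem_homog hx hy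
    have e := hπ.act_br i j x hx y hy
    have px := mem_homog.mp hx
    have py := mem_homog.mp hy
    have two : (1 + 1 : ZMod 2) = 0 := by decide
    ext f v
    rcases zmod_two_cases i with rfl | rfl <;> rcases zmod_two_cases j with rfl | rfl <;>
    · simp only [two, add_zero, zero_add] at hxy
      simp [dualAct, proj_of_mem h2 hx, proj_of_mem h2 hy, proj_of_mem h2 hxy, e,
        π.parity_act, px, py]
      try abel
  act_pMap x := by
    have h2 := two_ne_zero_of_char k p
    have key : ∀ y : homog k g 0, (dualAct π).act (y : g) =
        -LinearMap.lcomp k k (π.act (y : g)) := by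
      intro y
      ext f v
      simp [dualAct, proj_of_mem h2 y.2]
    have hpow : ∀ (a : Module.End k V) (r : ℕ), (LinearMap.lcomp k k a : Module.End k _) ^ r =
        LinearMap.lcomp k k (a ^ r) := by
      intro a r
      induction r with
      | zero => rfl
      | succ r ih =>
        rw [pow_succ, ih, pow_succ']
        rfl
    have hodd : Odd p := (Fact.out : p.Prime).odd_of_ne_two (Fact.out : 2 < p).ne'
    rw [key, key, hπ.act_pMap, ← hpow]
    exact (neg_end_pow hodd (LinearMap.lcomp k k (π.act (x : g)))).symm

end RestrictedActions

/-! ### Elements of coinduced representations and their values on the monomials -/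

section PBW

attribute [local instance] lawfulBEq_sum

theorem indexWord_injective {p n m : ℕ} : Function.Injective (indexWord (p := p) (n := n) (m := m)) := by
  intro x y h
  refine Prod.ext (funext fun i => Fin.ext ?_) (funext fun s => Fin.ext ?_)
  · have := congrArg (List.count (Sum.inl i)) h
    rwa [indexWord, indexWord, count_inl_orderedList, count_inl_orderedList] at this
  · have := congrArg (List.count (Sum.inr s)) h
    rwa [indexWord, indexWord, count_inr_orderedList, count_inr_orderedList] at this

variable {k : Type*} {p : ℕ} {g : Type*} [Field k] [AddCommGroup g] [Module k g]
  [LieSuperalgebra k g] [RestrictedLieSuperalgebra k p g] (H : RestrictedSubalgebra k p g)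

/-- The inclusion of `U'(h)` in `U'(g)`. -/
def subEnv : Env k p H.carrier →ₐ[k] Env k p g :=
  envLift (envι k p ∘ₗ H.carrier.subtype)
    (fun i j x hx y hy => by
      simp only [LinearMap.comp_apply, Submodule.subtype_apply, coe_br]
      exact envι_br i j _ _ ((coe_mem_homog H).mpr hx) ((coe_mem_homog H).mpr hy))
    (fun x => envι_pMap (evenIncl H x))

@[simp] theorem subEnv_ι (x : H.carrier) : subEnv H (envι k p x) = envι k p (x : g) :=
  (envLift_ι _ _ _ _).trans rfl

variable {H} {W : Type*} [AddCommGroup W] [Module k W] [Superspace k W]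

variable {n m : ℕ} (F : Frame H n m) [Fact p.Prime] [CharP k p] [Fact (2 < p)]

theorem subEnv_envWord {B : Type*} (y : B → H.carrier) (l : List B) :
    subEnv H (envWord p y l) = envWord p (fun i => (y i : g)) l := by
  induction l with
  | nil => simp
  | cons x l ih => simp [ih]

theorem envWord_map {B B' : Type*} (y : B' → g) (f : B → B') (l : List B) :
    envWord (k := k) p y (l.map f) = envWord p (fun x => y (f x)) l := by
  simp [envWord, Function.comp_def]

theorem envWord_homogBasis {Bh : Type*} (bh : HomogBasis k H.carrier Bh) (lh : List Bh)
    (lf : List (Fin n ⊕ Fin m)) :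
    envWord (k := k) p (F.homogBasis bh).basis (lh.map Sum.inlₗ ++ lf.map lexIndex) =
      subEnv H (envWord p bh.basis lh) * envWord p F.vec lf := by
  rw [envWord_append, envWord_map, envWord_map, subEnv_envWord]
  simp

/-- The products of words in `h` and monomials span `U'(g)`, and `h`-linearity determines the values
on them from the values on the monomials. -/
theorem evalPBW_injective (ρ : SuperAction k H.carrier W) :
    Function.Injective (evalPBW F ρ) := by
  obtain ⟨Bh, _, ⟨bh⟩⟩ := exists_homogBasis (V := H.carrier) (two_ne_zero_of_char k p)
  rw [← LinearMap.ker_eq_bot, LinearMap.ker_eq_bot']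
  intro f hf
  refine Subtype.ext (env_linear_ext (F.homogBasis bh) fun l hl => ?_)
  obtain ⟨lh, x, -, rfl⟩ := (isStandard_iff F bh l).mp hl
  rw [envWord_homogBasis]
  have hx : f.1 (envWord p F.vec (indexWord x)) = 0 := by
    rw [← evalPBW_apply, hf]; rfl
  clear hl
  induction lh with
  | nil => simpa using hx
  | cons u lh ih =>
    rw [envWord_cons, map_mul (subEnv H), subEnv_ι, mul_assoc, f.2, ih]
    simp

/-- Standard words are linearly independent, so the value on (word in `h`)·(monomial) may be
prescribed as the action of the word on the given vector. The resulting map is then `h`-linear. -/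
theorem evalPBW_surjective {ρ : SuperAction k H.carrier W} (hρ : ρ.IsRestricted p) :
    Function.Surjective (evalPBW F ρ) := by
  obtain ⟨Bh, _, ⟨bh⟩⟩ := exists_homogBasis (V := H.carrier) (two_ne_zero_of_char k p)
  intro c
  obtain ⟨L, hL⟩ : ∃ L : Env k p g →ₗ[k] W, ∀ (lh : List Bh) (x : Expo p n m),
      IsStandard p bh lh → L (subEnv H (envWord p bh.basis lh) * envWord p F.vec (indexWord x)) =
        ρ.toEnv hρ (envWord p bh.basis lh) (c x) := by
    classical
    have hdec : ∃ f : List (Bh ⊕ₗ (Fin n ⊕ₗ Fin m)) → W, ∀ (lh : List Bh) (x : Expo p n m),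
        f (lh.map Sum.inlₗ ++ (indexWord x).map lexIndex) =
          ρ.toEnv hρ (envWord p bh.basis lh) (c x) := by
      have hinj : Function.Injective (fun q : List Bh × Expo p n m =>
          (q.1.map Sum.inlₗ ++ (indexWord q.2).map lexIndex : List (Bh ⊕ₗ (Fin n ⊕ₗ Fin m)))) := by
        rintro ⟨lh, x⟩ ⟨lh', x'⟩ h
        have h1 := congrArg (List.filterMap fun z => Sum.getLeft? (ofLex z)) h
        have h2 := congrArg (List.filterMap fun z => Sum.getRight? (ofLex z)) h
        simp [List.filterMap_append, List.filterMap_map, Function.comp_def, Sum.inlₗ, lexIndex,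
          Sum.inrₗ] at h1 h2
        rw [h1, indexWord_injective (List.map_injective_iff.mpr toLex.injective h2)]
      -- Words not of this form get the value `0`; no standard word is among them.
      exact ⟨fun l => Function.extend _ (fun q : List Bh × Expo p n m =>
        ρ.toEnv hρ (envWord p bh.basis q.1) (c q.2)) (fun _ => 0) l, fun lh x =>
        hinj.extend_apply _ _ (lh, x)⟩
    obtain ⟨f, hf⟩ := hdec
    obtain ⟨L, hL⟩ := exists_env_linear (p := p) (F.homogBasis bh) f
    refine ⟨L, fun lh x hlh => ?_⟩
    rw [← envWord_homogBasis, hL _ ((isStandard_iff F bh _).mpr ⟨lh, x, hlh, rfl⟩), hf]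
  -- The prescription was made for standard words of `h`. These span `U'(h)`, so it holds for every
  -- `v`, which is what makes `h`-linearity checkable.
  have hL' : ∀ (x : Expo p n m) (v : Env k p H.carrier),
      L (subEnv H v * envWord p F.vec (indexWord x)) = ρ.toEnv hρ v (c x) := by
    intro x v
    have : L ∘ₗ LinearMap.mulRight k (envWord p F.vec (indexWord x)) ∘ₗ (subEnv H).toLinearMap =
        LinearMap.applyₗ (c x) ∘ₗ (ρ.toEnv hρ).toLinearMap :=
      env_linear_ext bh fun lh hlh => by simpa using hL lh x hlh
    exact LinearMap.congr_fun this v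
  refine ⟨⟨L, fun x u => ?_⟩, ?_⟩
  · have : L ∘ₗ LinearMap.mulLeft k (envι k p (x : g)) = ρ.act x ∘ₗ L := by
      refine env_linear_ext (F.homogBasis bh) fun l hl => ?_
      obtain ⟨lh, y, -, rfl⟩ := (isStandard_iff F bh l).mp hl
      rw [envWord_homogBasis]
      simp only [LinearMap.comp_apply, LinearMap.mulLeft_apply, ← mul_assoc]
      rw [← subEnv_ι, ← map_mul, hL', hL', map_mul]
      simp [SuperAction.toEnv]
    exact LinearMap.congr_fun this u
  · funext x
    rw [evalPBW_apply]
    simpa using hL' x 1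

end PBW

/-! ### Signs as powers of the parity -/

section Twist

variable {k V W : Type*} [Field k] [AddCommGroup V] [Module k V] [Superspace k V]
  [AddCommGroup W] [Module k W] [Superspace k W]

variable (k) in
/-- The map `v ↦ (-1)^{i|v|} v`. -/
def tw (i : ZMod 2) : V →ₗ[k] V := if i = 0 then LinearMap.id else parity (k := k)

@[simp] theorem tw_zero (v : V) : tw k 0 v = v := by simp [tw]

@[simp] theorem tw_one (v : V) : tw k 1 v = parity (k := k) v := by simp [tw]

theorem tw_tw (i j : ZMod 2) (v : V) : tw k i (tw k j v) = tw k (i + j) v := by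
  have two : (1 + 1 : ZMod 2) = 0 := by decide
  rcases zmod_two_cases i with rfl | rfl <;> rcases zmod_two_cases j with rfl | rfl <;> simp [two]

@[simp] theorem tw_tw_self (i : ZMod 2) (v : V) : tw k i (tw k i v) = v := by
  rcases zmod_two_cases i with rfl | rfl <;> simp

theorem tw_of_mem {i j : ZMod 2} {v : V} (hv : v ∈ homog k V j) :
    tw k i v = sgn k (i * j) • v := by
  rw [mem_homog] at hv
  rcases zmod_two_cases i with rfl | rfl <;> simp [hv]

theorem tw_mem {i j : ZMod 2} {v : V} (hv : v ∈ homog k V j) : tw k i v ∈ homog k V j := by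
  rw [tw_of_mem hv]
  exact Submodule.smul_mem _ _ hv

theorem parity_tw (i : ZMod 2) (v : V) : parity (k := k) (tw k i v) = tw k i (parity (k := k) v) := by
  rcases zmod_two_cases i with rfl | rfl <;> simp

theorem homog_induction (h2 : (2 : k) ≠ 0) {P : V → Prop} (add : ∀ v w, P v → P w → P (v + w))
    (mem : ∀ i, ∀ v ∈ homog k V i, P v) (v : V) : P v := by
  rw [← proj_add_proj h2 v]
  exact add _ _ (mem 0 _ (proj_mem 0 v)) (mem 1 _ (proj_mem 1 v))

theorem apply_mem_homog {i j : ZMod 2} {f : V →ₗ[k] W} (hf : f ∈ homog k (V →ₗ[k] W) i) {v : V}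
    (hv : v ∈ homog k V j) : f v ∈ homog k W (i + j) := by
  rw [mem_homog] at *
  have := LinearMap.congr_fun hf (parity (k := k) v)
  simp only [parity_hom, parity_parity, LinearMap.smul_apply] at this
  rw [this, hv, map_smul, smul_smul, sgn_add]

theorem apply_tw {i : ZMod 2} {f : V →ₗ[k] W} (hf : f ∈ homog k (V →ₗ[k] W) i) (j : ZMod 2) (v : V) :
    f (tw k j v) = sgn k (i * j) • tw k j (f v) := by
  rw [mem_homog] at *
  have := LinearMap.congr_fun hf (parity (k := k) v)
  simp only [parity_hom, parity_parity, LinearMap.smul_apply] at this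
  rcases zmod_two_cases j with rfl | rfl
  · simp
  · simp [this, smul_smul, sgn_mul_self]

end Twist

/-! ### Products defined by the coproduct -/

section Conv

variable {k : Type*} {p : ℕ} {g : Type*} [Field k] [AddCommGroup g] [Module k g]
  [LieSuperalgebra k g] [RestrictedLieSuperalgebra k p g]
  {V W U : Type*} [AddCommGroup V] [Module k V] [Superspace k V]
  [AddCommGroup W] [Module k W] [Superspace k W]
  [AddCommGroup U] [Module k U] [Superspace k U]

theorem tw_env_mul (i : ZMod 2) (u v : Env k p g) : tw k i (u * v) = tw k i u * tw k i v := by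
  rcases zmod_two_cases i with rfl | rfl <;> simp [parity_env_mul]

theorem tw_env_one (i : ZMod 2) : tw k i (1 : Env k p g) = 1 := by
  rcases zmod_two_cases i with rfl | rfl <;> simp [parity_env_one]

theorem env_one_mem : (1 : Env k p g) ∈ homog k (Env k p g) 0 := by
  rw [mem_homog, parity_env_one]; simp

theorem envι_mem {i : ZMod 2} {x : g} (hx : x ∈ homog k g i) :
    envι k p x ∈ homog k (Env k p g) i := by
  rw [mem_homog] at *
  rw [parity_env_ι, hx, map_smul]

theorem env_mul_mem {i j : ZMod 2} {u v : Env k p g} (hu : u ∈ homog k (Env k p g) i)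
    (hv : v ∈ homog k (Env k p g) j) : u * v ∈ homog k (Env k p g) (i + j) := by
  rw [mem_homog] at *
  rw [parity_env_mul, hu, hv, smul_mul_smul_comm, sgn_add]

theorem tw_envι {i j : ZMod 2} {x : g} (hx : x ∈ homog k g j) :
    tw k i (envι k p x) = sgn k (i * j) • envι k p x :=
  tw_of_mem (envι_mem hx)

/-- Induction by left multiplication with homogeneous elements. -/
theorem env_induction_homog (h2 : (2 : k) ≠ 0) {P : Env k p g → Prop} (one : P 1)
    (add : ∀ u v, P u → P v → P (u + v))
    (smul : ∀ (c : k) u, P u → P (c • u))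
    (ι_mul : ∀ j, ∀ x ∈ homog k g j, ∀ u, P u → P (envι k p x * u)) (u : Env k p g) : P u := by
  refine env_induction one add smul (fun x u hu => ?_) u
  refine homog_induction (P := fun x => P (envι k p x * u)) h2 (fun x y hx hy => ?_)
    (fun j x hx => ι_mul j x hx u hu) x
  rw [map_add, add_mul]
  exact add _ _ hx hy

/-- Induction by right multiplication with homogeneous elements. -/
theorem env_induction_right_homog (h2 : (2 : k) ≠ 0) {P : Env k p g → Prop} (one : P 1)
    (add : ∀ u v, P u → P v → P (u + v)) (smul : ∀ (c : k) u, P u → P (c • u))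
    (mul_ι : ∀ j, ∀ x ∈ homog k g j, ∀ u, P u → P (u * envι k p x)) (u : Env k p g) : P u := by
  refine env_induction_right one add smul (fun x u hu => ?_) u
  refine homog_induction (P := fun x => P (u * envι k p x)) h2 (fun x y hx hy => ?_)
    (fun j x hx => mul_ι j x hx u hu) x
  rw [map_add, mul_add]
  exact add _ _ hx hy

/-- The action `<u, x f> = <u x, f>` on linear maps. -/
def rmul (x : g) (f : Env k p g →ₗ[k] V) : Env k p g →ₗ[k] V :=
  f ∘ₗ LinearMap.mulRight k (envι k p x)

@[simp] theorem rmul_apply (x : g) (f : Env k p g →ₗ[k] V) (u : Env k p g) :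
    rmul x f u = f (u * envι k p x) := rfl

theorem rmul_mem {i j : ZMod 2} {x : g} (hx : x ∈ homog k g j) {f : Env k p g →ₗ[k] V}
    (hf : f ∈ homog k (Env k p g →ₗ[k] V) i) : rmul x f ∈ homog k (Env k p g →ₗ[k] V) (j + i) := by
  rw [mem_homog] at hf hx ⊢
  ext u
  have hx' : envι k p x = sgn k j • parity (k := k) (envι k p x) := by
    rw [parity_env_ι, hx, map_smul, smul_smul, sgn_mul_self, one_smul]
  simp only [parity_hom, rmul_apply, LinearMap.smul_apply]
  rw [hx', mul_smul_comm, ← parity_env_mul, map_smul, map_smul, ← parity_hom, hf, sgn_add,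
    LinearMap.smul_apply, smul_smul, ← hx']

variable [Fact p.Prime] [CharP k p] [Fact (2 < p)]

@[simp] theorem envComul_one : envComul k p g 1 = 1 ⊗ₜ 1 := by
  simp [envComul]

theorem parity_envComul (u : Env k p g) :
    parity (k := k) (envComul k p g u) = envComul k p g (parity (k := k) u) := by
  induction u using env_induction with
  | one => simp [parity_env_one]
  | add u v hu hv => simp [hu, hv]
  | smul c u hu => simp [hu]
  | ι_mul x u hu =>
    rw [envComul_ι_mul, SuperAction.parity_act, hu, parity_env_mul, parity_env_ι, envComul_ι_mul]

/-- The right action of `x` of degree `j` on `U' ⊗ U'`. -/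
def rightTensor (j : ZMod 2) (x : g) : Env k p g ⊗[k] Env k p g →ₗ[k] Env k p g ⊗[k] Env k p g :=
  TensorProduct.map LinearMap.id (LinearMap.mulRight k (envι k p x)) +
    TensorProduct.map (LinearMap.mulRight k (envι k p x)) (tw k j)

/-- The coproduct is defined through left multiplications. They commute with the operators
`rightTensor`, so the rule for right multiplication propagates from `u = 1`. -/
theorem envComul_mul_ι {j : ZMod 2} {x : g} (hx : x ∈ homog k g j) (u : Env k p g) :
    envComul k p g (u * envι k p x) = rightTensor j x (envComul k p g u) := by
  have h2 := two_ne_zero_of_char k p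
  induction u using env_induction_homog h2 with
  | one =>
    have h := envComul_ι_mul x (1 : Env k p g)
    have px := mem_homog.mp hx
    rcases zmod_two_cases j with rfl | rfl <;>
    · simp [tensorAct, regAct, proj_of_mem h2 hx, parity_env_one] at h
      simp [h, rightTensor, parity_env_one, add_comm]
  | add u v hu hv => simp [add_mul, hu, hv]
  | smul c u hu => simp [hu]
  | ι_mul i y hy u hu =>
    rw [mul_assoc, envComul_ι_mul, hu, envComul_ι_mul]
    have px := mem_homog.mp hx
    have py := mem_homog.mp hy
    induction envComul k p g u with
    | zero => simp
    | add a b ha hb => simp only [map_add, ha, hb]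
    | tmul a b =>
      rcases zmod_two_cases i with rfl | rfl <;> rcases zmod_two_cases j with rfl | rfl <;>
      · simp [rightTensor, tensorAct, regAct, proj_of_mem h2 hy, parity_env_mul, parity_env_ι, px,
          py, mul_assoc, TensorProduct.neg_tmul, TensorProduct.tmul_neg]
        try abel

theorem cupAux_of_mem {i : ZMod 2} {f : Env k p g →ₗ[k] V} (hf : f ∈ homog k (Env k p g →ₗ[k] V) i)
    (f' : Env k p g →ₗ[k] W) : cupAux f f' = TensorProduct.map f (f' ∘ₗ tw k i) := by
  have h2 := two_ne_zero_of_char k p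
  rcases zmod_two_cases i with rfl | rfl <;> ext a b <;> simp [cupAux, proj_of_mem h2 hf]

/-- The product of linear maps on `U'(g)` given by the coproduct and a bilinear map. -/
def conv (B : V ⊗[k] W →ₗ[k] U) :
    (Env k p g →ₗ[k] V) →ₗ[k] (Env k p g →ₗ[k] W) →ₗ[k] (Env k p g →ₗ[k] U) :=
  LinearMap.mk₂ k (fun f f' => B ∘ₗ cupAux f f' ∘ₗ envComul k p g)
    (fun f f₁ f' => by
      rw [← LinearMap.comp_add, ← LinearMap.add_comp]
      congr 2
      ext a b
      simp [cupAux, TensorProduct.add_tmul]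
      abel)
    (fun c f f' => by
      rw [← LinearMap.comp_smul, ← LinearMap.smul_comp]
      congr 2
      ext a b
      simp [cupAux, TensorProduct.smul_tmul'])
    (fun f f' f₁ => by
      rw [← LinearMap.comp_add, ← LinearMap.add_comp]
      congr 2
      ext a b
      simp [cupAux, TensorProduct.tmul_add]
      abel)
    (fun c f f' => by
      rw [← LinearMap.comp_smul, ← LinearMap.smul_comp]
      congr 2
      ext a b
      simp [cupAux])

theorem conv_def (B : V ⊗[k] W →ₗ[k] U) (f : Env k p g →ₗ[k] V) (f' : Env k p g →ₗ[k] W) :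
    conv B f f' = B ∘ₗ cupAux f f' ∘ₗ envComul k p g := rfl

theorem conv_one (B : V ⊗[k] W →ₗ[k] U) (f : Env k p g →ₗ[k] V) (f' : Env k p g →ₗ[k] W) :
    conv B f f' 1 = B (f 1 ⊗ₜ f' 1) := by
  have h2 := two_ne_zero_of_char k p
  simp only [conv_def, LinearMap.comp_apply, envComul_one, cupAux, LinearMap.add_apply,
    TensorProduct.map_tmul, parity_env_one]
  rw [← TensorProduct.add_tmul, ← LinearMap.add_apply, proj_add_proj h2]

/-- `x` is primitive, so it acts by the Leibniz rule. With the value at `1` from `conv_one` this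
determines the product recursively along right multiplications, and the algebraic identities below
are proved in this way. -/
theorem rmul_conv (B : V ⊗[k] W →ₗ[k] U) {i j : ZMod 2} {x : g} (hx : x ∈ homog k g j)
    {f : Env k p g →ₗ[k] V} (hf : f ∈ homog k (Env k p g →ₗ[k] V) i) (f' : Env k p g →ₗ[k] W) :
    rmul x (conv B f f') = conv B (rmul x f) f' + sgn k (j * i) • conv B f (rmul x f') := by
  ext u
  simp only [conv_def, rmul_apply, LinearMap.comp_apply, LinearMap.add_apply,
    LinearMap.smul_apply, envComul_mul_ι hx, cupAux_of_mem hf, cupAux_of_mem (rmul_mem hx hf)]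
  rw [← map_smul, ← map_add]
  congr 1
  induction envComul k p g u with
  | zero => simp
  | add a b ha hb => simp only [map_add, ha, hb, smul_add]; abel
  | tmul a b =>
    simp [rightTensor, tw_env_mul, tw_envι hx, tw_tw, add_comm, mul_comm]

theorem conv_mem {B : V ⊗[k] W →ₗ[k] U} (hB : ∀ t, parity (k := k) (B t) = B (parity (k := k) t))
    {i j : ZMod 2} {f : Env k p g →ₗ[k] V} {f' : Env k p g →ₗ[k] W}
    (hf : f ∈ homog k (Env k p g →ₗ[k] V) i) (hf' : f' ∈ homog k (Env k p g →ₗ[k] W) j) :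
    conv B f f' ∈ homog k (Env k p g →ₗ[k] U) (i + j) := by
  rw [mem_homog]
  ext u
  simp only [conv_def, parity_hom, LinearMap.comp_apply, cupAux_of_mem hf, LinearMap.smul_apply,
    ← parity_envComul, hB]
  rw [← map_smul]
  congr 1
  rw [mem_homog] at hf hf'
  induction envComul k p g u with
  | zero => simp
  | add a b ha hb => simp only [map_add, ha, hb, smul_add]
  | tmul a b =>
    have h1 := LinearMap.congr_fun hf a
    have h2 := LinearMap.congr_fun hf' (tw k i b)
    simp only [parity_hom, LinearMap.smul_apply] at h1 h2
    simp [← parity_tw, h1, h2, sgn_add, TensorProduct.smul_tmul', smul_smul, mul_comm]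

end Conv

/-! ### Associativity, supercommutativity and unit of the products -/

section ConvAlgebra

variable {k : Type*} {p : ℕ} {g : Type*} [Field k] [AddCommGroup g] [Module k g]
  [LieSuperalgebra k g] [RestrictedLieSuperalgebra k p g]
  {V W U X Y Z : Type*} [AddCommGroup V] [Module k V] [Superspace k V]
  [AddCommGroup W] [Module k W] [Superspace k W]
  [AddCommGroup U] [Module k U] [Superspace k U]
  [AddCommGroup X] [Module k X] [Superspace k X]
  [AddCommGroup Y] [Module k Y] [Superspace k Y]
  [AddCommGroup Z] [Module k Z] [Superspace k Z]
  [Fact p.Prime] [CharP k p] [Fact (2 < p)]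

/-- In place of coassociativity: both sides agree at `1` and obey the same Leibniz rule for
homogeneous `f` and `f'`, which are kept general in the induction. -/
theorem conv_assoc {B₁ : U ⊗[k] Z →ₗ[k] X} {B₂ : V ⊗[k] W →ₗ[k] U} {B₃ : V ⊗[k] Y →ₗ[k] X}
    {B₄ : W ⊗[k] Z →ₗ[k] Y} (hB : ∀ v w z, B₁ (B₂ (v ⊗ₜ w) ⊗ₜ z) = B₃ (v ⊗ₜ B₄ (w ⊗ₜ z)))
    (hB₂ : ∀ t, parity (k := k) (B₂ t) = B₂ (parity (k := k) t)) (f : Env k p g →ₗ[k] V)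
    (f' : Env k p g →ₗ[k] W) (f'' : Env k p g →ₗ[k] Z) :
    conv B₁ (conv B₂ f f') f'' = conv B₃ f (conv B₄ f' f'') := by
  have h2 := two_ne_zero_of_char k p
  ext u
  revert f''
  refine homog_induction (P := fun f => ∀ f'' : Env k p g →ₗ[k] Z,
    conv B₁ (conv B₂ f f') f'' u = conv B₃ f (conv B₄ f' f'') u) h2
    (fun v w hv hw f'' => by simp [hv, hw]) (fun i f hf => ?_) f
  refine homog_induction (P := fun f' => ∀ f'' : Env k p g →ₗ[k] Z,
    conv B₁ (conv B₂ f f') f'' u = conv B₃ f (conv B₄ f' f'') u) h2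
    (fun v w hv hw f'' => by simp [hv, hw]) (fun i' f' hf' => ?_) f'
  intro f''
  induction u using env_induction_right_homog h2 generalizing i i' f f' f'' with
  | one => simp [conv_one, hB]
  | add u v hu hv => simp [hu i f hf i' f' hf' f'', hv i f hf i' f' hf' f'']
  | smul c u hu => simp [hu i f hf i' f' hf' f'']
  | mul_ι j x hx u hu =>
    rw [← rmul_apply, ← rmul_apply, rmul_conv _ hx (conv_mem hB₂ hf hf'), rmul_conv _ hx hf,
      rmul_conv _ hx hf, rmul_conv _ hx hf']
    simp only [map_add, map_smul, LinearMap.add_apply, LinearMap.smul_apply,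
      hu _ _ (rmul_mem hx hf) _ _ hf', hu _ _ hf _ _ (rmul_mem hx hf'), hu _ _ hf _ _ hf',
      mul_add, sgn_add, smul_add, smul_smul]
    abel

theorem apply_one_eq_zero {f : Env k p g →ₗ[k] k} (hf : f ∈ homog k (Env k p g →ₗ[k] k) 1) :
    f 1 = 0 := by
  have h := apply_mem_homog hf env_one_mem
  rw [mem_homog, parity_field, add_zero, sgn_one, neg_smul, one_smul, eq_neg_iff_add_eq_zero,
    ← two_mul] at h
  exact (mul_eq_zero.mp h).resolve_left (two_ne_zero_of_char k p)

/-- The same induction as for associativity. At `1` the sign plays no role, since an odd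
scalar-valued map vanishes there. -/
theorem conv_comm {B : k ⊗[k] W →ₗ[k] U} {B' : W ⊗[k] k →ₗ[k] U}
    (hB : ∀ c w, B (c ⊗ₜ w) = B' (w ⊗ₜ c)) {i j : ZMod 2} {f : Env k p g →ₗ[k] k}
    {f' : Env k p g →ₗ[k] W} (hf : f ∈ homog k (Env k p g →ₗ[k] k) i)
    (hf' : f' ∈ homog k (Env k p g →ₗ[k] W) j) :
    conv B f f' = sgn k (i * j) • conv B' f' f := by
  have h2 := two_ne_zero_of_char k p
  ext u
  induction u using env_induction_right_homog h2 generalizing i j f f' with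
  | one =>
    rw [LinearMap.smul_apply, conv_one, conv_one, hB]
    rcases zmod_two_cases i with rfl | rfl
    · simp
    · simp [apply_one_eq_zero hf]
  | add u v hu hv => simp only [map_add, hu hf hf', hv hf hf']
  | smul c u hu => simp only [map_smul, hu hf hf']
  | mul_ι l x hx u hu =>
    rw [LinearMap.smul_apply, ← rmul_apply, ← rmul_apply, rmul_conv _ hx hf, rmul_conv _ hx hf',
      LinearMap.add_apply, LinearMap.smul_apply, hu (rmul_mem hx hf) hf', hu hf (rmul_mem hx hf'),
      LinearMap.add_apply, LinearMap.smul_apply, LinearMap.smul_apply, LinearMap.smul_apply,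
      smul_add, smul_smul, smul_smul, add_comm, add_mul, mul_add, sgn_add, sgn_add, ← mul_assoc,
      mul_comm i l, sgn_mul_self, one_mul]
    congr 2
    ring

/-- The counit as a linear map. -/
theorem rmul_counit (x : g) : rmul x (envCounit (k := k) (p := p) (g := g)).toLinearMap = 0 := by
  ext u
  simp [envCounit]

theorem counit_mem : (envCounit (k := k) (p := p) (g := g)).toLinearMap ∈
    homog k (Env k p g →ₗ[k] k) 0 := by
  rw [mem_homog, sgn_zero, one_smul]
  ext u
  simp only [parity_hom, parity_field]
  induction u using env_induction with
  | one => rw [parity_env_one]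
  | add u v hu hv => simp only [map_add, hu, hv]
  | smul c u hu => simp only [map_smul, hu]
  | ι_mul x u hu =>
    rw [parity_env_mul, parity_env_ι]
    simp [envCounit]

theorem conv_counit {B : k ⊗[k] W →ₗ[k] U} (f : Env k p g →ₗ[k] W) :
    conv B (envCounit (k := k) (p := p) (g := g)).toLinearMap f =
      B ∘ₗ TensorProduct.mk k k W 1 ∘ₗ f := by
  have h2 := two_ne_zero_of_char k p
  ext u
  induction u using env_induction_right_homog h2 generalizing f with
  | one => simp [conv_one]
  | add u v hu hv => simp only [map_add, hu, hv]
  | smul c u hu => simp only [map_smul, hu]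
  | mul_ι j x hx u hu =>
    rw [← rmul_apply, rmul_conv _ hx counit_mem, rmul_counit, map_zero, LinearMap.zero_apply,
      zero_add, mul_zero, sgn_zero, one_smul, hu]
    rfl

theorem parity_lid (t : k ⊗[k] W) : parity (k := k) ((TensorProduct.lid k W).toLinearMap t) =
    (TensorProduct.lid k W).toLinearMap (parity (k := k) t) := by
  induction t with
  | zero => simp
  | add a b ha hb => simp only [map_add, ha, hb]
  | tmul c w => simp

theorem parity_rid (t : W ⊗[k] k) : parity (k := k) ((TensorProduct.rid k W).toLinearMap t) =
    (TensorProduct.rid k W).toLinearMap (parity (k := k) t) := by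
  induction t with
  | zero => simp
  | add a b ha hb => simp only [map_add, ha, hb]
  | tmul c w => simp

theorem conv_lid_conv (B : V ⊗[k] W →ₗ[k] U) (a : Env k p g →ₗ[k] k) (f : Env k p g →ₗ[k] V)
    (f' : Env k p g →ₗ[k] W) :
    conv B (conv (TensorProduct.lid k V).toLinearMap a f) f' =
      conv (TensorProduct.lid k U).toLinearMap a (conv B f f') :=
  conv_assoc (fun c v w => by simp [← TensorProduct.smul_tmul']) parity_lid a f f'

theorem conv_conv_lid (B : V ⊗[k] W →ₗ[k] U) {i j : ZMod 2} {a : Env k p g →ₗ[k] k}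
    {f : Env k p g →ₗ[k] V} (ha : a ∈ homog k (Env k p g →ₗ[k] k) i)
    (hf : f ∈ homog k (Env k p g →ₗ[k] V) j) (f' : Env k p g →ₗ[k] W) :
    conv B f (conv (TensorProduct.lid k W).toLinearMap a f') =
      sgn k (i * j) • conv (TensorProduct.lid k U).toLinearMap a (conv B f f') := by
  rw [← conv_lid_conv, conv_comm (B' := (TensorProduct.rid k V).toLinearMap) (by simp) ha hf,
    map_smul, LinearMap.smul_apply, smul_smul, sgn_mul_self, one_smul]
  exact (conv_assoc (fun v c w => by simp [TensorProduct.smul_tmul']) parity_rid f a f').symm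

end ConvAlgebra

/-! ### The superalgebra `A`, its modules `Coind(ρ)` and the pairing with values in `A` -/

section CoindAlgebra

variable {k : Type*} {p : ℕ} {g : Type*} [Field k] [AddCommGroup g] [Module k g]
  [LieSuperalgebra k g] [RestrictedLieSuperalgebra k p g] {H : RestrictedSubalgebra k p g}
  {V W : Type*} [AddCommGroup V] [Module k V] [Superspace k V]
  [AddCommGroup W] [Module k W] [Superspace k W]
  {π : SuperAction k H.carrier V} {ρ : SuperAction k H.carrier W}

/-- The grading of the coinduced representation. -/
instance (ρ : SuperAction k H.carrier W) : Superspace k (Coind ρ) where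
  parity := (parity (k := k)).restrict fun _ => parity_mem_coind
  parity_parity f := Subtype.ext (show parity (k := k) (parity (k := k) f.1) = f.1 from parity_parity _)

theorem isHomog_iff {f : Coind ρ} {i : ZMod 2} : IsHomog f i ↔ f ∈ homog k (Coind ρ) i := by
  rw [IsHomog, mem_homog, mem_homog, Subtype.ext_iff]
  rfl

theorem isHomog_smul {i j : ZMod 2} {x : g} (hx : x ∈ homog k g j) {f : Coind ρ}
    (hf : IsHomog f i) : IsHomog (envι k p x • f) (j + i) :=
  rmul_mem hx hf

theorem IsHomog.smul {i : ZMod 2} {f : Coind ρ} (c : k) (hf : IsHomog f i) :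
    IsHomog (c • f) i := Submodule.smul_mem _ _ hf

theorem IsHomog.sum {ι : Type*} {i : ZMod 2} {s : Finset ι} {f : ι → Coind ρ}
    (hf : ∀ j ∈ s, IsHomog (f j) i) : IsHomog (∑ j ∈ s, f j) i := by
  rw [isHomog_iff]
  exact Submodule.sum_mem _ fun j hj => isHomog_iff.mp (hf j hj)

variable [Fact p.Prime] [CharP k p] [Fact (2 < p)]

theorem coind_homog_induction {P : Coind ρ → Prop} (add : ∀ f f', P f → P f' → P (f + f'))
    (mem : ∀ i f, IsHomog f i → P f) (f : Coind ρ) : P f :=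
  homog_induction (two_ne_zero_of_char k p) add (fun i f hf => mem i f (isHomog_iff.mpr hf)) f

theorem coe_cup (f : Coind π) (f' : Coind ρ) : (cup f f').1 = conv LinearMap.id f.1 f'.1 := rfl

theorem coe_smulA (a : Coind (trivAct k H.carrier)) (f : Coind ρ) :
    (smulA a f).1 = conv (TensorProduct.lid k W).toLinearMap a.1 f.1 := rfl

/-- The product on coinduced representations as a bilinear map. -/
def cupₗ (π : SuperAction k H.carrier V) (ρ : SuperAction k H.carrier W) :
    Coind π →ₗ[k] Coind ρ →ₗ[k] Coind (tensorAct π ρ) :=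
  LinearMap.mk₂ k cup
    (fun f f₁ f' => Subtype.ext (by simp [coe_cup])) (fun c f f' => Subtype.ext (by simp [coe_cup]))
    (fun f f' f₁ => Subtype.ext (by simp [coe_cup])) (fun c f f' => Subtype.ext (by simp [coe_cup]))

@[simp] theorem cupₗ_apply (f : Coind π) (f' : Coind ρ) : cupₗ π ρ f f' = cup f f' := rfl

/-- The action of `A` on coinduced representations as a bilinear map. -/
def smulAₗ (ρ : SuperAction k H.carrier W) :
    Coind (trivAct k H.carrier) →ₗ[k] Coind ρ →ₗ[k] Coind ρ :=
  LinearMap.mk₂ k smulA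
    (fun f f₁ f' => Subtype.ext (by simp [coe_smulA]))
    (fun c f f' => Subtype.ext (by simp [coe_smulA]))
    (fun f f' f₁ => Subtype.ext (by simp [coe_smulA]))
    (fun c f f' => Subtype.ext (by simp [coe_smulA]))

@[simp] theorem smulAₗ_apply (a : Coind (trivAct k H.carrier)) (f : Coind ρ) :
    smulAₗ ρ a f = smulA a f := rfl

variable (a b : Coind (trivAct k H.carrier)) (f f₁ : Coind ρ) (c : k)

theorem smulA_add : smulA a (f + f₁) = smulA a f + smulA a f₁ := map_add (smulAₗ ρ a) _ _

theorem add_smulA : smulA (a + b) f = smulA a f + smulA b f :=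
  LinearMap.map_add₂ (smulAₗ ρ) _ _ _

theorem smulA_smul : smulA a (c • f) = c • smulA a f := map_smul (smulAₗ ρ a) _ _

theorem smul_smulA : smulA (c • a) f = c • smulA a f := LinearMap.map_smul₂ (smulAₗ ρ) _ _ _

@[simp] theorem smulA_zero : smulA a (0 : Coind ρ) = 0 := map_zero (smulAₗ ρ a)

@[simp] theorem zero_smulA : smulA 0 f = 0 := LinearMap.map_zero₂ (smulAₗ ρ) _

theorem neg_smulA : smulA (-a) f = -smulA a f := by
  exact eq_neg_of_add_eq_zero_left
    ((add_smulA _ _ _).symm.trans ((congrArg (smulA · f) (neg_add_cancel a)).trans (zero_smulA f)))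

theorem smulA_sub : smulA a (f - f₁) = smulA a f - smulA a f₁ := map_sub (smulAₗ ρ a) _ _

theorem smulA_sum {ι : Type*} (s : Finset ι) (f : ι → Coind ρ) :
    smulA a (∑ j ∈ s, f j) = ∑ j ∈ s, smulA a (f j) := map_sum (smulAₗ ρ a) _ _

theorem sum_smulA {ι : Type*} (s : Finset ι) (a : ι → Coind (trivAct k H.carrier)) :
    smulA (∑ j ∈ s, a j) f = ∑ j ∈ s, smulA (a j) f := by
  simp only [← smulAₗ_apply, map_sum, LinearMap.sum_apply]

theorem smulA_one_apply : (smulA a f).1 1 = a.1 1 • f.1 1 := by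
  rw [coe_smulA, conv_one]; simp

theorem cup_one_apply (f : Coind π) (f' : Coind ρ) : (cup f f').1 1 = f.1 1 ⊗ₜ f'.1 1 := by
  rw [coe_cup, conv_one]; simp

theorem smulA_assoc : smulA (smulA a b) f = smulA a (smulA b f) :=
  Subtype.ext (conv_lid_conv _ a.1 b.1 f.1)

variable (H) in
theorem oneA_mem : IsHomog (oneA H) 0 := counit_mem

@[simp] theorem oneA_smulA : smulA (oneA H) f = f := Subtype.ext (by
  ext u
  rw [coe_smulA, oneA, conv_counit]
  simp)

@[simp] theorem oneA_apply_one : (oneA H).1 1 = 1 := map_one envCounit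

@[simp] theorem ι_smul_oneA (x : g) : envι k p x • oneA H = 0 := Subtype.ext (rmul_counit x)

variable {a b f} {i j l : ZMod 2}

theorem smulA_mem (ha : IsHomog a i) (hf : IsHomog f j) : IsHomog (smulA a f) (i + j) :=
  conv_mem parity_lid ha hf

theorem cup_mem {f : Coind π} {f' : Coind ρ} (hf : IsHomog f i) (hf' : IsHomog f' j) :
    IsHomog (cup f f') (i + j) :=
  conv_mem (B := LinearMap.id) (fun _ => rfl) hf hf'

theorem smulA_comm (ha : IsHomog a i) (hb : IsHomog b j) :
    smulA a b = sgn k (i * j) • smulA b a :=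
  Subtype.ext (conv_comm (fun c d => by simp [mul_comm]) ha hb)

@[simp] theorem smulA_oneA (a : Coind (trivAct k H.carrier)) : smulA a (oneA H) = a := by
  refine coind_homog_induction (P := fun a => smulA a (oneA H) = a) (fun a b ha hb => ?_)
    (fun i a ha => ?_) a
  · rw [add_smulA, ha, hb]
  · rw [smulA_comm ha (oneA_mem H), mul_zero, sgn_zero, one_smul, oneA_smulA]

theorem smulA_left_comm (ha : IsHomog a i) (hb : IsHomog b j) (f : Coind ρ) :
    smulA a (smulA b f) = sgn k (i * j) • smulA b (smulA a f) := by
  rw [← smulA_assoc, smulA_comm ha hb, smul_smulA, smulA_assoc]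

theorem ι_smul_smulA {x : g} (hx : x ∈ homog k g j) (ha : IsHomog a i) (f : Coind ρ) :
    envι k p x • smulA a f = smulA (envι k p x • a) f + sgn k (j * i) • smulA a (envι k p x • f) :=
  Subtype.ext (rmul_conv _ hx ha f.1)

theorem ι_smul_cup {x : g} (hx : x ∈ homog k g j) {f : Coind π} (hf : IsHomog f i) (f' : Coind ρ) :
    envι k p x • cup f f' = cup (envι k p x • f) f' + sgn k (j * i) • cup f (envι k p x • f') :=
  Subtype.ext (rmul_conv LinearMap.id hx hf f'.1)

theorem cup_smulA_left (a : Coind (trivAct k H.carrier)) (f : Coind π) (f' : Coind ρ) :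
    cup (smulA a f) f' = smulA a (cup f f') :=
  Subtype.ext (conv_lid_conv LinearMap.id a.1 f.1 f'.1)

theorem cup_smulA_right (ha : IsHomog a i) {f : Coind π} (hf : IsHomog f j) (f' : Coind ρ) :
    cup f (smulA a f') = sgn k (i * j) • smulA a (cup f f') :=
  Subtype.ext (conv_conv_lid LinearMap.id ha hf f'.1)

/-- The contraction `v ⊗ v* ↦ (-1)^{|v|} v*(v)`. -/
def contract (k V : Type*) [Field k] [AddCommGroup V] [Module k V] [Superspace k V] :
    V ⊗[k] Module.Dual k V →ₗ[k] k :=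
  TensorProduct.lift (LinearMap.flip (LinearMap.lcomp k k (parity (k := k))))

@[simp] theorem contract_tmul (v : V) (v' : Module.Dual k V) :
    contract k V (v ⊗ₜ v') = v' (parity (k := k) v) := rfl

theorem contract_parity (t : V ⊗[k] Module.Dual k V) :
    parity (k := k) (contract k V t) = contract k V (parity (k := k) t) := by
  induction t with
  | zero => simp
  | add a b ha hb => simp only [map_add, ha, hb]
  | tmul c w => simp

/-- The pairing `Coind(π) × Coind(π*) → A`. -/
def coindPair (f : Coind π) (f' : Coind (dualAct π)) : Coind (trivAct k H.carrier) :=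
  coindMap (contract k V) (fun x t => by
    have h2 := two_ne_zero_of_char k p
    induction t with
    | zero => simp
    | add a b ha hb => simp only [map_add, ha, hb]
    | tmul v v' =>
      have h1 : parity (k := k) (proj (k := k) 1 x) = -proj (k := k) 1 x := by
        have := mem_homog.mp (proj_mem (k := k) 1 x)
        simpa using this
      have h0 : parity (k := k) (proj (k := k) 0 x) = proj (k := k) 0 x := by
        have := mem_homog.mp (proj_mem (k := k) 0 x)
        simpa using this
      have hx := proj_add_proj h2 x
      conv_lhs => rw [← hx]
      simp [tensorAct, trivAct, dualAct, π.parity_act, h0, h1, proj_of_mem h2 (proj_mem (k := k) 0 x),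
        proj_of_mem h2 (proj_mem (k := k) 1 x)]) (cup f f')

theorem coe_coindPair (f : Coind π) (f' : Coind (dualAct π)) :
    (coindPair f f').1 = conv (contract k V) f.1 f'.1 := rfl

/-- The pairing of `Coind(π)` and `Coind(π*)` as a bilinear map. -/
def coindPairₗ (π : SuperAction k H.carrier V) :
    Coind π →ₗ[k] Coind (dualAct π) →ₗ[k] Coind (trivAct k H.carrier) :=
  LinearMap.mk₂ k coindPair
    (fun f f₁ f' => Subtype.ext (by simp [coe_coindPair]))
    (fun c f f' => Subtype.ext (by simp [coe_coindPair]))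
    (fun f f' f₁ => Subtype.ext (by simp [coe_coindPair]))
    (fun c f f' => Subtype.ext (by simp [coe_coindPair]))

@[simp] theorem coindPairₗ_apply (f : Coind π) (f' : Coind (dualAct π)) :
    coindPairₗ π f f' = coindPair f f' := rfl

theorem coindPair_mem {f : Coind π} {f' : Coind (dualAct π)} (hf : IsHomog f i)
    (hf' : IsHomog f' j) : IsHomog (coindPair f f') (i + j) :=
  conv_mem contract_parity hf hf'

theorem ι_smul_coindPair {x : g} (hx : x ∈ homog k g j) {f : Coind π} (hf : IsHomog f i)
    (f' : Coind (dualAct π)) : envι k p x • coindPair f f' =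
      coindPair (envι k p x • f) f' + sgn k (j * i) • coindPair f (envι k p x • f') :=
  Subtype.ext (rmul_conv _ hx hf f'.1)

theorem coindPair_smulA_left (a : Coind (trivAct k H.carrier)) (f : Coind π)
    (f' : Coind (dualAct π)) : coindPair (smulA a f) f' = smulA a (coindPair f f') :=
  Subtype.ext (conv_lid_conv _ a.1 f.1 f'.1)

theorem coindPair_smulA_right (ha : IsHomog a i) {f : Coind π} (hf : IsHomog f j)
    (f' : Coind (dualAct π)) :
    coindPair f (smulA a f') = sgn k (i * j) • smulA a (coindPair f f') :=
  Subtype.ext (conv_conv_lid _ ha hf f'.1)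

end CoindAlgebra

/-! ### A triangularity criterion -/

section Triangular

/-- The hypothesis says that `T` is triangular for the degree with `τ` on the diagonal. As `W` may
have infinite dimension, injectivity and surjectivity are proved separately, each degree by degree.
-/
theorem bijective_of_triangular {k X W W' : Type*} [Field k] [AddCommGroup W] [Module k W]
    [AddCommGroup W'] [Module k W'] [Finite X] (T : (X → W) →ₗ[k] (X → W')) (deg : X → ℕ)
    (τ : W →ₗ[k] W') (hτ : Function.Bijective τ)
    (h : ∀ c x, (∀ y, deg y < deg x → c y = 0) → T c x = τ (c x)) : Function.Bijective T := by
  constructor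
  · rw [← LinearMap.ker_eq_bot, LinearMap.ker_eq_bot']
    intro c hc
    have key : ∀ N, ∀ x, deg x < N → c x = 0 := by
      intro N
      induction N with
      | zero => intro x hx; omega
      | succ N ih =>
        intro x hx
        refine hτ.1 ?_
        rw [map_zero, ← h c x fun y hy => ih y (by omega), hc]
        rfl
    exact funext fun x => key _ x (Nat.lt_succ_self _)
  · intro b
    have key : ∀ N, ∃ c, ∀ x, deg x < N → T c x = b x := by
      intro N
      induction N with
      | zero => exact ⟨0, fun x hx => by omega⟩
      | succ N ih =>
        classical
        obtain ⟨c₀, h₀⟩ := ih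
        choose r hr using fun x => hτ.2 ((b - T c₀) x)
        let c₁ : X → W := fun x => if deg x = N then r x else 0
        refine ⟨c₀ + c₁, fun x hx => ?_⟩
        have h₁ : T c₁ x = τ (c₁ x) := h c₁ x fun y hy => if_neg (by omega)
        rw [map_add, Pi.add_apply, h₁]
        by_cases hN : deg x = N
        · simp [c₁, hN, hr]
        · simp [c₁, hN, h₀ x (by omega)]
    obtain ⟨N, hN⟩ : ∃ N, ∀ x, deg x < N := by
      obtain ⟨M, hM⟩ := (Set.finite_range deg).bddAbove
      exact ⟨M + 1, fun x => Nat.lt_succ_of_le (hM ⟨x, rfl⟩)⟩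
    obtain ⟨c, hc⟩ := key N
    exact ⟨c, funext fun x => hc x (hN x)⟩

end Triangular

/-! ### Values of products on words -/

section Words

variable {k : Type*} {p : ℕ} {g : Type*} [Field k] [AddCommGroup g] [Module k g]
  [LieSuperalgebra k g] [RestrictedLieSuperalgebra k p g]
  {V W U : Type*} [AddCommGroup V] [Module k V] [Superspace k V]
  [AddCommGroup W] [Module k W] [Superspace k W]
  [AddCommGroup U] [Module k U] [Superspace k U]
  {I : Type*} {y : I → g} {d : I → ZMod 2}

theorem envWord_mem (hy : ∀ j, y j ∈ homog k g (d j)) (l : List I) :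
    envWord p y l ∈ homog k (Env k p g) (l.map d).sum := by
  induction l with
  | nil => exact env_one_mem
  | cons j l ih =>
    rw [envWord_cons, List.map_cons, List.sum_cons]
    exact env_mul_mem (envι_mem (hy j)) ih

theorem envWord_concat (l : List I) (j : I) :
    envWord (k := k) p y (l ++ [j]) = envWord p y l * envι k p (y j) := by
  rw [envWord_append, envWord_cons, envWord_nil, mul_one]

theorem rmul_envWord (f : Env k p g →ₗ[k] V) (l : List I) (j : I) :
    rmul (y j) f (envWord p y l) = f (envWord p y (l ++ [j])) := by
  rw [envWord_concat, rmul_apply]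

theorem proj_apply_eq_zero (f : Env k p g →ₗ[k] V) {j : ZMod 2} {u : Env k p g}
    (hu : u ∈ homog k (Env k p g) j) (hf : f u = 0) (i : ZMod 2) : proj (k := k) i f u = 0 := by
  rw [mem_homog] at hu
  simp [proj, hu, hf]

variable [Fact p.Prime] [CharP k p] [Fact (2 < p)] (B : V ⊗[k] W →ₗ[k] U)

theorem conv_envWord_concat (hy : ∀ j, y j ∈ homog k g (d j)) {i : ZMod 2} {f : Env k p g →ₗ[k] V}
    (hf : f ∈ homog k (Env k p g →ₗ[k] V) i) (f' : Env k p g →ₗ[k] W) (l : List I) (j : I) :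
    conv B f f' (envWord p y (l ++ [j])) = conv B (rmul (y j) f) f' (envWord p y l) +
      sgn k (d j * i) • conv B f (rmul (y j) f') (envWord p y l) := by
  rw [← rmul_envWord, rmul_conv _ (hy j) hf]
  rfl

/-- Up to signs the coproduct of a word is the sum over its splittings into two complementary
subwords, and each summand vanishes by hypothesis. -/
theorem conv_envWord_eq_zero (hy : ∀ j, y j ∈ homog k g (d j)) (f : Env k p g →ₗ[k] V) (f' : Env k p g →ₗ[k] W) (l : List I)
    (h : ∀ l₁ l₂, l₁.Sublist l → l₂.Sublist l → l₁.length + l₂.length = l.length →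
      f (envWord p y l₁) = 0 ∨ f' (envWord p y l₂) = 0) :
    conv B f f' (envWord p y l) = 0 := by
  have h2 := two_ne_zero_of_char k p
  suffices key : ∀ i, ∀ f ∈ homog k (Env k p g →ₗ[k] V) i, (∀ l₁ l₂ : List I, l₁.Sublist l →
      l₂.Sublist l → l₁.length + l₂.length = l.length → f (envWord p y l₁) = 0 ∨
        f' (envWord p y l₂) = 0) → conv B f f' (envWord p y l) = 0 by
    have hp : ∀ i, conv B (proj (k := k) i f) f' (envWord p y l) = 0 := fun i =>
      key i _ (proj_mem i f) fun l₁ l₂ h₁ h₂ h₃ => (h l₁ l₂ h₁ h₂ h₃).imp_left fun h0 =>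
        proj_apply_eq_zero f (envWord_mem hy l₁) h0 i
    rw [← proj_add_proj h2 f, map_add, LinearMap.add_apply, LinearMap.add_apply, hp, hp, add_zero]
  clear h
  induction l using List.reverseRecOn generalizing f f' with
  | nil =>
    intro i f hf h
    rw [envWord_nil, conv_one]
    rcases h [] [] (List.Sublist.refl _) (List.Sublist.refl _) rfl with h | h <;>
    · rw [envWord_nil] at h
      simp [h]
  | append_singleton t j ih =>
    intro i f hf h
    rw [conv_envWord_concat B hy hf, ih 0 _ _ _ (rmul_mem (hy j) hf), ih 0 _ _ _ hf, smul_zero,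
      add_zero]
    · intro l₁ l₂ h₁ h₂ h₃
      rw [rmul_envWord]
      exact h _ _ (h₁.trans (List.sublist_append_left _ _)) (h₂.append (List.Sublist.refl _))
        (by simp; omega)
    · intro l₁ l₂ h₁ h₂ h₃
      rw [rmul_envWord]
      exact h _ _ (h₁.append (List.Sublist.refl _)) (h₂.trans (List.sublist_append_left _ _))
        (by simp; omega)

/-- Of all splittings, only the one that gives the whole word to `f` contributes. -/
theorem conv_envWord_eq_left (hy : ∀ j, y j ∈ homog k g (d j)) (f : Env k p g →ₗ[k] V) (f' : Env k p g →ₗ[k] W) (l : List I)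
    (h : ∀ l₁, l₁.Sublist l → l₁.length < l.length → f (envWord p y l₁) = 0) :
    conv B f f' (envWord p y l) = B (f (envWord p y l) ⊗ₜ f' 1) := by
  have h2 := two_ne_zero_of_char k p
  suffices key : ∀ i, ∀ f ∈ homog k (Env k p g →ₗ[k] V) i, (∀ l₁, l₁.Sublist l →
      l₁.length < l.length → f (envWord p y l₁) = 0) →
      conv B f f' (envWord p y l) = B (f (envWord p y l) ⊗ₜ f' 1) by
    have hp : ∀ i, conv B (proj (k := k) i f) f' (envWord p y l) =
        B (proj (k := k) i f (envWord p y l) ⊗ₜ f' 1) := fun i =>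
      key i _ (proj_mem i f) fun l₁ h₁ h₂ =>
        proj_apply_eq_zero f (envWord_mem hy l₁) (h l₁ h₁ h₂) i
    rw [← proj_add_proj h2 f, map_add, LinearMap.add_apply, LinearMap.add_apply, hp, hp,
      LinearMap.add_apply, TensorProduct.add_tmul, map_add]
  clear h
  induction l using List.reverseRecOn generalizing f f' with
  | nil =>
    intro i f hf h
    rw [envWord_nil, conv_one]
  | append_singleton t j ih =>
    intro i f hf h
    rw [conv_envWord_concat B hy hf, ih 0 _ _ _ (rmul_mem (hy j) hf),
      conv_envWord_eq_zero B hy f _ t, smul_zero, add_zero, rmul_envWord]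
    · intro l₁ l₂ h₁ h₂ h₃
      refine Or.inl (h _ (h₁.trans (List.sublist_append_left _ _)) ?_)
      have := h₁.length_le
      simp
      omega
    · intro l₁ h₁ h₂
      rw [rmul_envWord]
      exact h _ (h₁.append (List.Sublist.refl _)) (by simpa using h₂)

/-- Like the counit, `f` vanishes on all nonempty subwords, so only the splitting that gives the
whole word to `f'` contributes. -/
theorem conv_envWord_eq_right (hy : ∀ j, y j ∈ homog k g (d j)) {f : Env k p g →ₗ[k] V} (hf : f ∈ homog k (Env k p g →ₗ[k] V) 0)
    (f' : Env k p g →ₗ[k] W) (l : List I)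
    (h : ∀ l₁, l₁.Sublist l → l₁ ≠ [] → f (envWord p y l₁) = 0) :
    conv B f f' (envWord p y l) = B (f 1 ⊗ₜ f' (envWord p y l)) := by
  induction l using List.reverseRecOn generalizing f' with
  | nil => rw [envWord_nil, conv_one]
  | append_singleton t j ih =>
    rw [conv_envWord_concat B hy hf, ih _ fun l₁ h₁ h₂ =>
      h l₁ (h₁.trans (List.sublist_append_left _ _)) h₂, conv_envWord_eq_zero B hy _ _ t, zero_add,
      mul_zero, sgn_zero, one_smul, rmul_envWord]
    intro l₁ l₂ h₁ h₂ h₃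
    rw [rmul_envWord]
    exact Or.inl (h _ (h₁.append (List.Sublist.refl _)) (by simp))

/-- Here `f` behaves like the coordinate of the letter `j`, so only splittings that give it a single
`j` contribute. In an ordered word all of them leave the same word. The constant `κ` is the
multiplicity of an even letter and a sign for an odd one; it depends neither on `f` nor on `f'`. -/
theorem conv_envWord_coordinate (hy : ∀ j, y j ∈ homog k g (d j)) [BEq I] [LawfulBEq I] {r : I → I → Prop}
    (hr : ∀ a b, r a b → r b a → a = b) (j : I) (l : List I) (hl : l.Pairwise r)
    (hodd : d j ≠ 0 → l.count j ≤ 1) :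
    ∃ κ : k, (d j = 0 → κ = (l.count j : k)) ∧ (d j ≠ 0 → κ = 1 ∨ κ = -1) ∧
      ∀ f ∈ homog k (Env k p g →ₗ[k] k) (d j),
        (∀ l₁, l₁.Sublist l → (l₁ = [j] → f (envWord p y l₁) = 1) ∧
          (l₁ ≠ [j] → f (envWord p y l₁) = 0)) →
        ∀ f' : Env k p g →ₗ[k] W, conv (TensorProduct.lid k W).toLinearMap f f' (envWord p y l) =
          if j ∈ l then κ • f' (envWord p y (l.erase j)) else 0 := by
  have two : ∀ a : ZMod 2, a + a = 0 := by decide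
  induction l using List.reverseRecOn with
  | nil =>
    by_cases h0 : d j = 0
    · refine ⟨0, fun _ => by simp, fun h => (h h0).elim, fun f hf h f' => ?_⟩
      have := (h [] (List.Sublist.refl _)).2 (by simp)
      rw [envWord_nil] at this
      simp [conv_one, this]
    · refine ⟨1, fun h => (h0 h).elim, fun _ => Or.inl rfl, fun f hf h f' => ?_⟩
      have := (h [] (List.Sublist.refl _)).2 (by simp)
      rw [envWord_nil] at this
      simp [conv_one, this]
  | append_singleton t x ih =>
    have ht : t.Pairwise r := (List.pairwise_append.mp hl).1
    obtain ⟨κ, h0, h1, hκ⟩ := ih ht fun h => by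
      have := hodd h
      rw [List.count_append] at this
      omega
    have hsub : ∀ {l₁ : List I}, l₁.Sublist t → l₁.Sublist (t ++ [x]) := fun h =>
      h.trans (List.sublist_append_left _ _)
    by_cases hx : x = j
    · subst hx
      have hfirst : ∀ f ∈ homog k (Env k p g →ₗ[k] k) (d x),
          (∀ l₁, l₁.Sublist (t ++ [x]) → (l₁ = [x] → f (envWord p y l₁) = 1) ∧
            (l₁ ≠ [x] → f (envWord p y l₁) = 0)) →
          ∀ f' : Env k p g →ₗ[k] W, conv (TensorProduct.lid k W).toLinearMap (rmul (y x) f) f'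
            (envWord p y t) = f' (envWord p y t) := by
        intro f hf h f'
        rw [conv_envWord_eq_right _ hy (by simpa [two] using rmul_mem (hy x) hf)]
        · have := (h [x] (List.sublist_append_right _ _)).1 rfl
          rw [← List.nil_append [x], ← rmul_envWord, envWord_nil] at this
          simp [this]
        · intro l₁ h₁ h₂
          rw [rmul_envWord, (h _ (h₁.append (List.Sublist.refl _))).2]
          intro h
          have := congrArg List.length h
          simp at this
          exact h₂ this
      by_cases hd : d x = 0
      · refine ⟨κ + 1, fun _ => by simp [h0 hd], fun h => (h hd).elim, fun f hf h f' => ?_⟩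
        rw [conv_envWord_concat _ hy hf, hfirst f hf h, hκ f hf (fun l₁ h₁ => h l₁ (hsub h₁)),
          if_pos (by simp : x ∈ t ++ [x]), hd, mul_zero, sgn_zero, one_smul]
        by_cases hm : x ∈ t
        · have he : t.erase x ++ [x] = t := by
            refine List.Perm.eq_of_pairwise (le := r) (fun a b _ _ => hr a b)
              (hl.sublist (List.Sublist.append List.erase_sublist (List.Sublist.refl _))) ht ?_
            exact List.perm_append_comm.trans (List.perm_cons_erase hm).symm
          rw [if_pos hm, List.erase_append_left _ hm, rmul_envWord, he, add_smul, one_smul, add_comm]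
        · rw [if_neg hm, List.erase_append_right _ hm, add_zero, h0 hd,
            List.count_eq_zero_of_not_mem hm]
          simp
      · have hm : x ∉ t := fun hm => by
          have h3 := hodd hd
          have h4 := List.count_pos_iff.mpr hm
          rw [List.count_append, List.count_singleton_self] at h3
          omega
        refine ⟨1, fun h => (hd h).elim, fun _ => Or.inl rfl, fun f hf h f' => ?_⟩
        rw [conv_envWord_concat _ hy hf, hfirst f hf h, hκ f hf (fun l₁ h₁ => h l₁ (hsub h₁)),
          if_pos (by simp : x ∈ t ++ [x]), if_neg hm, List.erase_append_right _ hm]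
        simp
    · refine ⟨sgn k (d x * d j) * κ, fun h => ?_, fun h => ?_, fun f hf h f' => ?_⟩
      · rw [h0 h, h, List.count_append, List.count_singleton, beq_false_of_ne hx]
        simp
      · rcases zmod_two_cases (d x * d j) with h5 | h5 <;> rcases h1 h with h6 | h6 <;>
          simp [h5, h6]
      · rw [conv_envWord_concat _ hy hf, conv_envWord_eq_zero _ hy _ _ t, zero_add,
          hκ f hf (fun l₁ h₁ => h l₁ (hsub h₁))]
        · have hmem : j ∈ t ++ [x] ↔ j ∈ t := by simp [Ne.symm hx]
          by_cases hm : j ∈ t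
          · rw [if_pos hm, if_pos (hmem.mpr hm), List.erase_append_left _ hm, rmul_envWord, smul_smul]
          · rw [if_neg hm, if_neg (mt hmem.mp hm), smul_zero]
        · intro l₁ l₂ h₁ h₂ h₃
          rw [rmul_envWord, (h _ (h₁.append (List.Sublist.refl _))).2]
          · exact Or.inl rfl
          · intro h
            have h7 := congrArg List.getLast? h
            simp at h7
            exact hx h7

end Words

/-! ### Coordinates and their products -/

section FrameWords

attribute [local instance] lawfulBEq_sum

variable {k : Type*} {p : ℕ} {g : Type*} [Field k] [AddCommGroup g] [Module k g]
  [LieSuperalgebra k g] [RestrictedLieSuperalgebra k p g] {H : RestrictedSubalgebra k p g}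
  {V W : Type*} [AddCommGroup V] [Module k V] [Superspace k V]
  [AddCommGroup W] [Module k W] [Superspace k W]
  {π : SuperAction k H.carrier V} {ρ : SuperAction k H.carrier W} {n m : ℕ}

/-- The order of the indices of a frame. -/
def frameLE (i j : Fin n ⊕ Fin m) : Prop := toLex i ≤ toLex j

theorem frameLE_antisymm (i j : Fin n ⊕ Fin m) (h : frameLE i j) (h' : frameLE j i) : i = j :=
  toLex.injective (le_antisymm h h')

/-- The ordered words with exponents in `[0, p-1]^n × {0, 1}^m`. -/
def IsFrameWord (p : ℕ) (l : List (Fin n ⊕ Fin m)) : Prop :=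
  l.Pairwise frameLE ∧ ∀ j, l.count j < if frameDeg n m j = 0 then p else 2

theorem IsFrameWord.sublist {l l' : List (Fin n ⊕ Fin m)} (hl : IsFrameWord p l)
    (h : l'.Sublist l) : IsFrameWord p l' :=
  ⟨hl.1.sublist h, fun j => (h.count_le j).trans_lt (hl.2 j)⟩

theorem IsFrameWord.eq_of_perm {l l' : List (Fin n ⊕ Fin m)} (hl : IsFrameWord p l)
    (hl' : IsFrameWord p l') (h : l.Perm l') : l = l' :=
  List.Perm.eq_of_pairwise (fun a b _ _ => frameLE_antisymm a b) hl.1 hl'.1 h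

theorem isFrameWord_iff {l : List (Fin n ⊕ Fin m)} :
    IsFrameWord p l ↔ ∃ x : Expo p n m, l = indexWord x := by
  have hp : ∀ l : List (Fin n ⊕ Fin m), l.Pairwise frameLE ↔
      (l.map (lexIndex (Bh := Empty))).Pairwise (· ≤ ·) := fun l => by
    rw [List.pairwise_map]
    exact ⟨fun h => h.imp fun h => Sum.Lex.inr_le_inr_iff.mpr h,
      fun h => h.imp fun h => Sum.Lex.inr_le_inr_iff.mp h⟩
  constructor
  · rintro ⟨h1, h2⟩
    refine ⟨(fun i => ⟨l.count (Sum.inl i), by simpa [frameDeg] using h2 (Sum.inl i)⟩,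
      fun s => ⟨l.count (Sum.inr s), by simpa [frameDeg] using h2 (Sum.inr s)⟩), ?_⟩
    exact eq_orderedList_of_pairwise l ((hp l).mp h1)
  · rintro ⟨x, rfl⟩
    refine ⟨(hp _).mpr (pairwise_lexIndex _ _), ?_⟩
    rintro (i | s)
    · rw [indexWord, count_inl_orderedList]; simp [frameDeg]
    · rw [indexWord, count_inr_orderedList]; simpa [frameDeg] using (x.2 s).2

theorem isFrameWord_indexWord (x : Expo p n m) : IsFrameWord p (indexWord x) :=
  isFrameWord_iff.mpr ⟨x, rfl⟩

variable [Fact p.Prime]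

theorem isFrameWord_nil : IsFrameWord p ([] : List (Fin n ⊕ Fin m)) :=
  ⟨List.Pairwise.nil, fun j => by
    have := (Fact.out : p.Prime).pos
    split_ifs <;> simp [this]⟩

theorem isFrameWord_singleton (j : Fin n ⊕ Fin m) : IsFrameWord p [j] :=
  ⟨List.pairwise_singleton _ _, fun i => by
    have := (Fact.out : p.Prime).one_lt
    have h1 : List.count i [j] ≤ 1 := List.count_le_length
    split_ifs <;> omega⟩

theorem indexWord_zero : indexWord (0 : Expo p n m) = [] := by
  simp [indexWord, orderedList]

theorem indexWord_eq_nil {x : Expo p n m} : indexWord x = [] ↔ x = 0 :=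
  ⟨fun h => indexWord_injective (h.trans indexWord_zero.symm), fun h => h ▸ indexWord_zero⟩

theorem indexWord_single_inl (i : Fin n) :
    indexWord ((Pi.single i 1, 0) : Expo p n m) = [Sum.inl i] := by
  have hp := (Fact.out : p.Prime).one_lt
  obtain ⟨x, hx⟩ := isFrameWord_iff.mp (isFrameWord_singleton (p := p) (Sum.inl i : Fin n ⊕ Fin m))
  rw [hx]
  congr 1
  symm
  refine Prod.ext (funext fun i' => Fin.ext ?_) (funext fun s => Fin.ext ?_)
  · have := congrArg (List.count (Sum.inl i')) hx
    rw [indexWord, count_inl_orderedList] at this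
    rw [← this]
    by_cases h : i' = i
    · subst h; simp [Nat.mod_eq_of_lt hp]
    · simp [h, Ne.symm h]
  · have := congrArg (List.count (Sum.inr s)) hx
    rw [indexWord, count_inr_orderedList] at this
    rw [← this]
    simp

theorem indexWord_single_inr (s : Fin m) :
    indexWord ((0, Pi.single s 1) : Expo p n m) = [Sum.inr s] := by
  obtain ⟨x, hx⟩ := isFrameWord_iff.mp (isFrameWord_singleton (p := p) (Sum.inr s : Fin n ⊕ Fin m))
  rw [hx]
  congr 1
  symm
  refine Prod.ext (funext fun i => Fin.ext ?_) (funext fun s' => Fin.ext ?_)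
  · have := congrArg (List.count (Sum.inl i)) hx
    rw [indexWord, count_inl_orderedList] at this
    rw [← this]
    simp
  · have := congrArg (List.count (Sum.inr s')) hx
    rw [indexWord, count_inr_orderedList] at this
    rw [← this]
    by_cases h : s' = s
    · subst h; simp
    · simp [h, Ne.symm h]

variable [CharP k p] [Fact (2 < p)] (F : Frame H n m)

theorem coind_ext {f f' : Coind ρ}
    (h : ∀ l, IsFrameWord p l → f.1 (envWord p F.vec l) = f'.1 (envWord p F.vec l)) : f = f' :=
  evalPBW_injective F ρ (funext fun x => by
    rw [evalPBW_apply, evalPBW_apply, h _ (isFrameWord_indexWord x)])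

theorem isHomog_of_words {f : Coind ρ} {i : ZMod 2} (h : ∀ l, IsFrameWord p l →
    f.1 (envWord p F.vec l) ∈ homog k W (i + (l.map (frameDeg n m)).sum)) : IsHomog f i := by
  rw [isHomog_iff, mem_homog]
  refine coind_ext F fun l hl => ?_
  have h1 := h l hl
  have h2 := envWord_mem (p := p) F.vec_mem l
  rw [mem_homog] at h1 h2
  change parity (k := k) (f.1 (parity (k := k) (envWord p F.vec l))) = sgn k i • f.1 _
  rw [h2, map_smul, map_smul, h1, smul_smul, sgn_add, mul_left_comm, sgn_mul_self, mul_one]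

theorem evalPBW_ofPBW (hρ : ρ.IsRestricted p) (c : Expo p n m → W) (x : Expo p n m) :
    (ofPBW F ρ c).1 (envWord p F.vec (indexWord x)) = c x := by
  rw [← evalPBW_apply, ofPBW, Function.rightInverse_invFun (evalPBW_surjective F hρ)]

theorem hat_apply (hρ : ρ.IsRestricted p) (w : W) {l : List (Fin n ⊕ Fin m)}
    (hl : IsFrameWord p l) : (l = [] → (hat F ρ w).1 (envWord p F.vec l) = w) ∧
      (l ≠ [] → (hat F ρ w).1 (envWord p F.vec l) = 0) := by
  obtain ⟨x, rfl⟩ := isFrameWord_iff.mp hl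
  rw [hat, evalPBW_ofPBW F hρ, Ne, indexWord_eq_nil]
  refine ⟨fun h => by simp [h], fun h => by simp [h]⟩

theorem hat_apply_one (hρ : ρ.IsRestricted p) (w : W) : (hat F ρ w).1 1 = w :=
  (hat_apply F hρ w isFrameWord_nil).1 rfl

theorem hat_mem (hρ : ρ.IsRestricted p) {w : W} {i : ZMod 2} (hw : w ∈ homog k W i) :
    IsHomog (hat F ρ w) i := by
  refine isHomog_of_words F fun l hl => ?_
  rcases eq_or_ne l [] with h | h
  · rw [(hat_apply F hρ w hl).1 h, h]
    simpa using hw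
  · rw [(hat_apply F hρ w hl).2 h]
    exact Submodule.zero_mem _

theorem hat_add (hρ : ρ.IsRestricted p) (w w' : W) : hat F ρ (w + w') = hat F ρ w + hat F ρ w' := by
  refine coind_ext F fun l hl => ?_
  rw [Submodule.coe_add, LinearMap.add_apply]
  rcases eq_or_ne l [] with h | h
  · simp only [(hat_apply F hρ _ hl).1 h]
  · simp only [(hat_apply F hρ _ hl).2 h, add_zero]

theorem hat_smul (hρ : ρ.IsRestricted p) (c : k) (w : W) : hat F ρ (c • w) = c • hat F ρ w := by
  refine coind_ext F fun l hl => ?_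
  rw [Submodule.coe_smul, LinearMap.smul_apply]
  rcases eq_or_ne l [] with h | h
  · simp only [(hat_apply F hρ _ hl).1 h]
  · simp only [(hat_apply F hρ _ hl).2 h, smul_zero]

/-- The elements `v̂` as a linear map. -/
def hatₗ (hρ : ρ.IsRestricted p) : W →ₗ[k] Coind ρ where
  toFun := hat F ρ
  map_add' := hat_add F hρ
  map_smul' := hat_smul F hρ

@[simp] theorem hatₗ_apply (hρ : ρ.IsRestricted p) (w : W) : hatₗ F hρ w = hat F ρ w := rfl

theorem oneA_apply {l : List (Fin n ⊕ Fin m)} :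
    (l = [] → (oneA H).1 (envWord p F.vec l) = 1) ∧
      (l ≠ [] → (oneA H).1 (envWord p F.vec l) = 0) := by
  refine ⟨fun h => by rw [h, envWord_nil, oneA_apply_one], fun h => ?_⟩
  obtain ⟨j, l, rfl⟩ := List.exists_cons_of_ne_nil h
  rw [envWord_cons]
  simp [oneA, envCounit]

/-- The coordinates `η_i` and `ζ_s`. -/
def coord (j : Fin n ⊕ Fin m) : Coind (trivAct k H.carrier) := Sum.elim (eta F) (zeta F) j

theorem coord_apply (j : Fin n ⊕ Fin m) {l : List (Fin n ⊕ Fin m)} (hl : IsFrameWord p l) :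
    (l = [j] → (coord F j).1 (envWord p F.vec l) = 1) ∧
      (l ≠ [j] → (coord F j).1 (envWord p F.vec l) = 0) := by
  obtain ⟨x, rfl⟩ := isFrameWord_iff.mp hl
  rcases j with i | s
  · rw [coord, Sum.elim_inl, eta, evalPBW_ofPBW F trivAct_isRestricted,
      ← indexWord_single_inl (p := p), Ne, indexWord_injective.eq_iff]
    refine ⟨fun h => by simp [h], fun h => by simp [h]⟩
  · rw [coord, Sum.elim_inr, zeta, evalPBW_ofPBW F trivAct_isRestricted,
      ← indexWord_single_inr (p := p), Ne, indexWord_injective.eq_iff]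
    refine ⟨fun h => by simp [h], fun h => by simp [h]⟩

theorem coord_apply_one (j : Fin n ⊕ Fin m) : (coord F j).1 1 = 0 :=
  (coord_apply F j isFrameWord_nil).2 (by simp)

theorem coord_apply_vec (i j : Fin n ⊕ Fin m) :
    (coord F i).1 (envι k p (F.vec j)) = if i = j then 1 else 0 := by
  have h := coord_apply F i (isFrameWord_singleton (p := p) j)
  rw [envWord_cons, envWord_nil, mul_one] at h
  split_ifs with hij
  · exact h.1 (by rw [hij])
  · exact h.2 (by simpa using Ne.symm hij)

theorem coord_mem (j : Fin n ⊕ Fin m) : IsHomog (coord F j) (frameDeg n m j) := by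
  refine isHomog_of_words F fun l hl => ?_
  rcases eq_or_ne l [j] with h | h
  · rw [(coord_apply F j hl).1 h, h]
    have two : ∀ a : ZMod 2, a + a = 0 := by decide
    simp [two, mem_homog]
  · rw [(coord_apply F j hl).2 h]
    exact Submodule.zero_mem _

/-- Multiplication by a coordinate deletes one letter from the word. The factor is a sign or a
multiplicity below `p`, hence nonzero. -/
theorem exists_smulA_coord_apply (ρ : SuperAction k H.carrier W) (j : Fin n ⊕ Fin m)
    {l : List (Fin n ⊕ Fin m)} (hl : IsFrameWord p l) :
    ∃ κ : k, κ ≠ 0 ∧ ∀ f : Coind ρ, (j ∈ l → (smulA (coord F j) f).1 (envWord p F.vec l) =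
      κ • f.1 (envWord p F.vec (l.erase j))) ∧
        (j ∉ l → (smulA (coord F j) f).1 (envWord p F.vec l) = 0) := by
  obtain ⟨κ, h0, h1, h⟩ := conv_envWord_coordinate (W := W) (p := p) F.vec_mem frameLE_antisymm j l
    hl.1 (fun hj => by have := hl.2 j; rw [if_neg hj] at this; omega)
  have h' := fun f : Coind ρ => h (coord F j).1 (coord_mem F j)
    (fun l₁ hl₁ => coord_apply F j (hl.sublist hl₁)) f.1
  by_cases hjl : j ∈ l
  · refine ⟨κ, ?_, fun f => ⟨fun _ => ?_, fun hn => (hn hjl).elim⟩⟩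
    · by_cases hj : frameDeg n m j = 0
      · rw [h0 hj, Ne, CharP.cast_eq_zero_iff k p]
        have := hl.2 j
        rw [if_pos hj] at this
        exact Nat.not_dvd_of_pos_of_lt (List.count_pos_iff.mpr hjl) this
      · rcases h1 hj with h | h <;> simp [h]
    · rw [coe_smulA, h' f, if_pos hjl]
  · refine ⟨1, one_ne_zero, fun f => ⟨fun hn => (hjl hn).elim, fun _ => ?_⟩⟩
    rw [coe_smulA, h' f, if_neg hjl]

/-- The products of coordinates. -/
def mon (J : List (Fin n ⊕ Fin m)) : Coind (trivAct k H.carrier) :=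
  (J.map (coord F)).foldr smulA (oneA H)

@[simp] theorem mon_nil : mon F [] = oneA H := rfl

@[simp] theorem mon_cons (j : Fin n ⊕ Fin m) (J : List (Fin n ⊕ Fin m)) :
    mon F (j :: J) = smulA (coord F j) (mon F J) := rfl

theorem mon_append (J J' : List (Fin n ⊕ Fin m)) :
    mon F (J ++ J') = smulA (mon F J) (mon F J') := by
  induction J with
  | nil => simp
  | cons j J ih => rw [List.cons_append, mon_cons, ih, mon_cons, smulA_assoc]

theorem mon_mem (J : List (Fin n ⊕ Fin m)) :
    IsHomog (mon F J) (J.map (frameDeg n m)).sum := by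
  induction J with
  | nil => exact oneA_mem H
  | cons j J ih =>
    rw [mon_cons, List.map_cons, List.sum_cons]
    exact smulA_mem (coord_mem F j) ih

theorem coordMonomial_eq (a : Fin n → ℕ) (α : Fin m → ℕ) :
    coordMonomial F a α = mon F (orderedList Sum.inl Sum.inr a α) := by
  rw [coordMonomial, mon, map_orderedList]
  rfl

/-- Each coordinate deletes one letter, and `f` sees only the empty word; so the value on `l`
vanishes unless `l` is a rearrangement of `J`. Thus the products of coordinates are, up to nonzero
scalars, dual to the monomials. -/
theorem exists_smulA_mon_apply (ρ : SuperAction k H.carrier W) (J : List (Fin n ⊕ Fin m)) :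
    ∃ c : k, c ≠ 0 ∧ ∀ (f : Coind ρ) (w : W), (∀ l, IsFrameWord p l →
      (l = [] → f.1 (envWord p F.vec l) = w) ∧ (l ≠ [] → f.1 (envWord p F.vec l) = 0)) →
      ∀ l, IsFrameWord p l → (l.Perm J → (smulA (mon F J) f).1 (envWord p F.vec l) = c • w) ∧
        (¬ l.Perm J → (smulA (mon F J) f).1 (envWord p F.vec l) = 0) := by
  induction J with
  | nil =>
    refine ⟨1, one_ne_zero, fun f w h l hl => ?_⟩
    rw [List.perm_nil, mon_nil, oneA_smulA, one_smul]
    exact h l hl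
  | cons j J ih =>
    obtain ⟨c, hc, h⟩ := ih
    have hneg : ∀ (f : Coind ρ) (w : W), (∀ l, IsFrameWord p l →
      (l = [] → f.1 (envWord p F.vec l) = w) ∧ (l ≠ [] → f.1 (envWord p F.vec l) = 0)) →
      ∀ l, IsFrameWord p l → ¬ l.Perm (j :: J) →
        (smulA (mon F (j :: J)) f).1 (envWord p F.vec l) = 0 := by
      intro f w hf l hl hn
      rw [mon_cons, smulA_assoc]
      obtain ⟨κ, -, hκ⟩ := exists_smulA_coord_apply F ρ j hl
      by_cases hj : j ∈ l
      · rw [(hκ _).1 hj, (h f w hf _ (hl.sublist List.erase_sublist)).2, smul_zero]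
        intro hp
        exact hn ((List.perm_cons_erase hj).trans (hp.cons j))
      · exact (hκ _).2 hj
    by_cases hJ : ∃ l₀, IsFrameWord p l₀ ∧ l₀.Perm (j :: J)
    · obtain ⟨l₀, hl₀, hp₀⟩ := hJ
      obtain ⟨κ, hκ0, hκ⟩ := exists_smulA_coord_apply F ρ j hl₀
      refine ⟨κ * c, mul_ne_zero hκ0 hc, fun f w hf l hl => ⟨fun hp => ?_, hneg f w hf l hl⟩⟩
      obtain rfl := hl.eq_of_perm hl₀ (hp.trans hp₀.symm)
      have hj : j ∈ l := hp.symm.subset (by simp)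
      rw [mon_cons, smulA_assoc, (hκ _).1 hj, (h f w hf _ (hl.sublist List.erase_sublist)).1,
        smul_smul]
      exact (List.cons_perm_iff_perm_erase.mp hp.symm).2.symm
    -- No frame word is a rearrangement of `j :: J`, because some letter occurs too often; the
    -- product vanishes and any nonzero constant will do.
    · exact ⟨1, one_ne_zero, fun f w hf l hl =>
        ⟨fun hp => (hJ ⟨l, hl, hp⟩).elim, hneg f w hf l hl⟩⟩

theorem exists_mon_apply (J : List (Fin n ⊕ Fin m)) :
    ∃ c : k, c ≠ 0 ∧ ∀ l, IsFrameWord p l →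
      (l.Perm J → (mon F J).1 (envWord p F.vec l) = c) ∧
        (¬ l.Perm J → (mon F J).1 (envWord p F.vec l) = 0) := by
  obtain ⟨c, hc, h⟩ := exists_smulA_mon_apply F (trivAct k H.carrier) J
  refine ⟨c, hc, fun l hl => ?_⟩
  have := h (oneA H) 1 (fun l _ => oneA_apply F) l hl
  rwa [smulA_oneA, smul_eq_mul, mul_one] at this

theorem exists_smulA_mon_hat (hρ : ρ.IsRestricted p) (J : List (Fin n ⊕ Fin m)) :
    ∃ c : k, c ≠ 0 ∧ ∀ w l, IsFrameWord p l →
      (l.Perm J → (smulA (mon F J) (hat F ρ w)).1 (envWord p F.vec l) = c • w) ∧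
        (¬ l.Perm J → (smulA (mon F J) (hat F ρ w)).1 (envWord p F.vec l) = 0) := by
  obtain ⟨c, hc, h⟩ := exists_smulA_mon_apply F ρ J
  exact ⟨c, hc, fun w l hl => h _ w (fun l hl => hat_apply F hρ w hl) l hl⟩

end FrameWords

/-! ### The top monomial and the integral -/

section Top

attribute [local instance] lawfulBEq_sum

variable {k : Type*} {p : ℕ} {g : Type*} [Field k] [AddCommGroup g] [Module k g]
  [LieSuperalgebra k g] [RestrictedLieSuperalgebra k p g] {H : RestrictedSubalgebra k p g}
  {V W : Type*} [AddCommGroup V] [Module k V] [Superspace k V]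
  [AddCommGroup W] [Module k W] [Superspace k W]
  {π : SuperAction k H.carrier V} {ρ : SuperAction k H.carrier W} {n m : ℕ}

theorem subperm_of_count {X : Type*} [inst : BEq X] [LawfulBEq X] {l l' : List X}
    (h : ∀ a, l.count a ≤ l'.count a) : l.Subperm l' := by
  classical
  rw [List.subperm_iff_count]
  intro a
  have e : (instBEqOfDecidableEq : BEq X) = inst := lawful_beq_subsingleton _ _
  rw [e]
  exact h a

theorem exists_frameWord_perm {J : List (Fin n ⊕ Fin m)}
    (hJ : ∀ j, J.count j < if frameDeg n m j = 0 then p else 2) :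
    ∃ l, IsFrameWord p l ∧ l.Perm J := by
  refine ⟨_, isFrameWord_indexWord ((fun i => ⟨J.count (Sum.inl i), by
    simpa [frameDeg] using hJ (Sum.inl i)⟩, fun s => ⟨J.count (Sum.inr s), by
    simpa [frameDeg] using hJ (Sum.inr s)⟩) : Expo p n m), ?_⟩
  rw [List.perm_iff_count]
  rintro (i | s)
  · rw [indexWord, count_inl_orderedList]
  · rw [indexWord, count_inr_orderedList]

variable (p n m) in
/-- The word with the maximal exponents. -/
def topWord : List (Fin n ⊕ Fin m) := orderedList Sum.inl Sum.inr (fun _ => p - 1) (fun _ => 1)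

variable [Fact p.Prime]

theorem count_topWord (j : Fin n ⊕ Fin m) :
    (topWord p n m).count j + 1 = if frameDeg n m j = 0 then p else 2 := by
  have := (Fact.out : p.Prime).pos
  rcases j with i | s
  · rw [topWord, count_inl_orderedList, frameDeg, Sum.elim_inl, if_pos rfl]
    omega
  · rw [topWord, count_inr_orderedList, frameDeg, Sum.elim_inr, if_neg (by decide)]

theorem isFrameWord_topWord : IsFrameWord p (topWord p n m) := by
  have := (Fact.out : p.Prime).pos
  have h : topWord p n m = indexWord ((fun _ => ⟨p - 1, by omega⟩, fun _ => 1) : Expo p n m) := rfl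
  rw [h]
  exact isFrameWord_indexWord _

theorem IsFrameWord.subperm_topWord {l : List (Fin n ⊕ Fin m)} (hl : IsFrameWord p l) :
    l.Subperm (topWord p n m) := by
  refine subperm_of_count fun j => ?_
  have h1 := hl.2 j
  rw [← count_topWord] at h1
  omega

theorem IsFrameWord.length_le {l : List (Fin n ⊕ Fin m)} (hl : IsFrameWord p l) :
    l.length ≤ (topWord p n m).length := hl.subperm_topWord.length_le

theorem IsFrameWord.eq_topWord {l : List (Fin n ⊕ Fin m)} (hl : IsFrameWord p l)
    (h : (topWord p n m).length ≤ l.length) : l = topWord p n m :=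
  hl.eq_of_perm isFrameWord_topWord (hl.subperm_topWord.perm_of_length_le h)

variable [CharP k p] [Fact (2 < p)] (F : Frame H n m)

theorem topMonomial_eq : topMonomial F = mon F (topWord p n m) := coordMonomial_eq F _ _

theorem topMonomial_mem : IsHomog (topMonomial F) (m : ZMod 2) := by
  have h := mon_mem F (topWord p n m)
  rw [← topMonomial_eq] at h
  convert h using 1
  rw [topWord, map_orderedList, orderedList, List.sum_append]
  simp [List.flatMap, frameDeg]

/-- The top coefficient of the top monomial. -/
def topCoeff : k := (topMonomial F).1 (envWord p F.vec (topWord p n m))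

theorem topCoeff_ne_zero : topCoeff F ≠ 0 := by
  obtain ⟨c, hc, h⟩ := exists_mon_apply F (topWord p n m)
  rw [topCoeff, topMonomial_eq, (h _ isFrameWord_topWord).1 (List.Perm.refl _)]
  exact hc

theorem topMonomial_apply {l : List (Fin n ⊕ Fin m)} (hl : IsFrameWord p l)
    (h : l ≠ topWord p n m) : (topMonomial F).1 (envWord p F.vec l) = 0 := by
  obtain ⟨c, hc, h'⟩ := exists_mon_apply F (topWord p n m)
  rw [topMonomial_eq, (h' _ hl).2 fun hp => h (hl.eq_of_perm isFrameWord_topWord hp)]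

/-- `Λ` vanishes on proper subwords of frame words, since these are shorter than the top word. So
`f` enters only through its value at `1`. -/
theorem topMonomial_smulA_apply (f : Coind ρ) {l : List (Fin n ⊕ Fin m)} (hl : IsFrameWord p l) :
    (smulA (topMonomial F) f).1 (envWord p F.vec l) =
      (topMonomial F).1 (envWord p F.vec l) • f.1 1 := by
  rw [coe_smulA, conv_envWord_eq_left _ F.vec_mem]
  · simp
  · intro l₁ h₁ h₂
    refine topMonomial_apply F (hl.sublist h₁) fun h => ?_
    rw [h] at h₂
    exact absurd hl.length_le (by omega)

theorem topMonomial_smulA_eq_zero {f : Coind ρ} (hf : f.1 1 = 0) :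
    smulA (topMonomial F) f = 0 :=
  coind_ext F fun l hl => by
    rw [topMonomial_smulA_apply F f hl, hf, smul_zero]
    rfl

theorem topMonomial_smulA (f : Coind (trivAct k H.carrier)) :
    smulA (topMonomial F) f = f.1 1 • topMonomial F :=
  coind_ext F fun l hl => by
    rw [topMonomial_smulA_apply F f hl, smul_eq_mul, mul_comm]
    rfl

/-- The integral: the coefficient of the top monomial. -/
def integral : Coind (trivAct k H.carrier) →ₗ[k] k :=
  (topCoeff F)⁻¹ • (LinearMap.applyₗ (envWord p F.vec (topWord p n m)) ∘ₗ
    (Coind (trivAct k H.carrier)).subtype)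

theorem integral_apply (f : Coind (trivAct k H.carrier)) :
    integral F f = (topCoeff F)⁻¹ * f.1 (envWord p F.vec (topWord p n m)) := rfl

theorem integral_topMonomial : integral F (topMonomial F) = 1 :=
  inv_mul_cancel₀ (topCoeff_ne_zero F)

/-- The socle of `A` is spanned by `Λ`: a frame word `l` other than the top word has room for
another letter `j`, and the value of `a` on `l` is, up to a nonzero factor, the value of `x_j a` on
`l` with `j` inserted, `x_j` being the coordinate of `j`. -/
theorem eq_smul_topMonomial {a : Coind (trivAct k H.carrier)}
    (h : ∀ j, smulA (coord F j) a = 0) : a = integral F a • topMonomial F := by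
  refine coind_ext F fun l hl => ?_
  rw [Submodule.coe_smul, LinearMap.smul_apply]
  by_cases htop : l = topWord p n m
  · rw [htop, integral_apply, smul_eq_mul, mul_right_comm]
    change _ = (topCoeff F)⁻¹ * topCoeff F * _
    rw [inv_mul_cancel₀ (topCoeff_ne_zero F), one_mul]
  · rw [topMonomial_apply F hl htop, smul_zero]
    have hlt : ∃ j, l.count j < (topWord p n m).count j := by
      by_contra! hge
      exact htop (hl.eq_topWord (subperm_of_count hge).length_le)
    obtain ⟨j, hj⟩ := hlt
    obtain ⟨l', hl', hp⟩ := exists_frameWord_perm (p := p) (J := j :: l) fun i => by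
      rw [← count_topWord, List.count_cons]
      have h1 := hl.2 i
      rw [← count_topWord] at h1
      split_ifs with hij
      · rw [eq_of_beq hij] at hj
        omega
      · omega
    obtain ⟨κ, hκ0, hκ⟩ := exists_smulA_coord_apply F (trivAct k H.carrier) j hl'
    have hm : j ∈ l' := hp.symm.subset (by simp)
    have h1 := (hκ a).1 hm
    rw [h j, (hl'.sublist List.erase_sublist).eq_of_perm hl
      (List.cons_perm_iff_perm_erase.mp hp.symm).2.symm] at h1
    exact (smul_eq_zero.mp h1.symm).resolve_left hκ0

/-- A triangularity criterion for the bijectivity of maps between coinduced representations. -/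
theorem coind_bijective_of_triangular (hρ : ρ.IsRestricted p) (T : Coind ρ →ₗ[k] Coind π)
    (τ : W →ₗ[k] V) (hτ : Function.Bijective τ)
    (h : ∀ (f : Coind ρ) (l : List (Fin n ⊕ Fin m)), IsFrameWord p l →
      (∀ l', IsFrameWord p l' → l'.length < l.length → f.1 (envWord p F.vec l') = 0) →
        (T f).1 (envWord p F.vec l) = τ (f.1 (envWord p F.vec l))) : Function.Bijective T := by
  let e := LinearEquiv.ofBijective (evalPBW F ρ)
    ⟨evalPBW_injective F ρ, evalPBW_surjective F hρ⟩
  have he : ∀ c x, (e.symm c).1 (envWord p F.vec (indexWord x)) = c x := fun c x => by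
    rw [← evalPBW_apply]
    exact congrFun (e.apply_symm_apply c) x
  have key := bijective_of_triangular (evalPBW F π ∘ₗ T ∘ₗ e.symm.toLinearMap)
    (fun x => (indexWord x).length) τ hτ fun c x hc => by
      simp only [LinearMap.comp_apply, evalPBW_apply, LinearEquiv.coe_coe]
      rw [h _ _ (isFrameWord_indexWord x), he]
      intro l' hl' hlt
      obtain ⟨x', rfl⟩ := isFrameWord_iff.mp hl'
      rw [he, hc x' hlt]
  constructor
  · intro f f' hf
    have := key.1 (a₁ := e f) (a₂ := e f') (by simp [hf])
    exact e.injective this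
  · intro f
    obtain ⟨c, hc⟩ := key.2 (evalPBW F π f)
    exact ⟨e.symm c, evalPBW_injective F π hc⟩

/-- Linear maps on coinduced representations are determined by the products of coordinates. -/
theorem coind_linear_ext {Q : Type*} [AddCommGroup Q] [Module k Q] (hρ : ρ.IsRestricted p)
    {T T' : Coind ρ →ₗ[k] Q} (h : ∀ J, IsFrameWord p J → ∀ w,
      T (smulA (mon F J) (hat F ρ w)) = T' (smulA (mon F J) (hat F ρ w))) : T = T' := by
  ext f
  have hf : f = ∑ x : Expo p n m, smulA (mon F (indexWord x)) (hat F ρ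
      ((exists_smulA_mon_hat F hρ (indexWord x)).choose⁻¹ •
        f.1 (envWord p F.vec (indexWord x)))) := by
    refine evalPBW_injective F ρ ?_
    funext z
    rw [map_sum, Finset.sum_apply, Finset.sum_eq_single z]
    · rw [evalPBW_apply, evalPBW_apply]
      obtain ⟨hc, hz⟩ := (exists_smulA_mon_hat F hρ (indexWord z)).choose_spec
      rw [(hz _ _ (isFrameWord_indexWord z)).1 (List.Perm.refl _), smul_smul, mul_inv_cancel₀ hc,
        one_smul]
    · intro x _ hx
      obtain ⟨-, hz⟩ := (exists_smulA_mon_hat F hρ (indexWord x)).choose_spec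
      rw [evalPBW_apply]
      refine (hz _ _ (isFrameWord_indexWord z)).2 fun hp => hx (indexWord_injective ?_)
      exact ((isFrameWord_indexWord z).eq_of_perm (isFrameWord_indexWord x) hp).symm
    · simp
  rw [hf, map_sum, map_sum]
  exact Finset.sum_congr rfl fun x _ => h _ (isFrameWord_indexWord x) _

theorem hat_one : hat F (trivAct k H.carrier) 1 = oneA H :=
  coind_ext F fun l hl => by
    rcases eq_or_ne l [] with h | h
    · rw [(hat_apply F trivAct_isRestricted 1 hl).1 h, (oneA_apply F).1 h]
    · rw [(hat_apply F trivAct_isRestricted 1 hl).2 h, (oneA_apply F).2 h]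

theorem mon_linear_ext {Q : Type*} [AddCommGroup Q] [Module k Q]
    {T T' : Coind (trivAct k H.carrier) →ₗ[k] Q}
    (h : ∀ J, IsFrameWord p J → T (mon F J) = T' (mon F J)) : T = T' := by
  refine coind_linear_ext F trivAct_isRestricted fun J hJ w => ?_
  rw [← mul_one w, ← smul_eq_mul, hat_smul F trivAct_isRestricted, hat_one, smulA_smul, map_smul,
    map_smul, smulA_oneA, h J hJ]

end Top

/-! ### Partial derivatives, divergence and integration by parts -/

section Partials

attribute [local instance] lawfulBEq_sum

variable {k : Type*} {p : ℕ} {g : Type*} [Field k] [AddCommGroup g] [Module k g]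
  [LieSuperalgebra k g] [RestrictedLieSuperalgebra k p g] {H : RestrictedSubalgebra k p g}
  {W : Type*} [AddCommGroup W] [Module k W] [Superspace k W]
  {ρ : SuperAction k H.carrier W} {n m : ℕ}
  [Fact p.Prime] [CharP k p] [Fact (2 < p)] (F : Frame H n m)

theorem vec_smul_coord_apply_one (i l : Fin n ⊕ Fin m) :
    (envι k p (F.vec i) • coord F l).1 1 = if l = i then 1 else 0 := by
  rw [coind_smul_apply, one_mul, coord_apply_vec]

/-- The matrix of the frame elements acting on the coordinates is the identity at `1`. Solving for a
left inverse over `A` is therefore a linear system triangular in the length of words. -/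
theorem exists_dual_family : ∃ C : Fin n ⊕ Fin m → Fin n ⊕ Fin m → Coind (trivAct k H.carrier),
    ∀ j l, ∑ i, smulA (C j i) (envι k p (F.vec i) • coord F l) =
      if j = l then oneA H else 0 := by
  let e := LinearEquiv.ofBijective (evalPBW F (trivAct k H.carrier))
    ⟨evalPBW_injective F _, evalPBW_surjective F trivAct_isRestricted⟩
  have he : ∀ c x, (e.symm c).1 (envWord p F.vec (indexWord x)) = c x := fun c x => by
    rw [← evalPBW_apply]
    exact congrFun (e.apply_symm_apply c) x
  let S : Fin n ⊕ Fin m → ((Expo p n m × (Fin n ⊕ Fin m)) → k) →ₗ[k] Coind (trivAct k H.carrier) :=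
    fun i => e.symm.toLinearMap ∘ₗ LinearMap.funLeft k k (fun z => (z, i))
  -- The unknown is one row `(C_i)` of the inverse, recorded by its values on frame words; `T` gives
  -- the values of the sums `∑_i C_i δ_i(x_l)`.
  let T : ((Expo p n m × (Fin n ⊕ Fin m)) → k) →ₗ[k] ((Expo p n m × (Fin n ⊕ Fin m)) → k) :=
    LinearMap.pi fun xl => ∑ i, LinearMap.applyₗ (envWord p F.vec (indexWord xl.1)) ∘ₗ
      (Coind (trivAct k H.carrier)).subtype ∘ₗ
        (smulAₗ (trivAct k H.carrier)).flip (envι k p (F.vec i) • coord F xl.2) ∘ₗ S i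
  have hT : ∀ c xl, T c xl = (∑ i, smulA (S i c) (envι k p (F.vec i) • coord F xl.2)).1
      (envWord p F.vec (indexWord xl.1)) := by
    intro c xl
    rw [Submodule.coe_sum, LinearMap.sum_apply]
    simp only [T, LinearMap.pi_apply, LinearMap.sum_apply]
    rfl
  have hbij : Function.Bijective T := by
    refine bijective_of_triangular T (fun xl => (indexWord xl.1).length) LinearMap.id
      Function.bijective_id fun c xl hc => ?_
    rw [hT, Submodule.coe_sum, LinearMap.sum_apply, Finset.sum_eq_single xl.2]
    · rw [coe_smulA, conv_envWord_eq_left _ F.vec_mem, vec_smul_coord_apply_one, if_pos rfl]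
      · simp [S, he]
      · intro l₁ h₁ h₂
        obtain ⟨z, rfl⟩ := isFrameWord_iff.mp ((isFrameWord_indexWord xl.1).sublist h₁)
        simp [S, he, hc (z, xl.2) h₂]
    · intro i _ hi
      rw [coe_smulA, conv_envWord_eq_left _ F.vec_mem, vec_smul_coord_apply_one, if_neg hi.symm]
      · simp
      · intro l₁ h₁ h₂
        obtain ⟨z, rfl⟩ := isFrameWord_iff.mp ((isFrameWord_indexWord xl.1).sublist h₁)
        simp [S, he, hc (z, i) h₂]
    · simp
  choose c hc using fun j => hbij.2 fun xl : Expo p n m × (Fin n ⊕ Fin m) =>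
    (if j = xl.2 then oneA H else 0 : Coind (trivAct k H.carrier)).1
      (envWord p F.vec (indexWord xl.1))
  refine ⟨fun j i => S i (c j), fun j l => coind_ext F fun w hw => ?_⟩
  obtain ⟨x, rfl⟩ := isFrameWord_iff.mp hw
  have := congrFun (hc j) (x, l)
  rw [hT] at this
  exact this

theorem proj_smulA (i : ZMod 2) {j : ZMod 2} (a : Coind (trivAct k H.carrier)) {f : Coind ρ}
    (hf : IsHomog f j) : proj (k := k) (i + j) (smulA a f) = smulA (proj (k := k) i a) f := by
  have h2 := two_ne_zero_of_char k p
  refine coind_homog_induction (P := fun a => proj (k := k) (i + j) (smulA a f) =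
    smulA (proj (k := k) i a) f) (fun a b ha hb => ?_) (fun l a ha => ?_) a
  · rw [add_smulA, map_add, map_add, add_smulA, ha, hb]
  · rw [proj_of_mem h2 (isHomog_iff.mp (smulA_mem ha hf)), proj_of_mem h2 (isHomog_iff.mp ha)]
    by_cases h : l = i
    · rw [if_pos h, if_pos (by rw [h])]
    · rw [if_neg h, if_neg (by simpa using h), zero_smulA]

/-- Taking in each entry the component of the expected degree keeps the equations, since they are
homogeneous. -/
theorem exists_homog_dual_family :
    ∃ C : Fin n ⊕ Fin m → Fin n ⊕ Fin m → Coind (trivAct k H.carrier),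
    (∀ j i, IsHomog (C j i) (frameDeg n m j + frameDeg n m i)) ∧
    ∀ j l, ∑ i, smulA (C j i) (envι k p (F.vec i) • coord F l) =
      if j = l then oneA H else 0 := by
  have h2 := two_ne_zero_of_char k p
  have two : ∀ a : ZMod 2, a + a = 0 := by decide
  obtain ⟨C, hC⟩ := exists_dual_family F
  refine ⟨fun j i => proj (k := k) (frameDeg n m j + frameDeg n m i) (C j i),
    fun j i => isHomog_iff.mpr (proj_mem _ _), fun j l => ?_⟩
  have h := congrArg (proj (k := k) (frameDeg n m j + frameDeg n m l)) (hC j l)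
  rw [map_sum] at h
  have e : ∀ i : Fin n ⊕ Fin m, frameDeg n m j + frameDeg n m l =
      (frameDeg n m j + frameDeg n m i) + (frameDeg n m i + frameDeg n m l) := fun i => by
    rw [add_assoc, ← add_assoc (frameDeg n m i), two, zero_add]
  have h3 : ∀ i, smulA (proj (k := k) (frameDeg n m j + frameDeg n m i) (C j i))
      (envι k p (F.vec i) • coord F l) = proj (k := k) (frameDeg n m j + frameDeg n m l)
        (smulA (C j i) (envι k p (F.vec i) • coord F l)) := fun i => by
    rw [e i, proj_smulA _ _ (isHomog_smul (F.vec_mem i) (coord_mem F l))]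
  rw [Finset.sum_congr rfl fun i _ => h3 i, h]
  split_ifs with hjl
  · rw [hjl, two, proj_of_mem h2 (isHomog_iff.mp (oneA_mem H)), if_pos rfl]
  · rw [map_zero]

/-- The action of an element of `U'(g)` as a linear map. -/
def actₗ (ρ : SuperAction k H.carrier W) (u : Env k p g) : Coind ρ →ₗ[k] Coind ρ where
  toFun f := u • f
  map_add' f f' := smul_add u f f'
  map_smul' _ _ := Subtype.ext rfl

@[simp] theorem actₗ_apply (u : Env k p g) (f : Coind ρ) : actₗ ρ u f = u • f := rfl

theorem isSuperDerivation_act {j : ZMod 2} {x : g} (hx : x ∈ homog k g j) :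
    IsSuperDerivation j (actₗ (trivAct k H.carrier) (envι k p x)) where
  degree _ _ hf := isHomog_smul hx hf
  leibniz _ _ f' hf := ι_smul_smulA hx hf f'

theorem IsSuperDerivation.smulA_comp {e j : ZMod 2} {c : Coind (trivAct k H.carrier)}
    (hc : IsHomog c e) {D : Coind (trivAct k H.carrier) →ₗ[k] Coind (trivAct k H.carrier)}
    (hD : IsSuperDerivation j D) : IsSuperDerivation (e + j) (smulAₗ _ c ∘ₗ D) where
  degree i f hf := by
    rw [LinearMap.comp_apply, smulAₗ_apply, add_assoc]
    exact smulA_mem hc (hD.degree i f hf)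
  leibniz i f f' hf := by
    simp only [LinearMap.comp_apply, smulAₗ_apply]
    rw [hD.leibniz i f f' hf, smulA_add, smulA_smul, smulA_assoc,
      smulA_left_comm hc hf, smul_smul, ← sgn_add, add_mul, add_comm (j * i)]

theorem IsSuperDerivation.sum {ι : Type*} {s : Finset ι} {j : ZMod 2}
    {D : ι → Coind (trivAct k H.carrier) →ₗ[k] Coind (trivAct k H.carrier)}
    (h : ∀ i ∈ s, IsSuperDerivation j (D i)) : IsSuperDerivation j (∑ i ∈ s, D i) where
  degree i f hf := by
    rw [LinearMap.sum_apply]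
    exact IsHomog.sum fun l hl => (h l hl).degree i f hf
  leibniz i f f' hf := by
    simp only [LinearMap.sum_apply]
    rw [sum_smulA, smulA_sum, Finset.smul_sum, ← Finset.sum_add_distrib]
    exact Finset.sum_congr rfl fun l hl => (h l hl).leibniz i f f' hf

/-- The superderivations `∂/∂η_i` and `∂/∂ζ_s`, indexed by the frame. -/
structure IsPartialFamily (F : Frame H n m)
    (dd : Fin n ⊕ Fin m → Coind (trivAct k H.carrier) →ₗ[k] Coind (trivAct k H.carrier)) :
    Prop where
  der : ∀ j, IsSuperDerivation (frameDeg n m j) (dd j)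
  apply_coord : ∀ j l, dd j (coord F l) = if j = l then oneA H else 0

/-- The partial derivatives are the combinations `∑_i C_{ji} δ_i`; such `A`-multiples of
superderivations are again superderivations. -/
theorem exists_isPartialFamily : ∃ dd, IsPartialFamily F dd := by
  have two : ∀ a : ZMod 2, a + a = 0 := by decide
  obtain ⟨C, hC, h⟩ := exists_homog_dual_family F
  refine ⟨fun j => ∑ i, smulAₗ _ (C j i) ∘ₗ actₗ _ (envι k p (F.vec i)), ⟨fun j => ?_, fun j l => ?_⟩⟩
  · refine IsSuperDerivation.sum fun i _ => ?_
    have := (isSuperDerivation_act (H := H) (F.vec_mem i)).smulA_comp (hC j i)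
    rwa [add_assoc, two, add_zero] at this
  · rw [LinearMap.sum_apply, ← h j l]
    rfl

theorem IsSuperDerivation.map_oneA {j : ZMod 2}
    {D : Coind (trivAct k H.carrier) →ₗ[k] Coind (trivAct k H.carrier)}
    (hD : IsSuperDerivation j D) : D (oneA H) = 0 := by
  have h := hD.leibniz 0 (oneA H) (oneA H) (oneA_mem H)
  rw [oneA_smulA, smulA_oneA, oneA_smulA, mul_zero, sgn_zero, one_smul] at h
  exact left_eq_add.mp h

theorem IsSuperDerivation.map_mon_cons {j : ZMod 2}
    {D : Coind (trivAct k H.carrier) →ₗ[k] Coind (trivAct k H.carrier)}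
    (hD : IsSuperDerivation j D) (i : Fin n ⊕ Fin m) (J : List (Fin n ⊕ Fin m)) :
    D (mon F (i :: J)) = smulA (D (coord F i)) (mon F J) +
      sgn k (j * frameDeg n m i) • smulA (coord F i) (D (mon F J)) :=
  hD.leibniz _ _ _ (coord_mem F i)

/-- A superderivation kills the unit, and products of coordinates span `A`. -/
theorem IsSuperDerivation.ext {j : ZMod 2}
    {D D' : Coind (trivAct k H.carrier) →ₗ[k] Coind (trivAct k H.carrier)}
    (hD : IsSuperDerivation j D) (hD' : IsSuperDerivation j D')
    (h : ∀ i, D (coord F i) = D' (coord F i)) : D = D' := by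
  refine mon_linear_ext F (Q := Coind (trivAct k H.carrier)) (T := D) (T' := D') fun J hJ => ?_
  clear hJ
  induction J with
  | nil => rw [mon_nil, hD.map_oneA, hD'.map_oneA]
  | cons i J ih => rw [hD.map_mon_cons F, hD'.map_mon_cons F, h, ih]

variable {F} {dd : Fin n ⊕ Fin m → Coind (trivAct k H.carrier) →ₗ[k] Coind (trivAct k H.carrier)}
  (hdd : IsPartialFamily F dd)

/-- Both sides are superderivations of the degree of `x` with the same values on the coordinates. -/
theorem IsPartialFamily.chain (hdd : IsPartialFamily F dd) {j : ZMod 2} {x : g} (hx : x ∈ homog k g j)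
    (f : Coind (trivAct k H.carrier)) :
    envι k p x • f = ∑ i, smulA (envι k p x • coord F i) (dd i f) := by
  have two : ∀ a : ZMod 2, a + a = 0 := by decide
  have h : IsSuperDerivation j (∑ i, smulAₗ _ (envι k p x • coord F i) ∘ₗ dd i) := by
    refine IsSuperDerivation.sum fun i _ => ?_
    have := (hdd.der i).smulA_comp (isHomog_smul hx (coord_mem F i))
    rwa [add_assoc, two, add_zero] at this
  have h0 := (isSuperDerivation_act (H := H) hx).ext F h fun l => by
    rw [LinearMap.sum_apply, Finset.sum_eq_single l]
    · rw [LinearMap.comp_apply, hdd.apply_coord, if_pos rfl, smulAₗ_apply, smulA_oneA]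
      rfl
    · intro i _ hi
      rw [LinearMap.comp_apply, hdd.apply_coord, if_neg hi, map_zero]
    · simp
  have := LinearMap.congr_fun h0 f
  rw [LinearMap.sum_apply] at this
  exact this

theorem IsPartialFamily.apply_one (hdd : IsPartialFamily F dd) (j : Fin n ⊕ Fin m)
    (f : Coind (trivAct k H.carrier)) : (dd j f).1 1 = f.1 (envι k p (F.vec j)) := by
  have h := congrArg (fun f : Coind (trivAct k H.carrier) => f.1 1) (hdd.chain (F.vec_mem j) f)
  simp only [Submodule.coe_sum, LinearMap.sum_apply, smulA_one_apply,
    vec_smul_coord_apply_one] at h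
  rw [coind_smul_apply, one_mul] at h
  simpa using h.symm

/-- A partial derivative removes one factor from a product of coordinates, and such a product is
supported on words whose length is its number of factors. -/
theorem IsPartialFamily.mon_apply_eq_zero (hdd : IsPartialFamily F dd) (j : Fin n ⊕ Fin m)
    (J : List (Fin n ⊕ Fin m)) :
    ∀ l, IsFrameWord p l → l.length + 1 ≠ J.length →
      (dd j (mon F J)).1 (envWord p F.vec l) = 0 := by
  induction J with
  | nil =>
    intro l _ _
    rw [mon_nil, (hdd.der j).map_oneA]
    rfl
  | cons i J ih =>
    intro l hl hlen
    have h1 : (smulA (dd j (coord F i)) (mon F J)).1 (envWord p F.vec l) = 0 := by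
      rw [hdd.apply_coord]
      split_ifs
      · rw [oneA_smulA]
        obtain ⟨c, -, h⟩ := exists_mon_apply F J
        exact (h l hl).2 fun hp => hlen (by rw [hp.length_eq, List.length_cons])
      · rw [zero_smulA]; rfl
    have h2 : (smulA (coord F i) (dd j (mon F J))).1 (envWord p F.vec l) = 0 := by
      obtain ⟨κ, -, hκ⟩ := exists_smulA_coord_apply F (trivAct k H.carrier) i hl
      by_cases hi : i ∈ l
      · rw [(hκ _).1 hi, ih _ (hl.sublist List.erase_sublist), smul_zero]
        rw [List.length_erase_of_mem hi]
        have := List.length_pos_of_mem hi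
        simp only [List.length_cons] at hlen
        omega
      · exact (hκ _).2 hi
    rw [(hdd.der j).map_mon_cons F, Submodule.coe_add, Submodule.coe_smul, LinearMap.add_apply,
      LinearMap.smul_apply, h1, h2, smul_zero, add_zero]

/-- No frame word is longer than the top word, so a derivative never has a component of top degree.
-/
theorem IsPartialFamily.integral_eq_zero (hdd : IsPartialFamily F dd) (j : Fin n ⊕ Fin m)
    (f : Coind (trivAct k H.carrier)) : integral F (dd j f) = 0 := by
  have : integral F ∘ₗ dd j = 0 := mon_linear_ext F fun J hJ => by
    rw [LinearMap.comp_apply, integral_apply,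
      hdd.mon_apply_eq_zero j J _ isFrameWord_topWord, mul_zero]
    · rfl
    · have := hJ.length_le
      omega
  exact LinearMap.congr_fun this f

/-- The divergence of `x` of degree `j`. -/
def divOf (F : Frame H n m)
    (dd : Fin n ⊕ Fin m → Coind (trivAct k H.carrier) →ₗ[k] Coind (trivAct k H.carrier))
    (j : ZMod 2) (x : g) : Coind (trivAct k H.carrier) :=
  ∑ i, sgn k (frameDeg n m i * (j + 1)) • dd i (envι k p x • coord F i)

theorem IsPartialFamily.divOf_mem (hdd : IsPartialFamily F dd) {j : ZMod 2} {x : g}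
    (hx : x ∈ homog k g j) : IsHomog (divOf F dd j x) j := by
  refine IsHomog.sum fun i _ => IsHomog.smul _ ?_
  have two : ∀ a : ZMod 2, a + a = 0 := by decide
  have := (hdd.der i).degree _ _ (isHomog_smul hx (coord_mem F i))
  rwa [add_left_comm, two, add_zero] at this

/-- The Lie derivative of `f ω` is a total divergence: the two terms on the left, by the chain rule,
are the two Leibniz terms of `∂_i(δ_x(x_i) f)`. -/
theorem IsPartialFamily.act_add_divOf (hdd : IsPartialFamily F dd) {j : ZMod 2} {x : g}
    (hx : x ∈ homog k g j) (f : Coind (trivAct k H.carrier)) :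
    envι k p x • f + smulA (divOf F dd j x) f =
      ∑ i, sgn k (frameDeg n m i * (j + 1)) • dd i (smulA (envι k p x • coord F i) f) := by
  rw [hdd.chain hx f, divOf, sum_smulA, ← Finset.sum_add_distrib]
  refine Finset.sum_congr rfl fun i _ => ?_
  rw [(hdd.der i).leibniz _ _ _ (isHomog_smul hx (coord_mem F i)), smul_add, smul_smul, smul_smulA,
    add_comm]
  congr 1
  have : sgn k (frameDeg n m i * (j + 1)) * sgn k (frameDeg n m i * (j + frameDeg n m i)) = 1 := by
    rcases zmod_two_cases (frameDeg n m i) with h | h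
    · simp [h]
    · rw [h, one_mul, sgn_mul_self k]
  rw [this, one_smul]

theorem IsPartialFamily.integral_act (hdd : IsPartialFamily F dd) {j : ZMod 2} {x : g}
    (hx : x ∈ homog k g j) (f : Coind (trivAct k H.carrier)) :
    integral F (envι k p x • f + smulA (divOf F dd j x) f) = 0 := by
  rw [hdd.act_add_divOf hx, map_sum]
  exact Finset.sum_eq_zero fun i _ => by rw [map_smul, hdd.integral_eq_zero, smul_zero]

/-- Integration by parts. -/
theorem IsPartialFamily.integral_smulA (hdd : IsPartialFamily F dd) {i j : ZMod 2} {x : g}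
    (hx : x ∈ homog k g j) {a : Coind (trivAct k H.carrier)} (ha : IsHomog a i)
    (f : Coind (trivAct k H.carrier)) :
    integral F (smulA (envι k p x • a) f) =
      -(sgn k (j * i) * integral F (smulA a (envι k p x • f + smulA (divOf F dd j x) f))) := by
  have h := hdd.integral_act hx (smulA a f)
  rw [ι_smul_smulA hx ha, smulA_left_comm (hdd.divOf_mem hx) ha, add_assoc, ← smul_add,
    ← smulA_add, map_add, map_smul] at h
  exact eq_neg_of_add_eq_zero_left h

end Partials

/-! ### The divergence at the origin is `-strad` -/

section Divergence

variable {k : Type*} {p : ℕ} {g : Type*} [Field k] [AddCommGroup g] [Module k g]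
  [LieSuperalgebra k g] [RestrictedLieSuperalgebra k p g] {H : RestrictedSubalgebra k p g}
  {n m : ℕ} [Fact p.Prime] [CharP k p] [Fact (2 < p)] {F : Frame H n m}

/-- Coordinates vanish on `h`, which acts trivially on `k`; on `g/h` they form the basis dual to the
frame. -/
theorem coord_apply_ι (i : Fin n ⊕ Fin m) (z : g) :
    (coord F i).1 (envι k p z) = F.quotBasis.repr (H.carrier.mkQ z) i := by
  have h0 : ∀ x ∈ H.carrier, (coord F i).1 (envι k p x) = 0 := fun x hx => by
    have := (coord F i).2 ⟨x, hx⟩ 1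
    rw [mul_one] at this
    rw [this]
    rfl
  have h : H.carrier.liftQ ((coord F i).1 ∘ₗ envι k p) (fun x hx => h0 x hx) =
      F.quotBasis.coord i := F.quotBasis.ext fun j => by
    have h1 : (H.carrier.liftQ ((coord F i).1 ∘ₗ envι k p) fun x hx => h0 x hx)
        (H.carrier.mkQ (F.vec j)) = (coord F i).1 (envι k p (F.vec j)) := rfl
    rw [Module.Basis.coord_apply, Module.Basis.repr_self, Frame.quotBasis_apply, h1,
      coord_apply_vec]
    simp [Finsupp.single_apply, eq_comm]
  exact LinearMap.congr_fun h (H.carrier.mkQ z)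

theorem quotBasis_repr_parity (i : Fin n ⊕ Fin m) (z : g ⧸ H.carrier) :
    F.quotBasis.repr (parityQuot H z) i = sgn k (frameDeg n m i) * F.quotBasis.repr z i := by
  have h : F.quotBasis.coord i ∘ₗ parityQuot H = sgn k (frameDeg n m i) • F.quotBasis.coord i :=
    F.quotBasis.ext fun j => by
      have h1 : parityQuot H (F.quotBasis j) = sgn k (frameDeg n m j) • F.quotBasis j := by
        rw [Frame.quotBasis_apply, Submodule.mkQ_apply, parityQuot, Submodule.mapQ_apply,
          mem_homog.mp (F.vec_mem j)]
        rfl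
      rw [LinearMap.comp_apply, h1, map_smul, LinearMap.smul_apply]
      simp only [Module.Basis.coord_apply, Module.Basis.repr_self, Finsupp.single_apply]
      split_ifs with hij
      · rw [hij]
      · simp
  exact LinearMap.congr_fun h z

/-- At `1` the derivative `∂_i(δ_x x_i)` is the value of `x_i` on `e_i x`. For `x` in `h` the
coordinate kills `x e_i`, so this is the `i`-th coordinate of `[e_i, x]` modulo `h`, and the signed
sum is a supertrace. -/
theorem IsPartialFamily.divOf_apply_one {dd : Fin n ⊕ Fin m → Coind (trivAct k H.carrier) →ₗ[k]
    Coind (trivAct k H.carrier)} (hdd : IsPartialFamily F dd) {j : ZMod 2} {x : H.carrier}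
    (hx : x ∈ homog k H.carrier j) : (divOf F dd j (x : g)).1 1 = -strad H x := by
  have hx' := (coe_mem_homog H).mpr hx
  have h1 : strad H x = ∑ i, sgn k (frameDeg n m i) *
      F.quotBasis.repr (H.carrier.mkQ (br (k := k) (x : g) (F.vec i))) i := by
    rw [strad, LinearMap.comp_apply, LinearMap.comp_apply,
      LinearMap.trace_eq_matrix_trace k F.quotBasis, Matrix.trace]
    refine Finset.sum_congr rfl fun i _ => ?_
    rw [Matrix.diag_apply, LinearMap.toMatrix_apply, LinearMap.mulLeft_apply,
      Module.End.mul_apply, quotBasis_repr_parity, Frame.quotBasis_apply]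
    rfl
  rw [h1, divOf, Submodule.coe_sum, LinearMap.sum_apply, ← Finset.sum_neg_distrib]
  refine Finset.sum_congr rfl fun i _ => ?_
  rw [Submodule.coe_smul, LinearMap.smul_apply, hdd.apply_one, coind_smul_apply, smul_eq_mul]
  have h2 := envι_br (p := p) _ _ _ _ (F.vec_mem i) hx'
  have h3 : (coord F i).1 (envι k p (x : g) * envι k p (F.vec i)) = 0 := (coord F i).2 x _
  have h4 : (coord F i).1 (envι k p (F.vec i) * envι k p (x : g)) =
      (coord F i).1 (envι k p (br (k := k) (F.vec i) (x : g))) := by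
    rw [h2, map_sub, map_smul, h3, smul_zero, sub_zero]
  rw [h4, br_skew (F.vec_mem i) hx', map_neg, map_neg, map_smul, map_smul,
    coord_apply_ι, smul_eq_mul, mul_neg, ← mul_assoc, mul_add, mul_one, ← sgn_add, add_right_comm]
  have two : ∀ a : ZMod 2, a + a = 0 := by decide
  rw [two, zero_add]

end Divergence

/-! ### The antipode as a super-anti-automorphism and involution -/

section Antipode

variable {k : Type*} {p : ℕ} {g : Type*} [Field k] [AddCommGroup g] [Module k g]
  [LieSuperalgebra k g] [RestrictedLieSuperalgebra k p g]

theorem proj_homog (i : ZMod 2) {V : Type*} [AddCommGroup V] [Module k V] [Superspace k V] (v : V) :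
    parity (k := k) (proj (k := k) i v) = proj (k := k) i (parity (k := k) v) := by
  simp [proj]

variable [Fact p.Prime] [CharP k p] [Fact (2 < p)]

@[simp] theorem antipode_one : antipode k p g 1 = 1 := by simp [antipode]

theorem rightAct_apply {j : ZMod 2} {x : g} (hx : x ∈ homog k g j) (u : Env k p g) :
    (rightAct (k := k) (p := p) (g := g)).act x u = -(tw k j u * envι k p x) := by
  have h2 := two_ne_zero_of_char k p
  rcases zmod_two_cases j with rfl | rfl <;> simp [rightAct, proj_of_mem h2 hx]

theorem antipode_ι_mul {j : ZMod 2} {x : g} (hx : x ∈ homog k g j) (u : Env k p g) :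
    antipode k p g (envι k p x * u) = -(tw k j (antipode k p g u) * envι k p x) := by
  rw [← rightAct_apply hx]
  simp [antipode, SuperAction.toEnv]

theorem parity_antipode (u : Env k p g) :
    parity (k := k) (antipode k p g u) = antipode k p g (parity (k := k) u) := by
  have h2 := two_ne_zero_of_char k p
  induction u using env_induction_homog h2 with
  | one => simp [parity_env_one]
  | add u v hu hv => simp [hu, hv]
  | smul c u hu => simp [hu]
  | ι_mul j x hx u hu =>
    rw [antipode_ι_mul hx, map_neg, parity_env_mul, parity_tw, hu, parity_env_mul, parity_env_ι,
      antipode_ι_mul (parity_mem_homog hx)]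

theorem tw_antipode (i : ZMod 2) (u : Env k p g) :
    tw k i (antipode k p g u) = antipode k p g (tw k i u) := by
  rcases zmod_two_cases i with rfl | rfl <;> simp [parity_antipode]

theorem antipode_mul_ι {j : ZMod 2} {x : g} (hx : x ∈ homog k g j) (u : Env k p g) :
    antipode k p g (u * envι k p x) = -(envι k p x * antipode k p g (tw k j u)) := by
  have h2 := two_ne_zero_of_char k p
  induction u using env_induction_homog h2 with
  | one =>
    have := antipode_ι_mul hx (1 : Env k p g)
    rw [mul_one] at this
    rw [one_mul, this, antipode_one, tw_env_one, antipode_one, one_mul, mul_one]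
  | add u v hu hv => rw [add_mul, map_add, hu, hv, map_add, map_add, mul_add, neg_add]
  | smul c u hu => rw [smul_mul_assoc, map_smul, hu, map_smul, map_smul, mul_smul_comm, smul_neg]
  | ι_mul i y hy u hu =>
    rw [mul_assoc, antipode_ι_mul hy, hu, map_neg, tw_env_mul, tw_antipode, tw_env_mul,
      tw_envι hx, tw_envι hy, smul_mul_assoc, smul_mul_assoc, map_smul, antipode_ι_mul hy, tw_antipode,
      neg_mul, smul_mul_assoc, mul_assoc, smul_neg, mul_neg, mul_smul_comm, mul_comm i j]

theorem antipode_antipode (u : Env k p g) : antipode k p g (antipode k p g u) = u := by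
  have h2 := two_ne_zero_of_char k p
  induction u using env_induction_homog h2 with
  | one => simp
  | add u v hu hv => simp [hu, hv]
  | smul c u hu => simp [hu]
  | ι_mul j x hx u hu =>
    rw [antipode_ι_mul hx, map_neg, antipode_mul_ι hx, tw_tw_self, hu, neg_neg]

end Antipode

/-! ### The line spanned by the top monomial -/

section Volume

variable {k : Type*} {p : ℕ} {g : Type*} [Field k] [AddCommGroup g] [Module k g]
  [LieSuperalgebra k g] [RestrictedLieSuperalgebra k p g] {H : RestrictedSubalgebra k p g}
  {W : Type*} [AddCommGroup W] [Module k W] [Superspace k W]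
  {ρ : SuperAction k H.carrier W} {n m : ℕ}
  [Fact p.Prime] [CharP k p] [Fact (2 < p)] {F : Frame H n m}

theorem strad_odd {x : H.carrier} (hx : x ∈ homog k H.carrier 1) : strad H x = 0 := by
  have h2 := two_ne_zero_of_char k p
  have h := strad_parity H x
  rw [mem_homog.mp hx, map_smul, sgn_one, neg_smul, one_smul] at h
  have : (2 : k) * strad H x = 0 := by linear_combination -h
  exact (mul_eq_zero.mp this).resolve_left h2

theorem carrier_smul_apply_one (x : H.carrier) (f : Coind (trivAct k H.carrier)) :
    (envι k p (x : g) • f).1 1 = 0 := by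
  have := f.2 x 1
  rw [coind_smul_apply, one_mul, ← mul_one (envι k p (x : g)), this]
  rfl

/-- `x` in `h` preserves the elements of `A` that vanish at `1`, and these kill `Λ`; hence every
coordinate kills `x Λ`, which is therefore a multiple of `Λ`. The factor follows from `∫ (x Λ +
div(δ_x) Λ) = 0`, since `Λ` sees only the value `-strad(x)` of the divergence at `1`. -/
theorem smul_topMonomial_of_mem {j : ZMod 2} {x : H.carrier} (hx : x ∈ homog k H.carrier j) :
    envι k p (x : g) • topMonomial F = strad H x • topMonomial F := by
  obtain ⟨dd, hdd⟩ := exists_isPartialFamily F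
  have hx' := (coe_mem_homog H).mpr hx
  have hz : ∀ i, smulA (coord F i) (envι k p (x : g) • topMonomial F) = 0 := fun i => by
    have h1 := ι_smul_smulA hx' (topMonomial_mem F) (coord F i)
    have h2 := ι_smul_smulA hx' (coord_mem F i) (topMonomial F)
    have h3 : smulA (coord F i) (topMonomial F) = 0 := by
      rw [smulA_comm (coord_mem F i) (topMonomial_mem F), topMonomial_smulA, coord_apply_one,
        zero_smul, smul_zero]
    have h4 : smulA (envι k p (x : g) • coord F i) (topMonomial F) = 0 := by
      rw [smulA_comm (isHomog_smul hx' (coord_mem F i)) (topMonomial_mem F), topMonomial_smulA,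
        carrier_smul_apply_one, zero_smul, smul_zero]
    rw [h3, h4, smul_zero, zero_add] at h2
    have := congrArg (fun f => sgn k (j * frameDeg n m i) • f) h2.symm
    rwa [smul_smul, sgn_mul_self, one_smul, smul_zero] at this
  rw [eq_smul_topMonomial F hz]
  congr 1
  have h := hdd.integral_act hx' (topMonomial F)
  rw [smulA_comm (hdd.divOf_mem hx') (topMonomial_mem F), topMonomial_smulA,
    hdd.divOf_apply_one hx, map_add, LinearMap.map_smul, LinearMap.map_smul,
    integral_topMonomial] at h
  rcases zmod_two_cases j with rfl | rfl
  · rw [zero_mul, sgn_zero] at h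
    simp only [smul_eq_mul] at h
    linear_combination h
  · rw [strad_odd hx] at h ⊢
    simpa using h

theorem smul_topMonomial (x : H.carrier) :
    envι k p (x : g) • topMonomial F = strad H x • topMonomial F := by
  have h2 := two_ne_zero_of_char k p
  refine homog_induction (P := fun x : H.carrier => envι k p (x : g) • topMonomial F =
    strad H x • topMonomial F) h2 (fun x y hx hy => ?_) (fun j x hx => smul_topMonomial_of_mem hx) x
  rw [Submodule.coe_add, map_add, add_smul, hx, hy, map_add, add_smul]

theorem integral_of_mem {i : ZMod 2} {f : Coind (trivAct k H.carrier)} (hf : IsHomog f i)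
    (hi : i ≠ m) : integral F f = 0 := by
  have h2 := two_ne_zero_of_char k p
  rw [integral_apply]
  have h1 := apply_mem_homog hf (envWord_mem F.vec_mem (topWord p n m))
  have h4 := apply_mem_homog (topMonomial_mem F) (envWord_mem F.vec_mem (topWord p n m))
  have key : ∀ (a : ZMod 2) (c : k), c ∈ homog k k a → a ≠ 0 → c = 0 := fun a c hc ha => by
    rcases zmod_two_cases a with rfl | rfl
    · exact absurd rfl ha
    · rw [mem_homog, parity_field, sgn_one, neg_smul, one_smul] at hc
      have : (2 : k) * c = 0 := by linear_combination hc
      exact (mul_eq_zero.mp this).resolve_left h2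
  have h5 : (m : ZMod 2) + ((topWord p n m).map (frameDeg n m)).sum = 0 := by
    by_contra hne
    exact topCoeff_ne_zero F (key _ _ h4 hne)
  rw [key _ _ h1, mul_zero]
  intro h6
  exact hi (add_right_cancel (h6.trans h5.symm))

variable (F) in
/-- The form `u ↦ ∫ (ǔ Λ) f`, up to sign. -/
def berForm : Coind (trivAct k H.carrier) →ₗ[k] Env k p g →ₗ[k] k :=
  LinearMap.mk₂ k
    (fun f u => integral F (smulA (antipode k p g (tw k (m : ZMod 2) u) • topMonomial F) f))
    (fun f f' u => by rw [smulA_add, map_add])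
    (fun c f u => by rw [smulA_smul, map_smul])
    (fun f u v => by rw [map_add, map_add, add_smul, add_smulA, map_add])
    (fun c f u => by rw [map_smul, map_smul, smul_assoc, smul_smulA, map_smul])

theorem berForm_apply (f : Coind (trivAct k H.carrier)) (u : Env k p g) : berForm F f u =
    integral F (smulA (antipode k p g (tw k (m : ZMod 2) u) • topMonomial F) f) := rfl

theorem isHomog_env_smul {i j : ZMod 2} {u : Env k p g} (hu : u ∈ homog k (Env k p g) j)
    {f : Coind ρ} (hf : IsHomog f i) : IsHomog (u • f) (j + i) := by
  rw [isHomog_iff, mem_homog] at *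
  have h : ∀ (u : Env k p g) (f : Coind ρ), parity (k := k) (u • f) =
      parity (k := k) u • parity (k := k) f := fun u f =>
    Subtype.ext (LinearMap.ext fun w => by
      change parity (k := k) (f.1 (parity (k := k) w * u)) =
        parity (k := k) (f.1 (parity (k := k) (w * parity (k := k) u)))
      rw [parity_env_mul, parity_parity])
  rw [h, hu, hf, sgn_add, smul_assoc, ← smul_smul]
  congr 1

theorem antipode_mem {j : ZMod 2} {u : Env k p g} (hu : u ∈ homog k (Env k p g) j) :
    antipode k p g u ∈ homog k (Env k p g) j := by
  rw [mem_homog] at *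
  rw [parity_antipode, hu, map_smul]

end Volume

/-! ### The isomorphism `χ` from the Berezinian module -/

section Berezinian

variable {k : Type*} {p : ℕ} {g : Type*} [Field k] [AddCommGroup g] [Module k g]
  [LieSuperalgebra k g] [RestrictedLieSuperalgebra k p g] {H : RestrictedSubalgebra k p g}
  {n m : ℕ} [Fact p.Prime] [CharP k p] [Fact (2 < p)] {F : Frame H n m}
  {dd : Fin n ⊕ Fin m → Coind (trivAct k H.carrier) →ₗ[k] Coind (trivAct k H.carrier)}

theorem env_neg_smul {W : Type*} [AddCommGroup W] [Module k W] [Superspace k W]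
    {ρ : SuperAction k H.carrier W} (u : Env k p g) (f : Coind ρ) : (-u) • f = -(u • f) :=
  Subtype.ext (LinearMap.ext fun w => by
    change f.1 (w * -u) = -f.1 (w * u)
    rw [mul_neg, map_neg])

theorem coind_map_neg {W Q : Type*} [AddCommGroup W] [Module k W] [Superspace k W]
    [AddCommGroup Q] [Module k Q] {ρ : SuperAction k H.carrier W} (T : Coind ρ →ₗ[k] Q)
    (f : Coind ρ) : T (-f) = -T f := map_neg T f

/-- Under the antipode `x` becomes the outermost operator on `Λ`; integration by parts moves it to
`f`, where it acts by the Lie derivative. -/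
theorem berForm_mul_ι (hdd : IsPartialFamily F dd) {j : ZMod 2} {x : g} (hx : x ∈ homog k g j)
    (f : Coind (trivAct k H.carrier)) (u : Env k p g) :
    berForm F f (u * envι k p x) =
      berForm F (envι k p x • f + smulA (divOf F dd j x) f) u := by
  have h2 := two_ne_zero_of_char k p
  refine homog_induction (P := fun u => berForm F f (u * envι k p x) =
      berForm F (envι k p x • f + smulA (divOf F dd j x) f) u) h2
    (fun u v hu hv => by rw [add_mul, map_add, hu, hv]; exact (map_add _ _ _).symm) (fun i u hu => ?_) u
  have hm := isHomog_env_smul (antipode_mem (tw_mem (i := (m : ZMod 2)) hu)) (topMonomial_mem F)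
  rw [berForm_apply, berForm_apply, tw_env_mul, tw_envι hx, mul_smul_comm, map_smul,
    antipode_mul_ι hx, tw_of_mem (i := j) (tw_mem (i := (m : ZMod 2)) hu), map_smul,
    mul_smul_comm, smul_neg, smul_smul, env_neg_smul, smul_assoc, mul_smul (envι k p x), neg_smulA, coind_map_neg,
    smul_smulA, LinearMap.map_smul, hdd.integral_smulA hx hm, smul_eq_mul, mul_neg, neg_neg, ← mul_assoc]
  -- The sign `(-1)^{m|u|}` in `berForm` is there to make these three signs cancel.
  have : sgn k ((m : ZMod 2) * j) * sgn k (j * i) * sgn k (j * (i + m)) = 1 := by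
    rw [← sgn_add, ← sgn_add]
    have : ∀ a b c : ZMod 2, a * b + b * c + b * (c + a) = 0 := by decide
    rw [this, sgn_zero]
  rw [this, one_mul]

/-- The antipode puts `x` next to `Λ`, where it acts by `strad(x)`; the minus sign is that of the
antipode. For odd `x` both sides vanish. -/
theorem berForm_ι_mul (x : H.carrier) (f : Coind (trivAct k H.carrier)) (u : Env k p g) :
    berForm F f (envι k p (x : g) * u) = -strad H x * berForm F f u := by
  have h2 := two_ne_zero_of_char k p
  refine homog_induction (P := fun x : H.carrier => berForm F f (envι k p (x : g) * u) =
    -strad H x * berForm F f u) h2 (fun x y hx hy => ?_) (fun j x hx => ?_) x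
  · rw [Submodule.coe_add, map_add, add_mul, map_add, hx, hy, map_add]
    ring
  · have hx' := (coe_mem_homog H).mpr hx
    rw [berForm_apply, berForm_apply, tw_env_mul, tw_envι hx', smul_mul_assoc, map_smul,
      antipode_ι_mul hx', smul_neg, env_neg_smul, smul_assoc, mul_smul, smul_topMonomial]
    have h3 : tw k j (antipode k p g (tw k (m : ZMod 2) u)) • strad H x • topMonomial F =
        strad H x • (tw k j (antipode k p g (tw k (m : ZMod 2) u)) • topMonomial F) :=
      map_smul (actₗ (trivAct k H.carrier) _) _ _
    rw [h3, neg_smulA, coind_map_neg, smul_smulA, smul_smulA, LinearMap.map_smul, LinearMap.map_smul]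
    rcases zmod_two_cases j with rfl | rfl
    · simp
    · simp [strad_odd hx]

theorem berForm_one (f : Coind (trivAct k H.carrier)) : berForm F f 1 = f.1 1 := by
  rw [berForm_apply, tw_env_one, antipode_one, one_smul, topMonomial_smulA, LinearMap.map_smul,
    integral_topMonomial, smul_eq_mul, mul_one]

theorem berForm_parity (u : Env k p g) :
    berForm F (oneA H) (parity (k := k) u) = berForm F (oneA H) u := by
  have h2 := two_ne_zero_of_char k p
  refine homog_induction (P := fun u => berForm F (oneA H) (parity (k := k) u) =
      berForm F (oneA H) u) h2
    (fun u v hu hv => by simp only [map_add, hu, hv]) (fun i u hu => ?_) u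
  rcases zmod_two_cases i with rfl | rfl
  · rw [mem_homog.mp hu, sgn_zero, one_smul]
  · have h3 : berForm F (oneA H) u = 0 := by
      rw [berForm_apply, smulA_oneA]
      refine integral_of_mem
        (isHomog_env_smul (antipode_mem (tw_mem (i := (m : ZMod 2)) hu)) (topMonomial_mem F)) ?_
      simp
    rw [mem_homog.mp hu, map_smul, h3, smul_zero]

variable (F) in
/-- The map `χ` from the Berezinian module to the coinduced module. -/
def berMap : Coind (trivAct k H.carrier) →ₗ[k] Coind (negStradAct H m) :=
  LinearMap.codRestrict _
    (LinearMap.compRight k (LinearMap.toSpanSingleton k (Line k m) (lineGen k m)) ∘ₗ berForm F)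
    fun f x u => by
      change berForm F f _ • lineGen k m = (-strad H) x • (berForm F f u • lineGen k m)
      rw [berForm_ι_mul, smul_smul]
      rfl

theorem berMap_apply (f : Coind (trivAct k H.carrier)) (u : Env k p g) :
    (berMap F f).1 u = berForm F f u • lineGen k m := rfl

theorem ι_smul_berMap (hdd : IsPartialFamily F dd) {j : ZMod 2} {x : g} (hx : x ∈ homog k g j)
    (f : Coind (trivAct k H.carrier)) : envι k p x • berMap F f =
      berMap F (envι k p x • f + smulA (divOf F dd j x) f) :=
  Subtype.ext (LinearMap.ext fun u => by
    rw [coind_smul_apply, berMap_apply, berForm_mul_ι hdd hx, berMap_apply])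

/-- Both sides have the value `a(1) f(1)` at `1`, and they change in the same way under right
multiplication, since the Lie derivative obeys the Leibniz rule for the product by `a`. -/
theorem berMap_smulA (a f : Coind (trivAct k H.carrier)) :
    berMap F (smulA a f) = smulA a (berMap F f) := by
  have h2 := two_ne_zero_of_char k p
  obtain ⟨dd, hdd⟩ := exists_isPartialFamily F
  refine Subtype.ext (LinearMap.ext fun u => ?_)
  induction u using env_induction_right_homog h2 generalizing a f with
  | one =>
    rw [smulA_one_apply, berMap_apply, berMap_apply, berForm_one, berForm_one, smulA_one_apply,
      smul_smul]
    rfl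
  | add u v hu hv => rw [map_add, map_add, hu, hv]
  | smul c u hu => rw [map_smul, map_smul, hu]
  | mul_ι j x hx u hu =>
    refine coind_homog_induction (P := fun a => (berMap F (smulA a f)).1 (u * envι k p x) =
      (smulA a (berMap F f)).1 (u * envι k p x)) (fun a b ha hb => ?_) (fun i a ha => ?_) a
    · rw [add_smulA, add_smulA, map_add, Submodule.coe_add, Submodule.coe_add, LinearMap.add_apply,
        LinearMap.add_apply, ha, hb]
    · have h1 : envι k p x • smulA a f + smulA (divOf F dd j x) (smulA a f) =
          smulA (envι k p x • a) f +
            sgn k (j * i) • smulA a (envι k p x • f + smulA (divOf F dd j x) f) := by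
        rw [ι_smul_smulA hx ha, smulA_left_comm (hdd.divOf_mem hx) ha, add_assoc, ← smul_add,
          ← smulA_add]
      rw [← coind_smul_apply, ← coind_smul_apply, ι_smul_berMap hdd hx, h1, ι_smul_smulA hx ha,
        ι_smul_berMap hdd hx, map_add, LinearMap.map_smul, Submodule.coe_add, Submodule.coe_add,
        Submodule.coe_smul, Submodule.coe_smul, LinearMap.add_apply, LinearMap.add_apply,
        LinearMap.smul_apply, LinearMap.smul_apply, hu, hu]

theorem berMap_oneA_one : (berMap F (oneA H)).1 1 = lineGen k m := by
  rw [berMap_apply, berForm_one, oneA_apply_one, one_smul]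

theorem parity_line (c : Line k m) : parity (k := k) c = sgn k (m : ZMod 2) • c := by
  have : ∀ m : ℕ, (-1 : k) ^ m = sgn k (m : ZMod 2) := fun m => by
    induction m with
    | zero => simp
    | succ m ih =>
      rw [pow_succ, ih, Nat.cast_succ, sgn_add, sgn_one]
  rw [← this]
  rfl

theorem berMap_oneA_mem : IsHomog (berMap F (oneA H)) (m : ZMod 2) := by
  rw [IsHomog, mem_homog]
  ext u
  rw [parity_hom, berMap_apply, berForm_parity, parity_line]
  rfl

theorem berMap_eq (f : Coind (trivAct k H.carrier)) :
    berMap F f = smulA f (berMap F (oneA H)) := by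
  rw [← berMap_smulA, smulA_oneA]

/-- The map is `f ↦ f χ(ω)` and `χ(ω)` takes the generator as its value at `1`, so it is triangular.
-/
theorem berMap_bijective : Function.Bijective (berMap F) := by
  refine coind_bijective_of_triangular F trivAct_isRestricted (berMap F)
    (LinearMap.toSpanSingleton k (Line k m) (lineGen k m)) ?_ fun f l hl h => ?_
  · have : LinearMap.toSpanSingleton k (Line k m) (lineGen k m) = LinearMap.id (R := k) (M := k) :=
      LinearMap.ext fun c => mul_one c
    rw [this]
    exact Function.bijective_id
  · rw [berMap_eq, coe_smulA, conv_envWord_eq_left _ F.vec_mem, berMap_oneA_one]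
    · rfl
    · intro l₁ h₁ h₂
      exact h l₁ (hl.sublist h₁) h₂

theorem divergence_eq {d : Fin n → Coind (trivAct k H.carrier) →ₗ[k] Coind (trivAct k H.carrier)}
    {d' : Fin m → Coind (trivAct k H.carrier) →ₗ[k] Coind (trivAct k H.carrier)} {j : ZMod 2}
    {x : g} (hx : x ∈ homog k g j) :
    divergence F d d' x = divOf F (Sum.elim d d') j x := by
  have h1 : ∀ s, d' s (envι k p (parity (k := k) x) • zeta F s) =
      sgn k j • d' s (envι k p x • zeta F s) := fun s => by
    rw [mem_homog.mp hx, (envι k p).map_smul, smul_assoc, LinearMap.map_smul]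
  rw [divergence, divOf, Fintype.sum_sum_type]
  refine (sub_eq_add_neg (G := Coind (trivAct k H.carrier)) _ _).trans ?_
  refine congrArg₂ (· + ·) (Finset.sum_congr rfl fun i _ => ?_)
    ((Finset.sum_neg_distrib (G := Coind (trivAct k H.carrier)) _).symm.trans
      (Finset.sum_congr rfl fun s _ => ?_))
  · have : frameDeg n m (Sum.inl i) = 0 := rfl
    rw [this, zero_mul, sgn_zero, one_smul]
    rfl
  · have : frameDeg n m (Sum.inr s) = 1 := rfl
    rw [this, one_mul, h1, sgn_add, sgn_one, mul_neg, mul_one]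
    exact (neg_smul (M := Coind (trivAct k H.carrier)) _ _).symm

variable (F) in
/-- The isomorphism `χ`. -/
def berEquiv : Coind (trivAct k H.carrier) ≃ₗ[k] Coind (negStradAct H m) :=
  LinearEquiv.ofBijective (berMap F) berMap_bijective

theorem isBerezinianIso
    {d : Fin n → Coind (trivAct k H.carrier) →ₗ[k] Coind (trivAct k H.carrier)}
    {d' : Fin m → Coind (trivAct k H.carrier) →ₗ[k] Coind (trivAct k H.carrier)}
    (hdd : IsPartialFamily F (Sum.elim d d')) : IsBerezinianIso F d d' (berEquiv F) where
  map_smulA a f := berMap_smulA a f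
  map_lieDerivative i j x hx f hf := by
    change berMap F _ = envι k p x • berMap F f
    rw [ι_smul_berMap hdd hx, lieDerivative, divergence_eq hx, smulA_comm (hdd.divOf_mem hx) hf]
  one_apply_one := berMap_oneA_one

theorem IsPartialFamily.isPartials (hdd : IsPartialFamily F dd) :
    IsPartials F (fun i => dd (Sum.inl i)) (fun s => dd (Sum.inr s)) where
  even i := hdd.der (Sum.inl i)
  odd s := hdd.der (Sum.inr s)
  even_eta i j := (hdd.apply_coord (Sum.inl i) (Sum.inl j)).trans (by simp)
  even_zeta i t := (hdd.apply_coord (Sum.inl i) (Sum.inr t)).trans (by simp)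
  odd_eta s j := (hdd.apply_coord (Sum.inr s) (Sum.inl j)).trans (by simp)
  odd_zeta s t := (hdd.apply_coord (Sum.inr s) (Sum.inr t)).trans (by simp)

end Berezinian

/-! ### The morphism `Φ` -/

section Induced

variable {k : Type*} {p : ℕ} {g : Type*} [Field k] [AddCommGroup g] [Module k g]
  [LieSuperalgebra k g] [RestrictedLieSuperalgebra k p g] {H : RestrictedSubalgebra k p g}
  {V W : Type*} [AddCommGroup V] [Module k V] [Superspace k V]
  [AddCommGroup W] [Module k W] [Superspace k W]

theorem tensorAct_apply {L : Type*} [AddCommGroup L] [Module k L] [Superspace k L]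
    (h2 : (2 : k) ≠ 0) (π : SuperAction k L V) (ρ : SuperAction k L W) {j : ZMod 2} {x : L}
    (hx : x ∈ homog k L j) (v : V) (w : W) : (tensorAct π ρ).act x (v ⊗ₜ w) =
      π.act x v ⊗ₜ w + tw k j v ⊗ₜ ρ.act x w := by
  rcases zmod_two_cases j with rfl | rfl <;> simp [tensorAct, proj_of_mem h2 hx]

theorem dualAct_apply {L : Type*} [AddCommGroup L] [Module k L] [Superspace k L]
    (h2 : (2 : k) ≠ 0) (π : SuperAction k L V) {j : ZMod 2} {x : L}
    (hx : x ∈ homog k L j) (f : Module.Dual k V) (v : V) :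
    (dualAct π).act x f v = -(tw k j f (π.act x v)) := by
  rcases zmod_two_cases j with rfl | rfl <;> simp [dualAct, proj_of_mem h2 hx]

theorem lineAct_apply {L : Type*} [AddCommGroup L] [Module k L] [Superspace k L] (m : ℕ)
    (χ : L →ₗ[k] k) (hχ) (x : L) (c : Line k m) : (lineAct m χ hχ).act x c = χ x • c := rfl

theorem tw_line {m : ℕ} (j : ZMod 2) (c : Line k m) : tw k j c = sgn k (j * m) • c :=
  tw_of_mem (mem_homog.mpr (parity_line c))

/-- The linear map from the induced representation defined by a morphism of `h`-modules. -/
def indLift {ρ : SuperAction k H.carrier W} {π : SuperAction k H.carrier V}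
    (b : W →ₗ[k] Coind π) (hb : ∀ (x : H.carrier) w, envι k p (x : g) • b w = b (ρ.act x w)) :
    Ind ρ →ₗ[Env k p g] Coind π :=
  (indRel ρ).liftQ (TensorProduct.AlgebraTensorModule.lift
    (LinearMap.toSpanSingleton (Env k p g) (W →ₗ[k] Coind π) b)) (by
      rw [indRel, Submodule.span_le]
      rintro _ ⟨u, x, w, rfl⟩
      rw [SetLike.mem_coe, LinearMap.mem_ker]
      refine (map_sub _ _ _).trans (sub_eq_zero.mpr ?_)
      simp only [TensorProduct.AlgebraTensorModule.lift_tmul, LinearMap.toSpanSingleton_apply,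
        LinearMap.smul_apply]
      rw [mul_smul, hb])

variable {n m : ℕ} [Fact p.Prime] [CharP k p] [Fact (2 < p)] (F : Frame H n m)
  {π : SuperAction k H.carrier V}

/-- The map `c ⊗ v ↦ c Λ v̂`. -/
def topHat (hπ : π.IsRestricted p) : Line k m ⊗[k] V →ₗ[k] Coind π :=
  smulAₗ π (topMonomial F) ∘ₗ hatₗ F hπ ∘ₗ (TensorProduct.lid k V).toLinearMap ∘ₗ
    TensorProduct.map (lineCoord k m) LinearMap.id

theorem topHat_tmul (hπ : π.IsRestricted p) (c : Line k m) (v : V) :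
    topHat F hπ (c ⊗ₜ v) = lineCoord k m c • smulA (topMonomial F) (hat F π v) := by
  simp [topHat]

/-- `x v̂` and the hat of `x v` have the same value at `1`, and `Λ` sees nothing else. So `Λ v̂`
transforms under `h` like `Λ ⊗ v` in `Π^m k_strad ⊗ π`. -/
theorem ι_smul_topMonomial_hat (hπ : π.IsRestricted p) {j : ZMod 2} {x : H.carrier}
    (hx : x ∈ homog k H.carrier j) (v : V) :
    envι k p (x : g) • smulA (topMonomial F) (hat F π v) =
      strad H x • smulA (topMonomial F) (hat F π v) +
        sgn k (j * m) • smulA (topMonomial F) (hat F π (π.act x v)) := by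
  rw [ι_smul_smulA ((coe_mem_homog H).mpr hx) (topMonomial_mem F), smul_topMonomial, smul_smulA]
  congr 2
  have h : (envι k p (x : g) • hat F π v - hat F π (π.act x v)).1 1 = 0 := by
    have h1 : (envι k p (x : g) • hat F π v).1 1 = π.act x v := by
      rw [coind_smul_apply, one_mul, ← mul_one (envι k p (x : g)), (hat F π v).2,
        hat_apply_one F hπ]
    have h2 := hat_apply_one F hπ (π.act x v)
    change (envι k p (x : g) • hat F π v).1 1 - (hat F π (π.act x v)).1 1 = 0
    rw [h1, h2, sub_self]
  have := topMonomial_smulA_eq_zero F h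
  rw [smulA_sub] at this
  exact sub_eq_zero.mp this

theorem ι_smul_topHat (hπ : π.IsRestricted p) (x : H.carrier) (w : Line k m ⊗[k] V) :
    envι k p (x : g) • topHat F hπ w = topHat F hπ ((twist m π).act x w) := by
  have h2 := two_ne_zero_of_char k p
  refine homog_induction (P := fun x : H.carrier => envι k p (x : g) • topHat F hπ w =
    topHat F hπ ((twist m π).act x w)) h2 (fun x y hx hy => ?_) (fun j x hx => ?_) x
  · rw [Submodule.coe_add, map_add, add_smul, hx, hy, map_add, LinearMap.add_apply, map_add]
  · induction w with
    | zero => simp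
    | add a b ha hb => rw [map_add, smul_add, ha, hb, map_add, map_add]
    | tmul c v =>
      have hs : envι k p (x : g) • (lineCoord k m c • smulA (topMonomial F) (hat F π v)) =
          lineCoord k m c • (envι k p (x : g) • smulA (topMonomial F) (hat F π v)) :=
        map_smul (actₗ π _) _ _
      rw [topHat_tmul, hs, ι_smul_topMonomial_hat F hπ hx, tensorAct_apply h2 _ _ hx, map_add,
        topHat_tmul, topHat_tmul, stradAct, lineAct_apply, tw_line, map_smul, map_smul, smul_add,
        smul_smul, smul_smul, smul_eq_mul, smul_eq_mul, mul_comm, mul_comm (lineCoord k m c)]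

/-- The morphism `Φ`. -/
def phi (hπ : π.IsRestricted p) : Ind (twist m π) →ₗ[Env k p g] Coind π :=
  indLift (topHat F hπ) (ι_smul_topHat F hπ)

theorem phi_indMk (hπ : π.IsRestricted p) (u : Env k p g) (w : Line k m ⊗[k] V) :
    phi F hπ (indMk (twist m π) u w) = u • topHat F hπ w := rfl

end Induced

/-! ### The form `Ψ` and its invariance -/

section Pairing

variable {k : Type*} {p : ℕ} {g : Type*} [Field k] [AddCommGroup g] [Module k g]
  [LieSuperalgebra k g] [RestrictedLieSuperalgebra k p g] {H : RestrictedSubalgebra k p g}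
  {U V : Type*} [AddCommGroup U] [Module k U] [Superspace k U] [AddCommGroup V] [Module k V]
  [Superspace k V] {n m : ℕ} [Fact p.Prime] [CharP k p] [Fact (2 < p)] {F : Frame H n m}
  {σ : SuperAction k H.carrier U} {π : SuperAction k H.carrier V}

variable (F) in
/-- The map `μ ↦ μ χ(ω)`. -/
def mulBer (σ : SuperAction k H.carrier U) : Coind σ →ₗ[k] Coind (tensorAct σ (negStradAct H m)) :=
  (cupₗ σ (negStradAct H m)).flip (berMap F (oneA H))

theorem mulBer_apply (μ : Coind σ) : mulBer F σ μ = cup μ (berMap F (oneA H)) := rfl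

theorem mulBer_mem {i : ZMod 2} {μ : Coind σ} (hμ : IsHomog μ i) :
    IsHomog (mulBer F σ μ) (i + m) := cup_mem hμ berMap_oneA_mem

theorem tmul_lineGen_bijective (U : Type*) [AddCommGroup U] [Module k U] :
    Function.Bijective ((TensorProduct.mk k U (Line k m)).flip (lineGen k m)) := by
  have h : (TensorProduct.mk k U (Line k m)).flip (lineGen k m) =
      (TensorProduct.rid k U).symm.toLinearMap := LinearMap.ext fun v => rfl
  rw [h]
  exact (TensorProduct.rid k U).symm.bijective

theorem mulBer_bijective (hσ : σ.IsRestricted p) : Function.Bijective (mulBer F σ) := by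
  refine coind_bijective_of_triangular F hσ (mulBer F σ)
    ((TensorProduct.mk k U (Line k m)).flip (lineGen k m))
    (tmul_lineGen_bijective _) fun f l hl h => ?_
  rw [mulBer_apply, coe_cup, conv_envWord_eq_left _ F.vec_mem, berMap_oneA_one]
  · rfl
  · intro l₁ h₁ h₂
    exact h l₁ (hl.sublist h₁) h₂

/-- Leibniz rule for `μ χ(ω)`, with `x χ(ω) = div(δ_x) χ(ω)` moved back to the left factor. -/
theorem ι_smul_mulBer {dd : Fin n ⊕ Fin m → Coind (trivAct k H.carrier) →ₗ[k]
    Coind (trivAct k H.carrier)} (hdd : IsPartialFamily F dd) {j : ZMod 2} {x : g}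
    (hx : x ∈ homog k g j) (μ : Coind σ) : envι k p x • mulBer F σ μ =
      mulBer F σ (envι k p x • μ + smulA (divOf F dd j x) μ) := by
  refine coind_homog_induction (P := fun μ => envι k p x • mulBer F σ μ =
      mulBer F σ (envι k p x • μ + smulA (divOf F dd j x) μ)) (fun μ ν hμ hν => ?_)
    (fun i μ hμ => ?_) μ
  · rw [map_add, smul_add, hμ, hν, ← map_add, smul_add, smulA_add]
    congr 1
    abel
  · rw [mulBer_apply, ι_smul_cup hx hμ, ι_smul_berMap hdd hx, ι_smul_oneA, smulA_oneA, zero_add,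
      berMap_eq (divOf F dd j x), cup_smulA_right (hdd.divOf_mem hx) hμ, smul_smul, sgn_mul_self, one_smul,
      ← cup_smulA_left, map_add]
    rfl

/-- The isomorphism `μ ↦ μ χ(ω)`. -/
def mulBerEquiv (F : Frame H n m) (hπ : π.IsRestricted p) :
    Coind (dualAct π) ≃ₗ[k] Coind (dualTwist m π) :=
  LinearEquiv.ofBijective (mulBer F (dualAct π)) (mulBer_bijective (dualAct_isRestricted hπ))

/-- The form `Ψ`. -/
def psi (F : Frame H n m) (hπ : π.IsRestricted p) :
    Coind π →ₗ[k] Coind (dualTwist m π) →ₗ[k] k :=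
  ((coindPairₗ π).compr₂ (integral F)).compl₂ (mulBerEquiv F hπ).symm.toLinearMap

theorem psi_mulBer (hπ : π.IsRestricted p) (f : Coind π) (μ : Coind (dualAct π)) :
    psi F hπ f (mulBer F (dualAct π) μ) = integral F (coindPair f μ) := by
  have : (mulBerEquiv F hπ).symm (mulBer F (dualAct π) μ) = μ := (mulBerEquiv F hπ).symm_apply_apply μ
  simp only [psi, LinearMap.compl₂_apply, LinearEquiv.coe_coe, this]
  rfl

/-- The integral of the Lie derivative of `⟨f, μ⟩ ω` vanishes. Its three terms are `x` acting on
`f`, `x` acting on `μ`, and the divergence, which belongs to the action on `μ χ(ω)`. -/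
theorem psi_invariant (hπ : π.IsRestricted p) {i j : ZMod 2} {x : g} (hx : x ∈ homog k g j)
    {f : Coind π} (hf : IsHomog f i) (μ : Coind (dualTwist m π)) :
    psi F hπ (envι k p x • f) μ = -(sgn k (j * i) * psi F hπ f (actₗ (dualTwist m π) (envι k p x) μ)) := by
  obtain ⟨dd, hdd⟩ := exists_isPartialFamily F
  obtain ⟨μ, rfl⟩ := (mulBer_bijective (F := F) (dualAct_isRestricted hπ)).2 μ
  have h0 : actₗ (dualTwist m π) (envι k p x) (mulBer F (dualAct π) μ) =
      mulBer F (dualAct π) (envι k p x • μ + smulA (divOf F dd j x) μ) := ι_smul_mulBer hdd hx μ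
  rw [h0, psi_mulBer, psi_mulBer]
  have h := hdd.integral_act hx (coindPair f μ)
  have h1 : coindPair f (envι k p x • μ + smulA (divOf F dd j x) μ) =
      coindPair f (envι k p x • μ) + coindPair f (smulA (divOf F dd j x) μ) :=
    map_add (coindPairₗ π f) _ _
  have h3 : smulA (divOf F dd j x) (coindPair f μ) =
      sgn k (j * i) • coindPair f (smulA (divOf F dd j x) μ) := by
    rw [coindPair_smulA_right (hdd.divOf_mem hx) hf, smul_smul, sgn_mul_self, one_smul]
  rw [ι_smul_coindPair hx hf, h3, add_assoc, ← smul_add, ← h1, map_add, LinearMap.map_smul] at h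
  exact eq_neg_of_add_eq_zero_left h

end Pairing

theorem neg_one_pow_eq_sgn (k : Type*) [Field k] (r : ℕ) : (-1 : k) ^ r = sgn k (r : ZMod 2) := by
  induction r with
  | zero => simp
  | succ r ih => rw [pow_succ, ih, Nat.cast_succ, sgn_add, sgn_one]

/-! ### The sign of a product of odd monomials -/

section Inversions

variable {m : ℕ}

/-- The number of inversions modulo `2`, computed along a list. -/
def inversionList (α β : Fin m → ℕ) : List (Fin m) → ℕ
  | [] => 0
  | t :: L => β t * (L.map α).sum + inversionList α β L

theorem inversionList_eq (α β : Fin m → ℕ) (L : List (Fin m)) (hL : L.Pairwise (· < ·)) :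
    inversionList α β L =
      (L.map fun t => β t * (L.map fun s => if t < s then α s else 0).sum).sum := by
  induction L with
  | nil => rfl
  | cons t L ih =>
    have h := List.pairwise_cons.mp hL
    rw [inversionList, ih h.2, List.map_cons, List.sum_cons, List.map_cons, List.sum_cons,
      if_neg (lt_irrefl t), zero_add]
    congr 1
    · congr 1
      refine congrArg List.sum (List.map_congr_left fun s hs => ?_)
      rw [if_pos (h.1 s hs)]
    · refine congrArg List.sum (List.map_congr_left fun s hs => ?_)
      rw [List.map_cons, List.sum_cons, if_neg (h.1 s hs).not_gt, zero_add]

theorem inversions_eq (α β : Fin m → Fin 2) : inversions α β =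
    inversionList (fun s => (α s : ℕ)) (fun s => (β s : ℕ)) (List.finRange m) := by
  have h2 : ∀ a : Fin 2, (a : ℕ) = if a = 1 then 1 else 0 := by decide
  rw [inversionList_eq _ _ _ (List.pairwise_lt_finRange m), ← Fin.sum_univ_def, inversions,
    Finset.card_filter, Fintype.sum_prod_type, Finset.sum_comm]
  refine Finset.sum_congr rfl fun t _ => ?_
  rw [← Fin.sum_univ_def, Finset.mul_sum]
  refine Finset.sum_congr rfl fun s _ => ?_
  rw [h2 (α s), h2 (β t)]
  by_cases h3 : t < s <;> by_cases h4 : α s = 1 <;> by_cases h5 : β t = 1 <;> simp [h3, h4, h5]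

end Inversions

/-! ### Integrals of products of monomials -/

section Monomials

attribute [local instance] lawfulBEq_sum

variable {k : Type*} {p : ℕ} {g : Type*} [Field k] [AddCommGroup g] [Module k g]
  [LieSuperalgebra k g] [RestrictedLieSuperalgebra k p g] {H : RestrictedSubalgebra k p g}
  {V : Type*} [AddCommGroup V] [Module k V] [Superspace k V]
  {n m : ℕ} [Fact p.Prime] [CharP k p] [Fact (2 < p)] (F : Frame H n m)
  {π : SuperAction k H.carrier V}

theorem mon_perm_even {l l' : List (Fin n ⊕ Fin m)} (h : l.Perm l')
    (hl : ∀ j ∈ l, frameDeg n m j = 0) : mon F l = mon F l' := by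
  induction h with
  | nil => rfl
  | cons j _ ih => rw [mon_cons, mon_cons, ih fun i hi => hl i (List.mem_cons_of_mem _ hi)]
  | swap i j l =>
    have hi := coord_mem F i
    rw [hl i (by simp)] at hi
    rw [mon_cons, mon_cons, mon_cons, mon_cons, smulA_left_comm (coord_mem F j) hi, mul_zero,
      sgn_zero, one_smul]
  | trans h₁ _ ih₁ ih₂ => rw [ih₁ hl, ih₂ fun j hj => hl j (h₁.mem_iff.mpr hj)]

/-- Where `ζ_t` belongs to the second factor it is pulled to the front, past all remaining odd
factors of the first; their number is the contribution of `t` to `inversionList`. -/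
theorem mon_odd_append (α β : Fin m → ℕ) (h : ∀ s, α s + β s = 1) (L : List (Fin m)) :
    mon F (L.flatMap (fun s => List.replicate (α s) (Sum.inr s)) ++
      L.flatMap (fun s => List.replicate (β s) (Sum.inr s))) =
      sgn k (inversionList α β L : ZMod 2) • mon F (L.map (Sum.inr : Fin m → Fin n ⊕ Fin m)) := by
  induction L with
  | nil => simp [inversionList]
  | cons t L ih =>
    have hd : ((L.flatMap (fun s => List.replicate (α s) (Sum.inr s : Fin n ⊕ Fin m))).map
        (frameDeg n m)).sum = ((L.map α).sum : ℕ) := by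
      clear ih
      induction L with
      | nil => simp
      | cons s L ihL =>
        rw [List.flatMap_cons, List.map_append, List.sum_append, ihL, List.map_cons, List.sum_cons,
          Nat.cast_add]
        simp [frameDeg]
    have hα := h t
    rcases Nat.eq_zero_or_pos (β t) with hβ | hβ
    · have h1 : α t = 1 := by omega
      rw [List.flatMap_cons, List.flatMap_cons, h1, hβ, inversionList, hβ, zero_mul, zero_add,
        List.replicate_one, List.replicate_zero, List.nil_append, List.map_cons, mon_cons,
        List.append_assoc, List.singleton_append, mon_cons, ih, smulA_smul]
    · have h1 : α t = 0 := by omega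
      have h3 : β t = 1 := by omega
      rw [List.flatMap_cons, List.flatMap_cons, h1, h3, inversionList, h3, one_mul,
        List.replicate_one, List.replicate_zero, List.nil_append, List.map_cons, mon_cons,
        mon_append, List.singleton_append, mon_cons,
        smulA_left_comm (mon_mem F _) (coord_mem F (Sum.inr t)), ← mon_append, ih, smulA_smul,
        smul_smul, hd, Nat.cast_add, sgn_add]
      have : frameDeg n m (Sum.inr t) = 1 := rfl
      rw [this, mul_one]

theorem integral_mon {J : List (Fin n ⊕ Fin m)} (hJ : ¬ (topWord p n m).Perm J) :
    integral F (mon F J) = 0 := by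
  obtain ⟨c, -, h⟩ := exists_mon_apply F J
  rw [integral_apply, (h _ isFrameWord_topWord).2 hJ, mul_zero]

theorem orderedList_perm_topWord {a b : Fin n → ℕ} {α β : Fin m → ℕ}
    (h : (topWord p n m).Perm (orderedList Sum.inl Sum.inr a α ++ orderedList Sum.inl Sum.inr b β)) :
    (∀ r, a r + b r = p - 1) ∧ ∀ s, α s + β s = 1 := by
  refine ⟨fun r => ?_, fun s => ?_⟩
  · have := h.count_eq (Sum.inl r)
    rw [topWord, List.count_append, count_inl_orderedList, count_inl_orderedList,
      count_inl_orderedList] at this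
    exact this.symm
  · have := h.count_eq (Sum.inr s)
    rw [topWord, List.count_append, count_inr_orderedList, count_inr_orderedList,
      count_inr_orderedList] at this
    exact this.symm

theorem even_perm (a b c : Fin n → ℕ) (h : ∀ r, a r + b r = c r) :
    ((List.finRange n).flatMap (fun r => List.replicate (a r) (Sum.inl r : Fin n ⊕ Fin m)) ++
      (List.finRange n).flatMap (fun r => List.replicate (b r) (Sum.inl r))).Perm
      ((List.finRange n).flatMap (fun r => List.replicate (c r) (Sum.inl r))) := by
  induction List.finRange n with
  | nil => simp
  | cons r L ih =>
    simp only [List.flatMap_cons]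
    rw [← h r, List.replicate_add, List.append_assoc, List.append_assoc]
    refine List.Perm.append_left _ ?_
    refine (List.perm_append_comm_assoc _ _ _).trans ?_
    exact List.Perm.append_left _ ih

theorem coordMonomial_mul {a b : Fin n → ℕ} {α β : Fin m → ℕ} (h : ∀ r, a r + b r = p - 1)
    (h' : ∀ s, α s + β s = 1) : smulA (coordMonomial F a α) (coordMonomial F b β) =
      sgn k (inversionList α β (List.finRange m) : ZMod 2) • topMonomial F := by
  have heven : ∀ c : Fin n → ℕ, ∀ j ∈ (List.finRange n).flatMap
      (fun r => List.replicate (c r) (Sum.inl r : Fin n ⊕ Fin m)), frameDeg n m j = 0 := by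
    intro c j hj
    obtain ⟨r, -, hr⟩ := List.mem_flatMap.mp hj
    rw [List.eq_of_mem_replicate hr]
    rfl
  have h0 : ∀ c : Fin n → ℕ, IsHomog (mon F ((List.finRange n).flatMap
      (fun r => List.replicate (c r) (Sum.inl r : Fin n ⊕ Fin m)))) 0 := fun c => by
    have := mon_mem F ((List.finRange n).flatMap
      (fun r => List.replicate (c r) (Sum.inl r : Fin n ⊕ Fin m)))
    rwa [List.sum_eq_zero fun d hd => by
      obtain ⟨j, hj, rfl⟩ := List.mem_map.mp hd
      exact heven c j hj] at this
  have h1 := mon_odd_append F α β h' (List.finRange m)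
  have h3 : (List.finRange m).map (Sum.inr : Fin m → Fin n ⊕ Fin m) =
      (List.finRange m).flatMap (fun s => List.replicate 1 (Sum.inr s)) := by
    induction List.finRange m with
    | nil => rfl
    | cons s L ih => rw [List.map_cons, ih, List.flatMap_cons]; rfl
  rw [coordMonomial_eq, coordMonomial_eq, topMonomial_eq, topWord, orderedList, orderedList,
    orderedList, mon_append, mon_append, mon_append, smulA_assoc,
    smulA_left_comm (mon_mem F _) (h0 b), mul_zero, sgn_zero, one_smul, ← mon_append, h1, ← h3,
    smulA_smul, smulA_smul, ← smulA_assoc, ← mon_append,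
    mon_perm_even F (even_perm a b _ h) ?_]
  intro j hj
  rcases List.mem_append.mp hj with hj | hj
  · exact heven a j hj
  · exact heven b j hj

theorem integral_coordMonomial_mul (a b : Fin n → ℕ) (α β : Fin m → Fin 2) :
    integral F (smulA (coordMonomial F a (fun s => (α s : ℕ)))
      (coordMonomial F b (fun s => (β s : ℕ)))) =
      if (∀ r, a r + b r = p - 1) ∧ (∀ s, (α s : ℕ) + (β s : ℕ) = 1) then
        (-1 : k) ^ inversions α β else 0 := by
  split_ifs with h
  · rw [coordMonomial_mul F h.1 h.2, LinearMap.map_smul, integral_topMonomial, smul_eq_mul,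
      mul_one, inversions_eq, neg_one_pow_eq_sgn]
  · rw [coordMonomial_eq, coordMonomial_eq, ← mon_append]
    exact integral_mon F fun hp => h (orderedList_perm_topWord hp)

theorem coordMonomial_mem (a : Fin n → ℕ) (α : Fin m → ℕ) :
    IsHomog (coordMonomial F a α) (∑ s, (α s : ZMod 2)) := by
  have h := mon_mem F (orderedList Sum.inl Sum.inr a α)
  rw [← coordMonomial_eq] at h
  convert h using 1
  rw [map_orderedList, orderedList, List.sum_append, Fin.sum_univ_def]
  have h1 : ∀ L : List (Fin n), (L.flatMap fun i => List.replicate (a i)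
      (frameDeg n m (Sum.inl i))).sum = 0 := fun L => by
    induction L with
    | nil => rfl
    | cons i L ih => rw [List.flatMap_cons, List.sum_append, ih]; simp [frameDeg]
  have h2 : ∀ L : List (Fin m), (L.flatMap fun i => List.replicate (α i)
      (frameDeg n m (Sum.inr i))).sum = (L.map fun s => (α s : ZMod 2)).sum := fun L => by
    induction L with
    | nil => rfl
    | cons i L ih =>
      rw [List.flatMap_cons, List.sum_append, ih, List.map_cons, List.sum_cons]; simp [frameDeg]
  simp only [Function.comp_def] at *
  rw [h1, h2, zero_add]

end Monomials

/-! ### Values of `Ψ` on monomials, and the map `Ψ'` -/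

section Psi

variable {k : Type*} {p : ℕ} {g : Type*} [Field k] [AddCommGroup g] [Module k g]
  [LieSuperalgebra k g] [RestrictedLieSuperalgebra k p g] {H : RestrictedSubalgebra k p g}
  {U V : Type*} [AddCommGroup U] [Module k U] [Superspace k U] [AddCommGroup V] [Module k V]
  [Superspace k V] {n m : ℕ} [Fact p.Prime] [CharP k p] [Fact (2 < p)] {F : Frame H n m}
  {σ : SuperAction k H.carrier U} {π : SuperAction k H.carrier V}

theorem coindPair_hat (hπ : π.IsRestricted p) (v : V) (v' : Module.Dual k V) :
    coindPair (hat F π v) (hat F (dualAct π) v') = v' (parity (k := k) v) • oneA H :=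
  coind_ext F fun l hl => by
    rw [coe_coindPair, Submodule.coe_smul, LinearMap.smul_apply]
    rcases eq_or_ne l [] with h | h
    · rw [(oneA_apply F).1 h, h, envWord_nil, conv_one, hat_apply_one F hπ,
        hat_apply_one F (dualAct_isRestricted hπ), contract_tmul, smul_eq_mul, mul_one]
    · rw [(oneA_apply F).2 h, smul_zero]
      refine conv_envWord_eq_zero _ F.vec_mem _ _ _ fun l₁ l₂ h₁ h₂ hlen => ?_
      rcases eq_or_ne l₁ [] with h' | h'
      · refine Or.inr ((hat_apply F (dualAct_isRestricted hπ) v' (hl.sublist h₂)).2 ?_)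
        rintro rfl
        rw [h'] at hlen
        exact h (List.length_eq_zero_iff.mp hlen.symm)
      · exact Or.inl ((hat_apply F hπ v (hl.sublist h₁)).2 h')

theorem coindPair_smulA_hat (hπ : π.IsRestricted p) {i j : ZMod 2} {v : V} (hv : v ∈ homog k V i)
    (v' : Module.Dual k V) (a : Coind (trivAct k H.carrier)) {b : Coind (trivAct k H.carrier)}
    (hb : IsHomog b j) :
    coindPair (smulA a (hat F π v)) (smulA b (hat F (dualAct π) v')) =
      (sgn k (j * i) * v' (parity (k := k) v)) • smulA a b := by
  rw [coindPair_smulA_left, coindPair_smulA_right hb (hat_mem F hπ hv), coindPair_hat hπ,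
    smulA_smul, smulA_smul, smulA_oneA, smulA_smul, smul_smul]

theorem apply_eq_zero_of_ne {i j : ZMod 2} {v : V} (hv : v ∈ homog k V i) {v' : Module.Dual k V}
    (hv' : v' ∈ homog k (Module.Dual k V) j) (h2 : (2 : k) ≠ 0) (hij : i ≠ j) : v' v = 0 := by
  have h := apply_mem_homog hv' hv
  have key : ∀ i j : ZMod 2, i ≠ j → j + i = 1 := by decide
  rw [key i j hij, mem_homog, parity_field, sgn_one, neg_smul, one_smul] at h
  have : (2 : k) * v' v = 0 := by linear_combination h
  exact (mul_eq_zero.mp this).resolve_left h2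

theorem isPsi_psi (hπ : π.IsRestricted p) : IsPsi F π (berEquiv F) (psi F hπ) := by
  have h2 := two_ne_zero_of_char k p
  intro a b α β i j v hv v' hv'
  have h := psi_mulBer (F := F) hπ
    (smulA (coordMonomial F (fun r => (a r : ℕ)) (fun s => (α s : ℕ))) (hat F π v))
    (smulA (coordMonomial F (fun r => (b r : ℕ)) (fun s => (β s : ℕ))) (hat F (dualAct π) v'))
  refine h.trans ?_
  rw [coindPair_smulA_hat hπ hv v' _ (coordMonomial_mem F _ _), LinearMap.map_smul,
    integral_coordMonomial_mul, smul_eq_mul]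
  -- The contraction carries the sign `(-1)^{|v|}` instead of `(-1)^{|v||v*|}`; they agree whenever
  -- `v*(v)` is nonzero.
  have hs : v' (parity (k := k) v) = sgn k (i * j) * v' v := by
    rw [mem_homog.mp hv, map_smul, smul_eq_mul]
    by_cases hij : i = j
    · have : ∀ j : ZMod 2, j * j = j := by decide
      rw [hij, this]
    · rw [apply_eq_zero_of_ne hv hv' h2 hij, mul_zero, mul_zero]
  rw [hs, mul_comm (∑ s, ((β s : ℕ) : ZMod 2))]
  split_ifs
  · ring
  · ring

theorem exists_mulBer_eq (hσ : σ.IsRestricted p) {j : ZMod 2}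
    {ν : Coind (tensorAct σ (negStradAct H m))} (hν : IsHomog ν j) :
    ∃ μ : Coind σ, IsHomog μ (j + m) ∧ mulBer F σ μ = ν := by
  have h2 := two_ne_zero_of_char k p
  have two : ∀ a : ZMod 2, a + a = 0 := by decide
  obtain ⟨μ, rfl⟩ := (mulBer_bijective (F := F) hσ).2 ν
  refine ⟨proj (k := k) (j + m) μ, isHomog_iff.mpr (proj_mem _ _), ?_⟩
  have h : ∀ μ : Coind σ, mulBer F σ (proj (k := k) (j + m) μ) =
      proj (k := k) j (mulBer F σ μ) := fun μ => by
    refine coind_homog_induction (P := fun μ => mulBer F σ (proj (k := k) (j + m) μ) =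
      proj (k := k) j (mulBer F σ μ)) (fun μ ν hμ hν => ?_) (fun i μ hμ => ?_) μ
    · rw [map_add, map_add, hμ, hν, ← map_add, ← map_add]
    · rw [proj_of_mem h2 (isHomog_iff.mp hμ), proj_of_mem h2 (isHomog_iff.mp (mulBer_mem hμ))]
      by_cases hi : i = j + m
      · rw [if_pos hi, hi, add_assoc, two, add_zero, if_pos rfl]
      · rw [if_neg hi, if_neg, map_zero]
        intro hij
        rw [← hij, add_assoc, two, add_zero] at hi
        exact hi rfl
  rw [h, proj_of_mem h2 (isHomog_iff.mp hν), if_pos rfl]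

/-- `Ψ` is even: the degree `m` of the integral is compensated by that of `χ(ω)`. -/
theorem psi_eq_zero (hπ : π.IsRestricted p) {i j : ZMod 2} {f : Coind π} (hf : IsHomog f i)
    {μ : Coind (dualTwist m π)} (hμ : IsHomog (π := dualTwist m π) μ j) (hij : i ≠ j) : psi F hπ f μ = 0 := by
  obtain ⟨ν, hν, hνμ⟩ := exists_mulBer_eq (F := F) (dualAct_isRestricted hπ) hμ
  have h := psi_mulBer (F := F) hπ f ν
  rw [integral_of_mem (coindPair_mem hf hν)] at h
  · rw [← h]
    exact congrArg (psi F hπ f) hνμ.symm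
  · intro h'
    have h3 : ∀ a b c : ZMod 2, a + (b + c) = c → a = b := by decide
    exact hij (h3 _ _ _ h')

/-- The map `Ψ'`. -/
def psiDual (F : Frame H n m) (hπ : π.IsRestricted p) :
    Coind (dualTwist m π) →ₗ[k] Module.Dual k (Coind π) :=
  -- The sign is `(-1)^{|f|}`. It may replace `(-1)^{|f||μ|}` because `Ψ` pairs only elements of
  -- equal degree.
  (psi F hπ ∘ₗ parity (k := k)).flip

theorem psiDual_apply (hπ : π.IsRestricted p) (μ : Coind (dualTwist m π)) (f : Coind π) :
    psiDual F hπ μ f = psi F hπ (parity (k := k) f) μ := rfl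

theorem psiDual_apply_of_mem (hπ : π.IsRestricted p) (μ : Coind (dualTwist m π)) {i : ZMod 2}
    {f : Coind π} (hf : IsHomog f i) : psiDual F hπ μ f = sgn k i * psi F hπ f μ := by
  rw [psiDual_apply, mem_homog.mp (isHomog_iff.mp hf), LinearMap.map_smul, LinearMap.smul_apply,
    smul_eq_mul]

theorem isInducedBy_psiDual (hπ : π.IsRestricted p) :
    IsInducedBy π (psi F hπ) (psiDual F hπ) := by
  intro i j f μ hf hμ
  rw [psiDual_apply_of_mem hπ μ hf]
  by_cases hij : i = j
  · have : ∀ j : ZMod 2, j * j = j := by decide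
    rw [hij, this]
  · rw [psi_eq_zero hπ hf hμ hij, mul_zero, mul_zero]

theorem isEquivariantToDual_psiDual (hπ : π.IsRestricted p) :
    IsEquivariantToDual (ρ := dualTwist m π) (psiDual F hπ) := by
  intro i j x hx μ hμ f
  change psiDual F hπ (actₗ (dualTwist m π) (envι k p x) μ) f = _
  refine coind_homog_induction (P := fun f => psiDual F hπ (actₗ (dualTwist m π) (envι k p x) μ) f =
    -(sgn k (i * j) * psiDual F hπ μ (envι k p x • f))) (fun f f' hf hf' => ?_) (fun l f hf => ?_) f
  · rw [map_add, smul_add, map_add, hf, hf']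
    ring
  · have hxf := isHomog_smul hx hf
    have h := psi_invariant (F := F) hπ hx hf μ
    rw [psiDual_apply_of_mem hπ _ hf, psiDual_apply_of_mem hπ _ hxf]
    have h' : psi F hπ f (actₗ (dualTwist m π) (envι k p x) μ) =
        -(sgn k (i * l) * psi F hπ (envι k p x • f) μ) := by
      rw [h, mul_neg, neg_neg, ← mul_assoc, sgn_mul_self, one_mul]
    rw [h']
    by_cases hij : i + l = j
    · rw [← hij, mul_neg, ← mul_assoc, ← mul_assoc, ← sgn_add, ← sgn_add]
      have : ∀ i l : ZMod 2, l + i * l = i * (i + l) + (i + l) := by decide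
      rw [this]
    · rw [psi_eq_zero hπ hxf hμ hij]
      ring

end Psi

/-! ### `Ψ'` is bijective -/

section Duality

variable {k : Type*} {p : ℕ} {g : Type*} [Field k] [AddCommGroup g] [Module k g]
  [LieSuperalgebra k g] [RestrictedLieSuperalgebra k p g] {H : RestrictedSubalgebra k p g}
  {V : Type*} [AddCommGroup V] [Module k V]
  [Superspace k V] {n m : ℕ} [Fact p.Prime] [CharP k p] [Fact (2 < p)] (F : Frame H n m)
  {π : SuperAction k H.carrier V}

/-- The complementary exponents. -/
def revExpo (x : Expo p n m) : Expo p n m := (fun r => (x.1 r).rev, fun s => (x.2 s).rev)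

@[simp] theorem revExpo_revExpo (x : Expo p n m) : revExpo (revExpo x) = x := by
  simp [revExpo]

theorem eq_revExpo_iff {x y : Expo p n m} : ((∀ r, (x.1 r : ℕ) + (y.1 r : ℕ) = p - 1) ∧
    ∀ s, (x.2 s : ℕ) + (y.2 s : ℕ) = 1) ↔ y = revExpo x := by
  constructor
  · rintro ⟨h, h'⟩
    refine Prod.ext (funext fun r => Fin.ext ?_) (funext fun s => Fin.ext ?_)
    · have := h r
      simp only [revExpo, Fin.val_rev]
      omega
    · have := h' s
      simp only [revExpo, Fin.val_rev]
      omega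
  · rintro rfl
    refine ⟨fun r => ?_, fun s => ?_⟩
    · simp only [revExpo, Fin.val_rev]
      omega
    · simp only [revExpo, Fin.val_rev]
      omega

theorem exists_integral_mon_mul (x : Expo p n m) : ∃ c : k, c ≠ 0 ∧ ∀ y : Expo p n m,
    integral F (smulA (mon F (indexWord x)) (mon F (indexWord y))) =
      if y = revExpo x then c else 0 := by
  refine ⟨(-1) ^ inversions x.2 (revExpo x).2, by simp, fun y => ?_⟩
  have h := integral_coordMonomial_mul F (fun r => (x.1 r : ℕ)) (fun r => (y.1 r : ℕ)) x.2 y.2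
  rw [coordMonomial_eq, coordMonomial_eq] at h
  refine h.trans ?_
  by_cases hy : y = revExpo x
  · rw [if_pos (eq_revExpo_iff.mpr hy), if_pos hy, hy]
  · rw [if_neg fun h => hy (eq_revExpo_iff.mp h), if_neg hy]

/-- The form `(f, μ) ↦ ∫ ⟨f, μ⟩` as a map to the dual. -/
def integralDual (π : SuperAction k H.carrier V) :
    Coind (dualAct π) →ₗ[k] Module.Dual k (Coind π) :=
  ((coindPairₗ π).compr₂ (integral F)).flip

theorem integralDual_apply (μ : Coind (dualAct π)) (f : Coind π) :
    integralDual F π μ f = integral F (coindPair f μ) := rfl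

theorem integral_coindPair_mon (hπ : π.IsRestricted p) (x y : Expo p n m) (v : V)
    (v' : Module.Dual k V) : integral F (coindPair (smulA (mon F (indexWord x)) (hat F π v))
      (smulA (mon F (indexWord y)) (hat F (dualAct π) v'))) =
      integral F (smulA (mon F (indexWord x)) (mon F (indexWord y))) *
        v' (tw k (1 + ((indexWord y).map (frameDeg n m)).sum) v) := by
  have h2 := two_ne_zero_of_char k p
  refine homog_induction (P := fun v => integral F (coindPair (smulA (mon F (indexWord x))
    (hat F π v)) (smulA (mon F (indexWord y)) (hat F (dualAct π) v'))) =
      integral F (smulA (mon F (indexWord x)) (mon F (indexWord y))) *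
        v' (tw k (1 + ((indexWord y).map (frameDeg n m)).sum) v)) h2
    (fun v w hv hw => ?_) (fun i v hv => ?_) v
  · rw [hat_add F hπ, smulA_add, ← integralDual_apply, map_add, integralDual_apply,
      integralDual_apply, hv, hw, map_add, map_add, mul_add]
  · rw [coindPair_smulA_hat hπ hv v' _ (mon_mem F _), LinearMap.map_smul, tw_of_mem hv,
      mem_homog.mp hv, map_smul, map_smul, smul_eq_mul, smul_eq_mul, smul_eq_mul, add_mul, one_mul,
      sgn_add]
    ring

/-- The map `(w_x) ↦ ∑ η^a ζ^α ŵ_x`. -/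
def monSum {W : Type*} [AddCommGroup W] [Module k W] [Superspace k W]
    {ρ : SuperAction k H.carrier W} (hρ : ρ.IsRestricted p) :
    (Expo p n m → W) →ₗ[k] Coind ρ :=
  ∑ y, smulAₗ ρ (mon F (indexWord y)) ∘ₗ hatₗ F hρ ∘ₗ LinearMap.proj y

theorem monSum_apply {W : Type*} [AddCommGroup W] [Module k W] [Superspace k W]
    {ρ : SuperAction k H.carrier W} (hρ : ρ.IsRestricted p) (c : Expo p n m → W) :
    monSum F hρ c = ∑ y, smulA (mon F (indexWord y)) (hat F ρ (c y)) := by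
  rw [monSum, LinearMap.sum_apply]
  rfl

theorem monSum_surjective {W : Type*} [AddCommGroup W] [Module k W] [Superspace k W]
    {ρ : SuperAction k H.carrier W} (hρ : ρ.IsRestricted p) :
    Function.Surjective (monSum F hρ) := by
  have h : (LinearMap.range (monSum F hρ)).mkQ = 0 := by
    refine coind_linear_ext F hρ fun J hJ w => ?_
    rw [LinearMap.zero_apply, Submodule.mkQ_apply, Submodule.Quotient.mk_eq_zero]
    obtain ⟨x, rfl⟩ := isFrameWord_iff.mp hJ
    refine ⟨Pi.single x w, ?_⟩
    rw [monSum_apply, Finset.sum_eq_single x]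
    · rw [Pi.single_eq_same]
    · intro y _ hy
      rw [Pi.single_eq_of_ne hy, ← hatₗ_apply F hρ, map_zero, smulA_zero]
    · simp
  rw [← LinearMap.range_eq_top, ← Submodule.ker_mkQ (LinearMap.range (monSum F hρ)), h,
    LinearMap.ker_zero]

/-- Under the integral, monomials with complementary exponents are dual up to sign. With these bases
the map becomes, up to signs and a permutation of the finite set `X` of exponents, the map from
`(V*)^X` to the dual of `V^X`, which is bijective for every `V`. -/
theorem integralDual_bijective (hπ : π.IsRestricted p) :
    Function.Bijective (integralDual F π) := by
  have hd := dualAct_isRestricted hπ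
  choose ε hε hint using exists_integral_mon_mul F
  let d : Expo p n m → ZMod 2 := fun y => 1 + ((indexWord y).map (frameDeg n m)).sum
  have key : ∀ c x v, integralDual F π (monSum F hd c) (smulA (mon F (indexWord x)) (hat F π v)) =
      ε x * c (revExpo x) (tw k (d (revExpo x)) v) := fun c x v => by
    rw [monSum_apply, map_sum, LinearMap.sum_apply, Finset.sum_eq_single (revExpo x)]
    · rw [integralDual_apply, integral_coindPair_mon F hπ, hint, if_pos rfl]
    · intro y _ hy
      rw [integralDual_apply, integral_coindPair_mon F hπ, hint, if_neg hy, zero_mul]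
    · simp
  constructor
  · intro μ ν h
    obtain ⟨c, rfl⟩ := monSum_surjective F hd μ
    obtain ⟨c', rfl⟩ := monSum_surjective F hd ν
    congr 1
    refine funext fun y => LinearMap.ext fun v => mul_left_cancel₀ (hε (revExpo y)) ?_
    have h1 := key c (revExpo y) (tw k (d y) v)
    have h2 := key c' (revExpo y) (tw k (d y) v)
    rw [revExpo_revExpo, tw_tw_self] at h1 h2
    rw [← h1, ← h2, h]
  · intro ξ
    refine ⟨monSum F hd fun y => (ε (revExpo y))⁻¹ • (ξ ∘ₗ smulAₗ π (mon F (indexWord (revExpo y))) ∘ₗ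
      hatₗ F hπ ∘ₗ tw k (d y)), ?_⟩
    refine coind_linear_ext F hπ fun J hJ w => ?_
    obtain ⟨x, rfl⟩ := isFrameWord_iff.mp hJ
    rw [key, revExpo_revExpo]
    simp only [LinearMap.smul_apply, LinearMap.comp_apply, tw_tw_self, smul_eq_mul]
    rw [← mul_assoc, mul_inv_cancel₀ (hε x), one_mul]
    rfl

theorem psiDual_bijective (hπ : π.IsRestricted p) : Function.Bijective (psiDual F hπ) := by
  have hp : Function.Bijective (parity (k := k) (V := Coind π)) :=
    Function.Involutive.bijective fun f => parity_parity f
  have h : ∀ μ, psiDual F hπ μ = (parity (k := k) (V := Coind π)).dualMap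
      (integralDual F π ((mulBerEquiv F hπ).symm μ)) := fun μ => rfl
  have h' : ⇑(psiDual F hπ) = (parity (k := k) (V := Coind π)).dualMap ∘ integralDual F π ∘
      (mulBerEquiv F hπ).symm := funext h
  rw [h']
  refine Function.Bijective.comp ?_ ((integralDual_bijective F hπ).comp
    (mulBerEquiv F hπ).symm.bijective)
  exact ⟨LinearMap.dualMap_injective_iff.mpr hp.2, LinearMap.dualMap_surjective_iff.mpr hp.1⟩

end Duality

/-! ### Passing between `⟨u, μ⟩` and `μ(u)` -/

section Swap

variable {k V W : Type*} [Field k] [AddCommGroup V] [Module k V] [Superspace k V]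
  [AddCommGroup W] [Module k W] [Superspace k W]

/-- The map `f ↦ [v ↦ (-1)^{|f||v|} f(v)]`. -/
def superSwap : (V →ₗ[k] W) →ₗ[k] (V →ₗ[k] W) :=
  proj (k := k) 0 + LinearMap.lcomp k W (parity (k := k) (V := V)) ∘ₗ proj (k := k) 1

theorem superSwap_apply (f : V →ₗ[k] W) (v : V) : superSwap f v =
    proj (k := k) 0 f v + proj (k := k) 1 f (parity (k := k) v) := rfl

theorem superSwap_of_mem (h2 : (2 : k) ≠ 0) {j : ZMod 2} {f : V →ₗ[k] W}
    (hf : f ∈ homog k (V →ₗ[k] W) j) (v : V) : superSwap f v = f (tw k j v) := by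
  rw [superSwap_apply]
  rcases zmod_two_cases j with rfl | rfl <;> simp [proj_of_mem h2 hf]

theorem superSwap_superSwap (h2 : (2 : k) ≠ 0) (f : V →ₗ[k] W) : superSwap (superSwap f) = f := by
  refine homog_induction (P := fun f : V →ₗ[k] W => superSwap (superSwap f) = f) h2
    (fun f f' hf hf' => by rw [map_add, map_add, hf, hf']) (fun j f hf => ?_) f
  have h : superSwap f ∈ homog k (V →ₗ[k] W) j := by
    rw [mem_homog]
    ext v
    rw [parity_hom, superSwap_of_mem h2 hf, LinearMap.smul_apply, superSwap_of_mem h2 hf,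
      ← parity_tw, ← parity_hom, mem_homog.mp hf, LinearMap.smul_apply]
  ext v
  rw [superSwap_of_mem h2 h, superSwap_of_mem h2 hf, tw_tw_self]

theorem tw_hom (i : ZMod 2) (f : V →ₗ[k] W) (v : V) : tw k i f v = tw k i (f (tw k i v)) := by
  rcases zmod_two_cases i with rfl | rfl <;> simp

theorem tw_tmul (i : ZMod 2) (v : V) (w : W) : tw k i (v ⊗ₜ[k] w) = tw k i v ⊗ₜ tw k i w := by
  rcases zmod_two_cases i with rfl | rfl <;> simp

theorem SuperAction.tw_act {L : Type*} [AddCommGroup L] [Module k L] [Superspace k L]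
    (π : SuperAction k L V) (i : ZMod 2) (x : L) (v : V) :
    tw k i (π.act x v) = π.act (tw k i x) (tw k i v) := by
  rcases zmod_two_cases i with rfl | rfl <;> simp [π.parity_act]

end Swap

/-! ### The dual of an induced representation -/

section Theta

variable {k : Type*} {p : ℕ} {g : Type*} [Field k] [AddCommGroup g] [Module k g]
  [LieSuperalgebra k g] [RestrictedLieSuperalgebra k p g] {H : RestrictedSubalgebra k p g}
  {U W : Type*} [AddCommGroup U] [Module k U] [Superspace k U] [AddCommGroup W] [Module k W]
  [Superspace k W] {ρ : SuperAction k H.carrier W} {ρ' : SuperAction k H.carrier U}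

/-- The map `P` identifies `ρ'` with the contragredient of `ρ`. -/
structure IsContragredient (ρ : SuperAction k H.carrier W) (ρ' : SuperAction k H.carrier U)
    (P : U →ₗ[k] Module.Dual k W) : Prop where
  bijective : Function.Bijective P
  act : ∀ j, ∀ x ∈ homog k H.carrier j, ∀ b w,
    P (ρ'.act x b) w = -P (tw k j b) (ρ.act x w)

/-- `ξ` is only `k`-linear, while the relations span a `U'(g)`-submodule. The hypothesis for all `u`
says that all left multiples of the relations are killed. -/
theorem indRel_apply_eq_zero {ξ : Env k p g ⊗[k] W →ₗ[k] k}
    (h : ∀ (u : Env k p g) (x : H.carrier) (w : W),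
      ξ ((u * envι k p (x : g)) ⊗ₜ w) = ξ (u ⊗ₜ ρ.act x w)) {t : Env k p g ⊗[k] W}
    (ht : t ∈ indRel ρ) : ξ t = 0 := by
  have key : ∀ r : Env k p g, ξ (r • t) = 0 := by
    refine Submodule.span_induction (p := fun t _ => ∀ r : Env k p g, ξ (r • t) = 0)
      ?_ (fun r => by rw [smul_zero, map_zero])
      (fun a b _ _ ha hb r => by rw [smul_add, map_add, ha, hb, add_zero])
      (fun s a _ ha r => by rw [smul_smul]; exact ha _) ht
    rintro _ ⟨u, x, w, rfl⟩ r
    rw [smul_sub, map_sub, TensorProduct.smul_tmul', TensorProduct.smul_tmul', smul_eq_mul,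
      smul_eq_mul, ← mul_assoc, h, sub_self]
  have := key 1
  rwa [one_smul] at this

/-- The linear form on the induced representation given by a balanced linear form. -/
def indForm (ρ : SuperAction k H.carrier W) (ξ : Env k p g ⊗[k] W →ₗ[k] k)
    (h : ∀ (u : Env k p g) (x : H.carrier) (w : W),
      ξ ((u * envι k p (x : g)) ⊗ₜ w) = ξ (u ⊗ₜ ρ.act x w)) : Module.Dual k (Ind ρ) :=
  ((indRel ρ).restrictScalars k).liftQ ξ (fun _ ht => indRel_apply_eq_zero h ht) ∘ₗ
    (Submodule.Quotient.restrictScalarsEquiv k (indRel ρ)).symm.toLinearMap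

theorem ind_induction {P : Ind ρ → Prop} (add : ∀ a b, P a → P b → P (a + b))
    (mk : ∀ u w, P (indMk ρ u w)) (t : Ind ρ) : P t := by
  obtain ⟨s, rfl⟩ := (indRel ρ).mkQ_surjective t
  induction s with
  | zero =>
    have h := mk 0 0
    rwa [indMk, TensorProduct.zero_tmul] at h
  | add a b ha hb =>
    rw [map_add]
    exact add _ _ ha hb
  | tmul u w => exact mk u w

theorem ind_dual_ext {ξ ξ' : Module.Dual k (Ind ρ)}
    (h : ∀ u w, ξ (indMk ρ u w) = ξ' (indMk ρ u w)) : ξ = ξ' :=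
  LinearMap.ext fun t => ind_induction (P := fun t => ξ t = ξ' t)
    (fun a b ha hb => by rw [map_add, map_add, ha, hb]) h t

theorem indMk_add (u v : Env k p g) (w : W) : indMk ρ (u + v) w = indMk ρ u w + indMk ρ v w := by
  rw [indMk, TensorProduct.add_tmul, map_add]
  rfl

theorem smul_indMk (r u : Env k p g) (w : W) : r • indMk ρ u w = indMk ρ (r * u) w := rfl

theorem indMk_mul_ι (u : Env k p g) (x : H.carrier) (w : W) :
    indMk ρ (u * envι k p (x : g)) w = indMk ρ u (ρ.act x w) :=
  (Submodule.Quotient.eq _).mpr (Submodule.subset_span ⟨u, x, w, rfl⟩)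

/-- The bilinear map `(u, w) ↦ u ⊗ w` to the induced representation. -/
def indMkₗ (ρ : SuperAction k H.carrier W) : Env k p g →ₗ[k] W →ₗ[k] Ind ρ :=
  LinearMap.mk₂ k (indMk ρ) indMk_add
    (fun c u w => by
      rw [indMk, ← TensorProduct.smul_tmul', LinearMap.map_smul_of_tower]
      rfl)
    (fun u w w' => by
      rw [indMk, TensorProduct.tmul_add, map_add]
      rfl)
    (fun c u w => by
      rw [indMk, TensorProduct.tmul_smul, LinearMap.map_smul_of_tower]
      rfl)

variable [Fact p.Prime] [CharP k p] [Fact (2 < p)] {P : U →ₗ[k] Module.Dual k W}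

/-- The antipode carries `x` from the right of `u` to the left of `ǔ`, where it acts through `ρ'`;
contragredience passes this action on to `w`, and the signs cancel. -/
theorem IsContragredient.balanced (hP : IsContragredient ρ ρ' P) (f : Coind ρ')
    (u : Env k p g) (x : H.carrier) (w : W) :
    P (superSwap f.1 (antipode k p g (u * envι k p (x : g)))) w =
      P (superSwap f.1 (antipode k p g u)) (ρ.act x w) := by
  have h2 := two_ne_zero_of_char k p
  refine homog_induction (P := fun x : H.carrier =>
    P (superSwap f.1 (antipode k p g (u * envι k p (x : g)))) w =
      P (superSwap f.1 (antipode k p g u)) (ρ.act x w)) h2 (fun x y hx hy => ?_) (fun l x hx => ?_) x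
  · rw [Submodule.coe_add, map_add, mul_add, map_add, map_add, map_add, LinearMap.add_apply, hx, hy,
      map_add, LinearMap.add_apply, map_add]
  have hx' := (coe_mem_homog H).mpr hx
  refine coind_homog_induction (P := fun f : Coind ρ' =>
    P (superSwap f.1 (antipode k p g (u * envι k p (x : g)))) w =
      P (superSwap f.1 (antipode k p g u)) (ρ.act x w)) (fun f f' hf hf' => ?_) (fun j f hf => ?_) f
  · rw [Submodule.coe_add, map_add, LinearMap.add_apply, LinearMap.add_apply, map_add, map_add,
      LinearMap.add_apply, LinearMap.add_apply, hf, hf']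
  · rw [superSwap_of_mem h2 hf, superSwap_of_mem h2 hf, antipode_mul_ι hx', map_neg, map_neg,
      tw_env_mul, tw_envι hx', smul_mul_assoc, map_smul, f.2, map_neg, map_smul,
      LinearMap.neg_apply, LinearMap.smul_apply, hP.act l x hx, ← tw_antipode, tw_tw, add_comm j l,
      ← tw_tw, apply_tw hf, map_smul, tw_tw_self, map_smul, LinearMap.smul_apply, smul_neg, neg_neg,
      smul_smul, sgn_mul_self, one_smul]

/-- The map `Θ`. -/
def theta (hP : IsContragredient ρ ρ' P) : Coind ρ' →ₗ[k] Module.Dual k (Ind ρ) where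
  toFun f := indForm ρ (TensorProduct.lift (P ∘ₗ superSwap f.1 ∘ₗ antipode k p g))
    fun u x w => hP.balanced f u x w
  map_add' f f' := ind_dual_ext fun u w => by
    change P (superSwap (f + f').1 (antipode k p g u)) w =
      P (superSwap f.1 (antipode k p g u)) w + P (superSwap f'.1 (antipode k p g u)) w
    simp
  map_smul' c f := ind_dual_ext fun u w => by
    change P (superSwap (c • f).1 (antipode k p g u)) w =
      c • P (superSwap f.1 (antipode k p g u)) w
    simp

theorem theta_indMk (hP : IsContragredient ρ ρ' P) (f : Coind ρ') (u : Env k p g) (w : W) :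
    theta hP f (indMk ρ u w) = P (superSwap f.1 (antipode k p g u)) w := rfl

theorem theta_indMk_of_mem (hP : IsContragredient ρ ρ' P) {j : ZMod 2} {f : Coind ρ'}
    (hf : IsHomog f j) (u : Env k p g) (w : W) :
    theta hP f (indMk ρ u w) = P (f.1 (antipode k p g (tw k j u))) w := by
  rw [theta_indMk, superSwap_of_mem (two_ne_zero_of_char k p) hf, tw_antipode]

theorem theta_indMk_one (hP : IsContragredient ρ ρ' P) (f : Coind ρ') (w : W) :
    theta hP f (indMk ρ 1 w) = P (f.1 1) w := by
  rw [theta_indMk, antipode_one, superSwap_apply, parity_env_one, ← LinearMap.add_apply,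
    proj_add_proj (two_ne_zero_of_char k p)]

theorem isEquivariantToDual_theta (hP : IsContragredient ρ ρ' P) :
    IsEquivariantToDual (theta hP) := by
  intro i j x hx f hf t
  refine ind_induction (P := fun t => theta hP (envι k p x • f) t =
    -(sgn k (i * j) * theta hP f (envι k p x • t))) (fun a b ha hb => ?_) (fun u w => ?_) t
  · rw [map_add, smul_add, map_add, ha, hb]
    ring
  · rw [theta_indMk_of_mem hP (isHomog_smul hx hf), smul_indMk, theta_indMk_of_mem hP hf,
      coind_smul_apply, tw_env_mul, tw_envι hx, smul_mul_assoc, map_smul, antipode_ι_mul hx,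
      tw_antipode, tw_tw, map_smul, map_neg, map_smul, map_neg, LinearMap.smul_apply,
      LinearMap.neg_apply, smul_eq_mul, mul_neg, mul_neg, neg_neg, mul_comm j i, ← mul_assoc,
      sgn_mul_self, one_mul]

theorem theta_injective (hP : IsContragredient ρ ρ' P) : Function.Injective (theta hP) := by
  have h2 := two_ne_zero_of_char k p
  intro f f' h
  have h1 : superSwap f.1 = superSwap f'.1 := LinearMap.ext fun u => hP.bijective.1
    (LinearMap.ext fun w => by
      have := LinearMap.congr_fun h (indMk ρ (antipode k p g u) w)
      rwa [theta_indMk, theta_indMk, antipode_antipode] at this)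
  have := congrArg superSwap h1
  rw [superSwap_superSwap h2, superSwap_superSwap h2] at this
  exact Subtype.ext this

/-- The hypothesis is `h`-linearity with the sign proper to `μ(u)`. On the component of degree `i`
that sign is a scalar, and the swap removes it. -/
theorem superSwap_mem_coind {β : Env k p g →ₗ[k] U}
    (hβ : ∀ j, ∀ x ∈ homog k H.carrier j, ∀ u,
      β (envι k p (x : g) * u) = ρ'.act x (tw k j β u)) : superSwap β ∈ Coind ρ' := by
  have h2 := two_ne_zero_of_char k p
  have h0 : ∀ i j, ∀ x ∈ homog k H.carrier j, ∀ u, tw k i β (envι k p (x : g) * u) =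
      ρ'.act x (tw k i (tw k j β) u) := by
    intro i j x hx u
    have hx' := (coe_mem_homog H).mpr hx
    rw [tw_hom, tw_env_mul, tw_envι hx', smul_mul_assoc, map_smul, hβ j x hx, map_smul,
      ρ'.tw_act, tw_of_mem hx, map_smul, LinearMap.smul_apply, smul_smul, sgn_mul_self, one_smul,
      ← tw_hom]
  have h1 : ∀ i j, ∀ x ∈ homog k H.carrier j, ∀ u, proj (k := k) i β (envι k p (x : g) * u) =
      sgn k (j * i) • ρ'.act x (proj (k := k) i β u) := by
    intro i j x hx u
    have e1 := h0 0 j x hx u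
    have e2 := h0 1 j x hx u
    rw [tw_zero, tw_zero] at e1
    rw [tw_one, tw_one] at e2
    have e3 : ∀ β : Env k p g →ₗ[k] U, proj (k := k) i β = (2 : k)⁻¹ •
      (β + sgn k i • parity (k := k) β) := fun β => rfl
    have e4 : sgn k (j * i) • proj (k := k) i β = proj (k := k) i (tw k j β) := by
      rw [← tw_of_mem (proj_mem i β)]
      rcases zmod_two_cases j with rfl | rfl
      · simp
      · rw [tw_one, tw_one, proj_homog]
    rw [← map_smul, ← LinearMap.smul_apply, e4, e3, e3, LinearMap.smul_apply, LinearMap.add_apply,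
      LinearMap.smul_apply, e1, e2, LinearMap.smul_apply, LinearMap.add_apply, LinearMap.smul_apply,
      map_smul, map_add, map_smul]
  intro x u
  refine homog_induction (P := fun x : H.carrier => superSwap β (envι k p (x : g) * u) =
    ρ'.act x (superSwap β u)) h2 (fun x y hx hy => ?_) (fun j x hx => ?_) x
  · rw [Submodule.coe_add, map_add, add_mul, map_add, hx, hy, map_add, LinearMap.add_apply]
  · have hx' := (coe_mem_homog H).mpr hx
    rw [superSwap_apply, superSwap_apply, parity_env_mul, mem_homog.mp (envι_mem hx'),
      smul_mul_assoc, map_smul, h1 0 j x hx, h1 1 j x hx, mul_zero, sgn_zero, one_smul, mul_one,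
      smul_smul, sgn_mul_self, one_smul, map_add]

/-- A form `ξ` is recovered from `u ↦ P⁻¹(ξ(ǔ ⊗ ·))`, since the antipode and the swap are
involutions; balancedness of `ξ` becomes `h`-linearity. -/
theorem theta_surjective (hP : IsContragredient ρ ρ' P) : Function.Surjective (theta hP) := by
  have h2 := two_ne_zero_of_char k p
  intro ξ
  let Q := LinearEquiv.ofBijective P hP.bijective
  have hQ : ∀ φ w, P (Q.symm φ) w = φ w := fun φ w =>
    LinearMap.congr_fun (Q.apply_symm_apply φ) w
  let β : Env k p g →ₗ[k] U :=
    Q.symm.toLinearMap ∘ₗ (indMkₗ ρ).compr₂ ξ ∘ₗ antipode k p g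
  have hβ : ∀ u w, P (β u) w = ξ (indMk ρ (antipode k p g u) w) := fun u w => hQ _ w
  have hmem : superSwap β ∈ Coind ρ' := superSwap_mem_coind fun j x hx u => by
    have hx' := (coe_mem_homog H).mpr hx
    refine hP.bijective.1 (LinearMap.ext fun w => ?_)
    have h3 : ∀ v, indMk ρ (-v) (w : W) = -indMk ρ v w := fun v => map_neg ((indMkₗ ρ).flip w) v
    rw [hβ, hP.act j x hx, tw_hom, tw_tw_self, hβ, antipode_ι_mul hx', h3, indMk_mul_ι, map_neg,
      tw_antipode]
  refine ⟨⟨superSwap β, hmem⟩, ind_dual_ext fun u w => ?_⟩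
  rw [theta_indMk, superSwap_superSwap h2, hβ, antipode_antipode]

/-- The isomorphism `Θ`. -/
def thetaEquiv (hP : IsContragredient ρ ρ' P) : Coind ρ' ≃ₗ[k] Module.Dual k (Ind ρ) :=
  LinearEquiv.ofBijective (theta hP) ⟨theta_injective hP, theta_surjective hP⟩

end Theta

/-! ### `π* ⊗ Π^m k_{-strad}` is contragredient to `Π^m k_strad ⊗ π` -/

section Contragredient

variable {k : Type*} {p : ℕ} {g : Type*} [Field k] [AddCommGroup g] [Module k g]
  [LieSuperalgebra k g] [RestrictedLieSuperalgebra k p g] {H : RestrictedSubalgebra k p g}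
  {V : Type*} [AddCommGroup V] [Module k V] [Superspace k V] {m : ℕ}

theorem dualTwistPairing_tmul (f : Module.Dual k V) (c c' : Line k m) (v : V) :
    dualTwistPairing (f ⊗ₜ c) (c' ⊗ₜ v) = sgn k (m : ZMod 2) * (lineCoord k m c * lineCoord k m c' * f v) := by
  rw [← neg_one_pow_eq_sgn]
  simp [dualTwistPairing]
  ring

/-- The characters `strad` and `-strad` cancel, leaving the contragredience of `π` and `π*`. The
signs from moving past the line matter only for odd `x`, where `strad` vanishes. -/
theorem isContragredient_dualTwist [Fact p.Prime] [CharP k p] [Fact (2 < p)]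
    (π : SuperAction k H.carrier V) :
    IsContragredient (twist m π) (dualTwist m π) (dualTwistPairing (k := k) (m := m)) where
  bijective := by
    let e : Line k m ⊗[k] V ≃ₗ[k] V :=
      (TensorProduct.congr (LinearEquiv.refl k k : Line k m ≃ₗ[k] k) (LinearEquiv.refl k V)).trans
        (TensorProduct.lid k V)
    have hs : IsUnit (sgn k (m : ZMod 2)) := by
      rcases zmod_two_cases (m : ZMod 2) with h | h <;> simp [h]
    have h1 : Function.Bijective (dualTwistPairing (k := k) (V := V) (m := m) ∘ₗ
        (TensorProduct.mk k (Module.Dual k V) (Line k m)).flip (lineGen k m)) := by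
      have h2 : ⇑(dualTwistPairing (k := k) (V := V) (m := m) ∘ₗ
          (TensorProduct.mk k (Module.Dual k V) (Line k m)).flip (lineGen k m)) =
          ⇑((LinearEquiv.smulOfUnit hs.unit).trans e.dualMap) := by
        funext f
        refine TensorProduct.ext' fun c v => ?_
        have h3 := dualTwistPairing_tmul f (lineGen k m) c v
        refine h3.trans ?_
        have h4 : e (c ⊗ₜ v) = lineCoord k m c • v := rfl
        have h5 : lineCoord k m (lineGen k m) = 1 := rfl
        rw [LinearEquiv.trans_apply, LinearEquiv.dualMap_apply, h4, h5, one_mul, map_smul]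
        change _ = lineCoord k m c * (sgn k (m : ZMod 2) * f v)
        ring
      rw [h2]
      exact LinearEquiv.bijective _
    exact (Function.Bijective.of_comp_iff _ (tmul_lineGen_bijective _)).mp h1
  act j x hx b w := by
    have h2 := two_ne_zero_of_char k p
    induction w with
    | zero => simp
    | add w w' hw hw' => rw [map_add, map_add, map_add, hw, hw', neg_add]
    | tmul c v =>
      induction b with
      | zero => simp
      | add b b' hb hb' =>
        rw [map_add, map_add, map_add, map_add, LinearMap.add_apply, LinearMap.add_apply, hb, hb',
          neg_add]
      | tmul f c' =>
        rw [tensorAct_apply h2 _ _ hx, tensorAct_apply h2 _ _ hx, tw_tmul, map_add, map_add,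
          LinearMap.add_apply, dualTwistPairing_tmul, dualTwistPairing_tmul, dualTwistPairing_tmul,
          dualTwistPairing_tmul, dualAct_apply h2 _ hx, stradAct, negStradAct, lineAct_apply,
          lineAct_apply, tw_line, tw_line]
        simp only [map_smul, smul_eq_mul, LinearMap.neg_apply]
        rcases zmod_two_cases j with rfl | rfl
        · simp only [zero_mul, sgn_zero]
          ring
        · have h6 : sgn k (m : ZMod 2) * sgn k (m : ZMod 2) = 1 := sgn_mul_self k _
          rw [strad_odd hx, one_mul]
          linear_combination (sgn k (m : ZMod 2) * lineCoord k m c' * lineCoord k m c *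
            tw k 1 f (π.act x v)) * h6

end Contragredient

/-! ### The identity `ᵗΦ ∘ Ψ' = Θ` and the bijectivity of `Φ` -/

section Conclusion

variable {k : Type*} {p : ℕ} {g : Type*} [Field k] [AddCommGroup g] [Module k g]
  [LieSuperalgebra k g] [RestrictedLieSuperalgebra k p g] {H : RestrictedSubalgebra k p g}
  {V : Type*} [AddCommGroup V] [Module k V] [Superspace k V] {n m : ℕ}
  [Fact p.Prime] [CharP k p] [Fact (2 < p)] (F : Frame H n m)
  {π : SuperAction k H.carrier V}

theorem coindPair_one_apply (f : Coind π) (μ : Coind (dualAct π)) :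
    (coindPair f μ).1 1 = μ.1 1 (parity (k := k) (f.1 1)) := by
  rw [coe_coindPair, conv_one, contract_tmul]

/-- `Λ` reduces the pairing to its value at `1` and has integral `1`. The parity of `Λ v̂` in `Ψ'`
and that of `v` in the contraction leave the sign `(-1)^m`. -/
theorem psiDual_topMonomial_hat (hπ : π.IsRestricted p) (v : V) (μ : Coind (dualAct π)) :
    psiDual F hπ (mulBer F (dualAct π) μ) (smulA (topMonomial F) (hat F π v)) =
      sgn k (m : ZMod 2) * μ.1 1 v := by
  have h2 := two_ne_zero_of_char k p
  refine homog_induction (P := fun v => psiDual F hπ (mulBer F (dualAct π) μ)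
    (smulA (topMonomial F) (hat F π v)) = sgn k (m : ZMod 2) * μ.1 1 v) h2
    (fun v w hv hw => ?_) (fun i v hv => ?_) v
  · rw [hat_add F hπ, smulA_add, map_add, hv, hw, map_add, mul_add]
  · rw [psiDual_apply_of_mem hπ _ (smulA_mem (topMonomial_mem F) (hat_mem F hπ hv)), psi_mulBer,
      coindPair_smulA_left, topMonomial_smulA, LinearMap.map_smul, integral_topMonomial,
      smul_eq_mul, mul_one, coindPair_one_apply, hat_apply_one F hπ, mem_homog.mp hv, map_smul,
      smul_eq_mul, sgn_add, mul_assoc, ← mul_assoc (sgn k i), sgn_mul_self, one_mul]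

/-- The isomorphism `Θ` for `π`. -/
def thetaTwist (m : ℕ) (π : SuperAction k H.carrier V) :
    Coind (dualTwist m π) ≃ₗ[k] Module.Dual k (Ind (twist m π)) :=
  thetaEquiv (isContragredient_dualTwist π)

/-- The comparison at `u = 1`: the sign `(-1)^m` of `psiDual_topMonomial_hat` is the one in
`dualTwistPairing`, which expresses `⟨Λ, ω̄⟩ = 1`. -/
theorem psiDual_topHat (hπ : π.IsRestricted p) (μ : Coind (dualTwist m π))
    (w : Line k m ⊗[k] V) :
    psiDual F hπ μ (topHat F hπ w) = thetaTwist m π μ (indMk (twist m π) 1 w) := by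
  have h2 := two_ne_zero_of_char k p
  obtain ⟨μ, rfl⟩ := (mulBer_bijective (F := F) (dualAct_isRestricted hπ)).2 μ
  have h1 : ∀ w, thetaTwist m π (mulBer F (dualAct π) μ) (indMk (twist m π) 1 w) =
      dualTwistPairing (μ.1 1 ⊗ₜ lineGen k m) w := fun w => by
    refine (theta_indMk_one (isContragredient_dualTwist π) (mulBer F (dualAct π) μ) w).trans ?_
    have h3 := cup_one_apply μ (berMap F (oneA H))
    rw [berMap_oneA_one] at h3
    exact congrArg (fun b => dualTwistPairing b w) h3
  rw [h1]
  induction w with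
  | zero => simp
  | add w w' hw hw' => rw [map_add, map_add, map_add, hw, hw']
  | tmul c v =>
    rw [topHat_tmul, LinearMap.map_smul, psiDual_topMonomial_hat, dualTwistPairing_tmul]
    change _ = _ * (1 * _ * _)
    rw [smul_eq_mul]
    ring

/-- Both sides are equivariant in `μ` for the contragredient action, so a factor `x` on the left of
`u` can be moved to `μ`; the induction ends at `u = 1`, with `μ` general. -/
theorem psiDual_phi (hπ : π.IsRestricted p) (u : Env k p g) (μ : Coind (dualTwist m π))
    (w : Line k m ⊗[k] V) : psiDual F hπ μ (phi F hπ (indMk (twist m π) u w)) =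
      thetaTwist m π μ (indMk (twist m π) u w) := by
  have h2 := two_ne_zero_of_char k p
  have hθ := isEquivariantToDual_theta (isContragredient_dualTwist (m := m) π)
  have hψ := isEquivariantToDual_psiDual (F := F) hπ
  have hadd : ∀ u v : Env k p g, indMk (twist m π) (u + v) w =
    indMk (twist m π) u w + indMk (twist m π) v w := fun u v => indMk_add u v w
  have hsmul : ∀ (c : k) (u : Env k p g), indMk (twist m π) (c • u) w =
    c • indMk (twist m π) u w := fun c u => map_smul ((indMkₗ (twist m π)).flip w) c u
  have hφ : ∀ (c : k) t, phi F hπ (c • t) = c • phi F hπ t := fun c t =>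
    LinearMap.map_smul_of_tower _ c t
  induction u using env_induction_homog h2 generalizing μ with
  | one => rw [phi_indMk, one_smul, psiDual_topHat]
  | add u v hu hv => rw [hadd, map_add, map_add, map_add, hu, hv]
  | smul c u hu => rw [hsmul, hφ, map_smul, map_smul, hu]
  | ι_mul i x hx u hu =>
    have key : ∀ (j : ZMod 2) (μ : Coind (dualTwist m π)), IsHomog (π := dualTwist m π) μ j →
        psiDual F hπ μ (phi F hπ (indMk (twist m π) (envι k p x * u) w)) =
          thetaTwist m π μ (indMk (twist m π) (envι k p x * u) w) := fun j μ hμ => by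
      have e1 := hψ i j x hx μ hμ (phi F hπ (indMk (twist m π) u w))
      have e2 := hθ i j x hx μ hμ (indMk (twist m π) u w)
      have e3 := (e1.symm.trans (hu _)).trans e2
      have e4 := mul_left_cancel₀ (by
        rcases zmod_two_cases (i * j) with h | h <;> simp [h]) (neg_injective e3)
      rw [← map_smul] at e4
      exact e4
    let q : Coind (dualTwist m π) → Prop := fun μ =>
      psiDual F hπ μ (phi F hπ (indMk (twist m π) (envι k p x * u) w)) =
          thetaTwist m π μ (indMk (twist m π) (envι k p x * u) w)
    refine coind_homog_induction (ρ := dualTwist m π) (P := q) (fun μ ν hμ hν => ?_)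
      (fun j μ hμ => key j μ hμ) μ
    change psiDual F hπ (μ + ν) _ = thetaTwist m π (μ + ν) _
    rw [map_add, map_add, LinearMap.add_apply, LinearMap.add_apply]
    exact congrArg₂ (· + ·) hμ hν

theorem dualMap_phi_comp_psiDual (hπ : π.IsRestricted p) :
    ((phi F hπ).restrictScalars k).dualMap ∘ₗ psiDual F hπ = (thetaTwist m π).toLinearMap :=
  LinearMap.ext fun μ => ind_dual_ext fun u w => psiDual_phi F hπ u μ w

/-- `Ψ'` and `Θ` are bijective, hence so is `ᵗΦ`, and over a field a linear map is bijective as soon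
as its transpose is, in any dimension. -/
theorem phi_bijective (hπ : π.IsRestricted p) : Function.Bijective (phi F hπ) := by
  have h : Function.Bijective (((phi F hπ).restrictScalars k).dualMap ∘ₗ psiDual F hπ) := by
    rw [dualMap_phi_comp_psiDual]
    exact (thetaTwist m π).bijective
  have h' : Function.Bijective ((phi F hπ).restrictScalars k).dualMap :=
    (Function.Bijective.of_comp_iff _ (psiDual_bijective F hπ)).mp h
  exact ⟨LinearMap.dualMap_surjective_iff.mp h'.2, LinearMap.dualMap_injective_iff.mp h'.1⟩

/-- The isomorphism `Φ`. -/
def phiEquiv (hπ : π.IsRestricted p) : Ind (twist m π) ≃ₗ[Env k p g] Coind π :=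
  LinearEquiv.ofBijective (phi F hπ) (phi_bijective F hπ)

theorem isTheta_thetaTwist (π : SuperAction k H.carrier V) :
    IsTheta π (thetaTwist m π).toLinearMap := by
  intro i j u hu μ hμ w
  refine (theta_indMk_of_mem (isContragredient_dualTwist π) hμ u w).trans ?_
  rw [tw_of_mem hu, map_smul, map_smul, map_smul, mul_comm j i]
  rfl

end Conclusion

end RestrictedSuper

end

theorem mainTheorem5 {k : Type*} [Field k] (p : ℕ) [Fact p.Prime] [CharP k p] [Fact (2 < p)]
    {g : Type*} [AddCommGroup g] [Module k g] [LieSuperalgebra k g]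
    [RestrictedLieSuperalgebra k p g] (H : RestrictedSubalgebra k p g)
    {V : Type*} [AddCommGroup V] [Module k V] [Superspace k V]
    (π : SuperAction k H.carrier V) (hπ : π.IsRestricted p)
    {n m : ℕ} (F : Frame H n m) :
    Function.Bijective (evalPBW F (trivAct k H.carrier)) ∧
    Function.Bijective (evalPBW F π) ∧
    Function.Bijective (evalPBW F (dualAct π)) ∧
    ∃ (d : Fin n → Coind (trivAct k H.carrier) →ₗ[k] Coind (trivAct k H.carrier))
      (d' : Fin m → Coind (trivAct k H.carrier) →ₗ[k] Coind (trivAct k H.carrier))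
      (χ : Coind (trivAct k H.carrier) ≃ₗ[k] Coind (negStradAct H m))
      (Φ : Ind (twist m π) ≃ₗ[Env k p g] Coind π)
      (Ψ : Coind π →ₗ[k] Coind (dualTwist m π) →ₗ[k] k)
      (Ψ' : Coind (dualTwist m π) →ₗ[k] Module.Dual k (Coind π))
      (Θ : Coind (dualTwist m π) ≃ₗ[k] Module.Dual k (Ind (twist m π))),
      IsPartials F d d' ∧
      IsBerezinianIso F d d' χ ∧
      (∀ (u : Env k p g) (v : V), Φ (indMk (twist m π) u (lineGen k m ⊗ₜ[k] v)) =
        u • smulA (topMonomial F) (hat F π v)) ∧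
      IsPsi F π χ Ψ ∧
      IsInducedBy π Ψ Ψ' ∧
      Function.Injective Ψ' ∧
      IsEquivariantToDual Ψ' ∧
      IsTheta π Θ.toLinearMap ∧
      IsEquivariantToDual Θ.toLinearMap ∧
      (Φ.toLinearMap.restrictScalars k).dualMap ∘ₗ Ψ' = Θ.toLinearMap := by
  obtain ⟨dd, hdd⟩ := exists_isPartialFamily F
  have he : Sum.elim (fun i => dd (Sum.inl i)) (fun s => dd (Sum.inr s)) = dd :=
    Sum.elim_comp_inl_inr dd
  exact ⟨⟨evalPBW_injective F _, evalPBW_surjective F trivAct_isRestricted⟩,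
    ⟨evalPBW_injective F π, evalPBW_surjective F hπ⟩,
    ⟨evalPBW_injective F _, evalPBW_surjective F (dualAct_isRestricted hπ)⟩,
    fun i => dd (Sum.inl i), fun s => dd (Sum.inr s), berEquiv F, phiEquiv F hπ, psi F hπ,
    psiDual F hπ, thetaTwist m π, hdd.isPartials, isBerezinianIso (he ▸ hdd),
    fun u v => (congrArg (u • ·) (topHat_tmul F hπ (lineGen k m) v)).trans
      (congrArg (u • ·) (one_smul k _)),
    isPsi_psi hπ, isInducedBy_psiDual hπ, (psiDual_bijective F hπ).1,
    isEquivariantToDual_psiDual hπ, isTheta_thetaTwist π,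
    isEquivariantToDual_theta (isContragredient_dualTwist π), dualMap_phi_comp_psiDual F hπ⟩
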